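/- An instance of \textsc{Fair Correlation Clustering} (FCC) consists of an undirected $n$-vertex graph $G$, a budget $B\in\mathbb N$ and a coloring $\chi:V(G)\to\{1,\dots,\kappa\}$ with $\kappa\le n$. The fairlet $F$ is a minimum multiset of colors such that the multiset $\{\chi(v)\mid v\in V(G)\}$ can be partitioned into copies of $F$; a set $W\subseteq V(G)$ is fair if the multiset $\{\chi(v)\mid v\in W\}$ can be partitioned into copies of $F$. A clustering is a partition of $V(G)$ into nonempty clusters; its cost is the number of edges of $G$ between different clusters plus the number of non-adjacent pairs of distinct vertices inside clusters, and it is fair if every cluster is fair. The question is whether there is a fair clustering of cost at most $B$. Let $k$ be the vertex cover number of $G$, i.e. the minimum size of a vertex cover of $G$. \textbf{Theorem.} FCC is fixed-parameter tractable with respect to $k$, without any restriction on the size of the fairlet. That is, the parameterized problem consisting of all pairs $(x,k)\in\{0,1\}^*\times\mathbb N$ such that $x$ encodes a yes-instance $(G,B,\chi)$ of FCC and $k$ is the vertex cover number of $G$ can be decided in time $f(k)\cdot|x|^{O(1)}$ for a computable function $f$. More precisely, there is a word RAM algorithm (with words of $O(\log|x|)$ bits) which, given only the encoding $x$ of an instance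 $(G,B,\chi)$ with $n$ vertices and vertex cover number $k$ (which is not part of the input), decides whether it is a yes-instance in time $O\bigl(k^{O(k)}\cdot n^{2.5}\log n\bigr)$, where $n$ is read as $2$ if $n<2$ and $0^0=1$. -/

import Mathlib

/-! ### Fair Correlation Clustering -/

namespace FairCC

/-- The multiset `S` of colors can be partitioned into copies of the multiset `F`. -/
def SplitsInto {K : Type*} (F S : Multiset K) : Prop :=
  ∃ t : ℕ, S = t • F

/-- `F` is the fairlet of the coloring `χ`: a minimum multiset of colors such that the multiset of
all occurring colors can be partitioned into copies of `F`. -/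
def IsFairlet {V K : Type*} [Fintype V] (χ : V → K) (F : Multiset K) : Prop :=
  SplitsInto F (Finset.univ.val.map χ) ∧
    ∀ F' : Multiset K, SplitsInto F' (Finset.univ.val.map χ) → F.card ≤ F'.card

/-- The vertex set `W` is fair with respect to the fairlet `F`. -/
def IsFair {V K : Type*} (χ : V → K) (F : Multiset K) (W : Finset V) : Prop :=
  SplitsInto F (W.val.map χ)

/-- The cost of a clustering: the number of edges whose endpoints lie in different clusters plus
the number of non-edges (pairs of distinct non-adjacent vertices) inside clusters. -/
noncomputable def cost {V : Type*} [Fintype V] [DecidableEq V] (G : SimpleGraph V)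
    (P : Finpartition (Finset.univ : Finset V)) : ℕ :=
  {e : Sym2 V | e ∈ G.edgeSet ∧ ¬ ∃ C ∈ P.parts, ∀ v ∈ e, v ∈ C}.ncard +
    {e : Sym2 V | e ∈ Gᶜ.edgeSet ∧ ∃ C ∈ P.parts, ∀ v ∈ e, v ∈ C}.ncard

/-- An instance of Fair Correlation Clustering: an undirected graph on `n` vertices, a budget and
a coloring of the vertices with `κ ≤ n` colors. -/
structure Inst where
  /-- number of vertices -/
  n : ℕ
  /-- the input graph -/
  graph : SimpleGraph (Fin n)
  /-- the budget -/
  budget : ℕ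
  /-- number of colors -/
  κ : ℕ
  κ_le : κ ≤ n
  /-- the coloring -/
  color : Fin n → Fin κ

/-- There is a fair clustering of cost at most the budget. -/
def Inst.IsYes (I : Inst) : Prop :=
  ∃ F : Multiset (Fin I.κ), IsFairlet I.color F ∧
    ∃ P : Finpartition (Finset.univ : Finset (Fin I.n)),
      (∀ C ∈ P.parts, IsFair I.color F C) ∧ cost I.graph P ≤ I.budget

/-- The number `m` in unary: `m` ones and a terminating zero. -/
def unary (m : ℕ) : List Bool :=
  List.replicate m true ++ [false]

open Classical in
/-- The encoding of an instance as a bit string: the numbers of vertices and colors and the color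
of every vertex in unary, the adjacency matrix row by row, and the budget in binary (least
significant bit first, no leading zeros). Without the budget the length is `O(n²)`. -/
noncomputable def Inst.encode (I : Inst) : List Bool :=
  unary I.n ++ unary I.κ ++
    (List.finRange I.n).flatMap (fun v => unary (I.color v)) ++
    (List.finRange I.n).flatMap (fun u =>
      (List.finRange I.n).map (fun v => decide (I.graph.Adj u v))) ++
    I.budget.bits

end FairCC

/-! ### A word RAM with step count -/

namespace WordRAM

/-- Binary machine operations. Comparisons return `1` or `0`, subtraction is truncated. -/
inductive Op
  | add | sub | mul | div | mod | lt | eq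

/-- The result of an operation on natural numbers. -/
def Op.eval : Op → ℕ → ℕ → ℕ
  | .add, a, b => a + b
  | .sub, a, b => a - b
  | .mul, a, b => a * b
  | .div, a, b => a / b
  | .mod, a, b => a % b
  | .lt, a, b => if a < b then 1 else 0
  | .eq, a, b => if a = b then 1 else 0

/-- A memory state: the contents of the registers, and of the cells of the arrays. A program
mentions only finitely many registers and arrays; the cells of an array are addressed
by computed indices. -/
structure State where
  /-- registers -/
  reg : ℕ → ℕ
  /-- `arr a i` is cell `i` of array `a` -/
  arr : ℕ → ℕ → ℕ

/-- Expressions: constants, registers, reading a cell of array `a`, and operations. -/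
inductive Expr
  | lit (v : ℕ)
  | reg (r : ℕ)
  | get (a : ℕ) (i : Expr)
  | bin (o : Op) (e₁ e₂ : Expr)

/-- The value of an expression. -/
def Expr.eval (s : State) : Expr → ℕ
  | .lit v => v
  | .reg r => s.reg r
  | .get a i => s.arr a (i.eval s)
  | .bin o e₁ e₂ => o.eval (e₁.eval s) (e₂.eval s)

/-- The number of elementary steps needed to evaluate an expression. -/
def Expr.cost : Expr → ℕ
  | .lit _ => 1
  | .reg _ => 1
  | .get _ i => i.cost + 1
  | .bin _ e₁ e₂ => e₁.cost + e₂.cost + 1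

/-- All values that occur when the expression is evaluated fit into words of `w` bits. -/
def Expr.Fits (w : ℕ) (s : State) : Expr → Prop
  | .lit v => v < 2 ^ w
  | .reg r => s.reg r < 2 ^ w
  | .get a i => i.Fits w s ∧ s.arr a (i.eval s) < 2 ^ w
  | .bin o e₁ e₂ => e₁.Fits w s ∧ e₂.Fits w s ∧ o.eval (e₁.eval s) (e₂.eval s) < 2 ^ w

/-- Programs. -/
inductive Prog
  | skip
  | set (r : ℕ) (e : Expr)
  | put (a : ℕ) (i e : Expr)
  | seq (p q : Prog)
  | cond (e : Expr) (p q : Prog)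
  | loop (e : Expr) (p : Prog)

/-- The state after assigning `v` to register `r`. -/
def State.setReg (s : State) (r v : ℕ) : State :=
  { s with reg := Function.update s.reg r v }

/-- The state after writing `v` into cell `i` of array `a`. -/
def State.setArr (s : State) (a i v : ℕ) : State :=
  { s with arr := Function.update s.arr a (Function.update (s.arr a) i v) }

/-- `Exec w p s t s'`: on words of `w` bits, the program `p` started in state `s` halts in state
`s'` after `t` steps, and no value exceeds the word length on the way (a computation that
overflows is stuck). -/
inductive Exec (w : ℕ) : Prog → State → ℕ → State → Prop
  | skip (s : State) : Exec w .skip s 1 s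
  | set (s : State) (r : ℕ) (e : Expr) (he : e.Fits w s) :
      Exec w (.set r e) s (e.cost + 1) (s.setReg r (e.eval s))
  | put (s : State) (a : ℕ) (i e : Expr) (hi : i.Fits w s) (he : e.Fits w s) :
      Exec w (.put a i e) s (i.cost + e.cost + 1) (s.setArr a (i.eval s) (e.eval s))
  | seq (p q : Prog) (s₀ s₁ s₂ : State) (t₁ t₂ : ℕ) (hp : Exec w p s₀ t₁ s₁)
      (hq : Exec w q s₁ t₂ s₂) : Exec w (.seq p q) s₀ (t₁ + t₂) s₂
  | condTrue (e : Expr) (p q : Prog) (s s' : State) (t : ℕ) (he : e.Fits w s)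
      (h : e.eval s ≠ 0) (hp : Exec w p s t s') : Exec w (.cond e p q) s (e.cost + 1 + t) s'
  | condFalse (e : Expr) (p q : Prog) (s s' : State) (t : ℕ) (he : e.Fits w s)
      (h : e.eval s = 0) (hq : Exec w q s t s') : Exec w (.cond e p q) s (e.cost + 1 + t) s'
  | loopDone (e : Expr) (p : Prog) (s : State) (he : e.Fits w s) (h : e.eval s = 0) :
      Exec w (.loop e p) s (e.cost + 1) s
  | loopStep (e : Expr) (p : Prog) (s₀ s₁ s₂ : State) (t₁ t₂ : ℕ) (he : e.Fits w s₀)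
      (h : e.eval s₀ ≠ 0) (hp : Exec w p s₀ t₁ s₁) (hl : Exec w (.loop e p) s₁ t₂ s₂) :
      Exec w (.loop e p) s₀ (e.cost + 1 + t₁ + t₂) s₂

/-- The initial state on the bit string `x` and the number `k`: register `0` holds the length
of `x`, register `1` holds `k`, array `0` holds the bits of `x`, one per cell, and
everything else is `0`. -/
def initState (x : List Bool) (k : ℕ) : State where
  reg r := if r = 0 then x.length else if r = 1 then k else 0
  arr a i := if a = 0 then (x.getD i false).toNat else 0

/-- On words of `w` bits and from the initial state `s`, the program `p` halts after exactly `t`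
steps and answers the yes/no question `Q` correctly in register `0`. -/
def Prog.Answers (p : Prog) (w : ℕ) (s : State) (t : ℕ) (Q : Prop) : Prop :=
  ∃ s' : State, Exec w p s t s' ∧ (Q ∧ s'.reg 0 = 1 ∨ ¬ Q ∧ s'.reg 0 = 0)

/-- The class `FPT`: the parameterized problems `Q ⊆ {0,1}* × ℕ` that can be decided in time
`f(k) · |x|^{O(1)}` for a computable function `f` (on words just long enough to hold the
time bound; `|x| + 1` allows for the empty string). -/
def FPT : Set (Set (List Bool × ℕ)) :=
  {Q | ∃ (p : Prog) (f : ℕ → ℕ) (c : ℕ), Computable f ∧ ∀ (x : List Bool) (k : ℕ),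
    ∃ t ≤ f k * (x.length + 1) ^ c,
      p.Answers (Nat.size (f k * (x.length + 1) ^ c)) (initState x k) t ((x, k) ∈ Q)}

end WordRAM

/-- Fair Correlation Clustering parameterized by the vertex cover number of the graph. -/
def FairCC.parByVertexCover : Set (List Bool × ℕ) :=
  {y | ∃ I : FairCC.Inst, I.encode = y.1 ∧ I.graph.vertexCoverNum = (y.2 : ℕ∞) ∧ I.IsYes}

/-! The endpoints of a maximal matching form a vertex cover of size `s ≤ 2k`, and the vertices
outside it are pairwise non-adjacent. Counting ordered pairs of vertices shows that twice the cost
of a clustering, plus twice the number of ordered adjacent pairs inside clusters, plus `n`, equals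
the number of ordered adjacent pairs plus the sum of the squared cluster sizes (`two_mul_cost`). So
once the sizes are known, it remains to maximize the number of edges inside clusters.

The number of fairlets is the greatest common divisor of the color counts. Suppose that a cluster
with `j` cover vertices consists of `t ≥ 2` fairlets, with `t > 2j`. Then one of its fairlets, with
`f` vertices, can be chosen outside the cover. Splitting it off separates `(t - 1) f²` pairs, at
most `j f` of which are edges, so the cost does not increase (`exists_reduced_labeling`). Hence at
most `s` clusters meet the cover, each of at most `2s` fairlets, and all other clusters may be taken
to be single fairlets. A guess fixes the cluster of every cover vertex and the number of fairlets in
each of these clusters; there are `(2s + 2)^(2s)` digit vectors to try.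

For a fixed guess the colors are independent of each other. The vertices of one color outside the
cover have to be distributed over `s + 1` clusters with prescribed capacities, and a vertex earns
the number of its cover neighbors in its cluster. This transportation problem is solved by duality,
without any flow or matching algorithm: the optimum is the minimum over integer potentials `r` of `∑
v, max i (w v i + r i) - ∑ i, r i * cap i`. As the weights lie between `0` and `s`, some optimal
potential has all entries between `0` and `s` (`exists_dualValue_min`), and Hall's theorem for the
tight pairs yields an assignment that attains its value (`exists_optimal_assignment`). So it
suffices to try `(s + 2)^(s + 1)` potentials, each in time linear in `n` and polynomial in `s`.
`Inst.Cover.isYes_iff` combines these facts. The total time is `s^O(s) * n²`, which is below the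
claimed bound.

The remaining work is to carry this out on words of logarithmic length. Programs follow a stack
discipline (`Calc`): a subprogram returns its value in register `d` and touches nothing below. All
numbers stay below a fixed power of the input length; the budget, which need not fit into a word, is
cut off beyond `n²`. The version for the class `FPT` must in addition recognize encodings, reject
when `s > 2k`, and compute the exact vertex cover number by trying all traces of a cover on the
matched vertices. -/

namespace WordRAM

/-! ### A program logic with time bounds -/

/-- Started in `s`, the program `p` halts within `T` steps in a state satisfying `Q`. -/
def Runs (w : ℕ) (p : Prog) (s : State) (T : ℕ) (Q : State → Prop) : Prop :=
  ∃ t ≤ T, ∃ s', Exec w p s t s' ∧ Q s'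

theorem Runs.mono {w : ℕ} {p : Prog} {s : State} {T T' : ℕ} {Q Q' : State → Prop}
    (h : Runs w p s T Q) (hT : T ≤ T') (hQ : ∀ s', Q s' → Q' s') : Runs w p s T' Q' := by
  obtain ⟨t, ht, s', he, hq⟩ := h
  exact ⟨t, ht.trans hT, s', he, hQ _ hq⟩

theorem Runs.seq {w : ℕ} {p q : Prog} {s : State} {T₁ T₂ : ℕ} {R Q : State → Prop}
    (hp : Runs w p s T₁ R) (hq : ∀ s', R s' → Runs w q s' T₂ Q) :
    Runs w (.seq p q) s (T₁ + T₂) Q := by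
  obtain ⟨t, ht, s', he, hr⟩ := hp
  obtain ⟨t', ht', s'', he', hQ⟩ := hq s' hr
  exact ⟨t + t', by omega, s'', .seq _ _ _ _ _ _ _ he he', hQ⟩

theorem Runs.skip {w : ℕ} {s : State} {Q : State → Prop} (h : Q s) :
    Runs w .skip s 1 Q :=
  ⟨1, le_rfl, s, .skip s, h⟩

theorem Runs.set {w : ℕ} {r : ℕ} {e : Expr} {s : State} {Q : State → Prop}
    (he : e.Fits w s) (h : Q (s.setReg r (e.eval s))) : Runs w (.set r e) s (e.cost + 1) Q :=
  ⟨_, le_rfl, _, .set _ _ _ he, h⟩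

theorem Runs.put {w : ℕ} {a : ℕ} {i e : Expr} {s : State} {Q : State → Prop}
    (hi : i.Fits w s) (he : e.Fits w s) (h : Q (s.setArr a (i.eval s) (e.eval s))) :
    Runs w (.put a i e) s (i.cost + e.cost + 1) Q :=
  ⟨_, le_rfl, _, .put _ _ _ _ hi he, h⟩

theorem Runs.cond {w : ℕ} {e : Expr} {p q : Prog} {s : State} {T : ℕ} {Q : State → Prop}
    (he : e.Fits w s) (hp : e.eval s ≠ 0 → Runs w p s T Q)
    (hq : e.eval s = 0 → Runs w q s T Q) : Runs w (.cond e p q) s (e.cost + 1 + T) Q := by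
  by_cases h : e.eval s = 0
  · obtain ⟨t, ht, s', hx, hQ⟩ := hq h
    exact ⟨_, by omega, s', .condFalse _ _ _ _ _ _ he h hx, hQ⟩
  · obtain ⟨t, ht, s', hx, hQ⟩ := hp h
    exact ⟨_, by omega, s', .condTrue _ _ _ _ _ _ he h hx, hQ⟩

/-- A loop that makes exactly `N` iterations. -/
theorem Runs.loop {w : ℕ} {e : Expr} {p : Prog} {T N : ℕ} (Inv : ℕ → State → Prop)
    (hstep : ∀ i < N, ∀ s, Inv i s → e.Fits w s ∧ e.eval s ≠ 0 ∧ Runs w p s T (Inv (i + 1)))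
    (hend : ∀ s, Inv N s → e.Fits w s ∧ e.eval s = 0) {s : State} (h0 : Inv 0 s) :
    Runs w (.loop e p) s (N * (T + e.cost + 1) + e.cost + 1) (Inv N) := by
  suffices H : ∀ m i s, i + m = N → Inv i s →
      Runs w (.loop e p) s (m * (T + e.cost + 1) + e.cost + 1) (Inv N) from
    H N 0 s (by omega) h0
  intro m
  induction m with
  | zero =>
    intro i s hi hs
    obtain rfl : i = N := by omega
    obtain ⟨hf, hz⟩ := hend s hs
    exact ⟨e.cost + 1, by omega, s, .loopDone _ _ _ hf hz, hs⟩
  | succ m ih =>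
    intro i s hi hs
    obtain ⟨hf, hz, t, ht, s', hx, hs'⟩ := hstep i (by omega) s hs
    obtain ⟨t', ht', s'', hx', hs''⟩ := ih (i + 1) s' (by omega) hs'
    refine ⟨_, ?_, s'', .loopStep _ _ _ _ _ _ _ hf hz hx hx', hs''⟩
    rw [Nat.succ_mul]
    omega

/-- The states agree on the registers below `d` and on the arrays below `A`. -/
structure Agree (d A : ℕ) (s s' : State) : Prop where
  reg : ∀ r < d, s'.reg r = s.reg r
  arr : ∀ a < A, s'.arr a = s.arr a

theorem Agree.refl {d A : ℕ} (s : State) : Agree d A s s :=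
  ⟨fun _ _ => rfl, fun _ _ => rfl⟩

theorem Agree.trans {d A : ℕ} {s s' s'' : State} (h : Agree d A s s') (h' : Agree d A s' s'') :
    Agree d A s s'' :=
  ⟨fun r hr => (h'.reg r hr).trans (h.reg r hr), fun a ha => (h'.arr a ha).trans (h.arr a ha)⟩

theorem Agree.mono {d A d' A' : ℕ} {s s' : State} (h : Agree d A s s') (hd : d' ≤ d)
    (hA : A' ≤ A) : Agree d' A' s s' :=
  ⟨fun r hr => h.reg r (hr.trans_le hd), fun a ha => h.arr a (ha.trans_le hA)⟩

theorem Agree.setReg {d A : ℕ} {s s' : State} (h : Agree d A s s') {r : ℕ} (hr : d ≤ r) (v : ℕ) :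
    Agree d A s (s'.setReg r v) :=
  ⟨fun r' hr' => by
    simp only [State.setReg]; rw [Function.update_of_ne (by omega)]; exact h.reg r' hr',
    fun a ha => h.arr a ha⟩

theorem Agree.setArr {d A : ℕ} {s s' : State} (h : Agree d A s s') {a : ℕ} (ha : A ≤ a)
    (i v : ℕ) : Agree d A s (s'.setArr a i v) :=
  ⟨fun r' hr' => h.reg r' hr', fun a' ha' => by
    simp only [State.setArr]; rw [Function.update_of_ne (by omega)]; exact h.arr a' ha'⟩

@[simp] theorem State.setReg_reg_self (s : State) (r v : ℕ) : (s.setReg r v).reg r = v := by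
  simp [State.setReg]

@[simp] theorem State.setReg_reg (s : State) (r r' v : ℕ) :
    (s.setReg r v).reg r' = if r' = r then v else s.reg r' := by
  by_cases h : r' = r <;> simp [State.setReg, h]

@[simp] theorem State.setReg_arr (s : State) (r v : ℕ) : (s.setReg r v).arr = s.arr := rfl

@[simp] theorem State.setArr_reg (s : State) (a i v : ℕ) : (s.setArr a i v).reg = s.reg := rfl

@[simp] theorem State.setArr_arr (s : State) (a i v a' i' : ℕ) :
    (s.setArr a i v).arr a' i' = if a' = a ∧ i' = i then v else s.arr a' i' := by
  by_cases h : a' = a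
  · subst h
    by_cases h' : i' = i <;> simp [State.setArr, h']
  · simp [State.setArr, h]

/-- The program `p` computes the value `x` into register `d`, changing only registers from `d` on
and arrays from `A` on. -/
def Calc (w d A : ℕ) (p : Prog) (s : State) (T x : ℕ) : Prop :=
  Runs w p s T fun s' => Agree d A s s' ∧ s'.reg d = x

theorem Calc.mono {w d A : ℕ} {p : Prog} {s : State} {T T' x : ℕ} (h : Calc w d A p s T x)
    (hT : T ≤ T') : Calc w d A p s T' x :=
  Runs.mono h hT fun _ h => h

theorem Calc.set {w d A : ℕ} {e : Expr} {s : State} {x : ℕ} (he : e.Fits w s)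
    (hx : e.eval s = x) : Calc w d A (.set d e) s (e.cost + 1) x :=
  Runs.set he ⟨(Agree.refl s).setReg le_rfl _, by simp [hx]⟩

/-- The remaining program may use the value computed so far, and finally overwrites it. -/
theorem Calc.seq {w d A : ℕ} {p q : Prog} {s : State} {T₁ T₂ x y : ℕ}
    (hp : Calc w d A p s T₁ x)
    (hq : ∀ s', Agree d A s s' → s'.reg d = x → Calc w d A q s' T₂ y) :
    Calc w d A (.seq p q) s (T₁ + T₂) y :=
  Runs.seq hp fun s' h =>
    Runs.mono (hq s' h.1 h.2) le_rfl fun _ h' => ⟨h.1.trans h'.1, h'.2⟩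

/-- As `Calc.seq`, with the intermediate value in a scratch register. -/
theorem Calc.andThen {w d d' A : ℕ} {p q : Prog} {s : State} {T₁ T₂ x y : ℕ} (hd : d ≤ d')
    (hp : Calc w d' A p s T₁ x)
    (hq : ∀ s', Agree d' A s s' → s'.reg d' = x → Calc w d A q s' T₂ y) :
    Calc w d A (.seq p q) s (T₁ + T₂) y :=
  Runs.seq hp fun s' h => Runs.mono (hq s' h.1 h.2) le_rfl
    fun _ h' => ⟨(h.1.mono hd le_rfl).trans h'.1, h'.2⟩

/-! ### Loops with an accumulator -/

/-- `for (d+1) < rn`: compute the body into register `d+2`, then update the accumulator `d`. -/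
def forLoop (d rn : ℕ) (init E : Expr) (body : Prog) : Prog :=
  .seq (.set d init) <| .seq (.set (d + 1) (.lit 0)) <|
    .loop (.bin .lt (.reg (d + 1)) (.reg rn)) <|
      .seq body <| .seq (.set d E) (.set (d + 1) (.bin .add (.reg (d + 1)) (.lit 1)))

/-- `F i` is the accumulator before iteration `i`. The body works from register `d + 2` on, so it
can destroy neither the accumulator nor the counter; this makes nested loops compose without further
frame conditions. -/
theorem Calc.forLoop {w d A rn : ℕ} {init E : Expr} {body : Prog} {s : State} {N Tb : ℕ}
    {f F : ℕ → ℕ} (hrn : rn < d) (hN : s.reg rn = N) (hNw : N < 2 ^ w) (hw : 1 ≤ w)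
    (hinit : init.Fits w s) (hinit0 : init.eval s = F 0)
    (hbody : ∀ i < N, ∀ s', Agree d A s s' → s'.reg (d + 1) = i →
      Calc w (d + 2) A body s' Tb (f i))
    (hE : ∀ i < N, ∀ s', s'.reg d = F i → s'.reg (d + 2) = f i →
      E.Fits w s' ∧ E.eval s' = F (i + 1)) :
    Calc w d A (forLoop d rn init E body) s
      (N * (Tb + E.cost + 9) + init.cost + 7) (F N) := by
  have h1 : 1 < 2 ^ w := Nat.one_lt_two_pow (by omega)
  have key := Runs.loop (w := w) (e := .bin .lt (.reg (d + 1)) (.reg rn))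
    (p := .seq body <| .seq (.set d E) (.set (d + 1) (.bin .add (.reg (d + 1)) (.lit 1))))
    (T := Tb + (E.cost + 1 + 4)) (N := N)
    (fun i s' => i ≤ N ∧ Agree d A s s' ∧ s'.reg (d + 1) = i ∧ s'.reg d = F i) ?_ ?_
    (s := (s.setReg d (init.eval s)).setReg (d + 1) 0) ?_
  · refine Runs.mono (T := init.cost + 1 + (2 + (N * (Tb + (E.cost + 1 + 4) + 3 + 1) + 3 + 1)))
      (Q := fun s' => Agree d A s s' ∧ s'.reg d = F N) ?_ ?_ (fun s' h => h)
    · refine Runs.seq (Runs.set (Q := fun s' => s' = s.setReg d (init.eval s)) hinit rfl) ?_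
      rintro s' rfl
      refine Runs.seq (Runs.set
        (Q := fun s' => s' = (s.setReg d (init.eval s)).setReg (d + 1) 0) ?_ rfl) ?_
      · simp [Expr.Fits]
      rintro s' rfl
      exact key.mono le_rfl fun s' h => ⟨h.2.1, h.2.2.2⟩
    · ring_nf; omega
  · rintro i hi s' ⟨-, hag, hri, hrd⟩
    have hN' : s'.reg rn = N := by rw [hag.reg rn hrn, hN]
    refine ⟨?_, ?_, ?_⟩
    · simp only [Expr.Fits, Expr.eval, hri, hN', Op.eval]
      refine ⟨by omega, hNw, ?_⟩
      split_ifs; omega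
    · simp [Expr.eval, hri, hN', Op.eval, hi]
    · refine Runs.seq (hbody i hi s' hag hri) fun s₁ h₁ => ?_
      have hrd1 : s₁.reg d = F i := by rw [h₁.1.reg d (by omega), hrd]
      have hri1 : s₁.reg (d + 1) = i := by rw [h₁.1.reg _ (by omega), hri]
      obtain ⟨hEf, hEe⟩ := hE i hi s₁ hrd1 h₁.2
      refine Runs.seq (Runs.set (Q := fun s₂ => s₂ = s₁.setReg d (E.eval s₁)) hEf rfl)
        fun s₂ h₂ => ?_
      subst h₂
      refine Runs.set ?_ ⟨hi, ?_, ?_, ?_⟩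
      · simp only [Expr.Fits, Expr.eval, Op.eval, State.setReg_reg]
        simp only [show d + 1 ≠ d by omega, if_false, hri1]
        omega
      · exact ((hag.trans (h₁.1.mono (by omega) le_rfl)).setReg le_rfl _).setReg (by omega) _
      · simp [Expr.eval, Op.eval, hri1]
      · simp [hEe]
  · rintro s' ⟨-, hag, hri, hrd⟩
    have hN' : s'.reg rn = N := by rw [hag.reg rn hrn, hN]
    simp only [Expr.Fits, Expr.eval, hri, hN', Op.eval]
    refine ⟨⟨by omega, hNw, ?_⟩, ?_⟩
    all_goals simp
  · refine ⟨Nat.zero_le _, ((Agree.refl s).setReg le_rfl _).setReg (by omega) _, by simp, ?_⟩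
    simp [hinit0]

/-- Sum of the values of the body. -/
def sumLoop (d rn : ℕ) (body : Prog) : Prog :=
  forLoop d rn (.lit 0) (.bin .add (.reg d) (.reg (d + 2))) body

/-- Maximum of the values of the body. -/
def maxLoop (d rn : ℕ) (body : Prog) : Prog :=
  forLoop d rn (.lit 0) (.bin .add (.reg d) (.bin .sub (.reg (d + 2)) (.reg d))) body

/-- Only the total has to fit into a word, since partial sums are smaller. The time is rounded up to
a product, so that nested loops have readable bounds. -/
theorem Calc.sumLoop {w d A rn : ℕ} {body : Prog} {s : State} {N Tb T : ℕ}
    {f : ℕ → ℕ} (hrn : rn < d) (hN : s.reg rn = N) (hNw : N < 2 ^ w) (hw : 1 ≤ w)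
    (hbody : ∀ i < N, ∀ s', Agree d A s s' → s'.reg (d + 1) = i →
      Calc w (d + 2) A body s' Tb (f i))
    (hsum : ∑ i ∈ Finset.range N, f i < 2 ^ w) (hT : (N + 1) * (Tb + 12) ≤ T) :
    Calc w d A (sumLoop d rn body) s T (∑ i ∈ Finset.range N, f i) := by
  refine (Calc.forLoop (F := fun i => ∑ j ∈ Finset.range i, f j) (f := f) hrn hN hNw hw
    (by simp [Expr.Fits]) (by simp [Expr.eval]) hbody ?_).mono ?_
  · intro i hi s' h1 h2
    have hle : ∑ j ∈ Finset.range (i + 1), f j < 2 ^ w :=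
      (Finset.sum_le_sum_of_subset (Finset.range_mono hi)).trans_lt hsum
    rw [Finset.sum_range_succ] at hle
    simp only [Expr.Fits, Expr.eval, Op.eval, h1, h2]
    refine ⟨⟨by omega, by omega, hle⟩, (Finset.sum_range_succ _ _).symm⟩
  · simp only [Expr.cost]
    refine le_trans ?_ hT
    ring_nf; omega

/-- With truncated subtraction `a + (b - a)` is the maximum of `a` and `b`, so no branching is
needed and no intermediate value exceeds the larger operand. -/
theorem Calc.maxLoop {w d A rn : ℕ} {body : Prog} {s : State} {N Tb T : ℕ}
    {f : ℕ → ℕ} (hrn : rn < d) (hN : s.reg rn = N) (hNw : N < 2 ^ w) (hw : 1 ≤ w)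
    (hbody : ∀ i < N, ∀ s', Agree d A s s' → s'.reg (d + 1) = i →
      Calc w (d + 2) A body s' Tb (f i))
    (hsup : ∀ i < N, f i < 2 ^ w) (hT : (N + 1) * (Tb + 14) ≤ T) :
    Calc w d A (maxLoop d rn body) s T ((Finset.range N).sup f) := by
  refine (Calc.forLoop (F := fun i => (Finset.range i).sup f) (f := f) hrn hN hNw hw
    (by simp [Expr.Fits]) (by simp [Expr.eval]) hbody ?_).mono ?_
  · intro i hi s' h1 h2
    have hle : (Finset.range i).sup f < 2 ^ w := by
      refine (Finset.sup_lt_iff (by simp)).2 fun j hj => hsup j ?_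
      have := Finset.mem_range.1 hj
      omega
    have := hsup i hi
    simp only [Expr.Fits, Expr.eval, Op.eval, h1, h2]
    refine ⟨⟨by omega, ⟨by omega, by omega, by omega⟩, by omega⟩, ?_⟩
    rw [Finset.range_add_one, Finset.sup_insert]
    omega
  · simp only [Expr.cost]
    refine le_trans ?_ hT
    ring_nf; omega

end WordRAM

namespace WordRAM

/-! ### Enumeration of digit vectors -/

/-- Adding one in base `b`, where `J` is the first position whose digit is not `b - 1`. The digits
below `J` form the largest remainder `b ^ j - 1`, so for `j ≤ J` the quotient by `b ^ j` grows by
exactly one. -/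
theorem div_pow_mod_succ_of_carry {b N J : ℕ} (hb : 2 ≤ b)
    (hlow : ∀ j < J, N / b ^ j % b = b - 1) (hJ : N / b ^ J % b ≠ b - 1) (j : ℕ) :
    (N + 1) / b ^ j % b =
      if j < J then 0 else if j = J then N / b ^ j % b + 1 else N / b ^ j % b := by
  have hb0 : 0 < b := by omega
  have hmod : ∀ j ≤ J, N % b ^ j = b ^ j - 1 := by
    intro j
    induction j with
    | zero => intro _; simp [Nat.mod_one]
    | succ j ih =>
      intro hj
      rw [Nat.mod_pow_succ, ih (by omega), hlow j (by omega), pow_succ]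
      have := Nat.pow_pos (n := j) hb0
      obtain ⟨c, rfl⟩ : ∃ c, b = c + 1 := ⟨b - 1, by omega⟩
      simp only [Nat.add_sub_cancel, Nat.mul_succ]
      omega
  have hdiv : ∀ j ≤ J, (N + 1) / b ^ j = N / b ^ j + 1 := by
    intro j hj
    have hp := Nat.pow_pos (n := j) hb0
    have h1 := Nat.div_add_mod N (b ^ j)
    rw [hmod j hj] at h1
    have h2 : N + 1 = b ^ j * (N / b ^ j + 1) := by
      rw [Nat.mul_add]; omega
    conv_lhs => rw [h2]
    rw [Nat.mul_div_cancel_left _ hp]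
  rcases lt_trichotomy j J with h | h | h
  · rw [if_pos h, hdiv j h.le, Nat.add_mod, hlow j h, Nat.mod_eq_of_lt (show 1 < b by omega),
      show b - 1 + 1 = b by omega, Nat.mod_self]
  · subst h
    rw [if_neg (lt_irrefl _), if_pos rfl, hdiv j le_rfl, Nat.add_mod,
      Nat.mod_eq_of_lt (show 1 < b by omega), Nat.mod_eq_of_lt]
    have := Nat.mod_lt (N / b ^ j) hb0
    omega
  · rw [if_neg (by omega), if_neg (by omega)]
    congr 1
    -- Digit `J` can still be increased, so the carry is absorbed there and the quotients above it
    -- do not change.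
    have hs : (N + 1) / b ^ (J + 1) = N / b ^ (J + 1) := by
      rw [pow_succ, ← Nat.div_div_eq_div_mul, ← Nat.div_div_eq_div_mul, hdiv J le_rfl]
      have h1 := Nat.div_add_mod (N / b ^ J) b
      have h2 := Nat.mod_lt (N / b ^ J) hb0
      refine Nat.div_eq_of_lt_le ?_ ?_
      · rw [Nat.mul_comm]; omega
      · rw [Nat.add_mul, Nat.mul_comm (N / b ^ J / b)]; omega
    obtain ⟨c, rfl⟩ : ∃ c, j = J + 1 + c := ⟨j - (J + 1), by omega⟩
    rw [pow_add, ← Nat.div_div_eq_div_mul, ← Nat.div_div_eq_div_mul, hs]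

/-- Used to find a vector, known only from an existence argument, among the indices of an
enumeration. -/
theorem exists_digits (b : ℕ) (d : ℕ → ℕ) : ∀ m : ℕ, (∀ j < m, d j < b) →
    ∃ N < b ^ m, ∀ j < m, N / b ^ j % b = d j := by
  intro m
  induction m with
  | zero => intro _; exact ⟨0, by simp, by simp⟩
  | succ m ih =>
    intro hd
    obtain ⟨N, hN, hdig⟩ := ih fun j hj => hd j (by omega)
    have hb : 0 < b := (Nat.zero_le _).trans_lt (hd m (by omega))
    refine ⟨N + b ^ m * d m, ?_, ?_⟩
    · have h1 : b ^ m * d m ≤ b ^ m * (b - 1) := by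
        have := hd m (by omega)
        exact Nat.mul_le_mul_left _ (by omega)
      have h2 : b ^ (m + 1) = b ^ m * (b - 1) + b ^ m := by
        rw [pow_succ]
        obtain ⟨c, rfl⟩ : ∃ c, b = c + 1 := ⟨b - 1, by omega⟩
        simp [Nat.mul_succ]
      omega
    · intro j hj
      rcases Nat.lt_or_ge j m with h | h
      · rw [← hdig j h]
        obtain ⟨c, rfl⟩ : ∃ c, m = j + 1 + c := ⟨m - (j + 1), by omega⟩
        rw [show b ^ (j + 1 + c) * d (j + 1 + c) = b ^ j * (b * (b ^ c * d (j + 1 + c))) by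
          ring, Nat.add_mul_div_left _ _ (Nat.pow_pos hb), Nat.add_mul_mod_self_left]
      · obtain rfl : j = m := by omega
        rw [Nat.add_mul_div_left _ _ (Nat.pow_pos hb), Nat.div_eq_of_lt hN, zero_add,
          Nat.mod_eq_of_lt (hd j (by omega))]

/-- Enumerates in array `A` all vectors of `rm` digits in base `rb`; for each of them the body is
computed into register `d+2` and the accumulator `d` is updated. Cell `rm` is a sentinel. -/
def odometer (d A rm rb : ℕ) (init E : Expr) (body : Prog) : Prog :=
  .seq (.set d init) <| .seq (.set (d + 1) (.lit 0)) <|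
  .seq (.loop (.bin .lt (.reg (d + 1)) (.bin .add (.reg rm) (.lit 1)))
    (.seq (.put A (.reg (d + 1)) (.lit 0)) (.set (d + 1) (.bin .add (.reg (d + 1)) (.lit 1))))) <|
  .loop (.bin .eq (.get A (.reg rm)) (.lit 0)) <|
    .seq body <| .seq (.set d E) <| .seq (.set (d + 1) (.lit 0)) <|
    .seq (.loop (.bin .eq (.bin .add (.get A (.reg (d + 1))) (.lit 1)) (.reg rb))
      (.seq (.put A (.reg (d + 1)) (.lit 0))
        (.set (d + 1) (.bin .add (.reg (d + 1)) (.lit 1))))) <|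
    .put A (.reg (d + 1)) (.bin .add (.get A (.reg (d + 1))) (.lit 1))

/-- As `N < b ^ m`, the sentinel digit `m` is `0`, which differs from `b - 1` because `2 ≤ b`; so
the carry stops at the sentinel at the latest. For this reason every base has to be at least `2`,
even when the cover is empty. -/
theorem Runs.carry {w d A rb m b N : ℕ} {s : State} (hrb : rb < d)
    (hb : s.reg rb = b) (hb2 : 2 ≤ b) (hmw : m + 1 < 2 ^ w)
    (hbw : b + 1 < 2 ^ w) (hN : N < b ^ m) (hd : ∀ j ≤ m, s.arr A j = N / b ^ j % b)
    (hj0 : s.reg (d + 1) = 0) :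
    Runs w (.seq (.loop (.bin .eq (.bin .add (.get A (.reg (d + 1))) (.lit 1)) (.reg rb))
      (.seq (.put A (.reg (d + 1)) (.lit 0))
        (.set (d + 1) (.bin .add (.reg (d + 1)) (.lit 1)))))
      (.put A (.reg (d + 1)) (.bin .add (.get A (.reg (d + 1))) (.lit 1)))) s
      (m * 14 + 13) fun s' => Agree (d + 1) A s s' ∧
        ∀ j ≤ m, s'.arr A j = (N + 1) / b ^ j % b := by
  have hb0 : 0 < b := by omega
  have hex : ∃ j, N / b ^ j % b ≠ b - 1 := ⟨m, by
    rw [Nat.div_eq_of_lt hN, Nat.zero_mod]; omega⟩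
  set J := Nat.find hex with hJdef
  have hJ : N / b ^ J % b ≠ b - 1 := Nat.find_spec hex
  have hlow : ∀ j < J, N / b ^ j % b = b - 1 := fun j hj => by
    have := Nat.find_min hex hj
    omega
  have hJm : J ≤ m := Nat.find_min' hex (by
    rw [Nat.div_eq_of_lt hN, Nat.zero_mod]; omega)
  have hdlt : ∀ j, N / b ^ j % b < b := fun j => Nat.mod_lt _ hb0
  have key := Runs.loop (w := w)
    (e := .bin .eq (.bin .add (.get A (.reg (d + 1))) (.lit 1)) (.reg rb))
    (p := .seq (.put A (.reg (d + 1)) (.lit 0))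
        (.set (d + 1) (.bin .add (.reg (d + 1)) (.lit 1))))
    (T := 3 + 4) (N := J)
    (fun i s' => Agree (d + 1) A s s' ∧ s'.reg (d + 1) = i ∧
      ∀ j ≤ m, s'.arr A j = if j < i then 0 else N / b ^ j % b) ?_ ?_ (s := s) ?_
  · refine (key.seq (T₂ := 6) (Q := fun s' => Agree (d + 1) A s s' ∧
        ∀ j ≤ m, s'.arr A j = (N + 1) / b ^ j % b) ?_).mono ?_ (fun s' h => h)
    · rintro s' ⟨hag, hr, hd'⟩
      have hval := hd' J hJm
      rw [if_neg (lt_irrefl _)] at hval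
      have := hdlt J
      refine Runs.put ?_ ?_ ⟨hag.setArr le_rfl _ _, ?_⟩
      · simp only [Expr.Fits, hr]; omega
      · simp only [Expr.Fits, Expr.eval, Op.eval, hr, hval]
        refine ⟨⟨by omega, by omega⟩, by omega, by omega⟩
      · intro j hj
        rw [div_pow_mod_succ_of_carry hb2 hlow hJ j]
        simp only [State.setArr_arr, Expr.eval, Op.eval, hr, hval, true_and]
        by_cases h : j = J
        · subst h; simp
        · simp [h, hd' j hj]
    · simp only [Expr.cost]
      have : J * 14 ≤ m * 14 := Nat.mul_le_mul_right _ hJm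
      omega
  · rintro i hi s' ⟨hag, hr, hd'⟩
    have hval := hd' i (by omega)
    rw [if_neg (lt_irrefl _), hlow i hi] at hval
    have hrb' : s'.reg rb = b := by rw [hag.reg rb (by omega), hb]
    refine ⟨?_, ?_, ?_⟩
    · simp only [Expr.Fits, Expr.eval, Op.eval, hr, hval, hrb']
      refine ⟨⟨⟨by omega, by omega⟩, by omega, by omega⟩, by omega, ?_⟩
      split_ifs <;> omega
    · simp only [Expr.eval, Op.eval, hr, hval, hrb']
      rw [if_pos (by omega)]; omega
    · refine Runs.seq (Runs.put (Q := fun s'' => s'' = s'.setArr A i 0) ?_ ?_ ?_) ?_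
      · simp only [Expr.Fits, hr]; omega
      · simp only [Expr.Fits]; omega
      · simp [Expr.eval, hr]
      · rintro s'' rfl
        refine Runs.set ?_ ⟨(hag.setArr le_rfl _ _).setReg le_rfl _, ?_, ?_⟩
        · simp only [Expr.Fits, Expr.eval, Op.eval, State.setArr_reg, hr]
          omega
        · simp [Expr.eval, Op.eval, hr]
        · intro j hj
          simp only [State.setReg_arr, State.setArr_arr, true_and, hd' j hj]
          grind
  · rintro s' ⟨hag, hr, hd'⟩
    have hval := hd' J hJm
    rw [if_neg (lt_irrefl _)] at hval
    have := hdlt J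
    have hrb' : s'.reg rb = b := by rw [hag.reg rb (by omega), hb]
    simp only [Expr.Fits, Expr.eval, Op.eval, hr, hval, hrb']
    rw [if_neg (by omega)]
    refine ⟨⟨⟨⟨by omega, by omega⟩, by omega, by omega⟩, by omega, by omega⟩, rfl⟩
  · exact ⟨Agree.refl s, hj0, fun j hj => by simpa using hd j hj⟩

/-- Iteration `i` sees the digits of `i`, and the sentinel becomes `1` exactly at `i = b ^ m`, which
ends the loop. The body may change arrays only from `A + 1` on, so the digits survive it and
odometers can be nested. -/
theorem Calc.odometer {w d A rm rb : ℕ} {init E : Expr} {body : Prog} {s : State}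
    {m b Tb : ℕ} {f F : ℕ → ℕ} (hrm : rm < d) (hrb : rb < d) (hm : s.reg rm = m)
    (hb : s.reg rb = b) (hb2 : 2 ≤ b) (hmw : m + 1 < 2 ^ w) (hbw : b + 1 < 2 ^ w)
    (hinit : init.Fits w s) (hinit0 : init.eval s = F 0)
    (hbody : ∀ i < b ^ m, ∀ s', Agree d A s s' → (∀ j ≤ m, s'.arr A j = i / b ^ j % b) →
      Calc w (d + 2) (A + 1) body s' Tb (f i))
    (hE : ∀ i < b ^ m, ∀ s', s'.reg d = F i → s'.reg (d + 2) = f i →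
      E.Fits w s' ∧ E.eval s' = F (i + 1)) :
    Calc w d A (odometer d A rm rb init E body) s
      (b ^ m * (Tb + E.cost + m * 14 + 21) + init.cost + (m + 1) * 13 + 15) (F (b ^ m)) := by
  have hb0 : 0 < b := by omega
  have clear := Runs.loop (w := w) (e := .bin .lt (.reg (d + 1)) (.bin .add (.reg rm) (.lit 1)))
    (p := .seq (.put A (.reg (d + 1)) (.lit 0))
      (.set (d + 1) (.bin .add (.reg (d + 1)) (.lit 1))))
    (T := 3 + 4) (N := m + 1)
    (fun i s' => Agree d A s s' ∧ s'.reg (d + 1) = i ∧ s'.reg d = F 0 ∧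
      i ≤ m + 1 ∧ ∀ j < i, s'.arr A j = 0) ?_ ?_
    (s := (s.setReg d (init.eval s)).setReg (d + 1) 0) ?_
  rotate_left
  · rintro i hi s' ⟨hag, hr, hF, -, hz⟩
    have hrm' : s'.reg rm = m := by rw [hag.reg rm hrm, hm]
    refine ⟨?_, ?_, ?_⟩
    · simp only [Expr.Fits, Expr.eval, Op.eval, hr, hrm']
      refine ⟨by omega, ⟨by omega, by omega, by omega⟩, ?_⟩
      split_ifs; omega
    · simp [Expr.eval, Op.eval, hr, hrm', hi]
    · refine Runs.seq (Runs.put (Q := fun s'' => s'' = s'.setArr A i 0) ?_ ?_ ?_) ?_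
      · simp only [Expr.Fits, hr]; omega
      · simp only [Expr.Fits]; omega
      · simp [Expr.eval, hr]
      · rintro s'' rfl
        refine Runs.set ?_ ⟨(hag.setArr le_rfl _ _).setReg (by omega) _, ?_, ?_, by omega, ?_⟩
        · simp only [Expr.Fits, Expr.eval, Op.eval, State.setArr_reg, hr]
          omega
        · simp [Expr.eval, Op.eval, hr]
        · simp [hF]
        · intro j hj
          simp only [State.setReg_arr, State.setArr_arr, true_and]
          split_ifs with h
          · rfl
          · exact hz j (by omega)
  · rintro s' ⟨hag, hr, hF, -, hz⟩
    have hrm' : s'.reg rm = m := by rw [hag.reg rm hrm, hm]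
    simp only [Expr.Fits, Expr.eval, Op.eval, hr, hrm', lt_irrefl, if_false]
    refine ⟨⟨by omega, ⟨by omega, by omega, by omega⟩, by omega⟩, trivial⟩
  · exact ⟨((Agree.refl s).setReg le_rfl _).setReg (by omega) _, by simp, by simp [hinit0],
      by omega, by simp⟩
  have main := fun s₀ => Runs.loop (w := w) (e := .bin .eq (.get A (.reg rm)) (.lit 0))
    (p := .seq body <| .seq (.set d E) <| .seq (.set (d + 1) (.lit 0)) <|
    .seq (.loop (.bin .eq (.bin .add (.get A (.reg (d + 1))) (.lit 1)) (.reg rb))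
      (.seq (.put A (.reg (d + 1)) (.lit 0))
        (.set (d + 1) (.bin .add (.reg (d + 1)) (.lit 1))))) <|
    .put A (.reg (d + 1)) (.bin .add (.get A (.reg (d + 1))) (.lit 1)))
    (T := Tb + (E.cost + 1 + (2 + (m * 14 + 13)))) (N := b ^ m)
    (fun i s' => Agree d A s s' ∧ s'.reg d = F i ∧ ∀ j ≤ m, s'.arr A j = i / b ^ j % b)
    ?_ ?_ (s := s₀)
  rotate_left
  · rintro i hi s' ⟨hag, hF, hdig⟩
    have hrm' : s'.reg rm = m := by rw [hag.reg rm hrm, hm]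
    have h0 : s'.arr A m = 0 := by
      rw [hdig m le_rfl, Nat.div_eq_of_lt hi, Nat.zero_mod]
    refine ⟨?_, ?_, ?_⟩
    · simp only [Expr.Fits, Expr.eval, Op.eval, hrm', h0]
      refine ⟨⟨by omega, by omega⟩, by omega, ?_⟩
      split_ifs <;> omega
    · simp [Expr.eval, Op.eval, hrm', h0]
    · refine Runs.seq (hbody i hi s' hag hdig) fun s₁ h₁ => ?_
      obtain ⟨hEf, hEe⟩ := hE i hi s₁ (by rw [h₁.1.reg d (by omega), hF]) h₁.2
      refine Runs.seq (Runs.set (Q := fun s₂ => s₂ = s₁.setReg d (E.eval s₁)) hEf rfl) ?_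
      rintro s₂ rfl
      refine Runs.seq (Runs.set
        (Q := fun s₂ => s₂ = (s₁.setReg d (E.eval s₁)).setReg (d + 1) 0) ?_ rfl) ?_
      · simp [Expr.Fits]
      rintro s₂ rfl
      have hag2 : Agree d A s ((s₁.setReg d (E.eval s₁)).setReg (d + 1) 0) :=
        ((hag.trans (h₁.1.mono (by omega) (by omega))).setReg le_rfl _).setReg (by omega) _
      refine (Runs.carry (m := m) (N := i) hrb
        (by rw [hag2.reg rb hrb, hb]) hb2 hmw hbw hi ?_ (by simp)).mono le_rfl ?_
      · intro j hj
        simp only [State.setReg_arr]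
        rw [h₁.1.arr A (by omega), hdig j hj]
      · rintro s₃ ⟨h3, h3'⟩
        refine ⟨hag2.trans (h3.mono (by omega) le_rfl), ?_, h3'⟩
        rw [h3.reg d (by omega)]
        simp [hEe]
  · rintro s' ⟨hag, hF, hdig⟩
    have hrm' : s'.reg rm = m := by rw [hag.reg rm hrm, hm]
    have h0 : s'.arr A m = 1 := by
      rw [hdig m le_rfl, Nat.div_self (Nat.pow_pos hb0), Nat.mod_eq_of_lt (by omega)]
    simp only [Expr.Fits, Expr.eval, Op.eval, hrm', h0]
    exact ⟨⟨⟨by omega, by omega⟩, by omega, by simp⟩, by simp⟩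
  refine Runs.mono (T := init.cost + 1 + (2 + (((m + 1) * (3 + 4 + 5 + 1) + 5 + 1) +
      (b ^ m * (Tb + (E.cost + 1 + (2 + (m * 14 + 13))) + 4 + 1) + 4 + 1))))
    (Q := fun s' => Agree d A s s' ∧ s'.reg d = F (b ^ m)) ?_ ?_ (fun s' h => h)
  · refine Runs.seq (Runs.set (Q := fun s' => s' = s.setReg d (init.eval s)) hinit rfl) ?_
    rintro s' rfl
    refine Runs.seq (Runs.set
        (Q := fun s₂ => s₂ = (s.setReg d (init.eval s)).setReg (d + 1) 0) ?_ rfl) ?_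
    · simp [Expr.Fits]
    rintro s' rfl
    refine Runs.seq clear fun s' hs' => ?_
    refine (main s' ⟨hs'.1, hs'.2.2.1, fun j hj => ?_⟩).mono le_rfl fun s'' h => ⟨h.1, h.2.1⟩
    rw [hs'.2.2.2.2 j (by omega)]
    simp
  · ring_nf; omega

/-- Maximum of the values of the body over all digit vectors. -/
def maxOdometer (d A rm rb : ℕ) (body : Prog) : Prog :=
  odometer d A rm rb (.lit 0) (.bin .add (.reg d) (.bin .sub (.reg (d + 2)) (.reg d))) body

/-- Minimum of the initial value in register `ri` and the values of the body. -/
def minOdometer (d A rm rb ri : ℕ) (body : Prog) : Prog :=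
  odometer d A rm rb (.reg ri) (.bin .sub (.reg d) (.bin .sub (.reg d) (.reg (d + 2)))) body

theorem Calc.maxOdometer {w d A rm rb : ℕ} {body : Prog} {s : State} {m b Tb T : ℕ} {f : ℕ → ℕ}
    (hrm : rm < d) (hrb : rb < d) (hm : s.reg rm = m)
    (hb : s.reg rb = b) (hb2 : 2 ≤ b) (hmw : m + 1 < 2 ^ w) (hbw : b + 1 < 2 ^ w)
    (hbody : ∀ i < b ^ m, ∀ s', Agree d A s s' → (∀ j ≤ m, s'.arr A j = i / b ^ j % b) →
      Calc w (d + 2) (A + 1) body s' Tb (f i))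
    (hsup : ∀ i < b ^ m, f i < 2 ^ w) (hT : (b ^ m + 1) * ((m + 1) * (Tb + 32)) ≤ T) :
    Calc w d A (maxOdometer d A rm rb body) s T ((Finset.range (b ^ m)).sup f) := by
  refine (Calc.odometer (F := fun i => (Finset.range i).sup f) (f := f) hrm hrb hm hb hb2 hmw hbw
    (by simp [Expr.Fits]) (by simp [Expr.eval]) hbody ?_).mono ?_
  · intro i hi s' h1 h2
    have hle : (Finset.range i).sup f < 2 ^ w := by
      refine (Finset.sup_lt_iff (by simp)).2 fun j hj => hsup j ?_
      have := Finset.mem_range.1 hj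
      omega
    have := hsup i hi
    simp only [Expr.Fits, Expr.eval, Op.eval, h1, h2]
    refine ⟨⟨by omega, ⟨by omega, by omega, by omega⟩, by omega⟩, ?_⟩
    rw [Finset.range_add_one, Finset.sup_insert]
    omega
  · simp only [Expr.cost]
    refine le_trans ?_ hT
    have h1 : Tb + 5 + m * 14 + 21 ≤ (m + 1) * (Tb + 32) := by nlinarith [Nat.zero_le (m * Tb)]
    have h2 : 1 + (m + 1) * 13 + 15 ≤ (m + 1) * (Tb + 32) := by nlinarith [Nat.zero_le (m * Tb)]
    calc _ = b ^ m * (Tb + 5 + m * 14 + 21) + (1 + (m + 1) * 13 + 15) := by ring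
      _ ≤ b ^ m * ((m + 1) * (Tb + 32)) + (m + 1) * (Tb + 32) :=
        Nat.add_le_add (Nat.mul_le_mul_left _ h1) h2
      _ = _ := by ring

/-- With truncated subtraction `a - (a - b)` is the minimum of `a` and `b`. The result is expressed
as a fold because the initial value takes part in the minimum and `ℕ` has no largest element to
start from. -/
theorem Calc.minOdometer {w d A rm rb ri : ℕ} {body : Prog} {s : State} {m b Tb T x₀ : ℕ}
    {f : ℕ → ℕ} (hrm : rm < d) (hrb : rb < d) (hm : s.reg rm = m)
    (hb : s.reg rb = b) (hb2 : 2 ≤ b) (hmw : m + 1 < 2 ^ w) (hbw : b + 1 < 2 ^ w)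
    (hx : s.reg ri = x₀) (hxw : x₀ < 2 ^ w)
    (hbody : ∀ i < b ^ m, ∀ s', Agree d A s s' → (∀ j ≤ m, s'.arr A j = i / b ^ j % b) →
      Calc w (d + 2) (A + 1) body s' Tb (f i))
    (hsup : ∀ i < b ^ m, f i < 2 ^ w) (hT : (b ^ m + 1) * ((m + 1) * (Tb + 32)) ≤ T) :
    Calc w d A (minOdometer d A rm rb ri body) s T
      ((List.range (b ^ m)).foldl (fun acc i => min acc (f i)) x₀) := by
  have hFle : ∀ i, (List.range i).foldl (fun acc i => min acc (f i)) x₀ ≤ x₀ := by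
    intro i
    induction i with
    | zero => simp
    | succ i ih => rw [List.range_succ, List.foldl_append]; simp [ih]
  refine (Calc.odometer (F := fun i => (List.range i).foldl (fun acc i => min acc (f i)) x₀)
    (f := f) hrm hrb hm hb hb2 hmw hbw
    (by simp [Expr.Fits, hx, hxw]) (by simp [Expr.eval, hx]) hbody ?_).mono ?_
  · intro i hi s' h1 h2
    have hle := hFle i
    have := hsup i hi
    simp only [Expr.Fits, Expr.eval, Op.eval, h1, h2]
    refine ⟨⟨by omega, ⟨by omega, by omega, by omega⟩, by omega⟩, ?_⟩
    rw [List.range_succ, List.foldl_append]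
    simp only [List.foldl_cons, List.foldl_nil]
    omega
  · simp only [Expr.cost]
    refine le_trans ?_ hT
    have h1 : Tb + 5 + m * 14 + 21 ≤ (m + 1) * (Tb + 32) := by nlinarith [Nat.zero_le (m * Tb)]
    have h2 : 1 + (m + 1) * 13 + 15 ≤ (m + 1) * (Tb + 32) := by nlinarith [Nat.zero_le (m * Tb)]
    calc _ = b ^ m * (Tb + 5 + m * 14 + 21) + (1 + (m + 1) * 13 + 15) := by ring
      _ ≤ b ^ m * ((m + 1) * (Tb + 32)) + (m + 1) * (Tb + 32) :=
        Nat.add_le_add (Nat.mul_le_mul_left _ h1) h2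
      _ = _ := by ring

theorem foldl_min_le {f : ℕ → ℕ} {x₀ M i : ℕ} (hi : i < M) :
    (List.range M).foldl (fun acc i => min acc (f i)) x₀ ≤ f i := by
  induction M with
  | zero => omega
  | succ M ih =>
    rw [List.range_succ, List.foldl_append]
    simp only [List.foldl_cons, List.foldl_nil]
    rcases Nat.lt_succ_iff_lt_or_eq.1 hi with h | rfl
    · exact (min_le_left _ _).trans (ih h)
    · exact min_le_right _ _

theorem foldl_min_le_init {f : ℕ → ℕ} {x₀ : ℕ} (M : ℕ) :
    (List.range M).foldl (fun acc i => min acc (f i)) x₀ ≤ x₀ := by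
  induction M with
  | zero => simp
  | succ M ih =>
    rw [List.range_succ, List.foldl_append]
    simp [ih]

theorem le_foldl_min {f : ℕ → ℕ} {x₀ M y : ℕ} (h0 : y ≤ x₀) (h : ∀ i < M, y ≤ f i) :
    y ≤ (List.range M).foldl (fun acc i => min acc (f i)) x₀ := by
  induction M with
  | zero => simpa
  | succ M ih =>
    rw [List.range_succ, List.foldl_append]
    simp only [List.foldl_cons, List.foldl_nil]
    exact le_min (ih fun i hi => h i (by omega)) (h M (by omega))

end WordRAM

namespace FairCC

/-! ### Optimal assignments and potentials -/

/-- Any bijection of `X` with the disjoint union of the slots `Fin (cap i)` provides such a map. -/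
theorem exists_fiber_card_eq {α ι : Type*} [Fintype ι] [DecidableEq ι] (X : Finset α)
    (cap : ι → ℕ) (h : ∑ i, cap i = X.card) :
    ∃ φ : X → ι, ∀ i, (Finset.univ.filter fun v => φ v = i).card = cap i := by
  have e : X ≃ Σ i, Fin (cap i) := Fintype.equivOfCardEq (by simp [h])
  refine ⟨fun v => (e v).1, fun i => ?_⟩
  rw [← Fintype.card_fin (cap i), ← Fintype.card_subtype]
  refine Fintype.card_congr ((e.subtypeEquiv (q := fun x => x.1 = i) fun v => Iff.rfl).trans ?_)
  exact Equiv.sigmaSubtype i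

/-- The dual objective of the assignment problem with weights `w` and capacities `cap`, for the
potential `r`. -/
noncomputable def dualValue {α ι : Type*} [Fintype α] [Fintype ι] [Nonempty ι] (w : α → ι → ℕ)
    (cap : ι → ℕ) (r : ι → ℤ) : ℤ :=
  ∑ v, Finset.univ.sup' Finset.univ_nonempty (fun i => (w v i : ℤ) + r i) - ∑ i, r i * cap i

section
variable {α ι : Type*} [Fintype α] [Fintype ι] [Nonempty ι] (w : α → ι → ℕ)

omit [Nonempty ι] in
-- Summing over fibers: a potential contributes the same amount to every assignment that fills the
-- capacities.
theorem sum_potential_eq [DecidableEq ι] {cap : ι → ℕ} {φ : α → ι}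
    (hφ : ∀ i, (Finset.univ.filter fun v => φ v = i).card = cap i) (r : ι → ℤ) :
    ∑ v, r (φ v) = ∑ i, r i * cap i := by
  rw [← Finset.sum_fiberwise (s := Finset.univ) (g := φ)]
  refine Finset.sum_congr rfl fun i _ => ?_
  rw [Finset.sum_congr rfl (g := fun _ => r i) (fun v hv => by rw [(Finset.mem_filter.1 hv).2])]
  rw [Finset.sum_const, hφ]
  simp [mul_comm]

/-- Weak duality: an assignment picks one index where the dual objective takes the maximum, and the
potential terms cancel by `sum_potential_eq`. -/
theorem le_dualValue [DecidableEq ι] {cap : ι → ℕ} {φ : α → ι}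
    (hφ : ∀ i, (Finset.univ.filter fun v => φ v = i).card = cap i) (r : ι → ℤ) :
    ((∑ v, w v (φ v) : ℕ) : ℤ) ≤ dualValue w cap r := by
  have h : ∑ v, ((w v (φ v) : ℤ) + r (φ v)) ≤
      ∑ v, Finset.univ.sup' Finset.univ_nonempty (fun i => (w v i : ℤ) + r i) :=
    Finset.sum_le_sum fun v _ =>
      Finset.le_sup' (fun i => (w v i : ℤ) + r i) (Finset.mem_univ (φ v))
  rw [Finset.sum_add_distrib, sum_potential_eq hφ] at h
  rw [dualValue]
  push_cast
  linarith

/-- The total capacity is the number of elements, so the constant is added and subtracted equally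
often. Hence the maximum of a potential can be normalized. -/
theorem dualValue_add_const {cap : ι → ℕ} (hcap : ∑ i, cap i = Fintype.card α) (r : ι → ℤ)
    (c : ℤ) : dualValue w cap (fun i => r i + c) = dualValue w cap r := by
  have h1 : ∀ v, Finset.univ.sup' Finset.univ_nonempty (fun i => (w v i : ℤ) + (r i + c)) =
      Finset.univ.sup' Finset.univ_nonempty (fun i => (w v i : ℤ) + r i) + c := by
    intro v
    refine le_antisymm (Finset.sup'_le _ _ fun i hi => ?_) ?_
    · have := Finset.le_sup' (fun i => (w v i : ℤ) + r i) hi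
      linarith
    · obtain ⟨i, hi, he⟩ := Finset.exists_mem_eq_sup' (s := Finset.univ) Finset.univ_nonempty
        (fun i => (w v i : ℤ) + r i)
      rw [he]
      have := Finset.le_sup' (fun i => (w v i : ℤ) + (r i + c)) hi
      linarith
  simp only [dualValue, h1, Finset.sum_add_distrib, add_mul, Finset.sum_const, Finset.card_univ,
    ← Finset.mul_sum]
  rw [← Nat.cast_sum, hcap]
  simp only [nsmul_eq_mul]
  ring

/-- Among the potentials with maximum `s` there is one of minimum dual value with all
entries nonnegative. -/
theorem exists_dualValue_min (s : ℕ) (hw : ∀ v i, w v i ≤ s) {cap : ι → ℕ}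
    (hcap : ∑ i, cap i = Fintype.card α) :
    ∃ r : ι → ℤ, (∀ i, 0 ≤ r i ∧ r i ≤ s) ∧ ∀ r', dualValue w cap r ≤ dualValue w cap r' := by
  classical
  obtain ⟨φ, hφ⟩ := exists_fiber_card_eq (Finset.univ : Finset α) cap (by simpa using hcap)
  -- Weak duality against some assignment bounds all dual values from below. So a minimum exists,
  -- and `toNat` loses nothing.
  have hnn : ∀ r, 0 ≤ dualValue w cap r := fun r => by
    refine le_trans ?_ (le_dualValue w (φ := fun v => φ ⟨v, Finset.mem_univ v⟩) (cap := cap) ?_ r)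
    · positivity
    · intro i
      rw [← hφ i]
      refine Finset.card_bij (fun v _ => ⟨v, Finset.mem_univ v⟩) ?_ ?_ ?_
      · intro v hv; simpa using hv
      · intro v _ v' _ h; simpa using h
      · intro v hv; exact ⟨v.1, by simpa using hv, rfl⟩
  let S : Set (ι → ℤ) := {r | (∀ i, r i ≤ s) ∧ ∃ i, r i = s}
  -- Lexicographic order: first the dual value, then the total distance of the entries from `s`. The
  -- second component pushes the entries of the minimizer up as far as the dual value allows.
  let f : (ι → ℤ) → ℕ ×ₗ ℕ :=
    fun r => toLex ((dualValue w cap r).toNat, (∑ i, ((s : ℤ) - r i)).toNat)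
  obtain ⟨r, ⟨hrS, j, hj⟩, hmin⟩ := WellFounded.has_min (InvImage.wf f wellFounded_lt) S
    ⟨fun _ => s, fun _ => le_rfl, Classical.arbitrary ι, rfl⟩
  have hmin' : ∀ r' ∈ S, dualValue w cap r ≤ dualValue w cap r' := by
    intro r' hr'
    have h := hmin r' hr'
    by_contra hlt
    refine h ?_
    show f r' < f r
    rw [Prod.Lex.toLex_lt_toLex]
    left
    have := hnn r'
    simp only
    omega
  refine ⟨r, fun i => ⟨?_, hrS i⟩, fun r' => ?_⟩
  -- Raise a negative entry `i` by one. Its values then are at most `s`, as the weights are; an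
  -- entry `j` equal to `s` gives values of at least `s`, so no maximum grows, and the subtracted
  -- sum does not shrink. The new potential is closer to `s`, a contradiction.
  · by_contra hneg
    push Not at hneg
    have hij : j ≠ i := by rintro rfl; omega
    let r' := Function.update r i (r i + 1)
    have hr'S : r' ∈ S := by
      refine ⟨fun i' => ?_, j, by simp [r', hij, hj]⟩
      by_cases h : i' = i
      · subst h; simp only [r', Function.update_self]; omega
      · simp only [r', Function.update_of_ne h]; exact hrS i'
    have hsum : ∑ i', ((s : ℤ) - r' i') < ∑ i', ((s : ℤ) - r i') := by
      refine Finset.sum_lt_sum (fun i' _ => ?_) ⟨i, Finset.mem_univ i, by simp [r']⟩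
      by_cases h : i' = i
      · subst h; simp only [r', Function.update_self]; omega
      · simp [r', h]
    have hsum0 : 0 ≤ ∑ i', ((s : ℤ) - r' i') :=
      Finset.sum_nonneg fun i' _ => by have := hr'S.1 i'; omega
    have hD : dualValue w cap r' ≤ dualValue w cap r := by
      refine sub_le_sub (Finset.sum_le_sum fun v _ => Finset.sup'_le _ _ fun i' _ => ?_)
        (Finset.sum_le_sum fun i' _ => ?_)
      · by_cases h : i' = i
        · subst h
          refine le_trans ?_ (Finset.le_sup' (fun i => (w v i : ℤ) + r i) (Finset.mem_univ j))
          have := hw v i'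
          simp only [r', Function.update_self]
          omega
        · simp only [r', Function.update_of_ne h]
          exact Finset.le_sup' (fun i => (w v i : ℤ) + r i) (Finset.mem_univ i')
      · refine mul_le_mul_of_nonneg_right ?_ (by positivity)
        by_cases h : i' = i
        · subst h; simp [r']
        · simp [r', h]
    refine hmin r' hr'S ?_
    show f r' < f r
    rw [Prod.Lex.toLex_lt_toLex]
    have := hmin' r' hr'S
    right
    simp only
    exact ⟨by rw [le_antisymm hD this], by omega⟩
  -- An arbitrary competitor is shifted until its maximum is `s`, which does not change its dual
  -- value.
  · obtain ⟨i, -, hi⟩ := Finset.exists_mem_eq_sup' (s := Finset.univ) Finset.univ_nonempty r'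
    have hle : ∀ i', r' i' ≤ r' i := fun i' =>
      (Finset.le_sup' r' (Finset.mem_univ i')).trans_eq hi
    rw [← dualValue_add_const w hcap r' (s - r' i)]
    exact hmin' _ ⟨fun i' => by have := hle i'; simp only; omega, i, by simp⟩

/-- Strong duality. For an optimal potential an assignment is sought that uses only tight pairs,
those attaining the maximum in the dual objective; such an assignment has exactly the dual value as
its weight. -/
theorem exists_optimal_assignment [DecidableEq ι] (s : ℕ) (hw : ∀ v i, w v i ≤ s) {cap : ι → ℕ}
    (hcap : ∑ i, cap i = Fintype.card α) :
    ∃ φ : α → ι, (∀ i, (Finset.univ.filter fun v => φ v = i).card = cap i) ∧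
      ∃ r : ι → ℤ, (∀ i, 0 ≤ r i ∧ r i ≤ s) ∧
        ((∑ v, w v (φ v) : ℕ) : ℤ) = dualValue w cap r := by
  classical
  obtain ⟨r, hr, hmin⟩ := exists_dualValue_min w s hw hcap
  let M : α → ℤ := fun v => Finset.univ.sup' Finset.univ_nonempty (fun i => (w v i : ℤ) + r i)
  have hM : ∀ v i, (w v i : ℤ) + r i ≤ M v := fun v i =>
    Finset.le_sup' (fun i => (w v i : ℤ) + r i) (Finset.mem_univ i)
  let tight : α → Finset ι := fun v => Finset.univ.filter fun i => (w v i : ℤ) + r i = M v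
  let slots : α → Finset (Σ i, Fin (cap i)) := fun v =>
    Finset.univ.filter fun x => x.1 ∈ tight v
  -- Hall's condition. Lowering the potential by one on the tight neighbors `N` of `S` lowers the
  -- maximum of every element of `S` by at least one, while the subtracted term drops by the
  -- capacity of `N`. As the potential is optimal, `S` cannot have more elements than that capacity.
  have hall : ∀ S : Finset α, S.card ≤ (S.biUnion slots).card := by
    intro S
    let N := S.biUnion tight
    have hN : (S.biUnion slots).card = ∑ i ∈ N, cap i := by
      have : S.biUnion slots = N.sigma fun i => (Finset.univ : Finset (Fin (cap i))) := by
        ext x; simp [N, slots]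
      rw [this, Finset.card_sigma]
      simp
    rw [hN]
    have h := hmin fun i => r i - if i ∈ N then 1 else 0
    have h2 : ∑ v, Finset.univ.sup' Finset.univ_nonempty
        (fun i => (w v i : ℤ) + (r i - if i ∈ N then 1 else 0)) ≤
        ∑ v, (M v - if v ∈ S then 1 else 0) := by
      refine Finset.sum_le_sum fun v _ => Finset.sup'_le _ _ fun i _ => ?_
      have := hM v i
      by_cases hv : v ∈ S
      · by_cases hi : i ∈ N
        · simp only [hv, hi, if_true]; omega
        · have hne : (w v i : ℤ) + r i ≠ M v := fun he =>
            hi (Finset.mem_biUnion.2 ⟨v, hv, by simp [tight, he]⟩)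
          simp only [hv, hi, if_true, if_false]
          omega
      · simp only [hv, if_false]
        split_ifs <;> omega
    have h3 : ∑ i, (r i - if i ∈ N then (1 : ℤ) else 0) * cap i =
        ∑ i, r i * cap i - ∑ i ∈ N, (cap i : ℤ) := by
      simp only [sub_mul, Finset.sum_sub_distrib, ite_mul, one_mul, zero_mul]
      congr 1
      rw [Finset.sum_ite_mem, Finset.univ_inter]
    have h4 : ∑ v, (M v - if v ∈ S then (1 : ℤ) else 0) = ∑ v, M v - S.card := by
      rw [Finset.sum_sub_distrib, Finset.sum_ite_mem, Finset.univ_inter]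
      simp
    unfold dualValue at h
    rw [h3] at h
    rw [h4] at h2
    have : (S.card : ℤ) ≤ ∑ i ∈ N, (cap i : ℤ) := by
      have : ∑ v, M v = ∑ v, Finset.univ.sup' Finset.univ_nonempty
        (fun i => (w v i : ℤ) + r i) := rfl
      linarith
    exact_mod_cast this
  obtain ⟨g, hginj, hg⟩ := (Finset.all_card_le_biUnion_card_iff_exists_injective slots).1 hall
  -- There are as many slots as elements, so an injective choice of slots fills all of them.
  have hgb : Function.Bijective g :=
    (Fintype.bijective_iff_injective_and_card g).2 ⟨hginj, by simp [hcap]⟩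
  have hφ : ∀ i, (Finset.univ.filter fun v => (g v).1 = i).card = cap i := by
    intro i
    rw [← Fintype.card_fin (cap i), ← Fintype.card_subtype]
    exact Fintype.card_congr (((Equiv.ofBijective g hgb).subtypeEquiv (q := fun x => x.1 = i)
      fun v => Iff.rfl).trans (Equiv.sigmaSubtype i))
  refine ⟨fun v => (g v).1, hφ, r, hr, ?_⟩
  have ht : ∀ v, (w v (g v).1 : ℤ) + r (g v).1 = M v := fun v => by
    have := hg v
    simpa [slots, tight] using this
  have hs := Finset.sum_congr rfl fun v (_ : v ∈ Finset.univ) => ht v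
  rw [Finset.sum_add_distrib, sum_potential_eq hφ] at hs
  unfold dualValue
  push_cast
  have : ∑ v, M v = ∑ v, Finset.univ.sup' Finset.univ_nonempty
    (fun i => (w v i : ℤ) + r i) := rfl
  linarith

end

end FairCC

namespace FairCC

/-! ### Clusterings as labelings -/

section
variable {V K : Type*} [Fintype V] [DecidableEq V] [Fintype K] [DecidableEq K]

/-- Every label class contains the colors with multiplicities proportional to `F`. -/
def FairLabeling (col : V → K) (F : K → ℕ) (l : V → ℕ) : Prop :=
  ∀ c, ∃ t, ∀ q, (Finset.univ.filter fun v => l v = c ∧ col v = q).card = t * F q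

/-- The total weight of the ordered pairs with equal labels. -/
def sameWeight (g : V → V → ℕ) (l : V → ℕ) : ℕ :=
  ∑ u, ∑ v, if l u = l v then g u v else 0

omit [DecidableEq V] in
theorem card_filter_eq_sum_color (col : V → K) (p : V → Prop) [DecidablePred p] :
    (Finset.univ.filter p).card = ∑ q, (Finset.univ.filter fun v => p v ∧ col v = q).card := by
  rw [Finset.card_eq_sum_card_fiberwise (f := col) (t := Finset.univ) (fun _ _ => by simp)]
  simp only [Finset.filter_filter]

omit [DecidableEq V] in
theorem card_class_eq {col : V → K} {F : K → ℕ} {l : V → ℕ} {c t : ℕ}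
    (h : ∀ q, (Finset.univ.filter fun v => l v = c ∧ col v = q).card = t * F q) :
    (Finset.univ.filter fun v => l v = c).card = t * ∑ q, F q := by
  rw [card_filter_eq_sum_color col, Finset.mul_sum]
  exact Finset.sum_congr rfl fun q _ => h q

/-- Moving a subset `X` of the class `c` to a fresh class. -/
theorem sameWeight_split {g : V → V → ℕ} (hg : ∀ u v, g u v = g v u) {l : V → ℕ} {c c' : ℕ}
    {X : Finset V} (hX : ∀ v ∈ X, l v = c) (hc' : ∀ v, l v ≠ c') :
    sameWeight g l = sameWeight g (fun v => if v ∈ X then c' else l v) +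
      2 * ∑ u ∈ X, ∑ v ∈ Finset.univ.filter (fun v => l v = c ∧ v ∉ X), g u v := by
  -- The only pairs that stop sharing a label are those between `X` and the rest of class `c`, each
  -- in both orders.
  have key : ∀ u v, (if l u = l v then g u v else 0) =
      (if (if u ∈ X then c' else l u) = (if v ∈ X then c' else l v) then g u v else 0) +
      ((if u ∈ X then if l v = c ∧ v ∉ X then g u v else 0 else 0) +
        (if v ∈ X then if l u = c ∧ u ∉ X then g v u else 0 else 0)) := by
    intro u v
    rw [hg v u]
    have h1 := hX u
    have h2 := hX v
    have h3 := hc' u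
    have h4 := hc' v
    by_cases hu : u ∈ X <;> by_cases hv : v ∈ X <;> simp only [hu, hv, if_true, if_false] <;> grind
  have e1 : ∑ u, ∑ v, (if u ∈ X then if l v = c ∧ v ∉ X then g u v else 0 else 0) =
      ∑ u ∈ X, ∑ v ∈ Finset.univ.filter (fun v => l v = c ∧ v ∉ X), g u v := by
    rw [← Finset.sum_filter_add_sum_filter_not Finset.univ (fun u => u ∈ X)]
    rw [Finset.sum_eq_zero (s := Finset.univ.filter fun u => ¬ u ∈ X), add_zero]
    · simp only [Finset.filter_mem_eq_inter, Finset.univ_inter]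
      refine Finset.sum_congr rfl fun u hu => ?_
      rw [Finset.sum_filter]
      simp [hu]
    · intro u hu
      simp [(Finset.mem_filter.1 hu).2]
  have e2 : ∑ u, ∑ v, (if v ∈ X then if l u = c ∧ u ∉ X then g v u else 0 else 0) =
      ∑ u, ∑ v, (if u ∈ X then if l v = c ∧ v ∉ X then g u v else 0 else 0) :=
    Finset.sum_comm
  unfold sameWeight
  simp only [key, Finset.sum_add_distrib]
  rw [e2, e1]
  ring

/-- Under fair labelings that satisfy the cost bound there is one in which every class with `k`
vertices of the cover `C` consists of at most `2k` copies of the fairlet, or of one. -/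
theorem exists_reduced_labeling {col : V → K} {F : K → ℕ} {A : V → V → ℕ}
    (hA : ∀ u v, A u v = A v u) (hA1 : ∀ u v, A u v ≤ 1) {C : Finset V}
    (hC : ∀ u v, u ∉ C → v ∉ C → A u v = 0) {a b : ℕ}
    (hex : ∃ l : V → ℕ, FairLabeling col F l ∧
      a + sameWeight (fun _ _ => 1) l ≤ b + 2 * sameWeight A l) :
    ∃ l : V → ℕ, FairLabeling col F l ∧
      a + sameWeight (fun _ _ => 1) l ≤ b + 2 * sameWeight A l ∧
      ∀ c t, (∃ v, l v = c) →
        (∀ q, (Finset.univ.filter fun v => l v = c ∧ col v = q).card = t * F q) →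
        t ≤ 1 ∨ t ≤ 2 * (C.filter fun v => l v = c).card := by
  -- Among the admissible labelings take one with the fewest ordered pairs in a common class. A
  -- class that is too large would allow to split off a fairlet and to decrease this number.
  obtain ⟨l, ⟨hfair, hle⟩, hmin⟩ := WellFounded.has_min
    (InvImage.wf (fun l : V → ℕ => sameWeight (fun _ _ => 1) l) wellFounded_lt)
    {l | FairLabeling col F l ∧ a + sameWeight (fun _ _ => 1) l ≤ b + 2 * sameWeight A l} hex
  refine ⟨l, hfair, hle, ?_⟩
  rintro c t ⟨v₀, hv₀⟩ ht
  by_contra! hcon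
  obtain ⟨ht1, ht2⟩ := hcon
  set k := (C.filter fun v => l v = c).card with hk
  -- A fairlet outside the cover: a color with `F q ≥ 1` has at least `(k + 1) * F q ≥ F q + k`
  -- vertices in the class, of which at most `k` belong to the cover.
  have hsub : ∀ q, ∃ X ⊆ Finset.univ.filter (fun v => (l v = c ∧ col v = q) ∧ v ∉ C),
      X.card = F q := by
    intro q
    refine Finset.exists_subset_card_eq ?_
    have h1 : (Finset.univ.filter fun v => (l v = c ∧ col v = q) ∧ v ∈ C).card ≤ k := by
      refine Finset.card_le_card fun v hv => ?_
      simp only [Finset.mem_filter, Finset.mem_univ, true_and] at hv ⊢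
      exact ⟨hv.2, hv.1.1⟩
    have h2 := Finset.card_filter_add_card_filter_not
      (s := Finset.univ.filter fun v => l v = c ∧ col v = q) (fun v => v ∈ C)
    simp only [Finset.filter_filter] at h2
    rw [ht q] at h2
    rcases Nat.eq_zero_or_pos (F q) with h0 | h0
    · omega
    · have : (k + 1) * F q ≤ t * F q := Nat.mul_le_mul_right _ (by omega)
      have : k * 1 ≤ k * F q := Nat.mul_le_mul_left _ h0
      rw [Nat.add_mul] at *
      omega
  choose X hXsub hXcard using hsub
  have hXmem : ∀ q v, v ∈ X q → l v = c ∧ col v = q ∧ v ∉ C := fun q v hv => by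
    have := hXsub q hv
    simp only [Finset.mem_filter, Finset.mem_univ, true_and] at this
    exact ⟨this.1.1, this.1.2, this.2⟩
  set Y : Finset V := Finset.univ.biUnion X with hY
  have hYmem : ∀ v, v ∈ Y ↔ v ∈ X (col v) := by
    intro v
    simp only [hY, Finset.mem_biUnion, Finset.mem_univ, true_and]
    constructor
    · rintro ⟨q, hq⟩
      rwa [(hXmem q v hq).2.1]
    · exact fun h => ⟨_, h⟩
  have hYl : ∀ v ∈ Y, l v = c := fun v hv => (hXmem _ v ((hYmem v).1 hv)).1
  have hYC : ∀ v ∈ Y, v ∉ C := fun v hv => (hXmem _ v ((hYmem v).1 hv)).2.2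
  have hYq : ∀ q, (Finset.univ.filter fun v => v ∈ Y ∧ col v = q) = X q := by
    intro q
    ext v
    simp only [Finset.mem_filter, Finset.mem_univ, true_and, hYmem]
    constructor
    · rintro ⟨h, rfl⟩; exact h
    · intro h
      have := (hXmem q v h).2.1
      exact ⟨this ▸ h, this⟩
  obtain ⟨c', hc'⟩ : ∃ c', ∀ v, l v ≠ c' :=
    ⟨Finset.univ.sup l + 1, fun v h => by
      have := Finset.le_sup (f := l) (Finset.mem_univ v)
      omega⟩
  have hfair' : FairLabeling col F (fun v => if v ∈ Y then c' else l v) := by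
    intro x
    by_cases hx' : x = c'
    · refine ⟨1, fun q => ?_⟩
      rw [one_mul, ← hXcard q, ← hYq q]
      congr 1
      ext v
      have := hc' v
      simp only [Finset.mem_filter, Finset.mem_univ, true_and]
      grind
    · by_cases hxc : x = c
      · refine ⟨t - 1, fun q => ?_⟩
        rw [Nat.sub_mul, one_mul, ← ht q, ← hXcard q, ← hYq q, ← Finset.card_sdiff_of_subset]
        · congr 1
          ext v
          simp only [Finset.mem_filter, Finset.mem_univ, true_and, Finset.mem_sdiff]
          have := hYl v
          grind
        · intro v hv
          simp only [Finset.mem_filter, Finset.mem_univ, true_and] at hv ⊢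
          exact ⟨hYl v hv.1, hv.2⟩
      · obtain ⟨t', ht'⟩ := hfair x
        refine ⟨t', fun q => ?_⟩
        rw [← ht' q]
        congr 1
        ext v
        have := hYl v
        simp only [Finset.mem_filter, Finset.mem_univ, true_and]
        grind
  have hYcard : Y.card = ∑ q, F q := by
    have := card_filter_eq_sum_color col (fun v => v ∈ Y)
    simp only [hYq, hXcard] at this
    rw [← this]
    simp
  have hS : (Finset.univ.filter fun v => l v = c).card = t * ∑ q, F q := card_class_eq ht
  set f := ∑ q, F q with hf
  have hf1 : 1 ≤ f := by
    by_contra h0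
    have : (Finset.univ.filter fun v => l v = c).card = 0 := by rw [hS]; simp; omega
    rw [Finset.card_eq_zero] at this
    have hmem : v₀ ∈ Finset.univ.filter fun v => l v = c := by simp [hv₀]
    rw [this] at hmem
    simp at hmem
  have hR : (Finset.univ.filter fun v => l v = c ∧ v ∉ Y).card = (t - 1) * f := by
    rw [Nat.sub_mul, one_mul, ← hS, ← hYcard, ← Finset.card_sdiff_of_subset]
    · congr 1
      ext v
      simp
    · intro v hv
      simp [hYl v hv]
  have s1 := sameWeight_split (g := fun _ _ => 1) (fun _ _ => rfl) hYl hc'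
  have s2 := sameWeight_split hA hYl hc'
  simp only [Finset.sum_const, smul_eq_mul, mul_one, hR, hYcard] at s1
  -- The split-off vertices lie outside the cover, so each of them has at most `k` neighbors in the
  -- class.
  have hcross : ∑ u ∈ Y, ∑ v ∈ Finset.univ.filter (fun v => l v = c ∧ v ∉ Y), A u v ≤ f * k := by
    rw [← hYcard, ← smul_eq_mul]
    refine Finset.sum_le_card_nsmul _ _ _ fun u hu => ?_
    rw [hk, Finset.card_eq_sum_ones, Finset.sum_filter, Finset.sum_filter]
    rw [← Finset.sum_subset (Finset.subset_univ C)]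
    · refine Finset.sum_le_sum fun v _ => ?_
      have := hA1 u v
      split_ifs <;> simp_all
    · intro v _ hv
      simp [hC u v (hYC u hu) hv]
  obtain ⟨t', rfl⟩ : ∃ t', t = t' + 2 := ⟨t - 2, by omega⟩
  -- Here `t > 2 * k` enters: the number of separated pairs is at least twice the number of adjacent
  -- pairs among them, so the cost inequality is preserved.
  have hbig : f * (2 * k) ≤ f * ((t' + 2 - 1) * f) := by
    refine Nat.mul_le_mul_left _ ?_
    calc 2 * k ≤ (t' + 2 - 1) * 1 := by omega
      _ ≤ _ := Nat.mul_le_mul_left _ hf1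
  have hpos : 0 < f * ((t' + 2 - 1) * f) := by
    have : 0 < t' + 2 - 1 := by omega
    positivity
  refine hmin (fun v => if v ∈ Y then c' else l v) ⟨hfair', ?_⟩ ?_
  · have : f * (2 * k) = 2 * (f * k) := by ring
    omega
  · show sameWeight _ _ < sameWeight _ _
    omega

end

end FairCC

/-! ### Distributions: clusters that meet the cover, and a remainder of single fairlets -/

namespace FairCC

section
variable {V K : Type*} [Fintype V] [DecidableEq V] [Fintype K] [DecidableEq K]

/-- A distribution of the vertices to `s` proper clusters, with `t i` copies of the fairlet in
cluster `i`, and a remainder `s` without cover vertices, to be split into `t s` fairlets. -/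
structure IsDistribution (col : V → K) (F : K → ℕ) (C : Finset V) (s : ℕ) (t : ℕ → ℕ)
    (lab : V → ℕ) : Prop where
  le : ∀ v, lab v ≤ s
  card : ∀ i ≤ s, ∀ q, (Finset.univ.filter fun v => lab v = i ∧ col v = q).card = t i * F q
  cover : ∀ v ∈ C, lab v < s

/-- Summing class sizes over all vertices, a proper cluster contributes its square, while each
vertex of the remainder lies in a class of one fairlet and contributes the size of a fairlet. -/
theorem sameWeight_one_eq {col : V → K} {F : K → ℕ} {C : Finset V} {s : ℕ} {t : ℕ → ℕ}
    {lab l : V → ℕ} (h : IsDistribution col F C s t lab)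
    (hcl : ∀ u, (Finset.univ.filter fun v => l v = l u).card =
      if lab u < s then t (lab u) * ∑ q, F q else ∑ q, F q) :
    sameWeight (fun _ _ => 1) l =
      ∑ i ∈ Finset.range s, (t i * ∑ q, F q) ^ 2 + t s * (∑ q, F q) * ∑ q, F q := by
  have h1 : sameWeight (fun _ _ => 1) l =
      ∑ u, if lab u < s then t (lab u) * ∑ q, F q else ∑ q, F q := by
    unfold sameWeight
    refine Finset.sum_congr rfl fun u _ => ?_
    rw [← hcl u, Finset.card_filter]
    exact Finset.sum_congr rfl fun v _ => by simp [eq_comm]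
  rw [h1, ← Finset.sum_fiberwise_of_maps_to (t := Finset.range (s + 1)) (g := lab)
    (fun v _ => Finset.mem_range.2 (Nat.lt_succ_of_le (h.le v))), Finset.sum_range_succ]
  congr 1
  · refine Finset.sum_congr rfl fun i hi => ?_
    have hi' := Finset.mem_range.1 hi
    rw [Finset.sum_congr rfl (g := fun _ => t i * ∑ q, F q), Finset.sum_const,
      card_class_eq (h.card i hi'.le), smul_eq_mul, sq]
    intro v hv
    rw [(Finset.mem_filter.1 hv).2, if_pos hi']
  · rw [Finset.sum_congr rfl (g := fun _ => ∑ q, F q), Finset.sum_const,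
      card_class_eq (h.card s le_rfl), smul_eq_mul]
    intro v hv
    rw [(Finset.mem_filter.1 hv).2, if_neg (lt_irrefl _)]

/-- The remainder contains no cover vertices, so no two of its vertices are adjacent, and cutting it
into single fairlets loses no weight. Each color is cut separately, by `exists_fiber_card_eq`. -/
theorem IsDistribution.exists_labeling {col : V → K} {F : K → ℕ} {C : Finset V} {s : ℕ}
    {t : ℕ → ℕ} {lab : V → ℕ} (h : IsDistribution col F C s t lab) {A : V → V → ℕ}
    (hC : ∀ u v, u ∉ C → v ∉ C → A u v = 0) :
    ∃ l, FairLabeling col F l ∧ sameWeight A l = sameWeight A lab ∧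
      sameWeight (fun _ _ => 1) l =
        ∑ i ∈ Finset.range s, (t i * ∑ q, F q) ^ 2 + t s * (∑ q, F q) * ∑ q, F q := by
  have hg : ∀ q, ∃ g : V → ℕ, (∀ v, lab v = s → col v = q → g v < t s) ∧ ∀ i < t s,
      (Finset.univ.filter fun v => (lab v = s ∧ col v = q) ∧ g v = i).card = F q := by
    intro q
    obtain ⟨φ, hφ⟩ := exists_fiber_card_eq (ι := Fin (t s))
      (Finset.univ.filter fun v => lab v = s ∧ col v = q) (fun _ => F q)
      (by rw [h.card s le_rfl q]; simp)
    have hmem : ∀ {v}, lab v = s ∧ col v = q →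
        v ∈ Finset.univ.filter fun v => lab v = s ∧ col v = q := fun hv => by simpa using hv
    refine ⟨fun v => if hv : lab v = s ∧ col v = q then φ ⟨v, hmem hv⟩ else 0, ?_, ?_⟩
    · intro v h1 h2
      beta_reduce
      rw [dif_pos ⟨h1, h2⟩]
      exact (φ _).2
    · intro i hi
      rw [← hφ ⟨i, hi⟩]
      symm
      refine Finset.card_bij (fun v _ => v.1) ?_ ?_ ?_
      · intro v hv
        have hv1 : lab v = s ∧ col v = q := (Finset.mem_filter.1 v.2).2
        have hv2 : φ v = ⟨i, hi⟩ := by simpa using hv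
        simp only [Finset.mem_filter, Finset.mem_univ, true_and]
        refine ⟨hv1, ?_⟩
        rw [dif_pos hv1, show (⟨v.1, hmem hv1⟩ : { x // x ∈ _ }) = v from rfl, hv2]
      · intro v _ v' _ hvv; exact Subtype.ext hvv
      · intro v hv
        simp only [Finset.mem_filter, Finset.mem_univ, true_and] at hv
        obtain ⟨hv1, hv2⟩ := hv
        rw [dif_pos hv1] at hv2
        exact ⟨⟨v, hmem hv1⟩, by simp only [Finset.mem_filter, Finset.mem_univ, true_and]
                                 exact Fin.ext hv2, rfl⟩
  choose g hglt hgcard using hg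
  -- Proper clusters use labels below `s`, so the labels `s + j` are free for the fairlets of the
  -- remainder.
  let l : V → ℕ := fun v => if lab v = s then s + g (col v) v else lab v
  have hl : ∀ v, l v = if lab v = s then s + g (col v) v else lab v := fun _ => rfl
  have hle := h.le
  have hfilt : ∀ j < t s, ∀ q, (Finset.univ.filter fun v => l v = s + j ∧ col v = q).card =
      1 * F q := by
    intro j hj q
    rw [one_mul, ← hgcard q j hj]
    congr 1
    ext v
    have := hle v
    simp only [Finset.mem_filter, Finset.mem_univ, true_and, hl]
    constructor
    · rintro ⟨h1, rfl⟩
      split_ifs at h1 with h2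
      · exact ⟨⟨h2, rfl⟩, by omega⟩
      · omega
    · rintro ⟨⟨h1, rfl⟩, h2⟩
      rw [if_pos h1]
      exact ⟨by omega, rfl⟩
  have hfilt' : ∀ c < s, ∀ q, (Finset.univ.filter fun v => l v = c ∧ col v = q).card =
      t c * F q := by
    intro c hc q
    rw [← h.card c hc.le q]
    congr 1
    ext v
    simp only [Finset.mem_filter, Finset.mem_univ, true_and, hl]
    have := hle v
    split_ifs <;> grind
  have hlt : ∀ v, lab v = s → g (col v) v < t s := fun v hv => hglt _ v hv rfl
  refine ⟨l, ?_, ?_, sameWeight_one_eq h ?_⟩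
  · intro c
    by_cases hc : c < s
    · exact ⟨t c, hfilt' c hc⟩
    · obtain ⟨j, rfl⟩ : ∃ j, c = s + j := ⟨c - s, by omega⟩
      by_cases hj : j < t s
      · exact ⟨1, hfilt j hj⟩
      · refine ⟨0, fun q => ?_⟩
        rw [zero_mul, Finset.card_eq_zero, Finset.filter_eq_empty_iff]
        rintro v - ⟨h1, -⟩
        rw [hl] at h1
        have := hle v
        split_ifs at h1 with h2
        · have := hlt v h2; omega
        · omega
  · unfold sameWeight
    refine Finset.sum_congr rfl fun u _ => Finset.sum_congr rfl fun v _ => ?_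
    have hu := hle u
    have hv := hle v
    by_cases h1 : lab u = s
    · by_cases h2 : lab v = s
      · have hu' : u ∉ C := fun hu => by have := h.cover u hu; omega
        have hv' : v ∉ C := fun hv => by have := h.cover v hv; omega
        simp [hC u v hu' hv']
      · rw [if_neg (by rw [hl, hl, if_pos h1, if_neg h2]; omega), if_neg (by omega)]
    · by_cases h2 : lab v = s
      · rw [if_neg (by rw [hl, hl, if_neg h1, if_pos h2]; omega), if_neg (by omega)]
      · rw [hl, hl, if_neg h1, if_neg h2]
  · intro u
    have hu := hle u
    split_ifs with h1
    · rw [hl u, if_neg (by omega)]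
      exact card_class_eq (col := col) (hfilt' _ h1)
    · rw [hl u, if_pos (by omega)]
      have := card_class_eq (col := col) (hfilt _ (hlt u (by omega)))
      rw [this, one_mul]

/-- A class that meets the cover is named by the least index of a cover vertex in it, which leaves
at most `s` names; all other classes are merged into the remainder. By `hred` those consist of one
fairlet each, so merging forgets nothing about the sizes, and it creates no weight since their
vertices are independent. -/
theorem exists_distribution {col : V → K} {F : K → ℕ} {A : V → V → ℕ} {s : ℕ} {C : Finset V}
    (hCs : C.card = s) {cv : ℕ → V} (hcv : ∀ v, v ∈ C ↔ ∃ j < s, cv j = v)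
    (hC : ∀ u v, u ∉ C → v ∉ C → A u v = 0) {T : ℕ}
    (hT : ∀ q, (Finset.univ.filter fun v => col v = q).card = T * F q) {l : V → ℕ}
    (hl : FairLabeling col F l)
    (hred : ∀ c t, (∃ v, l v = c) →
        (∀ q, (Finset.univ.filter fun v => l v = c ∧ col v = q).card = t * F q) →
        t ≤ 1 ∨ t ≤ 2 * (C.filter fun v => l v = c).card) :
    ∃ t lab, IsDistribution col F C s t lab ∧ (∀ i < s, t i ≤ 2 * s) ∧
      ∑ i ∈ Finset.range s, t i ≤ T ∧ t s = T - ∑ i ∈ Finset.range s, t i ∧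
      sameWeight A lab = sameWeight A l ∧
      sameWeight (fun _ _ => 1) l =
        ∑ i ∈ Finset.range s, (t i * ∑ q, F q) ^ 2 + t s * (∑ q, F q) * ∑ q, F q := by
  classical
  choose m hm using hl
  let lab : V → ℕ := fun v => if h : ∃ j, j < s ∧ l (cv j) = l v then Nat.find h else s
  have hlab_lt : ∀ v, (∃ j, j < s ∧ l (cv j) = l v) → lab v < s ∧ l (cv (lab v)) = l v := by
    intro v h
    simp only [lab, dif_pos h]
    exact Nat.find_spec h
  have hlab_eq : ∀ v, (¬ ∃ j, j < s ∧ l (cv j) = l v) → lab v = s := fun v h => by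
    simp only [lab, dif_neg h]
  have hlab_congr : ∀ u v, l u = l v → lab u = lab v := by
    intro u v h
    simp only [lab, h]
  have hlab_le : ∀ v, lab v ≤ s := fun v => by
    by_cases h : ∃ j, j < s ∧ l (cv j) = l v
    · exact (hlab_lt v h).1.le
    · exact (hlab_eq v h).le
  have hlab_lt' : ∀ v, lab v < s → l (cv (lab v)) = l v := fun v hv => by
    by_cases h : ∃ j, j < s ∧ l (cv j) = l v
    · exact (hlab_lt v h).2
    · rw [hlab_eq v h] at hv; omega
  have hcover : ∀ v ∈ C, lab v < s := fun v hv => by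
    obtain ⟨j, hj, rfl⟩ := (hcv v).1 hv
    exact (hlab_lt _ ⟨j, hj, rfl⟩).1
  -- An index that is not the least one in its class is nobody's name; its cluster is empty and gets
  -- no fairlets.
  let t₀ : ℕ → ℕ := fun i => if ∃ v, lab v = i then m (l (cv i)) else 0
  have hcard : ∀ i < s, ∀ q, (Finset.univ.filter fun v => lab v = i ∧ col v = q).card =
      t₀ i * F q := by
    intro i hi q
    by_cases h : ∃ v, lab v = i
    · obtain ⟨v₀, hv₀⟩ := h
      simp only [t₀, if_pos (⟨v₀, hv₀⟩ : ∃ v, lab v = i)]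
      rw [← hm]
      congr 1
      ext v
      simp only [Finset.mem_filter, Finset.mem_univ, true_and]
      have h1 := hlab_lt' v₀ (by omega)
      rw [hv₀] at h1
      refine and_congr_left fun _ => ⟨fun hv => ?_, fun hv => ?_⟩
      · rw [← hlab_lt' v (by omega), hv]
      · rw [← hv₀]
        exact hlab_congr _ _ (by rw [hv, h1])
    · simp only [t₀, if_neg h, zero_mul]
      rw [Finset.card_eq_zero, Finset.filter_eq_empty_iff]
      rintro v - ⟨h1, -⟩
      exact h ⟨v, h1⟩
  have hsplit : ∀ q, (∑ i ∈ Finset.range s, t₀ i) * F q +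
      (Finset.univ.filter fun v => lab v = s ∧ col v = q).card = T * F q := by
    intro q
    rw [← hT q, Finset.card_eq_sum_card_fiberwise (f := lab) (t := Finset.range (s + 1))
      (s := Finset.univ.filter fun v => col v = q)
      (fun v _ => Finset.mem_coe.2 (Finset.mem_range.2 (Nat.lt_succ_of_le (hlab_le v)))),
      Finset.sum_range_succ, Finset.sum_mul]
    simp only [Finset.filter_filter]
    congr 1
    · refine Finset.sum_congr rfl fun i hi => ?_
      rw [← hcard i (Finset.mem_range.1 hi) q]
      congr 1
      ext v
      simp [and_comm]
    · congr 1
      ext v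
      simp [and_comm]
  have hsum : ∑ i ∈ Finset.range s, t₀ i ≤ T := by
    by_cases hF : ∃ q, F q ≠ 0
    · obtain ⟨q, hq⟩ := hF
      have := hsplit q
      exact Nat.le_of_mul_le_mul_right (c := F q) (by omega) (by omega)
    -- An empty fairlet forces `V`, and with it the cover, to be empty.
    · push Not at hF
      have hV : IsEmpty V := ⟨fun v => by
        have h1 := hT (col v)
        rw [hF, mul_zero, Finset.card_eq_zero, Finset.filter_eq_empty_iff] at h1
        exact h1 (Finset.mem_univ v) rfl⟩
      have : s = 0 := by
        rw [← hCs, Finset.card_eq_zero]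
        exact Finset.eq_empty_of_isEmpty C
      subst this
      simp
  let t : ℕ → ℕ := fun i => if i < s then t₀ i else T - ∑ i ∈ Finset.range s, t₀ i
  have hts : t s = T - ∑ i ∈ Finset.range s, t₀ i := by simp [t]
  have hti : ∀ i < s, t i = t₀ i := fun i hi => by simp [t, hi]
  have hsumt : ∑ i ∈ Finset.range s, t i = ∑ i ∈ Finset.range s, t₀ i :=
    Finset.sum_congr rfl fun i hi => hti i (Finset.mem_range.1 hi)
  have hdist : IsDistribution col F C s t lab := by
    refine ⟨hlab_le, fun i hi q => ?_, hcover⟩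
    rcases hi.lt_or_eq with h | rfl
    · rw [hti i h, hcard i h q]
    · rw [hts, Nat.sub_mul]
      have := hsplit q
      omega
  refine ⟨t, lab, hdist, fun i hi => ?_, by rw [hsumt]; exact hsum, by rw [hsumt, hts], ?_,
    sameWeight_one_eq hdist fun u => ?_⟩
  · rw [hti i hi]
    simp only [t₀]
    split_ifs with h
    · obtain ⟨v, hv⟩ := h
      rcases hred (l (cv i)) (m (l (cv i))) ⟨_, rfl⟩ (hm _) with h1 | h1
      · omega
      · have := Finset.card_filter_le C fun v => l v = l (cv i)
        omega
    · omega
  · unfold sameWeight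
    refine Finset.sum_congr rfl fun u _ => Finset.sum_congr rfl fun v _ => ?_
    by_cases h : l u = l v
    · rw [if_pos h, if_pos (hlab_congr u v h)]
    · rw [if_neg h]
      by_cases h' : lab u = lab v
      · rw [if_pos h']
        by_cases hs : lab u < s
        · exact absurd (by rw [← hlab_lt' u hs, ← hlab_lt' v (by omega), h']) h
        · exact hC u v (fun hu => hs (hcover u hu)) (fun hv => hs (h' ▸ hcover v hv))
      · rw [if_neg h']
  · split_ifs with h
    · rw [← card_class_eq (col := col) (fun q => (hcard _ h q).trans (by rw [hti _ h]))]
      congr 1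
      ext v
      simp only [Finset.mem_filter, Finset.mem_univ, true_and]
      refine ⟨fun hv => hlab_congr _ _ hv, fun hv => ?_⟩
      rw [← hlab_lt' v (by omega), ← hlab_lt' u h, hv]
    · rw [card_class_eq (col := col) (hm (l u))]
      have h0 : (C.filter fun v => l v = l u).card = 0 := by
        rw [Finset.card_eq_zero, Finset.filter_eq_empty_iff]
        intro v hv hvu
        exact h (hlab_congr v u hvu ▸ hcover v hv)
      have hm1 : m (l u) ≤ 1 := by
        have := hred (l u) (m (l u)) ⟨u, rfl⟩ (hm _)
        omega
      have hm0 : m (l u) ≠ 0 := by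
        intro h0
        have h1 := hm (l u) (col u)
        rw [h0, zero_mul, Finset.card_eq_zero, Finset.filter_eq_empty_iff] at h1
        exact h1 (Finset.mem_univ u) ⟨rfl, rfl⟩
      rw [show m (l u) = 1 by omega, one_mul]

end

end FairCC

/-! ### Fairlets, partitions and costs in terms of color counts and labelings -/

namespace FairCC

theorem splitsInto_map_iff {V K : Type*} [DecidableEq K] (χ : V → K) (F : Multiset K)
    (W : Finset V) : SplitsInto F (W.val.map χ) ↔
      ∃ t, ∀ q, (W.filter fun v => χ v = q).card = t * F.count q := by
  unfold SplitsInto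
  refine exists_congr fun t => ?_
  rw [Multiset.ext]
  refine forall_congr' fun q => ?_
  rw [Multiset.count_nsmul, Multiset.count_map, Finset.card_def, Finset.filter_val]
  simp only [eq_comm]

theorem two_mul_ncard_edgeSet {V : Type*} [Fintype V] (H : SimpleGraph V)
    [DecidableRel H.Adj] : 2 * H.edgeSet.ncard = ∑ u, ∑ v, if H.Adj u v then 1 else 0 := by
  classical
  rw [← SimpleGraph.coe_edgeFinset, Set.ncard_coe_finset, ← H.sum_degrees_eq_twice_card_edges]
  refine Finset.sum_congr rfl fun u _ => ?_
  rw [← SimpleGraph.card_neighborFinset_eq_degree, SimpleGraph.neighborFinset_eq_filter,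
    Finset.card_filter]

-- Compare the contributions of every ordered pair. Cut edges are adjacent pairs with different
-- labels; non-edges inside clusters are pairs with equal labels, minus the adjacent ones and minus
-- the diagonal, which accounts for the number of vertices. The identity is stated additively to
-- avoid truncated subtraction.
open Classical in
theorem two_mul_cost {V : Type*} [Fintype V] [DecidableEq V] (G : SimpleGraph V)
    (P : Finpartition (Finset.univ : Finset V)) (l : V → ℕ)
    (hl : ∀ u v, (∃ C ∈ P.parts, u ∈ C ∧ v ∈ C) ↔ l u = l v) :
    2 * cost G P + 2 * sameWeight (fun u v => if G.Adj u v then 1 else 0) l + Fintype.card V =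
      ∑ u, ∑ v, (if G.Adj u v then 1 else 0) + sameWeight (fun _ _ => 1) l := by
  let H₁ : SimpleGraph V :=
    { Adj := fun u v => G.Adj u v ∧ l u ≠ l v
      symm := ⟨fun u v h => ⟨h.1.symm, h.2.symm⟩⟩
      loopless := ⟨fun u h => h.2 rfl⟩ }
  let H₂ : SimpleGraph V :=
    { Adj := fun u v => Gᶜ.Adj u v ∧ l u = l v
      symm := ⟨fun u v h => ⟨h.1.symm, h.2.symm⟩⟩
      loopless := ⟨fun u h => h.1.ne rfl⟩ }
  have e1 : {e : Sym2 V | e ∈ G.edgeSet ∧ ¬ ∃ C ∈ P.parts, ∀ v ∈ e, v ∈ C} = H₁.edgeSet := by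
    ext e
    induction e with
    | _ u v =>
      have := hl u v
      simp only [Set.mem_ofPred_eq, SimpleGraph.mem_edgeSet, Sym2.mem_iff, forall_eq_or_imp,
        forall_eq, this]
      rfl
  have e2 : {e : Sym2 V | e ∈ Gᶜ.edgeSet ∧ ∃ C ∈ P.parts, ∀ v ∈ e, v ∈ C} = H₂.edgeSet := by
    ext e
    induction e with
    | _ u v =>
      have := hl u v
      simp only [Set.mem_ofPred_eq, SimpleGraph.mem_edgeSet, Sym2.mem_iff, forall_eq_or_imp,
        forall_eq, this]
      rfl
  unfold cost
  rw [e1, e2, Nat.mul_add, two_mul_ncard_edgeSet, two_mul_ncard_edgeSet]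
  unfold sameWeight
  have hn : Fintype.card V = ∑ u : V, ∑ v : V, if u = v then 1 else 0 := by simp
  rw [hn]
  simp only [Finset.mul_sum, ← Finset.sum_add_distrib]
  refine Finset.sum_congr rfl fun u _ => Finset.sum_congr rfl fun v _ => ?_
  simp only [H₁, H₂, SimpleGraph.compl_adj]
  by_cases h1 : u = v
  · subst h1; simp
  · by_cases h2 : G.Adj u v <;> by_cases h3 : l u = l v <;> simp [h1, h2, h3]

/-- The number of vertices of color `q`. -/
def Inst.colorCount (I : Inst) (q : Fin I.κ) : ℕ :=
  (Finset.univ.filter fun v => I.color v = q).card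

theorem Inst.sum_colorCount (I : Inst) : ∑ q, I.colorCount q = I.n := by
  have := Finset.card_eq_sum_card_fiberwise (f := I.color) (s := Finset.univ)
    (t := Finset.univ) (fun _ _ => by simp)
  simp only [Finset.card_univ, Fintype.card_fin] at this
  rw [this]
  rfl

/-- `T` is the number of fairlets and `F` is the fairlet, given by its multiplicities. -/
structure Inst.Fairlets (I : Inst) (T : ℕ) (F : Fin I.κ → ℕ) : Prop where
  pos : 1 ≤ T
  eq : ∀ q, I.colorCount q = T * F q
  max : ∀ d, 1 ≤ d → (∀ q, d ∣ I.colorCount q) → I.n = 0 ∨ d ≤ T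

/-- If `t` copies of `M` give all colors, then `t` is a common divisor of the color counts, and `t`
times the size of `M` is `n`; so `M` is smallest for the largest `t`, which is `T`. For `n = 0` the
number of copies is not determined, but the fairlet is empty. -/
theorem Inst.Fairlets.isFairlet_iff {I : Inst} {T : ℕ} {F : Fin I.κ → ℕ} (h : I.Fairlets T F)
    (M : Multiset (Fin I.κ)) : IsFairlet I.color M ↔ ∀ q, M.count q = F q := by
  have hcard : ∀ {M : Multiset (Fin I.κ)}, M.card = ∑ q, M.count q := fun {M} =>
    (Multiset.sum_count_eq_card fun a _ => Finset.mem_univ a).symm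
  have hsplit : ∀ M : Multiset (Fin I.κ), SplitsInto M (Finset.univ.val.map I.color) ↔
      ∃ t, ∀ q, I.colorCount q = t * M.count q := fun M => splitsInto_map_iff _ _ _
  have hex : ∃ M₀ : Multiset (Fin I.κ), ∀ q, M₀.count q = F q :=
    ⟨∑ q, Multiset.replicate (F q) q, fun q => by
      rw [Multiset.count_sum']
      simp [Multiset.count_replicate]⟩
  obtain ⟨M₀, hM₀⟩ := hex
  have hle : ∀ M : Multiset (Fin I.κ), SplitsInto M (Finset.univ.val.map I.color) →
      ∑ q, F q ≤ M.card := by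
    intro M hM
    obtain ⟨t, ht⟩ := (hsplit M).1 hM
    rw [hcard]
    have h1 := I.sum_colorCount
    simp only [h.eq, ← Finset.mul_sum] at h1
    have h2 := I.sum_colorCount
    simp only [ht, ← Finset.mul_sum] at h2
    have hT := h.pos
    rcases Nat.eq_zero_or_pos t with rfl | ht0
    · have : T * ∑ q, F q = 0 := by omega
      have : ∑ q, F q = 0 := by
        rcases Nat.mul_eq_zero.1 this with h | h <;> omega
      omega
    · rcases h.max t ht0 (fun q => ⟨_, ht q⟩) with h0 | htT
      · have : T * ∑ q, F q = 0 := by omega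
        have : ∑ q, F q = 0 := by
          rcases Nat.mul_eq_zero.1 this with h | h <;> omega
        omega
      · have h3 : T * ∑ q, F q = t * ∑ q, M.count q := by omega
        have h4 : t * ∑ q, M.count q ≤ T * ∑ q, M.count q := Nat.mul_le_mul_right _ htT
        exact Nat.le_of_mul_le_mul_left (h3 ▸ h4) (by omega)
  constructor
  · rintro ⟨h1, h2⟩ q
    have hM0 : SplitsInto M₀ (Finset.univ.val.map I.color) :=
      (hsplit M₀).2 ⟨T, fun q => by rw [hM₀, h.eq]⟩
    have hc : M.card = ∑ q, F q := by
      refine le_antisymm ?_ (hle M h1)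
      have := h2 M₀ hM0
      rw [hcard (M := M₀)] at this
      simpa [hM₀] using this
    obtain ⟨t, ht⟩ := (hsplit M).1 h1
    rw [hcard] at hc
    have e1 := I.sum_colorCount
    simp only [h.eq, ← Finset.mul_sum] at e1
    have e2 := I.sum_colorCount
    simp only [ht, ← Finset.mul_sum] at e2
    rcases Nat.eq_zero_or_pos (∑ q, F q) with hz | hz
    · rw [hz] at hc
      rw [Finset.sum_eq_zero_iff] at hc hz
      rw [hc q (Finset.mem_univ q), hz q (Finset.mem_univ q)]
    · have htT : t = T := by
        rw [hc] at e2
        exact Nat.eq_of_mul_eq_mul_right hz (by omega)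
      have := ht q
      rw [h.eq q, htT] at this
      exact (Nat.eq_of_mul_eq_mul_left (by have := h.pos; omega) this).symm
  · intro hM
    refine ⟨(hsplit M).2 ⟨T, fun q => by rw [hM, h.eq]⟩, fun M' hM' => ?_⟩
    rw [hcard]
    simpa [hM] using hle M' hM'

open Classical in
/-- The adjacency weights of an instance. -/
noncomputable def Inst.adj (I : Inst) (u v : Fin I.n) : ℕ :=
  if I.graph.Adj u v then 1 else 0

/-- A partition becomes a labeling by encoding the part of each vertex as a number, and a labeling
becomes the partition into its nonempty classes; labels that do not occur count as zero copies. The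
cost condition is doubled and rewritten by `two_mul_cost`. -/
theorem Inst.Fairlets.isYes_iff {I : Inst} {T : ℕ} {F : Fin I.κ → ℕ} (h : I.Fairlets T F) :
    I.IsYes ↔ ∃ l : Fin I.n → ℕ, FairLabeling I.color F l ∧
      ∑ u, ∑ v, I.adj u v + sameWeight (fun _ _ => 1) l ≤
        2 * I.budget + I.n + 2 * sameWeight I.adj l := by
  classical
  have hcost := fun P l hl => two_mul_cost I.graph P l hl
  simp only [Fintype.card_fin] at hcost
  have hcost' : ∀ (P : Finpartition (Finset.univ : Finset (Fin I.n))) (l : Fin I.n → ℕ),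
      (∀ u v, (∃ C ∈ P.parts, u ∈ C ∧ v ∈ C) ↔ l u = l v) →
      2 * cost I.graph P + 2 * sameWeight I.adj l + I.n =
      ∑ u, ∑ v, I.adj u v + sameWeight (fun _ _ => 1) l := fun P l hl => by
    rw [show I.adj = fun u v => if I.graph.Adj u v then 1 else 0 by
      funext u v; unfold Inst.adj; congr]
    exact hcost P l hl
  constructor
  · rintro ⟨M, hM, P, hP, hc⟩
    rw [h.isFairlet_iff] at hM
    let l : Fin I.n → ℕ := fun v => Encodable.encode (P.part v)
    have hl : ∀ u v, (∃ C ∈ P.parts, u ∈ C ∧ v ∈ C) ↔ l u = l v := by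
      intro u v
      simp only [l, Encodable.encode_inj]
      constructor
      · rintro ⟨C, hC, hu, hv⟩
        rw [P.part_eq_of_mem hC hu, P.part_eq_of_mem hC hv]
      · intro huv
        exact ⟨P.part u, P.part_mem.2 (Finset.mem_univ _), P.mem_part (Finset.mem_univ _),
          huv ▸ P.mem_part (Finset.mem_univ _)⟩
    refine ⟨l, fun c => ?_, ?_⟩
    · by_cases hc : ∃ v, l v = c
      · obtain ⟨v, rfl⟩ := hc
        obtain ⟨t, ht⟩ := (splitsInto_map_iff _ _ _).1 (hP (P.part v)
          (P.part_mem.2 (Finset.mem_univ _)))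
        refine ⟨t, fun q => ?_⟩
        rw [← hM q, ← ht q]
        congr 1
        ext u
        simp only [Finset.mem_filter, Finset.mem_univ, true_and]
        refine and_congr_left fun _ => ?_
        simp only [l, Encodable.encode_inj]
        constructor
        · intro huv
          exact huv ▸ P.mem_part (Finset.mem_univ _)
        · intro hu
          exact P.part_eq_of_mem (P.part_mem.2 (Finset.mem_univ _)) hu
      · refine ⟨0, fun q => ?_⟩
        rw [zero_mul, Finset.card_eq_zero, Finset.filter_eq_empty_iff]
        rintro v - ⟨h1, -⟩
        exact hc ⟨v, h1⟩
    · have := hcost' P l hl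
      omega
  · rintro ⟨l, hl, hle⟩
    have hex : ∃ M : Multiset (Fin I.κ), ∀ q, M.count q = F q :=
      ⟨∑ q, Multiset.replicate (F q) q, fun q => by
        rw [Multiset.count_sum']
        simp [Multiset.count_replicate]⟩
    obtain ⟨M, hM⟩ := hex
    let P : Finpartition (Finset.univ : Finset (Fin I.n)) := Finpartition.ofSetoid (Setoid.ker l)
    have hpart : ∀ C ∈ P.parts, ∃ u, C = Finset.univ.filter fun v => l u = l v := by
      intro C hC
      simp only [P, Finpartition.ofSetoid, Finpartition.ofSetSetoid, Finset.mem_image,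
        Finset.mem_univ, true_and] at hC
      obtain ⟨u, rfl⟩ := hC
      exact ⟨u, by ext v; simp [Setoid.ker_def]⟩
    have hmem : ∀ u, (Finset.univ.filter fun v => l u = l v) ∈ P.parts := by
      intro u
      simp only [P, Finpartition.ofSetoid, Finpartition.ofSetSetoid, Finset.mem_image,
        Finset.mem_univ, true_and]
      exact ⟨u, by ext v; simp [Setoid.ker_def]⟩
    refine ⟨M, (h.isFairlet_iff M).2 hM, P, fun C hC => ?_, ?_⟩
    · obtain ⟨u, rfl⟩ := hpart C hC
      refine (splitsInto_map_iff _ _ _).2 ?_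
      obtain ⟨t, ht⟩ := hl (l u)
      refine ⟨t, fun q => ?_⟩
      rw [hM, ← ht q, Finset.filter_filter]
      congr 1
      ext v
      simp [eq_comm]
    · have := hcost' P l fun u v => ?_
      · omega
      · constructor
        · rintro ⟨C, hC, hu, hv⟩
          obtain ⟨w, rfl⟩ := hpart C hC
          simp only [Finset.mem_filter, Finset.mem_univ, true_and] at hu hv
          rw [← hu, hv]
        · intro huv
          exact ⟨_, hmem u, by simp, by simpa using huv⟩

/-- Budgets that agree up to `n²` are equivalent. -/
theorem Inst.isYes_congr_budget {I : Inst} {B : ℕ} (h : ∀ c ≤ I.n ^ 2, c ≤ B ↔ c ≤ I.budget) :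
    ({ I with budget := B } : Inst).IsYes ↔ I.IsYes := by
  classical
  have hcost : ∀ P : Finpartition (Finset.univ : Finset (Fin I.n)),
      cost I.graph P ≤ I.n ^ 2 := by
    intro P
    have h1 := two_mul_cost I.graph P (fun v => Encodable.encode (P.part v)) fun u v => by
      simp only [Encodable.encode_inj]
      constructor
      · rintro ⟨C, hC, hu, hv⟩
        rw [P.part_eq_of_mem hC hu, P.part_eq_of_mem hC hv]
      · intro huv
        exact ⟨P.part u, P.part_mem.2 (Finset.mem_univ _), P.mem_part (Finset.mem_univ _),
          huv ▸ P.mem_part (Finset.mem_univ _)⟩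
    have h2 : ∑ u : Fin I.n, ∑ v, (if I.graph.Adj u v then 1 else 0) ≤ I.n ^ 2 := by
      calc _ ≤ ∑ u : Fin I.n, ∑ v : Fin I.n, 1 :=
            Finset.sum_le_sum fun u _ => Finset.sum_le_sum fun v _ => by split_ifs <;> omega
        _ = _ := by simp [sq]
    have h3 : sameWeight (fun _ _ => 1) (fun v => Encodable.encode (P.part v)) ≤ I.n ^ 2 := by
      unfold sameWeight
      calc _ ≤ ∑ u : Fin I.n, ∑ v : Fin I.n, 1 :=
            Finset.sum_le_sum fun u _ => Finset.sum_le_sum fun v _ => by split_ifs <;> simp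
        _ = _ := by simp [sq]
    omega
  unfold Inst.IsYes
  refine exists_congr fun F => and_congr_right fun _ => exists_congr fun P =>
    and_congr_right fun _ => ?_
  exact h _ (hcost P)

end FairCC

namespace FairCC

/-! ### The quantities computed by the algorithm -/

section
variable (I : Inst)

open Classical in
/-- The adjacency matrix. -/
noncomputable def Inst.adjN (u v : ℕ) : ℕ :=
  if ∃ (hu : u < I.n) (hv : v < I.n), I.graph.Adj ⟨u, hu⟩ ⟨v, hv⟩ then 1 else 0

/-- The color of a vertex. -/
def Inst.colN (v : ℕ) : ℕ :=
  if h : v < I.n then I.color ⟨v, h⟩ else 0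

/-- The number of vertices of color `q`. -/
def Inst.cntN (q : ℕ) : ℕ :=
  ∑ v ∈ Finset.range I.n, if I.colN v = q then 1 else 0

/-- The number of fairlets: the largest common divisor of the color counts. -/
def Inst.numFairlets : ℕ :=
  max 1 ((Finset.range I.n).sup fun d =>
    if ∑ q ∈ Finset.range I.κ, (if I.cntN q % (d + 1) = 0 then 0 else 1) = 0 then d + 1 else 0)

/-- The multiplicity of color `q` in the fairlet. -/
def Inst.mult (q : ℕ) : ℕ := I.cntN q / I.numFairlets

/-- The number of ordered adjacent pairs. -/
noncomputable def Inst.numAdj : ℕ :=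
  ∑ u ∈ Finset.range I.n, ∑ v ∈ Finset.range I.n, I.adjN u v

variable {I}

theorem Inst.adjN_eq (u v : Fin I.n) : I.adjN u v = I.adj u v := by
  unfold Inst.adjN Inst.adj
  by_cases h : I.graph.Adj u v
  · rw [if_pos h, if_pos ⟨u.2, v.2, h⟩]
  · rw [if_neg h, if_neg fun ⟨_, _, h'⟩ => h h']

theorem Inst.adjN_le_one (u v : ℕ) : I.adjN u v ≤ 1 := by
  unfold Inst.adjN
  split_ifs <;> omega

theorem Inst.adjN_comm (u v : ℕ) : I.adjN u v = I.adjN v u := by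
  unfold Inst.adjN
  congr 1
  refine propext ⟨?_, ?_⟩ <;> rintro ⟨h1, h2, h⟩ <;> exact ⟨h2, h1, h.symm⟩

theorem Inst.colN_eq (v : Fin I.n) : I.colN v = I.color v := by
  simp [Inst.colN]

theorem Inst.colN_lt {v : ℕ} (hv : v < I.n) : I.colN v < I.κ := by
  simp [Inst.colN, hv]

theorem Inst.cntN_eq (q : Fin I.κ) : I.cntN q = I.colorCount q := by
  unfold Inst.cntN Inst.colorCount
  rw [Finset.sum_range, Finset.card_filter]
  refine Finset.sum_congr rfl fun v _ => ?_
  rw [Inst.colN_eq]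
  simp only [Fin.ext_iff]

theorem Inst.cntN_le (q : ℕ) : I.cntN q ≤ I.n := by
  unfold Inst.cntN
  calc _ ≤ ∑ v ∈ Finset.range I.n, 1 := Finset.sum_le_sum fun v _ => by split_ifs <;> omega
    _ = _ := by simp

/-- The index `d` stands for the divisor `d + 1`, so the candidate `1` is always present when `n >
0`; the maximum with `1` matters only for `n = 0`. -/
theorem Inst.numFairlets_spec : (∀ q < I.κ, I.numFairlets ∣ I.cntN q) ∧
    ∀ d < I.n, (∀ q < I.κ, d + 1 ∣ I.cntN q) → d + 1 ≤ I.numFairlets := by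
  have hzero : ∀ d, (∑ q ∈ Finset.range I.κ, (if I.cntN q % (d + 1) = 0 then 0 else 1) = 0 ↔
      ∀ q < I.κ, d + 1 ∣ I.cntN q) := by
    intro d
    rw [Finset.sum_eq_zero_iff]
    refine forall_congr' fun q => ?_
    rw [Finset.mem_range, Nat.dvd_iff_mod_eq_zero]
    simp
  constructor
  · unfold Inst.numFairlets
    set S := (Finset.range I.n).sup fun d =>
      if ∑ q ∈ Finset.range I.κ, (if I.cntN q % (d + 1) = 0 then 0 else 1) = 0 then d + 1 else 0
      with hS
    rcases Nat.eq_zero_or_pos S with h0 | h0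
    · rw [h0]; simp
    · have hne : (Finset.range I.n).Nonempty := by
        rw [Finset.nonempty_iff_ne_empty]
        intro h
        rw [h] at hS
        simp at hS
        omega
      obtain ⟨d, hd, he⟩ := Finset.exists_mem_eq_sup _ hne fun d =>
        if ∑ q ∈ Finset.range I.κ, (if I.cntN q % (d + 1) = 0 then 0 else 1) = 0
        then d + 1 else 0
      rw [← hS] at he
      split_ifs at he with h
      · rw [max_eq_right (by omega), he]
        exact (hzero d).1 h
      · omega
  · intro d hd h
    unfold Inst.numFairlets
    refine le_max_of_le_right ?_
    have := Finset.le_sup (f := fun d =>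
      if ∑ q ∈ Finset.range I.κ, (if I.cntN q % (d + 1) = 0 then 0 else 1) = 0
      then d + 1 else 0) (Finset.mem_range.2 hd)
    simp only [(hzero d).2 h, if_true] at this
    exact this

/-- A common divisor of the color counts divides their sum `n`, so for `n > 0` the search up to `n`
finds all of them. -/
theorem Inst.fairlets : I.Fairlets I.numFairlets (fun q => I.mult q) := by
  have hpos : 1 ≤ I.numFairlets := le_max_left _ _
  refine ⟨hpos, fun q => ?_, fun d hd h => ?_⟩
  · rw [← Inst.cntN_eq, Inst.mult, Nat.mul_div_cancel' (Inst.numFairlets_spec.1 q q.2)]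
  · by_cases hn : I.n = 0
    · exact Or.inl hn
    right
    obtain ⟨d, rfl⟩ : ∃ e, d = e + 1 := ⟨d - 1, by omega⟩
    refine Inst.numFairlets_spec.2 d ?_ fun q hq => ?_
    · have : d + 1 ∣ I.n := by
        rw [← I.sum_colorCount]
        exact Finset.dvd_sum fun q _ => h q
      have := Nat.le_of_dvd (by omega) this
      omega
    · rw [show I.cntN q = I.colorCount ⟨q, hq⟩ from I.cntN_eq ⟨q, hq⟩]
      exact h _

theorem Inst.sum_mult : ∑ q : Fin I.κ, I.mult q = I.n / I.numFairlets := by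
  have h := I.sum_colorCount
  simp only [Inst.fairlets.eq, ← Finset.mul_sum] at h
  rw [← h, Nat.mul_div_cancel_left _ Inst.fairlets.pos]

theorem Inst.numFairlets_le : I.numFairlets ≤ I.n + 1 := by
  unfold Inst.numFairlets
  refine max_le (by omega) (Finset.sup_le fun d hd => ?_)
  have := Finset.mem_range.1 hd
  split_ifs <;> omega

theorem Inst.numAdj_eq : I.numAdj = ∑ u, ∑ v, I.adj u v := by
  unfold Inst.numAdj
  rw [Finset.sum_range]
  refine Finset.sum_congr rfl fun u _ => ?_
  rw [Finset.sum_range]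
  exact Finset.sum_congr rfl fun v _ => Inst.adjN_eq u v

end

/-- A vertex cover, as a list of `s` vertices, together with marks on its members. -/
structure Inst.Cover (I : Inst) where
  /-- size -/
  s : ℕ
  /-- members -/
  cv : ℕ → ℕ
  /-- marks -/
  mark : ℕ → ℕ
  mark_le : ∀ v < I.n, mark v ≤ 1
  lt : ∀ j < s, cv j < I.n
  inj : ∀ i < s, ∀ j < s, cv i = cv j → i = j
  mark_iff : ∀ v < I.n, mark v ≠ 0 ↔ ∃ j < s, cv j = v
  cover : ∀ u < I.n, ∀ v < I.n, mark u = 0 → mark v = 0 → I.adjN u v = 0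

namespace Inst.Cover
variable {I : Inst} (c : I.Cover) (a : ℕ → ℕ)

/-- The number of fairlets in the clusters `i < s`. -/
def used : ℕ := ∑ i ∈ Finset.range c.s, a (c.s + i)

/-- The number of remaining fairlets. -/
def rest : ℕ := I.numFairlets - c.used a

/-- The number of fairlets in cluster `i`; the remaining vertices are cluster `s`. -/
def copies (i : ℕ) : ℕ := a (c.s + i) + if i = c.s then c.rest a else 0

/-- The number of cover vertices of color `q` in cluster `i`. -/
def coverCount (q i : ℕ) : ℕ :=
  ∑ j ∈ Finset.range c.s, (if a j = i then 1 else 0) * (if I.colN (c.cv j) = q then 1 else 0)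

/-- The number of neighbors of `v` among the cover vertices in cluster `i`. -/
noncomputable def weight (v i : ℕ) : ℕ :=
  ∑ j ∈ Finset.range c.s, I.adjN v (c.cv j) * (if a j = i then 1 else 0)

/-- The number of further vertices of color `q` that cluster `i` needs. -/
def cap (q i : ℕ) : ℕ := c.copies a i * I.mult q - c.coverCount a q i

/-- The dual objective for color `q` and potential `r`. -/
noncomputable def dual (q : ℕ) (r : ℕ → ℕ) : ℕ :=
  ∑ v ∈ Finset.range I.n, (if c.mark v = 0 then 1 else 0) * (if I.colN v = q then 1 else 0) *
      ((Finset.range (c.s + 1)).sup fun i => c.weight a v i + r i) -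
    ∑ i ∈ Finset.range (c.s + 1), r i * c.cap a q i

/-- The maximum total weight for color `q`. -/
noncomputable def best (q : ℕ) : ℕ :=
  (List.range ((c.s + 2) ^ (c.s + 1))).foldl
    (fun acc i => min acc (c.dual a q fun j => i / (c.s + 2) ^ j % (c.s + 2))) (I.n * I.n)

/-- The maximum total weight. -/
noncomputable def gain : ℕ := ∑ q ∈ Finset.range I.κ, c.best a q

/-- The number of ordered adjacent pairs of cover vertices in the same cluster. -/
noncomputable def inner : ℕ :=
  ∑ j ∈ Finset.range c.s, ∑ j' ∈ Finset.range c.s,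
    I.adjN (c.cv j) (c.cv j') * (if a j = a j' then 1 else 0)

/-- The sum of the squares of the cluster sizes. -/
def squares : ℕ :=
  ∑ i ∈ Finset.range c.s, (a (c.s + i) * (I.n / I.numFairlets)) *
      (a (c.s + i) * (I.n / I.numFairlets)) +
    c.rest a * (I.n / I.numFairlets) * (I.n / I.numFairlets)

/-- The number of violated constraints. -/
def violations : ℕ :=
  ∑ j ∈ Finset.range c.s, (if c.s < a j + 1 then 1 else 0) +
    (if I.numFairlets < c.used a then 1 else 0) +
    ∑ q ∈ Finset.range I.κ, ∑ i ∈ Finset.range c.s,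
      (if a (c.s + i) * I.mult q < c.coverCount a q i then 1 else 0)

/-- The test for one guess. -/
noncomputable def accept (B : ℕ) : ℕ :=
  if c.violations a = 0 then
    if 2 * B + I.n + 2 * (c.inner a + 2 * c.gain a) < I.numAdj + c.squares a then 0 else 1
  else 0

end Inst.Cover

end FairCC

/-! ### Correctness of the test for a guess -/

namespace FairCC.Inst.Cover
open FairCC
variable {I : Inst} (c : I.Cover)

/-- The cover as a set of vertices. -/
def toFinset : Finset (Fin I.n) := Finset.univ.filter fun v => c.mark v ≠ 0

theorem mem_toFinset (v : Fin I.n) : v ∈ c.toFinset ↔ c.mark v ≠ 0 := by simp [toFinset]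

theorem mark_cv {j : ℕ} (hj : j < c.s) : c.mark (c.cv j) ≠ 0 :=
  (c.mark_iff _ (c.lt j hj)).2 ⟨j, hj, rfl⟩

/-- The list `cv` runs through the marked vertices without repetition. -/
theorem sum_marked (g : ℕ → ℕ) :
    ∑ v ∈ Finset.range I.n, (if c.mark v = 0 then 0 else g v) =
      ∑ j ∈ Finset.range c.s, g (c.cv j) := by
  have h : (Finset.range I.n).filter (fun v => ¬ c.mark v = 0) =
      (Finset.range c.s).image c.cv := by
    ext v
    simp only [Finset.mem_filter, Finset.mem_range, Finset.mem_image]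
    constructor
    · rintro ⟨hv, hm⟩; exact (c.mark_iff v hv).1 hm
    · rintro ⟨j, hj, rfl⟩; exact ⟨c.lt j hj, c.mark_cv hj⟩
  rw [← Finset.sum_image (s := Finset.range c.s) (g := c.cv), ← h, Finset.sum_filter]
  · exact Finset.sum_congr rfl fun v _ => by split_ifs <;> simp_all
  · intro i hi j hj hij
    exact c.inj i (by simpa using hi) j (by simpa using hj) hij

theorem sum_split (g : ℕ → ℕ) :
    ∑ v ∈ Finset.range I.n, g v = ∑ j ∈ Finset.range c.s, g (c.cv j) +
      ∑ v ∈ Finset.range I.n, (if c.mark v = 0 then g v else 0) := by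
  rw [← c.sum_marked, ← Finset.sum_add_distrib]
  exact Finset.sum_congr rfl fun v _ => by split_ifs <;> simp

theorem card_toFinset : c.toFinset.card = c.s := by
  have h := c.sum_marked fun _ => 1
  rw [Finset.sum_range] at h
  simp only [Finset.sum_const, Finset.card_range, smul_eq_mul, mul_one] at h
  rw [toFinset, Finset.card_filter, ← h]
  exact Finset.sum_congr rfl fun v _ => by simp [ite_not]

theorem s_le : c.s ≤ I.n := by
  rw [← c.card_toFinset]
  simpa using Finset.card_le_univ c.toFinset

theorem adj_eq_zero (u v : Fin I.n) (hu : u ∉ c.toFinset) (hv : v ∉ c.toFinset) :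
    I.adj u v = 0 := by
  rw [mem_toFinset, not_not] at hu hv
  rw [← Inst.adjN_eq]
  exact c.cover u u.2 v v.2 hu hv

theorem weight_le (a : ℕ → ℕ) (v i : ℕ) : c.weight a v i ≤ c.s := by
  unfold weight
  calc _ ≤ ∑ j ∈ Finset.range c.s, 1 := Finset.sum_le_sum fun j _ => by
        have := Inst.adjN_le_one (I := I) v (c.cv j)
        split_ifs <;> omega
    _ = _ := by simp

theorem coverCount_le (a : ℕ → ℕ) (q i : ℕ) : c.coverCount a q i ≤ c.s := by
  unfold coverCount
  calc _ ≤ ∑ j ∈ Finset.range c.s, 1 := Finset.sum_le_sum fun j _ => by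
        split_ifs <;> omega
    _ = _ := by simp

variable {c} {a : ℕ → ℕ}

/-- Pairs of cover vertices give `inner`. Pairs with exactly one cover vertex occur in both orders,
which gives the factor `2`. Pairs without a cover vertex are not adjacent. -/
theorem sameWeight_adj {lab : ℕ → ℕ} (h : ∀ j < c.s, lab (c.cv j) = a j) :
    sameWeight I.adj (fun v => lab v) = c.inner a +
      2 * ∑ v ∈ Finset.range I.n, (if c.mark v = 0 then c.weight a v (lab v) else 0) := by
  have h0 : sameWeight I.adj (fun v => lab v) = ∑ u ∈ Finset.range I.n,
      ∑ v ∈ Finset.range I.n, if lab u = lab v then I.adjN u v else 0 := by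
    unfold sameWeight
    rw [Finset.sum_range]
    refine Finset.sum_congr rfl fun u _ => ?_
    rw [Finset.sum_range]
    exact Finset.sum_congr rfl fun v _ => by rw [Inst.adjN_eq]
  have h1 : ∀ v ∈ Finset.range I.n, (if c.mark v = 0 then c.weight a v (lab v) else 0) =
      ∑ j ∈ Finset.range c.s, if c.mark v = 0 then
        (if lab (c.cv j) = lab v then I.adjN (c.cv j) v else 0) else 0 := by
    intro v _
    split_ifs
    · unfold weight
      refine Finset.sum_congr rfl fun j hj => ?_
      rw [h j (Finset.mem_range.1 hj), Inst.adjN_comm]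
      split_ifs <;> simp
    · simp
  have h2 : ∑ v ∈ Finset.range I.n, (if c.mark v = 0 then c.weight a v (lab v) else 0) =
      ∑ j ∈ Finset.range c.s, ∑ v ∈ Finset.range I.n, if c.mark v = 0 then
        (if lab (c.cv j) = lab v then I.adjN (c.cv j) v else 0) else 0 := by
    rw [Finset.sum_congr rfl h1, Finset.sum_comm]
  have h3 : ∀ u ∈ Finset.range I.n, (if c.mark u = 0 then
      ∑ v ∈ Finset.range I.n, (if lab u = lab v then I.adjN u v else 0) else 0) =
      if c.mark u = 0 then c.weight a u (lab u) else 0 := by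
    intro u hu
    split_ifs with hm
    · rw [c.sum_split, Finset.sum_eq_zero (s := Finset.range I.n), add_zero]
      · unfold weight
        refine Finset.sum_congr rfl fun j hj => ?_
        rw [h j (Finset.mem_range.1 hj)]
        by_cases hx : lab u = a j
        · simp [hx]
        · rw [if_neg hx, if_neg (Ne.symm hx), mul_zero]
      · intro v hv
        split_ifs with h1 h2
        · exact c.cover u (Finset.mem_range.1 hu) v (Finset.mem_range.1 hv) hm h1
        · rfl
        · rfl
    · rfl
  rw [h0, c.sum_split, Finset.sum_congr rfl h3]
  have h4 : ∀ j ∈ Finset.range c.s, ∑ v ∈ Finset.range I.n,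
      (if lab (c.cv j) = lab v then I.adjN (c.cv j) v else 0) =
      ∑ j' ∈ Finset.range c.s, I.adjN (c.cv j) (c.cv j') * (if a j = a j' then 1 else 0) +
      ∑ v ∈ Finset.range I.n, if c.mark v = 0 then
        (if lab (c.cv j) = lab v then I.adjN (c.cv j) v else 0) else 0 := by
    intro j hj
    rw [c.sum_split]
    congr 1
    refine Finset.sum_congr rfl fun j' hj' => ?_
    rw [h j (Finset.mem_range.1 hj), h j' (Finset.mem_range.1 hj')]
    split_ifs <;> simp
  rw [Finset.sum_congr rfl h4, Finset.sum_add_distrib, ← h2]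
  unfold inner
  ring

theorem card_class_color (lab : ℕ → ℕ) (h : ∀ j < c.s, lab (c.cv j) = a j) (q : Fin I.κ) (i : ℕ) :
    (Finset.univ.filter fun v : Fin I.n => lab v = i ∧ I.color v = q).card =
      c.coverCount a q i +
      (Finset.univ.filter fun v : Fin I.n => (c.mark v = 0 ∧ I.colN v = q) ∧ lab v = i).card := by
  have h1 : (Finset.univ.filter fun v : Fin I.n => lab v = i ∧ I.color v = q).card =
      ∑ v ∈ Finset.range I.n, if lab v = i ∧ I.colN v = q then 1 else 0 := by
    rw [Finset.card_filter, Finset.sum_range]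
    refine Finset.sum_congr rfl fun v _ => ?_
    rw [Inst.colN_eq]
    simp only [Fin.ext_iff]
  rw [h1, c.sum_split, Finset.card_filter, Finset.sum_range (n := I.n)]
  congr 1
  · unfold coverCount
    refine Finset.sum_congr rfl fun j hj => ?_
    rw [h j (Finset.mem_range.1 hj)]
    split_ifs <;> simp_all
  · refine Finset.sum_congr rfl fun v _ => ?_
    split_ifs <;> simp_all

/-- Weak duality. -/
theorem sum_weight_le_dual (q : Fin I.κ) {lab : ℕ → ℕ} (hlab : ∀ v < I.n, lab v ≤ c.s)
    (hcard : ∀ i ≤ c.s, (Finset.univ.filter fun v : Fin I.n =>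
      (c.mark v = 0 ∧ I.colN v = q) ∧ lab v = i).card = c.cap a q i) (r : ℕ → ℕ) :
    ∑ v ∈ Finset.range I.n,
      (if c.mark v = 0 ∧ I.colN v = q then c.weight a v (lab v) else 0) ≤ c.dual a q r := by
  unfold dual
  have h1 : ∑ i ∈ Finset.range (c.s + 1), r i * c.cap a q i =
      ∑ v ∈ Finset.range I.n, if c.mark v = 0 ∧ I.colN v = q then r (lab v) else 0 := by
    rw [Finset.sum_range (n := I.n), ← Finset.sum_filter,
      ← Finset.sum_fiberwise_of_maps_to (t := Finset.range (c.s + 1))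
        (g := fun v : Fin I.n => lab v)
        (fun v _ => Finset.mem_range.2 (Nat.lt_succ_of_le (hlab v v.2)))]
    refine Finset.sum_congr rfl fun i hi => ?_
    rw [Finset.sum_congr rfl (g := fun _ => r i), Finset.sum_const, Finset.filter_filter,
      hcard i (by have := Finset.mem_range.1 hi; omega), smul_eq_mul, mul_comm]
    intro v hv
    rw [(Finset.mem_filter.1 hv).2]
  -- The subtraction in `dual` is truncated; the side condition, proved last, says that nothing is
  -- cut off when a feasible assignment exists.
  rw [h1, Nat.le_sub_iff_add_le, ← Finset.sum_add_distrib]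
  · refine Finset.sum_le_sum fun v hv => ?_
    have hle : c.weight a v (lab v) + r (lab v) ≤
        (Finset.range (c.s + 1)).sup fun i => c.weight a v i + r i :=
      Finset.le_sup (f := fun i => c.weight a v i + r i)
        (Finset.mem_range.2 (Nat.lt_succ_of_le (hlab v (Finset.mem_range.1 hv))))
    split_ifs <;> simp_all
  · refine Finset.sum_le_sum fun v hv => ?_
    have hle : c.weight a v (lab v) + r (lab v) ≤
        (Finset.range (c.s + 1)).sup fun i => c.weight a v i + r i :=
      Finset.le_sup (f := fun i => c.weight a v i + r i)
        (Finset.mem_range.2 (Nat.lt_succ_of_le (hlab v (Finset.mem_range.1 hv))))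
    split_ifs <;> simp_all
    omega

/-- Strong duality. -/
theorem exists_best_le (q : Fin I.κ) (hle : ∀ i ≤ c.s, c.coverCount a q i ≤
      c.copies a i * I.mult q) (ha : ∀ j < c.s, a j < c.s)
    (hused : c.used a ≤ I.numFairlets) (h0 : a (2 * c.s) = 0) :
    ∃ φ : {v : Fin I.n // c.mark v = 0 ∧ I.colN v = q} → Fin (c.s + 1),
      (∀ i, (Finset.univ.filter fun v => φ v = i).card = c.cap a q i) ∧
      c.best a q ≤ ∑ v, c.weight a v.1 (φ v) := by
  -- The capacities are balanced: all clusters together contain `numFairlets` copies of the fairlet,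
  -- hence all vertices of color `q`, and the cover vertices are removed on both sides. `h0` is
  -- needed because `copies` reads cell `2 * s` for the remainder.
  have hcap : ∑ i : Fin (c.s + 1), c.cap a q i =
      Fintype.card {v : Fin I.n // c.mark v = 0 ∧ I.colN v = q} := by
    have e1 : ∑ i ∈ Finset.range (c.s + 1), c.cap a q i +
        ∑ i ∈ Finset.range (c.s + 1), c.coverCount a q i = I.numFairlets * I.mult q := by
      rw [← Finset.sum_add_distrib, Finset.sum_congr rfl
        (g := fun i => c.copies a i * I.mult q), ← Finset.sum_mul]
      · congr 1
        rw [Finset.sum_range_succ]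
        have : ∑ i ∈ Finset.range c.s, c.copies a i = c.used a :=
          Finset.sum_congr rfl fun i hi => by
            have := Finset.mem_range.1 hi
            simp [copies, show i ≠ c.s by omega]
        rw [this, copies, ← two_mul, h0, if_pos rfl, rest]
        omega
      · intro i hi
        have := hle i (by have := Finset.mem_range.1 hi; omega)
        unfold cap
        omega
    have e2 : ∑ i ∈ Finset.range (c.s + 1), c.coverCount a q i =
        ∑ j ∈ Finset.range c.s, if I.colN (c.cv j) = q then 1 else 0 := by
      unfold coverCount
      rw [Finset.sum_comm]
      refine Finset.sum_congr rfl fun j hj => ?_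
      have := ha j (Finset.mem_range.1 hj)
      rw [← Finset.sum_mul, Finset.sum_ite_eq, if_pos (Finset.mem_range.2 (by omega)), one_mul]
    have e3 : I.numFairlets * I.mult q = I.cntN q := by
      rw [Inst.cntN_eq, Inst.fairlets.eq]
    rw [← Finset.sum_range (fun i => c.cap a q i)]
    rw [e3, Inst.cntN, c.sum_split, e2] at e1
    rw [Fintype.card_subtype, Finset.card_filter]
    rw [Finset.sum_range (n := I.n)] at e1
    have e4 : ∑ v : Fin I.n, (if c.mark v = 0 then if I.colN v = q then 1 else 0 else 0) =
        ∑ v : Fin I.n, if c.mark v = 0 ∧ I.colN v = q then 1 else 0 :=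
      Finset.sum_congr rfl fun v _ => by split_ifs <;> simp_all
    omega
  obtain ⟨φ, hφ, r, hr, heq⟩ := exists_optimal_assignment
    (α := {v : Fin I.n // c.mark v = 0 ∧ I.colN v = q}) (fun v (i : Fin (c.s + 1)) =>
      c.weight a v.1 i) c.s (fun v i => c.weight_le a v.1 i) (cap := fun i => c.cap a q i) hcap
  refine ⟨φ, hφ, ?_⟩
  let r' : ℕ → ℕ := fun i => if h : i < c.s + 1 then (r ⟨i, h⟩).toNat else 0
  have hr' : ∀ i : Fin (c.s + 1), (r' i : ℤ) = r i := fun i => by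
    have := hr i
    simp only [r', i.2, dif_pos, Fin.eta]
    omega
  -- The entries of the optimal potential are at most `s`, so it is one of the enumerated digit
  -- vectors. Base `s + 1` would hold them too, but the base must be at least `2` also for `s = 0`.
  obtain ⟨N, hN, hdig⟩ := WordRAM.exists_digits (c.s + 2) r' (c.s + 1) fun j hj => by
    have := hr ⟨j, hj⟩
    simp only [r', hj, dif_pos]
    omega
  have hbest : c.best a q ≤ c.dual a q r' := by
    refine (WordRAM.foldl_min_le hN).trans_eq ?_
    have hd : ∀ i ∈ Finset.range (c.s + 1), N / (c.s + 2) ^ i % (c.s + 2) = r' i :=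
      fun i hi => hdig i (Finset.mem_range.1 hi)
    have hs : ∀ v, ((Finset.range (c.s + 1)).sup fun i =>
        c.weight a v i + N / (c.s + 2) ^ i % (c.s + 2)) =
        (Finset.range (c.s + 1)).sup fun i => c.weight a v i + r' i := fun v =>
      Finset.sup_congr rfl fun i hi => by rw [hd i hi]
    unfold dual
    simp only [hs]
    congr 1
    exact Finset.sum_congr rfl fun i hi => by rw [hd i hi]
  refine hbest.trans ?_
  unfold dual
  have e2 : (∑ v ∈ Finset.range I.n, ((if c.mark v = 0 then 1 else 0) *
      (if I.colN v = q then 1 else 0) *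
      ((Finset.range (c.s + 1)).sup fun i => c.weight a v i + r' i) : ℕ)) =
      ∑ v : {v : Fin I.n // c.mark v = 0 ∧ I.colN v = q},
        (Finset.range (c.s + 1)).sup fun i => c.weight a v.1 i + r' i := by
    rw [Finset.sum_range, ← Finset.sum_subtype (p := fun v : Fin I.n =>
      c.mark v = 0 ∧ I.colN v = q) (Finset.univ.filter fun v : Fin I.n =>
      c.mark v = 0 ∧ I.colN v = q) (by simp) (fun v : Fin I.n =>
        (Finset.range (c.s + 1)).sup fun i => c.weight a v i + r' i), Finset.sum_filter]
    exact Finset.sum_congr rfl fun v _ => by split_ifs <;> simp_all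
  rw [Nat.sub_le_iff_le_add, e2]
  zify
  have e1 : (∑ i ∈ Finset.range (c.s + 1), (r' i : ℤ) * c.cap a q i) =
      ∑ i, r i * c.cap a q i := by
    rw [Finset.sum_range]
    exact Finset.sum_congr rfl fun i _ => by rw [hr']
  rw [e1]
  push_cast at heq
  rw [heq, dualValue, sub_add_cancel]
  refine Finset.sum_le_sum fun v _ => ?_
  obtain ⟨i, hi, he⟩ := Finset.exists_mem_eq_sup (Finset.range (c.s + 1)) ⟨0, by simp⟩
    fun i => c.weight a v.1 i + r' i
  rw [he]
  refine le_trans ?_ (Finset.le_sup' (fun i : Fin (c.s + 1) =>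
    ((c.weight a v.1 i : ℕ) : ℤ) + r i) (Finset.mem_univ ⟨i, Finset.mem_range.1 hi⟩))
  rw [← hr' ⟨i, Finset.mem_range.1 hi⟩]
  push_cast
  exact le_rfl

/-- Justifies the initial value `n * n` of the minimum in `best`: it is never below the weight of an
assignment. -/
theorem sum_weight_le (q : ℕ) (lab : ℕ → ℕ) :
    ∑ v ∈ Finset.range I.n,
      (if c.mark v = 0 ∧ I.colN v = q then c.weight a v (lab v) else 0) ≤ I.n * I.n := by
  calc _ ≤ ∑ v ∈ Finset.range I.n, I.n := Finset.sum_le_sum fun v _ => by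
        have := c.weight_le a v (lab v)
        have := c.s_le
        split_ifs <;> omega
    _ = _ := by simp

theorem sum_color_weight (lab : ℕ → ℕ) :
    ∑ v ∈ Finset.range I.n, (if c.mark v = 0 then c.weight a v (lab v) else 0) =
      ∑ q ∈ Finset.range I.κ, ∑ v ∈ Finset.range I.n,
        (if c.mark v = 0 ∧ I.colN v = q then c.weight a v (lab v) else 0) := by
  rw [Finset.sum_comm]
  refine Finset.sum_congr rfl fun v hv => ?_
  have := Inst.colN_lt (I := I) (Finset.mem_range.1 hv)
  by_cases hm : c.mark v = 0
  · simp [hm, this]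
  · simp [hm]

theorem violations_eq_zero_iff : c.violations a = 0 ↔ (∀ j < c.s, a j < c.s) ∧
    c.used a ≤ I.numFairlets ∧
    ∀ q < I.κ, ∀ i < c.s, c.coverCount a q i ≤ a (c.s + i) * I.mult q := by
  unfold violations
  rw [Nat.add_eq_zero_iff, Nat.add_eq_zero_iff, and_assoc, Finset.sum_eq_zero_iff,
    Finset.sum_eq_zero_iff]
  refine and_congr (forall_congr' fun j => ?_) (and_congr ?_ (forall_congr' fun q => ?_))
  · rw [Finset.mem_range]
    refine imp_congr_right fun _ => ?_
    by_cases h : c.s < a j + 1 <;> (simp [h]; try omega)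
  · by_cases h : I.numFairlets < c.used a <;> (simp [h]; try omega)
  · rw [Finset.mem_range, Finset.sum_eq_zero_iff]
    refine imp_congr_right fun _ => forall_congr' fun i => ?_
    rw [Finset.mem_range]
    refine imp_congr_right fun _ => ?_
    by_cases h : a (c.s + i) * I.mult q < c.coverCount a q i <;> (simp [h]; try omega)

theorem squares_eq : c.squares a = ∑ i ∈ Finset.range c.s,
    (a (c.s + i) * ∑ q : Fin I.κ, I.mult q) ^ 2 +
    c.rest a * (∑ q : Fin I.κ, I.mult q) * ∑ q : Fin I.κ, I.mult q := by
  unfold squares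
  rw [Inst.sum_mult]
  simp only [sq]

theorem accept_eq_one_iff {B : ℕ} : c.accept a B = 1 ↔ c.violations a = 0 ∧
    I.numAdj + c.squares a ≤ 2 * B + I.n + 2 * (c.inner a + 2 * c.gain a) := by
  unfold accept
  split_ifs <;> simp_all

/-- The optimal assignments of the single colors and the guessed labels of the cover vertices fit
together to a distribution with the guessed sizes. Its weight is at least `gain`, so its cost obeys
the budget. -/
theorem isYes_of_accept (h0 : a (2 * c.s) = 0) (h : c.accept a I.budget = 1) : I.IsYes := by
  classical
  rw [accept_eq_one_iff, violations_eq_zero_iff] at h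
  obtain ⟨⟨ha, hused, hcount⟩, hle⟩ := h
  have hcs : ∀ q, c.coverCount a q c.s = 0 := fun q => by
    unfold coverCount
    refine Finset.sum_eq_zero fun j hj => ?_
    rw [if_neg (by have := ha j (Finset.mem_range.1 hj); omega), zero_mul]
  have hcopies : ∀ i < c.s, c.copies a i = a (c.s + i) := fun i hi => by
    simp [copies, show i ≠ c.s by omega]
  have hcopiess : c.copies a c.s = c.rest a := by
    simp [copies, ← two_mul, h0]
  have hcle : ∀ q : Fin I.κ, ∀ i ≤ c.s, c.coverCount a q i ≤ c.copies a i * I.mult q := by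
    intro q i hi
    rcases hi.lt_or_eq with h | rfl
    · rw [hcopies i h]; exact hcount q q.2 i h
    · rw [hcs]; omega
  choose φ hφ hbest using fun q => exists_best_le (c := c) (a := a) q (hcle q) ha hused h0
  have hidx : ∀ v : ℕ, ∃ j, v < I.n → c.mark v ≠ 0 → j < c.s ∧ c.cv j = v := fun v => by
    by_cases h : v < I.n ∧ c.mark v ≠ 0
    · obtain ⟨j, hj⟩ := (c.mark_iff v h.1).1 h.2
      exact ⟨j, fun _ _ => hj⟩
    · exact ⟨0, fun h1 h2 => absurd ⟨h1, h2⟩ h⟩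
  choose idx hidx using hidx
  let lab : ℕ → ℕ := fun v => if hv : v < I.n then
    if hm : c.mark v = 0 then φ (I.color ⟨v, hv⟩) ⟨⟨v, hv⟩, hm, Inst.colN_eq ⟨v, hv⟩⟩
    else a (idx v) else 0
  have hlabcv : ∀ j < c.s, lab (c.cv j) = a j := by
    intro j hj
    have h1 := hidx (c.cv j) (c.lt j hj) (c.mark_cv hj)
    simp only [lab, dif_pos (c.lt j hj), dif_neg (c.mark_cv hj)]
    rw [c.inj _ h1.1 _ hj h1.2]
  have hlabφ : ∀ (q : Fin I.κ) (v : {v : Fin I.n // c.mark v = 0 ∧ I.colN v = q}),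
      lab v.1 = φ q v := by
    rintro q ⟨v, hm, hq⟩
    have : q = I.color v := by
      rw [Inst.colN_eq] at hq
      exact Fin.ext hq.symm
    subst this
    simp only [lab, v.2, dif_pos, hm]
  have hlable : ∀ v < I.n, lab v ≤ c.s := by
    intro v hv
    by_cases hm : c.mark v = 0
    · rw [hlabφ (I.color ⟨v, hv⟩) ⟨⟨v, hv⟩, hm, Inst.colN_eq ⟨v, hv⟩⟩]
      have := (φ (I.color ⟨v, hv⟩) ⟨⟨v, hv⟩, hm, Inst.colN_eq ⟨v, hv⟩⟩).2
      omega
    · obtain ⟨h1, h2⟩ := hidx v hv hm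
      rw [← h2, hlabcv _ h1]
      exact (ha _ h1).le
  have hcard : ∀ (q : Fin I.κ), ∀ i ≤ c.s, (Finset.univ.filter fun v : Fin I.n =>
      (c.mark v = 0 ∧ I.colN v = q) ∧ lab v = i).card = c.cap a q i := by
    intro q i hi
    rw [← hφ q ⟨i, by omega⟩]
    symm
    refine Finset.card_bij (fun v _ => v.1) ?_ ?_ ?_
    · intro v hv
      simp only [Finset.mem_filter, Finset.mem_univ, true_and] at hv ⊢
      exact ⟨v.2, by rw [hlabφ q v, hv]⟩
    · intro v _ v' _ hvv; exact Subtype.ext hvv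
    · intro v hv
      simp only [Finset.mem_filter, Finset.mem_univ, true_and] at hv
      refine ⟨⟨v, hv.1⟩, ?_, rfl⟩
      simp only [Finset.mem_filter, Finset.mem_univ, true_and]
      refine Fin.ext ?_
      rw [← hlabφ q ⟨v, hv.1⟩, hv.2]
  have hdist : IsDistribution I.color (fun q => I.mult q) c.toFinset c.s (c.copies a)
      (fun v => lab v) := by
    refine ⟨fun v => hlable v v.2, fun i hi q => ?_, fun v hv => ?_⟩
    · rw [card_class_color lab hlabcv q i, hcard q i hi, cap]
      have := hcle q i hi
      omega
    · rw [mem_toFinset] at hv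
      obtain ⟨h1, h2⟩ := hidx v v.2 hv
      rw [← h2, hlabcv _ h1]
      exact ha _ h1
  obtain ⟨l, hfair, hadj, hone⟩ := hdist.exists_labeling (A := I.adj) c.adj_eq_zero
  refine Inst.fairlets.isYes_iff.2 ⟨l, hfair, ?_⟩
  rw [← Inst.numAdj_eq, hadj, sameWeight_adj hlabcv, hone, hcopiess,
    Finset.sum_congr rfl (g := fun i => (a (c.s + i) * ∑ q : Fin I.κ, I.mult q) ^ 2)
      (fun i hi => by rw [hcopies i (Finset.mem_range.1 hi)]), ← squares_eq]
  have hgain : c.gain a ≤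
      ∑ v ∈ Finset.range I.n, (if c.mark v = 0 then c.weight a v (lab v) else 0) := by
    rw [sum_color_weight]
    refine Finset.sum_le_sum fun q hq => ?_
    have hq' := Finset.mem_range.1 hq
    refine (hbest ⟨q, hq'⟩).trans_eq ?_
    rw [Finset.sum_range, ← Finset.sum_filter, Finset.sum_subtype (p := fun v : Fin I.n =>
      c.mark v = 0 ∧ I.colN v = q) (Finset.univ.filter fun v : Fin I.n =>
      c.mark v = 0 ∧ I.colN v = q) (by simp)]
    exact Finset.sum_congr rfl fun v _ => by rw [hlabφ ⟨q, hq'⟩ v]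
  refine hle.trans ?_
  omega

/-- A solution may be assumed reduced, and its distribution is read as a guess: `s` digits for the
labels of the cover vertices, then `s` digits for the numbers of fairlets, which are at most `2 *
s`. By weak duality `gain` is at least the weight that the solution achieves. -/
theorem exists_accept (h : I.IsYes) : ∃ N < (2 * c.s + 2) ^ (2 * c.s),
    c.accept (fun j => N / (2 * c.s + 2) ^ j % (2 * c.s + 2)) I.budget = 1 := by
  classical
  obtain ⟨l, hl, hle, hred⟩ := exists_reduced_labeling (A := I.adj) (C := c.toFinset)
    (fun u v => by rw [← Inst.adjN_eq, ← Inst.adjN_eq, Inst.adjN_comm])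
    (fun u v => by rw [← Inst.adjN_eq]; exact Inst.adjN_le_one _ _) c.adj_eq_zero
    (Inst.fairlets.isYes_iff.1 h)
  obtain ⟨t, lab, hdist, ht2, htT, hts, hadj, hone⟩ : ∃ (t : ℕ → ℕ) (lab : Fin I.n → ℕ),
      IsDistribution I.color (fun q => I.mult q) c.toFinset c.s t lab ∧
      (∀ i < c.s, t i ≤ 2 * c.s) ∧
      ∑ i ∈ Finset.range c.s, t i ≤ I.numFairlets ∧
      t c.s = I.numFairlets - ∑ i ∈ Finset.range c.s, t i ∧
      sameWeight I.adj lab = sameWeight I.adj l ∧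
      sameWeight (fun _ _ => 1) l =
        ∑ i ∈ Finset.range c.s, (t i * ∑ q : Fin I.κ, I.mult q) ^ 2 +
          t c.s * (∑ q : Fin I.κ, I.mult q) * ∑ q : Fin I.κ, I.mult q := by
    -- Without vertices there is no default value that extends the list of cover vertices to all
    -- indices, as `exists_distribution` requires.
    by_cases hn : I.n = 0
    · have hs : c.s = 0 := by have := c.s_le; omega
      have hκ : I.κ = 0 := by have := I.κ_le; omega
      have : IsEmpty (Fin I.n) := by rw [hn]; infer_instance
      have : IsEmpty (Fin I.κ) := by rw [hκ]; infer_instance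
      refine ⟨fun _ => I.numFairlets, l, ⟨fun v => isEmptyElim v, fun _ _ q => isEmptyElim q,
        fun v => isEmptyElim v⟩, by omega, ?_, ?_, rfl, ?_⟩
      · simp [hs]
      · simp [hs]
      · simp [hs, sameWeight]
    · refine exists_distribution c.card_toFinset
        (cv := fun j => if hj : j < c.s then ⟨c.cv j, c.lt j hj⟩ else ⟨0, by omega⟩) ?_
        c.adj_eq_zero (fun q => Inst.fairlets.eq q) hl hred
      intro v
      rw [mem_toFinset, c.mark_iff v v.2]
      refine exists_congr fun j => and_congr_right fun hj => ?_
      simp only [hj, dif_pos, Fin.ext_iff]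
  let lab' : ℕ → ℕ := fun v => if hv : v < I.n then lab ⟨v, hv⟩ else 0
  have hlab' : ∀ v : Fin I.n, lab' v = lab v := fun v => by simp [lab']
  obtain ⟨N, hN, hdig⟩ := WordRAM.exists_digits (2 * c.s + 2)
    (fun j => if j < c.s then lab' (c.cv j) else t (j - c.s)) (2 * c.s) fun j hj => by
      split_ifs with h
      · have := hdist.le ⟨c.cv j, c.lt j h⟩
        rw [← hlab'] at this
        simp only at this
        omega
      · have := ht2 (j - c.s) (by omega)
        omega
  refine ⟨N, hN, ?_⟩
  set a : ℕ → ℕ := fun j => N / (2 * c.s + 2) ^ j % (2 * c.s + 2) with ha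
  have ha1 : ∀ j < c.s, lab' (c.cv j) = a j := fun j hj => by
    rw [ha]; simp only; rw [hdig j (by omega), if_pos hj]
  have ha2 : ∀ i < c.s, a (c.s + i) = t i := fun i hi => by
    rw [ha]; simp only; rw [hdig (c.s + i) (by omega), if_neg (by omega)]
    congr 1; omega
  have ha3 : a (2 * c.s) = 0 := by
    rw [ha]; simp only; rw [Nat.div_eq_of_lt hN, Nat.zero_mod]
  have hused : c.used a = ∑ i ∈ Finset.range c.s, t i :=
    Finset.sum_congr rfl fun i hi => ha2 i (Finset.mem_range.1 hi)
  have hrest : c.rest a = t c.s := by rw [rest, hused, hts]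
  have hcopies : ∀ i ≤ c.s, c.copies a i = t i := fun i hi => by
    rcases hi.lt_or_eq with h | rfl
    · simp [copies, show i ≠ c.s by omega, ha2 i h]
    · simp [copies, ← two_mul, ha3, hrest]
  have hclass : ∀ (q : Fin I.κ), ∀ i ≤ c.s, c.coverCount a q i +
      (Finset.univ.filter fun v : Fin I.n =>
        (c.mark v = 0 ∧ I.colN v = q) ∧ lab' v = i).card = t i * I.mult q := by
    intro q i hi
    rw [← card_class_color lab' ha1, ← hdist.card i hi q]
    simp only [hlab']
  rw [accept_eq_one_iff, violations_eq_zero_iff]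
  refine ⟨⟨fun j hj => ?_, by rw [hused]; exact htT, fun q hq i hi => ?_⟩, ?_⟩
  · rw [← ha1 j hj]
    have := hdist.cover ⟨c.cv j, c.lt j hj⟩ ((c.mem_toFinset _).2 (c.mark_cv hj))
    rwa [← hlab'] at this
  · rw [ha2 i hi]
    have := hclass ⟨q, hq⟩ i hi.le
    simp only at this
    omega
  · have hsq : c.squares a = sameWeight (fun _ _ => 1) l := by
      rw [hone, squares_eq, hrest]
      congr 1
      exact Finset.sum_congr rfl fun i hi => by rw [ha2 i (Finset.mem_range.1 hi)]
    have hgain : ∑ v ∈ Finset.range I.n, (if c.mark v = 0 then c.weight a v (lab' v) else 0) ≤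
        c.gain a := by
      rw [sum_color_weight]
      refine Finset.sum_le_sum fun q hq => ?_
      refine WordRAM.le_foldl_min (sum_weight_le q lab') fun i _ => ?_
      refine sum_weight_le_dual ⟨q, Finset.mem_range.1 hq⟩
        (fun v hv => by simpa [lab', hv] using hdist.le ⟨v, hv⟩) (fun i hi => ?_) _
      have := hclass ⟨q, Finset.mem_range.1 hq⟩ i hi
      rw [cap, hcopies i hi]
      simp only at this ⊢
      omega
    have hE : sameWeight I.adj l = c.inner a +
        2 * ∑ v ∈ Finset.range I.n, (if c.mark v = 0 then c.weight a v (lab' v) else 0) := by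
      rw [← hadj, ← sameWeight_adj ha1]
      simp only [hlab']
    rw [hsq, Inst.numAdj_eq]
    omega

/-- The enumeration of all guesses decides the instance. -/
theorem isYes_iff : I.IsYes ↔ ∃ N < (2 * c.s + 2) ^ (2 * c.s),
    c.accept (fun j => N / (2 * c.s + 2) ^ j % (2 * c.s + 2)) I.budget = 1 :=
  ⟨exists_accept, fun ⟨_, hN, h⟩ =>
    isYes_of_accept (by rw [Nat.div_eq_of_lt hN, Nat.zero_mod]) h⟩

end FairCC.Inst.Cover

namespace FairCC
open WordRAM

/-! ### Programs for the quantities of the algorithm -/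

theorem fits_eq {w : ℕ} {st : State} {e₁ e₂ : Expr} (h₁ : e₁.Fits w st) (h₂ : e₂.Fits w st)
    (hw : 1 < 2 ^ w) : (Expr.bin .eq e₁ e₂).Fits w st := by
  refine ⟨h₁, h₂, ?_⟩
  simp only [Op.eval]
  split_ifs <;> omega

theorem fits_lt {w : ℕ} {st : State} {e₁ e₂ : Expr} (h₁ : e₁.Fits w st) (h₂ : e₂.Fits w st)
    (hw : 1 < 2 ^ w) : (Expr.bin .lt e₁ e₂).Fits w st := by
  refine ⟨h₁, h₂, ?_⟩
  simp only [Op.eval]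
  split_ifs <;> omega

theorem eval_lt_of_fits {w : ℕ} {st : State} {e : Expr} (h : e.Fits w st) :
    e.eval st < 2 ^ w := by
  cases e with
  | lit v => exact h
  | reg r => exact h
  | get a i => exact h.2
  | bin o e₁ e₂ => exact h.2.2

theorem fits_sub {w : ℕ} {st : State} {e₁ e₂ : Expr} (h₁ : e₁.Fits w st) (h₂ : e₂.Fits w st) :
    (Expr.bin .sub e₁ e₂).Fits w st :=
  ⟨h₁, h₂, (Nat.sub_le _ _).trans_lt (eval_lt_of_fits h₁)⟩

theorem fits_div {w : ℕ} {st : State} {e₁ e₂ : Expr} (h₁ : e₁.Fits w st) (h₂ : e₂.Fits w st) :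
    (Expr.bin .div e₁ e₂).Fits w st :=
  ⟨h₁, h₂, (Nat.div_le_self _ _).trans_lt (eval_lt_of_fits h₁)⟩

theorem fits_mod {w : ℕ} {st : State} {e₁ e₂ : Expr} (h₁ : e₁.Fits w st) (h₂ : e₂.Fits w st) :
    (Expr.bin .mod e₁ e₂).Fits w st :=
  ⟨h₁, h₂, (Nat.mod_le _ _).trans_lt (eval_lt_of_fits h₁)⟩

/-- Multiplication by a truth value does not overflow. -/
theorem fits_mul_of_le_one {w : ℕ} {st : State} {e₁ e₂ : Expr} (h₁ : e₁.Fits w st)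
    (h₂ : e₂.Fits w st) (h : e₁.eval st ≤ 1 ∨ e₂.eval st ≤ 1) :
    (Expr.bin .mul e₁ e₂).Fits w st := by
  refine ⟨h₁, h₂, ?_⟩
  have e1 := eval_lt_of_fits h₁
  have e2 := eval_lt_of_fits h₂
  simp only [Op.eval]
  rcases h with h | h
  · exact (Nat.mul_le_mul_right _ h).trans_lt (by omega)
  · exact (Nat.mul_le_mul_left _ h).trans_lt (by omega)

theorem eval_eq_le_one (st : State) (e₁ e₂ : Expr) : (Expr.bin .eq e₁ e₂).eval st ≤ 1 := by
  simp only [Expr.eval, Op.eval]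
  split_ifs <;> omega

theorem eval_lt_le_one (st : State) (e₁ e₂ : Expr) : (Expr.bin .lt e₁ e₂).eval st ≤ 1 := by
  simp only [Expr.eval, Op.eval]
  split_ifs <;> omega

/-- Word length and position of the adjacency matrix: no polynomial of moderate degree in the
number of vertices overflows. -/
structure Bounds (w : ℕ) (I : Inst) (ab N : ℕ) : Prop where
  n_le : I.n + 2 ≤ N
  ab_le : ab + I.n * I.n ≤ N
  pow_le : N ^ 10 ≤ 2 ^ w

namespace Bounds
variable {w : ℕ} {I : Inst} {ab N : ℕ} (b : Bounds w I ab N)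
include b

theorem two_le : 2 ≤ N := by have := b.n_le; omega

theorem lt_of_le_pow {x k : ℕ} (hx : x ≤ N ^ k) (hk : k < 10) : x < 2 ^ w :=
  hx.trans_lt ((Nat.pow_lt_pow_right b.two_le hk).trans_le b.pow_le)

theorem lt_of_le {x : ℕ} (hx : x ≤ N) : x < 2 ^ w := b.lt_of_le_pow (k := 1) (by simpa) (by omega)

theorem one_lt : 1 < 2 ^ w := b.lt_of_le (by have := b.two_le; omega)

theorem two_lt : 2 < 2 ^ w := b.lt_of_le b.two_le

theorem one_le : 1 ≤ w := by
  have := b.one_lt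
  by_contra h
  obtain rfl : w = 0 := by omega
  simp at this

theorem κ_le : I.κ + 2 ≤ N := by have := b.n_le; have := I.κ_le; omega

theorem mult_le (q : ℕ) : I.mult q + 2 ≤ N := by
  have := b.n_le
  have h : I.mult q ≤ I.cntN q := Nat.div_le_self _ _
  have := I.cntN_le q
  omega

end Bounds

/-- Bookkeeping against overflow: every quantity is bounded by a power of `N`, and an addition
raises the exponent by one. -/
theorem add_le_pow {N x y p : ℕ} (hN : 2 ≤ N) (hx : x ≤ N ^ p) (hy : y ≤ N ^ p) :
    x + y ≤ N ^ (p + 1) := by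
  rw [pow_succ]
  calc x + y ≤ N ^ p * 2 := by omega
    _ ≤ _ := Nat.mul_le_mul_left _ hN

theorem mul_le_pow {N x y p q : ℕ} (hx : x ≤ N ^ p) (hy : y ≤ N ^ q) : x * y ≤ N ^ (p + q) := by
  rw [pow_add]; exact Nat.mul_le_mul hx hy

theorem sum_le_pow {N n p : ℕ} {f : ℕ → ℕ} (hn : n ≤ N) (hf : ∀ i < n, f i ≤ N ^ p) :
    ∑ i ∈ Finset.range n, f i ≤ N ^ (p + 1) := by
  calc _ ≤ ∑ i ∈ Finset.range n, N ^ p :=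
        Finset.sum_le_sum fun i hi => hf i (Finset.mem_range.1 hi)
    _ = n * N ^ p := by simp
    _ ≤ N * N ^ p := Nat.mul_le_mul_right _ hn
    _ = _ := by ring

/-- The graph is in memory. -/
structure GraphMem (I : Inst) (ab : ℕ) (st : State) : Prop where
  r2 : st.reg 2 = I.n
  r3 : st.reg 3 = I.κ
  r4 : st.reg 4 = ab
  adj : ∀ u < I.n, ∀ v < I.n, st.arr 0 (ab + (u * I.n + v)) = I.adjN u v
  col : ∀ v < I.n, st.arr 1 v = I.colN v

theorem GraphMem.agree {I : Inst} {ab d A : ℕ} {st st' : State} (h : GraphMem I ab st)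
    (hd : 5 ≤ d) (hA : 2 ≤ A) (hag : Agree d A st st') : GraphMem I ab st' where
  r2 := by rw [hag.reg 2 (by omega), h.r2]
  r3 := by rw [hag.reg 3 (by omega), h.r3]
  r4 := by rw [hag.reg 4 (by omega), h.r4]
  adj := by rw [hag.arr 0 (by omega)]; exact h.adj
  col := by rw [hag.arr 1 (by omega)]; exact h.col

/-- The graph and a vertex cover are in memory. -/
structure CoverMem (I : Inst) (c : I.Cover) (ab : ℕ) (st : State) : Prop
    extends GraphMem I ab st where
  r6 : st.reg 6 = c.s
  mark : ∀ v < I.n, st.arr 2 v = c.mark v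
  cv : ∀ j < c.s, st.arr 3 j = c.cv j

theorem CoverMem.agree {I : Inst} {c : I.Cover} {ab d A : ℕ} {st st' : State}
    (h : CoverMem I c ab st) (hd : 7 ≤ d) (hA : 4 ≤ A) (hag : Agree d A st st') :
    CoverMem I c ab st' where
  toGraphMem := h.toGraphMem.agree (by omega) (by omega) hag
  r6 := by rw [hag.reg 6 (by omega), h.r6]
  mark := by rw [hag.arr 2 (by omega)]; exact h.mark
  cv := by rw [hag.arr 3 (by omega)]; exact h.cv

/-- Everything that is needed for the enumeration of guesses is in memory. -/
structure MainMem (I : Inst) (c : I.Cover) (ab B : ℕ) (st : State) : Prop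
    extends CoverMem I c ab st where
  r7 : st.reg 7 = I.numFairlets
  r8 : st.reg 8 = I.n / I.numFairlets
  r9 : st.reg 9 = I.numAdj
  r10 : st.reg 10 = B
  r11 : st.reg 11 = 2 * c.s
  r12 : st.reg 12 = 2 * c.s + 2
  r13 : st.reg 13 = c.s + 1
  r14 : st.reg 14 = c.s + 2
  r15 : st.reg 15 = I.n * I.n

theorem MainMem.agree {I : Inst} {c : I.Cover} {ab B d A : ℕ} {st st' : State}
    (h : MainMem I c ab B st) (hd : 20 ≤ d) (hA : 4 ≤ A) (hag : Agree d A st st') :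
    MainMem I c ab B st' where
  toCoverMem := h.toCoverMem.agree (by omega) (by omega) hag
  r7 := by rw [hag.reg 7 (by omega), h.r7]
  r8 := by rw [hag.reg 8 (by omega), h.r8]
  r9 := by rw [hag.reg 9 (by omega), h.r9]
  r10 := by rw [hag.reg 10 (by omega), h.r10]
  r11 := by rw [hag.reg 11 (by omega), h.r11]
  r12 := by rw [hag.reg 12 (by omega), h.r12]
  r13 := by rw [hag.reg 13 (by omega), h.r13]
  r14 := by rw [hag.reg 14 (by omega), h.r14]
  r15 := by rw [hag.reg 15 (by omega), h.r15]

/-- The entry of the adjacency matrix for the vertices computed by two expressions. -/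
def adjExpr (u v : Expr) : Expr :=
  .get 0 (.bin .add (.reg 4) (.bin .add (.bin .mul u (.reg 2)) v))

theorem index_lt {n u v : ℕ} (hu : u < n) (hv : v < n) : u * n + v < n * n := by
  have : (u + 1) * n ≤ n * n := Nat.mul_le_mul_right _ hu
  rw [Nat.add_mul] at this
  omega

theorem eval_adjExpr {I : Inst} {ab : ℕ} {st : State} (h : GraphMem I ab st) {e₁ e₂ : Expr}
    {u v : ℕ} (hu : e₁.eval st = u) (hv : e₂.eval st = v) (hun : u < I.n) (hvn : v < I.n) :
    (adjExpr e₁ e₂).eval st = I.adjN u v := by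
  simp only [adjExpr, Expr.eval, Op.eval, hu, hv, h.r2, h.r4]
  exact h.adj u hun v hvn

theorem fits_adjExpr {w N : ℕ} {I : Inst} {ab : ℕ} {st : State} (b : Bounds w I ab N)
    (h : GraphMem I ab st) {e₁ e₂ : Expr}
    {u v : ℕ} (hu : e₁.eval st = u) (hv : e₂.eval st = v) (hun : u < I.n) (hvn : v < I.n)
    (f₁ : e₁.Fits w st) (f₂ : e₂.Fits w st) : (adjExpr e₁ e₂).Fits w st := by
  have h1 := index_lt hun hvn
  have h2 := b.ab_le
  have h3 := b.n_le
  refine ⟨⟨?_, ⟨⟨f₁, ?_, ?_⟩, f₂, ?_⟩, ?_⟩, ?_⟩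
  · exact b.lt_of_le (by rw [h.r4]; omega)
  · exact b.lt_of_le (by rw [h.r2]; omega)
  · simp only [Expr.eval, Op.eval, hu, h.r2]
    exact b.lt_of_le (by omega)
  · simp only [Expr.eval, Op.eval, hu, hv, h.r2]
    exact b.lt_of_le (by omega)
  · simp only [Expr.eval, Op.eval, hu, hv, h.r2, h.r4]
    exact b.lt_of_le (by omega)
  · have := eval_adjExpr h hu hv hun hvn
    simp only [adjExpr, Expr.eval] at this ⊢
    rw [this]
    have := I.adjN_le_one u v
    exact b.lt_of_le (by omega)

/-- The multiplicity in the fairlet of the color in register `q`. -/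
def multProg (d q : ℕ) : Prog :=
  .seq (sumLoop d 2 (.set (d + 2) (.bin .eq (.get 1 (.reg (d + 1))) (.reg q))))
    (.set d (.bin .div (.reg d) (.reg 7)))

/-- The number of vertices of the color in register `q`. -/
def cntProg (d q : ℕ) : Prog :=
  sumLoop d 2 (.set (d + 2) (.bin .eq (.get 1 (.reg (d + 1))) (.reg q)))

theorem calc_cnt {w N d A q Q ab : ℕ} {I : Inst} {st : State}
    (b : Bounds w I ab N) (h : GraphMem I ab st) (hd : 5 ≤ d) (hA : 2 ≤ A) (hq : q < d)
    (hQ : st.reg q = Q) (hQN : Q ≤ N) :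
    Calc w d A (cntProg d q) st ((I.n + 1) * 20) (I.cntN Q) := by
  have hn := b.n_le
  refine Calc.sumLoop (Tb := 5) (by omega) h.r2 (b.lt_of_le (by omega)) b.one_le ?_ ?_
    (Nat.mul_le_mul_left _ (by omega))
  · intro v hv s' hag hr
    have h' := h.agree hd hA hag
    have hq' : s'.reg q = Q := by rw [hag.reg q hq, hQ]
    refine Calc.mono (Calc.set (fits_eq ⟨?_, ?_⟩ ?_ b.one_lt) ?_) (by simp [Expr.cost])
    · exact b.lt_of_le (by rw [hr]; omega)
    · simp only [Expr.eval, hr, h'.col v hv]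
      have := I.colN_lt hv
      have := b.κ_le
      exact b.lt_of_le (by omega)
    · exact b.lt_of_le (by rw [hq']; omega)
    · simp only [Expr.eval, Op.eval, hr, hq', h'.col v hv]
  · have := I.cntN_le Q
    unfold Inst.cntN at this
    exact b.lt_of_le (by omega)

theorem calc_mult {w N d A q Q ab B : ℕ} {I : Inst} {c : I.Cover} {st : State}
    (b : Bounds w I ab N) (h : MainMem I c ab B st) (hd : 20 ≤ d) (hA : 4 ≤ A) (hq : q < d)
    (hQ : st.reg q = Q) (hQN : Q ≤ N) :
    Calc w d A (multProg d q) st ((I.n + 1) * 24) (I.mult Q) := by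
  refine Calc.mono (T := (I.n + 1) * 20 + 4) ?_ (by omega)
  refine (calc_cnt b h.toGraphMem (by omega) (by omega) hq hQ hQN).seq fun s' hag hr => ?_
  have h' := h.agree hd hA hag
  have := I.cntN_le Q
  have := b.n_le
  have := I.numFairlets_le
  exact Calc.set (fits_div (b.lt_of_le (by rw [hr]; omega)) (b.lt_of_le (by rw [h'.r7]; omega)))
    (by simp only [Expr.eval, Op.eval, hr, h'.r7, Inst.mult])

/-- The number of cover vertices of the color in register `q` in the cluster in register `i`. -/
def coverCountProg (d q i : ℕ) : Prog :=
  sumLoop d 6 (.set (d + 2) (.bin .mul (.bin .eq (.get 4 (.reg (d + 1))) (.reg i))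
    (.bin .eq (.get 1 (.get 3 (.reg (d + 1)))) (.reg q))))

section
variable {w N ab B : ℕ} {I : Inst} {c : I.Cover} {a : ℕ → ℕ} {st : State}

theorem calc_coverCount {d A q i Q J : ℕ} (b : Bounds w I ab N) (h : MainMem I c ab B st)
    (hd : 20 ≤ d) (hA : 5 ≤ A) (hq : q < d) (hi : i < d)
    (hQ : st.reg q = Q) (hQN : Q ≤ N) (hJ : st.reg i = J) (hJN : J ≤ N)
    (ha : ∀ j ≤ 2 * c.s, st.arr 4 j = a j) (haN : ∀ j, a j < 2 * c.s + 2) :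
    Calc w d A (coverCountProg d q i) st ((c.s + 1) * 30) (c.coverCount a Q J) := by
  have hn := b.n_le
  have hs := c.s_le
  have hN2 := b.two_le
  refine Calc.sumLoop (Tb := 11) (by omega) h.r6 (b.lt_of_le (by omega)) b.one_le ?_ ?_
    (Nat.mul_le_mul_left _ (by omega))
  · intro j hj s' hag hr
    have h' := h.agree hd (by omega) hag
    have hq' : s'.reg q = Q := by rw [hag.reg q hq, hQ]
    have hi' : s'.reg i = J := by rw [hag.reg i hi, hJ]
    have ha' : s'.arr 4 j = a j := by rw [hag.arr 4 (by omega), ha j (by omega)]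
    have hcvlt := c.lt j hj
    have := haN j
    have hjw : j < 2 ^ w := b.lt_of_le (by omega)
    refine Calc.mono (Calc.set (fits_mul_of_le_one (fits_eq ⟨?_, ?_⟩ ?_ b.one_lt)
      (fits_eq ⟨⟨?_, ?_⟩, ?_⟩ ?_ b.one_lt) (Or.inl (eval_eq_le_one _ _ _))) ?_)
      (by simp [Expr.cost])
    · rw [Expr.Fits, hr]; exact hjw
    · simp only [Expr.eval, hr, ha']
      exact b.lt_of_le_pow (k := 2) (by nlinarith) (by omega)
    · exact b.lt_of_le (by rw [hi']; omega)
    · rw [Expr.Fits, hr]; exact hjw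
    · simp only [Expr.eval, hr, h'.cv j hj]
      exact b.lt_of_le (by omega)
    · simp only [Expr.eval, hr, h'.cv j hj, h'.col _ hcvlt]
      have := I.colN_lt hcvlt
      have := b.κ_le
      exact b.lt_of_le (by omega)
    · exact b.lt_of_le (by rw [hq']; omega)
    · simp only [Expr.eval, Op.eval, hr, hq', hi', ha', h'.cv j hj, h'.col _ hcvlt]
  · have := c.coverCount_le a Q J
    unfold Inst.Cover.coverCount at this
    exact b.lt_of_le (by omega)

/-- The number of neighbors of the vertex in register `v` in the cover part of the cluster in
register `i`. -/
def weightProg (d v i : ℕ) : Prog :=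
  sumLoop d 6 (.set (d + 2) (.bin .mul (adjExpr (.reg v) (.get 3 (.reg (d + 1))))
    (.bin .eq (.get 4 (.reg (d + 1))) (.reg i))))

theorem calc_weight {d A v i u J : ℕ} (b : Bounds w I ab N) (h : MainMem I c ab B st)
    (hd : 20 ≤ d) (hA : 5 ≤ A) (hv : v < d) (hi : i < d)
    (hu : st.reg v = u) (hun : u < I.n) (hJ : st.reg i = J) (hJN : J ≤ N)
    (ha : ∀ j ≤ 2 * c.s, st.arr 4 j = a j) (haN : ∀ j, a j < 2 * c.s + 2) :
    Calc w d A (weightProg d v i) st ((c.s + 1) * 40) (c.weight a u J) := by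
  have hn := b.n_le
  have hs := c.s_le
  have hN2 := b.two_le
  refine Calc.sumLoop (Tb := 15) (by omega) h.r6 (b.lt_of_le (by omega)) b.one_le ?_ ?_
    (Nat.mul_le_mul_left _ (by omega))
  · intro j hj s' hag hr
    have h' := h.agree hd (by omega) hag
    have hv' : s'.reg v = u := by rw [hag.reg v hv, hu]
    have hi' : s'.reg i = J := by rw [hag.reg i hi, hJ]
    have ha' : s'.arr 4 j = a j := by rw [hag.arr 4 (by omega), ha j (by omega)]
    have hcvlt := c.lt j hj
    have := haN j
    have hjw : j < 2 ^ w := b.lt_of_le (by omega)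
    have hcv : (Expr.get 3 (.reg (d + 1))).eval s' = c.cv j := by
      simp only [Expr.eval, hr, h'.cv j hj]
    refine Calc.mono (Calc.set (fits_mul_of_le_one
      (fits_adjExpr b h'.toGraphMem (u := u) hv' hcv hun hcvlt
      ?_ ⟨?_, ?_⟩) (fits_eq ⟨?_, ?_⟩ ?_ b.one_lt)
      (Or.inr (eval_eq_le_one _ _ _))) ?_) (by simp [Expr.cost, adjExpr])
    · exact b.lt_of_le (by rw [hv']; omega)
    · rw [Expr.Fits, hr]; exact hjw
    · simp only [Expr.eval, hr, h'.cv j hj]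
      exact b.lt_of_le (by omega)
    · rw [Expr.Fits, hr]; exact hjw
    · simp only [Expr.eval, hr, ha']
      exact b.lt_of_le_pow (k := 2) (by nlinarith) (by omega)
    · exact b.lt_of_le (by rw [hi']; omega)
    · have := eval_adjExpr h'.toGraphMem (e₁ := .reg v) (u := u) hv' hcv hun hcvlt
      rw [Expr.eval, this]
      simp only [Expr.eval, Op.eval, hr, hi', ha']
  · have := c.weight_le a u J
    unfold Inst.Cover.weight at this
    exact b.lt_of_le (by omega)

end

end FairCC

/-! ### Programs for the two parts of the dual objective -/

namespace FairCC
open WordRAM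

theorem two_mul_le_pow {N x p : ℕ} (hN : 2 ≤ N) (hx : x ≤ N ^ p) : 2 * x ≤ N ^ (p + 1) := by
  rw [pow_succ, mul_comm]; exact Nat.mul_le_mul hx hN

theorem le_pow_of_le {N x p q : ℕ} (hN : 2 ≤ N) (hx : x ≤ N ^ p) (h : p ≤ q) : x ≤ N ^ q :=
  hx.trans (Nat.pow_le_pow_right (by omega) h)

section
variable {w N ab B : ℕ} {I : Inst} {c : I.Cover} {a r : ℕ → ℕ} {st : State}

theorem rest_le (b : Bounds w I ab N) : c.rest a ≤ N := by
  have := b.n_le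
  have := I.numFairlets_le
  exact (Nat.sub_le _ _).trans (by omega)

theorem copies_le (b : Bounds w I ab N) (haN : ∀ j, a j < 2 * c.s + 2) (i : ℕ) :
    c.copies a i ≤ N ^ 3 := by
  have hs := c.s_le
  have hn := b.n_le
  have := haN (c.s + i)
  have h1 : c.rest a ≤ N := rest_le b
  refine add_le_pow b.two_le (p := 2) ?_ ?_
  · nlinarith [b.two_le]
  · split_ifs <;> nlinarith [b.two_le]

/-- The sum of the maxima in the dual objective. -/
def dualSumProg : Prog :=
  sumLoop 32 2 <| .seq (maxLoop 34 13 <|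
      .seq (weightProg 36 33 35) (.set 36 (.bin .add (.reg 36) (.get 5 (.reg 35))))) <|
    .set 34 (.bin .mul (.bin .mul (.bin .eq (.get 2 (.reg 33)) (.lit 0))
      (.bin .eq (.get 1 (.reg 33)) (.reg 28))) (.reg 34))

/-- All `n` vertices are visited; those in the cover or of another color are multiplied by zero.
Since this happens for every color, and there are at most `n` colors, the running time becomes
quadratic in `n`. -/
theorem calc_dualSum {Q : ℕ} (b : Bounds w I ab N) (h : MainMem I c ab B st)
    (hQ : st.reg 28 = Q) (hQN : Q ≤ N)
    (ha : ∀ j ≤ 2 * c.s, st.arr 4 j = a j) (haN : ∀ j, a j < 2 * c.s + 2)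
    (hr : ∀ j ≤ c.s + 1, st.arr 5 j = r j) (hrN : ∀ j, r j < c.s + 2) :
    Calc w 32 6 dualSumProg st ((I.n + 1) * ((c.s + 1) * (c.s + 1) * 150))
      (∑ v ∈ Finset.range I.n, (if c.mark v = 0 then 1 else 0) *
        (if I.colN v = Q then 1 else 0) *
        ((Finset.range (c.s + 1)).sup fun i => c.weight a v i + r i)) := by
  have hn := b.n_le
  have hs := c.s_le
  have hN2 := b.two_le
  have hsup : ∀ v, ((Finset.range (c.s + 1)).sup fun i => c.weight a v i + r i) ≤ N ^ 2 := by
    intro v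
    refine Finset.sup_le fun i _ => ?_
    have := c.weight_le a v i
    have := hrN i
    nlinarith
  refine Calc.sumLoop (Tb := (c.s + 2) * ((c.s + 1) * 40 + 5 + 14) + 13) (by omega) h.r2
    (b.lt_of_le (by omega)) b.one_le ?_ ?_ (Nat.mul_le_mul_left _ (by nlinarith))
  · intro v hv s' hag hr33
    have h' := h.agree (by omega) (by omega) hag
    refine Calc.seq (x := (Finset.range (c.s + 1)).sup fun i => c.weight a v i + r i) ?_ ?_
    · refine Calc.maxLoop (Tb := (c.s + 1) * 40 + 5) (by omega) h'.r13 (b.lt_of_le (by omega))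
        b.one_le ?_ ?_ le_rfl
      · intro i hi s₂ hag₂ hr35
        have h₂ := h'.agree (by omega) (by omega) hag₂
        have hr33' : s₂.reg 33 = v := by rw [hag₂.reg 33 (by omega), hr33]
        refine (calc_weight (a := a) (v := 33) (i := 35) b h₂ (by omega) (by omega) (by omega)
          (by omega) hr33' hv hr35 (by omega) ?_ haN).seq ?_
        · intro j hj
          rw [hag₂.arr 4 (by omega), hag.arr 4 (by omega), ha j hj]
        · intro s₃ hag₃ hr36
          have h35 : s₃.reg 35 = i := by rw [hag₃.reg 35 (by omega), hr35]
          have h5 : s₃.arr 5 i = r i := by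
            rw [hag₃.arr 5 (by omega), hag₂.arr 5 (by omega), hag.arr 5 (by omega),
              hr i (by omega)]
          have e1 := c.weight_le a v i
          have e2 := hrN i
          refine Calc.mono (Calc.set ⟨?_, ⟨?_, ?_⟩, ?_⟩ ?_) (by simp [Expr.cost])
          · exact b.lt_of_le (by rw [hr36]; omega)
          · exact b.lt_of_le (by rw [h35]; omega)
          · simp only [Expr.eval, h35, h5]
            exact b.lt_of_le (by omega)
          · simp only [Expr.eval, Op.eval, h35, h5, hr36]
            exact b.lt_of_le_pow (k := 2) (by nlinarith) (by omega)
          · simp only [Expr.eval, Op.eval, h35, h5, hr36]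
      · intro i hi
        exact b.lt_of_le_pow ((Finset.le_sup (f := fun i => c.weight a v i + r i)
          (Finset.mem_range.2 hi)).trans (hsup v)) (by omega)
    · intro s₂ hag₂ hr34
      have h₂ := h'.agree (by omega) (by omega) hag₂
      have h33 : s₂.reg 33 = v := by rw [hag₂.reg 33 (by omega), hr33]
      have h28 : s₂.reg 28 = Q := by rw [hag₂.reg 28 (by omega), hag.reg 28 (by omega), hQ]
      have hmark := h₂.mark v hv
      have hcol := h₂.col v hv
      have hc := I.colN_lt hv
      have hκ := b.κ_le
      refine Calc.mono (Calc.set (fits_mul_of_le_one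
        (fits_mul_of_le_one (fits_eq ⟨?_, ?_⟩ ?_ b.one_lt)
        (fits_eq ⟨?_, ?_⟩ ?_ b.one_lt) (Or.inl (eval_eq_le_one _ _ _))) ?_ (Or.inl ?_)) ?_)
        (by simp [Expr.cost])
      · exact b.lt_of_le (by rw [h33]; omega)
      · simp only [Expr.eval, h33, hmark]
        have := c.mark_le v hv
        exact b.lt_of_le (by omega)
      · exact b.lt_of_le (by omega)
      · exact b.lt_of_le (by rw [h33]; omega)
      · simp only [Expr.eval, h33, hcol]
        exact b.lt_of_le (by omega)
      · exact b.lt_of_le (by rw [h28]; omega)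
      · exact b.lt_of_le_pow (by rw [hr34]; exact hsup v) (by omega)
      · exact (Nat.mul_le_mul (eval_eq_le_one _ _ _) (eval_eq_le_one _ _ _)).trans (by simp)
      · simp only [Expr.eval, Op.eval, h33, hmark, hcol, h28, hr34]
  · refine b.lt_of_le_pow (k := 3) (sum_le_pow (p := 2) (by omega) fun v _ => ?_) (by omega)
    refine le_trans ?_ (hsup v)
    split_ifs <;> simp

/-- The part of the dual objective that depends on the capacities. -/
def dualCapProg : Prog :=
  sumLoop 33 13 <| .seq (coverCountProg 35 28 34) <|
    .set 35 (.bin .mul (.get 5 (.reg 34)) (.bin .sub (.bin .mul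
      (.bin .add (.get 4 (.bin .add (.reg 6) (.reg 34)))
        (.bin .mul (.bin .eq (.reg 34) (.reg 6)) (.reg 23))) (.reg 29)) (.reg 35)))

/-- The remaining fairlets are added for `i = s` by means of a truth value. In that iteration cell
`2 * s`, the sentinel of the guess, is read; therefore `ha` includes this index. -/
theorem calc_dualCap {Q : ℕ} (b : Bounds w I ab N) (h : MainMem I c ab B st)
    (hQ : st.reg 28 = Q) (hQN : Q ≤ N) (h23 : st.reg 23 = c.rest a)
    (h29 : st.reg 29 = I.mult Q)
    (ha : ∀ j ≤ 2 * c.s, st.arr 4 j = a j) (haN : ∀ j, a j < 2 * c.s + 2)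
    (hr : ∀ j ≤ c.s + 1, st.arr 5 j = r j) (hrN : ∀ j, r j < c.s + 2) :
    Calc w 33 6 dualCapProg st ((c.s + 1) * (c.s + 1) * 130)
      (∑ i ∈ Finset.range (c.s + 1), r i * c.cap a Q i) := by
  have hn := b.n_le
  have hs := c.s_le
  have hN2 := b.two_le
  have hm := b.mult_le Q
  have hcap : ∀ i, c.cap a Q i ≤ N ^ 4 := fun i =>
    (Nat.sub_le _ _).trans (mul_le_pow (p := 3) (q := 1) (copies_le b haN i)
      (by simpa using by omega))
  have hrc : ∀ i, r i * c.cap a Q i ≤ N ^ 5 := fun i =>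
    mul_le_pow (p := 1) (q := 4) (by have := hrN i; simpa using by omega) (hcap i)
  refine Calc.sumLoop (Tb := (c.s + 1) * 30 + 18) (by omega) h.r13
    (b.lt_of_le (by omega)) b.one_le ?_ ?_ (by nlinarith)
  · intro i hi s' hag hr34
    have h' := h.agree (by omega) (by omega) hag
    refine (calc_coverCount (a := a) (q := 28) (i := 34) (Q := Q) (J := i) b h' (by omega)
      (by omega) (by omega) (by omega) (by rw [hag.reg 28 (by omega), hQ]) hQN hr34 (by omega)
      ?_ haN).seq ?_
    · intro j hj
      rw [hag.arr 4 (by omega), ha j hj]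
    · intro s₂ hag₂ hr35
      have h₂ := h'.agree (by omega) (by omega) hag₂
      have e34 : s₂.reg 34 = i := by rw [hag₂.reg 34 (by omega), hr34]
      have e23 : s₂.reg 23 = c.rest a := by
        rw [hag₂.reg 23 (by omega), hag.reg 23 (by omega), h23]
      have e29 : s₂.reg 29 = I.mult Q := by
        rw [hag₂.reg 29 (by omega), hag.reg 29 (by omega), h29]
      have e4 : s₂.arr 4 (c.s + i) = a (c.s + i) := by
        rw [hag₂.arr 4 (by omega), hag.arr 4 (by omega), ha _ (by omega)]
      have e5 : s₂.arr 5 i = r i := by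
        rw [hag₂.arr 5 (by omega), hag.arr 5 (by omega), hr _ (by omega)]
      have e6 := h₂.r6
      have hcop' : a (c.s + i) + (if i = c.s then 1 else 0) * c.rest a = c.copies a i := by
        simp only [Inst.Cover.copies]
        split_ifs <;> simp
      have hcop : (Expr.bin .add (.get 4 (.bin .add (.reg 6) (.reg 34)))
          (.bin .mul (.bin .eq (.reg 34) (.reg 6)) (.reg 23))).eval s₂ = c.copies a i := by
        simp only [Expr.eval, Op.eval, e34, e6, e4, e23, hcop']
      have haN' := haN (c.s + i)
      have hrest := rest_le (c := c) (a := a) b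
      have hrN' := hrN i
      have hcc := c.coverCount_le a Q i
      refine Calc.mono (Calc.set ⟨⟨?_, ?_⟩, fits_sub ⟨⟨⟨⟨?_, ?_, ?_⟩, ?_⟩, fits_mul_of_le_one
        (fits_eq ?_ ?_ b.one_lt) ?_ (Or.inl (eval_eq_le_one _ _ _)), ?_⟩, ?_, ?_⟩ ?_, ?_⟩ ?_)
        (by simp [Expr.cost])
      · exact b.lt_of_le (by rw [e34]; omega)
      · simp only [Expr.eval, e34, e5]
        exact b.lt_of_le (by omega)
      · exact b.lt_of_le (by rw [e6]; omega)
      · exact b.lt_of_le (by rw [e34]; omega)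
      · simp only [Expr.eval, Op.eval, e34, e6]
        exact b.lt_of_le_pow (k := 2) (by nlinarith) (by omega)
      · simp only [Expr.eval, Op.eval, e34, e6, e4]
        exact b.lt_of_le_pow (k := 2) (by nlinarith) (by omega)
      · exact b.lt_of_le (by rw [e34]; omega)
      · exact b.lt_of_le (by rw [e6]; omega)
      · exact b.lt_of_le (by rw [e23]; omega)
      · have := copies_le b haN i
        rw [← hcop] at this
        exact b.lt_of_le_pow this (by omega)
      · exact b.lt_of_le (by rw [e29]; omega)
      · rw [hcop]
        simp only [Expr.eval, Op.eval, e29]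
        exact b.lt_of_le_pow (mul_le_pow (q := 1) (copies_le b haN i) (by simpa using by omega))
          (by omega)
      · exact b.lt_of_le (by rw [hr35]; omega)
      · simp only [Expr.eval, Op.eval, e29, hr35, e34, e5, e6, e4, e23, hcop']
        exact b.lt_of_le_pow (hrc i) (by omega)
      · simp only [Expr.eval, Op.eval, e29, hr35, e34, e5, e6, e4, e23, hcop', Inst.Cover.cap]
  · exact b.lt_of_le_pow (sum_le_pow (p := 5) (by omega) fun i _ => hrc i) (by omega)

end

end FairCC

/-! ### Programs for the optimal weight, the constraints and the inner edges -/

namespace FairCC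
open WordRAM

section
variable {w N ab B : ℕ} {I : Inst} {c : I.Cover} {a : ℕ → ℕ} {st : State}

theorem dual_le (b : Bounds w I ab N) (q : ℕ) {r : ℕ → ℕ} (hrN : ∀ j, r j < c.s + 2) :
    c.dual a q r ≤ N ^ 3 := by
  have hn := b.n_le
  have hs := c.s_le
  refine (Nat.sub_le _ _).trans (sum_le_pow (p := 2) (by omega) fun v _ => ?_)
  have hsup : ((Finset.range (c.s + 1)).sup fun i => c.weight a v i + r i) ≤ N ^ 2 := by
    refine Finset.sup_le fun i _ => ?_
    have := c.weight_le a v i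
    have := hrN i
    nlinarith [b.two_le]
  refine le_trans ?_ hsup
  split_ifs <;> simp

/-- The maximum total weight for the color in register 28. -/
def bestProg : Prog :=
  minOdometer 30 5 13 14 15 <|
    .seq dualSumProg <| .seq dualCapProg <| .set 32 (.bin .sub (.reg 32) (.reg 33))

/-- The potentials are the vectors of `s + 1` digits in base `s + 2`, kept in array `5` above the
guess in array `4`. One potential is evaluated in time `O(n s²)`. -/
theorem calc_best {Q : ℕ} (b : Bounds w I ab N) (h : MainMem I c ab B st)
    (hQ : st.reg 28 = Q) (hQN : Q ≤ N) (h23 : st.reg 23 = c.rest a)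
    (h29 : st.reg 29 = I.mult Q)
    (ha : ∀ j ≤ 2 * c.s, st.arr 4 j = a j) (haN : ∀ j, a j < 2 * c.s + 2) :
    Calc w 30 5 bestProg st
      ((c.s + 2) ^ (c.s + 1) * ((c.s + 1) * ((I.n + 1) * ((c.s + 1) * (c.s + 1)) * 1264)))
      (c.best a Q) := by
  have hn := b.n_le
  have hs := c.s_le
  have hN2 := b.two_le
  refine Calc.minOdometer
    (Tb := (I.n + 1) * ((c.s + 1) * (c.s + 1) * 150) + ((c.s + 1) * (c.s + 1) * 130 + 4))
    (by omega) (by omega) h.r13 h.r14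
    (by omega) (b.lt_of_le (by omega)) (b.lt_of_le_pow (k := 2) (by nlinarith) (by omega)) h.r15
    (b.lt_of_le_pow (k := 2) (by nlinarith) (by omega)) ?_ ?_ ?_
  · intro i hi s' hag hdig
    have h' := h.agree (by omega) (by omega) hag
    have hdigN : ∀ j, i / (c.s + 2) ^ j % (c.s + 2) < c.s + 2 := fun j =>
      Nat.mod_lt _ (by omega)
    refine Calc.seq (calc_dualSum (a := a) b h' (by rw [hag.reg 28 (by omega), hQ]) hQN
      (fun j hj => by rw [hag.arr 4 (by omega), ha j hj]) haN hdig hdigN) fun s₂ hag₂ hr₂ => ?_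
    have h₂ := h'.agree (by omega) (by omega) hag₂
    refine Calc.andThen (by omega) (calc_dualCap (a := a) (Q := Q) b
      (h'.agree (d := 32) (A := 6) (by omega) (by omega) hag₂)
      (by rw [hag₂.reg 28 (by omega), hag.reg 28 (by omega), hQ]) hQN
      (by rw [hag₂.reg 23 (by omega), hag.reg 23 (by omega), h23])
      (by rw [hag₂.reg 29 (by omega), hag.reg 29 (by omega), h29])
      (fun j hj => by rw [hag₂.arr 4 (by omega), hag.arr 4 (by omega), ha j hj]) haN
      (fun j hj => by rw [hag₂.arr 5 (by omega), hdig j hj]) hdigN) fun s₃ hag₃ hr₃ => ?_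
    have e32 : s₃.reg 32 = _ := (hag₃.reg 32 (by omega)).trans hr₂
    refine Calc.mono (Calc.set (fits_sub ?_ ?_) ?_) (by simp [Expr.cost])
    · rw [Expr.Fits, e32]
      refine b.lt_of_le_pow (k := 3) (sum_le_pow (p := 2) (by omega) fun v _ => ?_) (by omega)
      have hsup : ((Finset.range (c.s + 1)).sup fun i_1 => c.weight a v i_1 +
          i / (c.s + 2) ^ i_1 % (c.s + 2)) ≤ N ^ 2 := by
        refine Finset.sup_le fun j _ => ?_
        have := c.weight_le a v j
        have := hdigN j
        nlinarith
      refine le_trans ?_ hsup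
      split_ifs <;> simp
    · rw [Expr.Fits, hr₃]
      refine b.lt_of_le_pow (sum_le_pow (p := 5) (by omega) fun i _ => ?_) (by omega)
      refine mul_le_pow (p := 1) (q := 4) (by have := hdigN i; simpa using by omega) ?_
      exact (Nat.sub_le _ _).trans (mul_le_pow (p := 3) (q := 1) (copies_le b haN i)
        (by have := b.mult_le Q; simpa using by omega))
    · simp only [Expr.eval, Op.eval, e32, hr₃, Inst.Cover.dual]
  · intro i _
    exact b.lt_of_le_pow (dual_le b Q fun j => Nat.mod_lt _ (by omega)) (by omega)
  -- The constant is `1264 = 2 * 2 * 316` with `316 = 150 + 130 + 4 + 32`; the factors `2` come from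
  -- `X + 1 ≤ 2 * X` and `s + 2 ≤ 2 * (s + 1)`.
  · have hX : 1 ≤ (c.s + 2) ^ (c.s + 1) := Nat.one_le_pow _ _ (by omega)
    set X := (c.s + 2) ^ (c.s + 1)
    have hU : 1 ≤ (c.s + 1) * (c.s + 1) := Nat.mul_pos (by omega) (by omega)
    set U := (c.s + 1) * (c.s + 1)
    have hV : U ≤ (I.n + 1) * U := Nat.le_mul_of_pos_left _ (by omega)
    have e : (I.n + 1) * (U * 150) = (I.n + 1) * U * 150 := by ring
    rw [e]
    set V := (I.n + 1) * U
    calc (X + 1) * ((c.s + 1 + 1) * (V * 150 + (U * 130 + 4) + 32))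
        ≤ (2 * X) * ((2 * (c.s + 1)) * (V * 316)) :=
          Nat.mul_le_mul (by omega) (Nat.mul_le_mul (by omega) (by omega))
      _ = _ := by ring

theorem best_le (b : Bounds w I ab N) (q : ℕ) : c.best a q ≤ N ^ 2 := by
  have := b.n_le
  exact (foldl_min_le_init _).trans (by nlinarith)

theorem gain_le (b : Bounds w I ab N) : c.gain a ≤ N ^ 3 :=
  sum_le_pow (p := 2) (by have := b.κ_le; omega) fun q _ => best_le b q

/-- The maximum total weight. -/
def gainProg : Prog :=
  sumLoop 27 3 <| .seq (multProg 29 28) <| .seq bestProg <| .set 29 (.reg 30)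

theorem calc_gain (b : Bounds w I ab N) (h : MainMem I c ab B st)
    (h23 : st.reg 23 = c.rest a)
    (ha : ∀ j ≤ 2 * c.s, st.arr 4 j = a j) (haN : ∀ j, a j < 2 * c.s + 2) :
    Calc w 27 5 gainProg st ((I.n + 1) * ((c.s + 2) ^ (c.s + 1) *
      ((c.s + 1) * ((I.n + 1) * ((c.s + 1) * (c.s + 1)) * 1302)))) (c.gain a) := by
  have hκ := b.κ_le
  have hκn := I.κ_le
  refine Calc.sumLoop (Tb := (I.n + 1) * 24 + (((c.s + 2) ^ (c.s + 1) *
      ((c.s + 1) * ((I.n + 1) * ((c.s + 1) * (c.s + 1)) * 1264))) + 2)) (by omega) h.r3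
    (b.lt_of_le (by omega)) b.one_le ?_ ?_ ?_
  · intro q hq s' hag hr
    have h' := h.agree (by omega) (by omega) hag
    refine Calc.seq (calc_mult b h' (by omega) (by omega) (by omega) hr (by omega))
      fun s₂ hag₂ hr₂ => ?_
    have h₂ := h'.agree (by omega) (by omega) hag₂
    refine Calc.andThen (by omega) (calc_best (a := a) (Q := q) b h₂
      (by rw [hag₂.reg 28 (by omega), hr]) (by omega)
      (by rw [hag₂.reg 23 (by omega), hag.reg 23 (by omega), h23]) hr₂
      (fun j hj => by rw [hag₂.arr 4 (by omega), hag.arr 4 (by omega), ha j hj]) haN)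
      fun s₃ hag₃ hr₃ => ?_
    refine Calc.mono (Calc.set ?_ ?_) (by simp [Expr.cost])
    · exact b.lt_of_le_pow (by rw [hr₃]; exact best_le b q) (by omega)
    · simp only [Expr.eval, hr₃]
  · exact b.lt_of_le_pow (gain_le b) (by omega)
  -- The constant is `1302 = 1264 + 24 + 2 + 12`: the minimum, the multiplicity, the copy and the
  -- overhead of the loop.
  · refine Nat.mul_le_mul (by omega) ?_
    have hX : 1 ≤ (c.s + 2) ^ (c.s + 1) := Nat.one_le_pow _ _ (by omega)
    have hU : 1 ≤ (c.s + 1) * (c.s + 1) := Nat.mul_pos (by omega) (by omega)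
    have hZ : (I.n + 1) ≤ (c.s + 2) ^ (c.s + 1) * ((c.s + 1) * ((I.n + 1) *
        ((c.s + 1) * (c.s + 1)))) := by
      calc I.n + 1 = 1 * (1 * ((I.n + 1) * 1)) := by ring
        _ ≤ _ := Nat.mul_le_mul hX (Nat.mul_le_mul (by omega) (Nat.mul_le_mul_left _ hU))
    have e : ∀ k, (c.s + 2) ^ (c.s + 1) * ((c.s + 1) * ((I.n + 1) *
        ((c.s + 1) * (c.s + 1)) * k)) = (c.s + 2) ^ (c.s + 1) * ((c.s + 1) * ((I.n + 1) *
        ((c.s + 1) * (c.s + 1)))) * k := fun k => by ring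
    rw [e, e]
    omega

/-- The number of guessed labels that are out of range. -/
def labelProg : Prog :=
  sumLoop 24 6 (.set 26 (.bin .lt (.reg 6) (.bin .add (.get 4 (.reg 25)) (.lit 1))))

/-- The number of pairs of a color and a cluster with too many cover vertices. -/
def capacityProg : Prog :=
  sumLoop 25 3 <| .seq (multProg 27 26) <| .seq
    (sumLoop 28 6 <| .seq (coverCountProg 30 26 29) <|
      .set 30 (.bin .lt (.bin .mul (.get 4 (.bin .add (.reg 6) (.reg 29))) (.reg 27)) (.reg 30)))
    (.set 27 (.reg 28))

theorem sum_le_of_le_one {n : ℕ} {f : ℕ → ℕ} (hf : ∀ i, f i ≤ 1) :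
    ∑ i ∈ Finset.range n, f i ≤ n := by
  calc _ ≤ ∑ i ∈ Finset.range n, 1 := Finset.sum_le_sum fun i _ => hf i
    _ = _ := by simp

theorem calc_label (b : Bounds w I ab N) (h : MainMem I c ab B st)
    (ha : ∀ j ≤ 2 * c.s, st.arr 4 j = a j) (haN : ∀ j, a j < 2 * c.s + 2) :
    Calc w 24 5 labelProg st ((c.s + 1) * 20)
      (∑ j ∈ Finset.range c.s, if c.s < a j + 1 then 1 else 0) := by
  have hn := b.n_le
  have hs := c.s_le
  have hN2 := b.two_le
  refine Calc.sumLoop (Tb := 7) (by omega) h.r6 (b.lt_of_le (by omega)) b.one_le ?_ ?_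
    (Nat.mul_le_mul_left _ (by omega))
  · intro j hj s' hag hr
    have h' := h.agree (by omega) (by omega) hag
    have ha' : s'.arr 4 j = a j := by rw [hag.arr 4 (by omega), ha j (by omega)]
    have := haN j
    refine Calc.mono (Calc.set (fits_lt ?_ ⟨⟨?_, ?_⟩, ?_, ?_⟩ b.one_lt) ?_) (by simp [Expr.cost])
    · exact b.lt_of_le (by rw [h'.r6]; omega)
    · exact b.lt_of_le (by rw [hr]; omega)
    · simp only [Expr.eval, hr, ha']
      exact b.lt_of_le_pow (k := 2) (by nlinarith) (by omega)
    · exact b.one_lt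
    · simp only [Expr.eval, Op.eval, hr, ha']
      exact b.lt_of_le_pow (k := 2) (by nlinarith) (by omega)
    · simp only [Expr.eval, Op.eval, hr, ha', h'.r6]
  · have := sum_le_of_le_one (n := c.s) (f := fun j => if c.s < a j + 1 then 1 else 0)
      fun j => by split_ifs <;> omega
    exact b.lt_of_le (by omega)

theorem calc_capacity (b : Bounds w I ab N) (h : MainMem I c ab B st)
    (ha : ∀ j ≤ 2 * c.s, st.arr 4 j = a j) (haN : ∀ j, a j < 2 * c.s + 2) :
    Calc w 25 5 capacityProg st ((I.n + 1) * ((I.n + 1) * ((c.s + 1) * (c.s + 1)) * 100))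
      (∑ q ∈ Finset.range I.κ, ∑ i ∈ Finset.range c.s,
        if a (c.s + i) * I.mult q < c.coverCount a q i then 1 else 0) := by
  have hn := b.n_le
  have hs := c.s_le
  have hN2 := b.two_le
  have hκ := b.κ_le
  have hκn := I.κ_le
  have hin : ∀ q, ∑ i ∈ Finset.range c.s,
      (if a (c.s + i) * I.mult q < c.coverCount a q i then 1 else 0) ≤ c.s := fun q =>
    sum_le_of_le_one fun j => by split_ifs <;> omega
  refine Calc.sumLoop (Tb := (I.n + 1) * 24 + ((c.s + 1) * ((c.s + 1) * 30 + 10 + 12) + 2))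
    (by omega) h.r3 (b.lt_of_le (by omega)) b.one_le ?_ ?_ ?_
  · intro q hq s' hag hr
    have h' := h.agree (by omega) (by omega) hag
    have hm := b.mult_le q
    refine Calc.seq (calc_mult b h' (by omega) (by omega) (by omega) hr (by omega))
      fun s₂ hag₂ hr₂ => ?_
    have h₂ := h'.agree (by omega) (by omega) hag₂
    refine Calc.andThen (d' := 28) (by omega) (Calc.sumLoop (Tb := (c.s + 1) * 30 + 10)
      (f := fun i => if a (c.s + i) * I.mult q < c.coverCount a q i then 1 else 0)
      (by omega) h₂.r6
      (b.lt_of_le (by omega)) b.one_le ?_ (b.lt_of_le (by have := hin q; omega)) le_rfl)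
      fun s₃ hag₃ hr₃ => ?_
    · intro i hi s₃ hag₃ hr₃
      have h₃ := h₂.agree (by omega) (by omega) hag₃
      have ha₃ : ∀ j ≤ 2 * c.s, s₃.arr 4 j = a j := fun j hj => by
        rw [hag₃.arr 4 (by omega), hag₂.arr 4 (by omega), hag.arr 4 (by omega), ha j hj]
      refine Calc.seq (calc_coverCount (a := a) (q := 26) (i := 29) (Q := q) (J := i) b h₃
        (by omega) (by omega) (by omega) (by omega)
        (by rw [hag₃.reg 26 (by omega), hag₂.reg 26 (by omega), hr]) (by omega) hr₃ (by omega)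
        ha₃ haN) fun s₄ hag₄ hr₄ => ?_
      have h₄ := h₃.agree (by omega) (by omega) hag₄
      have e29 : s₄.reg 29 = i := by rw [hag₄.reg 29 (by omega), hr₃]
      have e27 : s₄.reg 27 = I.mult q := by
        rw [hag₄.reg 27 (by omega), hag₃.reg 27 (by omega), hr₂]
      have e4 : s₄.arr 4 (c.s + i) = a (c.s + i) := by
        rw [hag₄.arr 4 (by omega), ha₃ _ (by omega)]
      have := haN (c.s + i)
      have hcc := c.coverCount_le a q i
      refine Calc.mono (Calc.set (fits_lt ⟨⟨⟨?_, ?_, ?_⟩, ?_⟩, ?_, ?_⟩ ?_ b.one_lt) ?_)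
        (by simp [Expr.cost])
      · exact b.lt_of_le (by rw [h₄.r6]; omega)
      · exact b.lt_of_le (by rw [e29]; omega)
      · simp only [Expr.eval, Op.eval, h₄.r6, e29]
        exact b.lt_of_le_pow (k := 2) (by nlinarith) (by omega)
      · simp only [Expr.eval, Op.eval, h₄.r6, e29, e4]
        exact b.lt_of_le_pow (k := 2) (by nlinarith) (by omega)
      · exact b.lt_of_le (by rw [e27]; omega)
      · simp only [Expr.eval, Op.eval, h₄.r6, e29, e4, e27]
        exact b.lt_of_le_pow (mul_le_pow (p := 2) (q := 1) (by nlinarith)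
          (by simpa using by omega)) (by omega)
      · exact b.lt_of_le (by rw [hr₄]; omega)
      · simp only [Expr.eval, Op.eval, h₄.r6, e29, e4, e27, hr₄]
    · refine Calc.mono (Calc.set ?_ ?_) (by simp [Expr.cost])
      · exact b.lt_of_le (by rw [hr₃]; have := hin q; omega)
      · simp only [Expr.eval, hr₃]
  · refine b.lt_of_le_pow (sum_le_pow (p := 1) (by omega) fun q _ => ?_) (by omega)
    have := hin q
    rw [pow_one]
    omega
  · refine Nat.mul_le_mul (by omega) ?_
    have hU : c.s + 1 ≤ (c.s + 1) * (c.s + 1) := Nat.le_mul_of_pos_left _ (by omega)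
    have hV : (c.s + 1) * (c.s + 1) ≤ (I.n + 1) * ((c.s + 1) * (c.s + 1)) :=
      Nat.le_mul_of_pos_left _ (by omega)
    have hV' : I.n + 1 ≤ (I.n + 1) * ((c.s + 1) * (c.s + 1)) :=
      Nat.le_mul_of_pos_right _ (Nat.mul_pos (by omega) (by omega))
    have e : (c.s + 1) * ((c.s + 1) * 30 + 10 + 12) = (c.s + 1) * (c.s + 1) * 30 +
      (c.s + 1) * 22 := by ring
    rw [e]
    omega

/-- The number of ordered adjacent pairs of cover vertices with equal labels. -/
def innerProg : Prog :=
  sumLoop 25 6 <| sumLoop 27 6 <| .set 29 (.bin .mul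
    (adjExpr (.get 3 (.reg 26)) (.get 3 (.reg 28)))
    (.bin .eq (.get 4 (.reg 26)) (.get 4 (.reg 28))))

theorem inner_row_le (j : ℕ) : ∑ j' ∈ Finset.range c.s,
    I.adjN (c.cv j) (c.cv j') * (if a j = a j' then 1 else 0) ≤ c.s :=
  sum_le_of_le_one fun j' => by
    have := I.adjN_le_one (c.cv j) (c.cv j')
    split_ifs <;> omega

theorem inner_le (b : Bounds w I ab N) : c.inner a ≤ N ^ 2 :=
  sum_le_pow (p := 1) (by have := b.n_le; have := c.s_le; omega) fun j _ =>
    (inner_row_le j).trans (by have := b.n_le; have := c.s_le; rw [pow_one]; omega)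

theorem calc_inner (b : Bounds w I ab N) (h : MainMem I c ab B st)
    (ha : ∀ j ≤ 2 * c.s, st.arr 4 j = a j) (haN : ∀ j, a j < 2 * c.s + 2) :
    Calc w 25 5 innerProg st ((c.s + 1) * (c.s + 1) * 50) (c.inner a) := by
  have hn := b.n_le
  have hs := c.s_le
  have hN2 := b.two_le
  refine Calc.sumLoop (Tb := (c.s + 1) * (17 + 12)) (by omega) h.r6 (b.lt_of_le (by omega))
    b.one_le ?_ ?_ (by nlinarith)
  · intro j hj s' hag hr
    have h' := h.agree (by omega) (by omega) hag
    refine Calc.sumLoop (Tb := 17) (by omega) h'.r6 (b.lt_of_le (by omega)) b.one_le ?_ ?_ le_rfl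
    · intro j' hj' s₂ hag₂ hr₂
      have h₂ := h'.agree (by omega) (by omega) hag₂
      have e26 : s₂.reg 26 = j := by rw [hag₂.reg 26 (by omega), hr]
      have ha₂ : ∀ j < c.s, s₂.arr 4 j = a j := fun j hj => by
        rw [hag₂.arr 4 (by omega), hag.arr 4 (by omega), ha j (by omega)]
      have hc := c.lt j hj
      have hc' := c.lt j' hj'
      have x1 : (Expr.get 3 (.reg 26)).eval s₂ = c.cv j := by
        simp only [Expr.eval, e26, h₂.cv j hj]
      have x2 : (Expr.get 3 (.reg 28)).eval s₂ = c.cv j' := by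
        simp only [Expr.eval, hr₂, h₂.cv j' hj']
      have y1 := haN j
      have y2 := haN j'
      refine Calc.mono (Calc.set (fits_mul_of_le_one (fits_adjExpr b h₂.toGraphMem x1 x2 hc hc'
        ⟨?_, ?_⟩ ⟨?_, ?_⟩) (fits_eq ⟨?_, ?_⟩ ⟨?_, ?_⟩ b.one_lt)
        (Or.inr (eval_eq_le_one _ _ _))) ?_) (by simp [Expr.cost, adjExpr])
      · exact b.lt_of_le (by rw [e26]; omega)
      · rw [← Expr.eval, x1]; exact b.lt_of_le (by omega)
      · exact b.lt_of_le (by rw [hr₂]; omega)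
      · rw [← Expr.eval, x2]; exact b.lt_of_le (by omega)
      · exact b.lt_of_le (by rw [e26]; omega)
      · simp only [Expr.eval, e26, ha₂ j hj]
        exact b.lt_of_le_pow (k := 2) (by nlinarith) (by omega)
      · exact b.lt_of_le (by rw [hr₂]; omega)
      · simp only [Expr.eval, hr₂, ha₂ j' hj']
        exact b.lt_of_le_pow (k := 2) (by nlinarith) (by omega)
      · have := eval_adjExpr h₂.toGraphMem x1 x2 hc hc'
        rw [Expr.eval, this]
        simp only [Expr.eval, Op.eval, e26, hr₂, ha₂ j hj, ha₂ j' hj']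
    · exact b.lt_of_le (by have := inner_row_le (c := c) (a := a) j; omega)
  · exact b.lt_of_le_pow (inner_le b) (by omega)

end

end FairCC

/-! ### Programs for the test of one guess and for the search over all guesses -/

namespace FairCC
open WordRAM

section
variable {w N ab B : ℕ} {I : Inst} {c : I.Cover} {a : ℕ → ℕ} {st : State}

/-- The number of fairlets in proper clusters. -/
def usedProg : Prog :=
  sumLoop 22 6 (.set 24 (.get 4 (.bin .add (.reg 6) (.reg 23))))

theorem used_le (b : Bounds w I ab N) (haN : ∀ j, a j < 2 * c.s + 2) : c.used a ≤ N ^ 3 := by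
  have hn := b.n_le
  have hs := c.s_le
  refine sum_le_pow (p := 2) (by omega) fun i _ => ?_
  have := haN (c.s + i)
  nlinarith [b.two_le]

theorem calc_used (b : Bounds w I ab N) (h : MainMem I c ab B st)
    (ha : ∀ j ≤ 2 * c.s, st.arr 4 j = a j) (haN : ∀ j, a j < 2 * c.s + 2) :
    Calc w 22 5 usedProg st ((c.s + 1) * 20) (c.used a) := by
  have hn := b.n_le
  have hs := c.s_le
  have hN2 := b.two_le
  refine Calc.sumLoop (Tb := 5) (by omega) h.r6 (b.lt_of_le (by omega)) b.one_le ?_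
    (b.lt_of_le_pow (used_le b haN) (by omega)) (Nat.mul_le_mul_left _ (by omega))
  intro j hj s' hag hr
  have h' := h.agree (by omega) (by omega) hag
  have ha' : s'.arr 4 (c.s + j) = a (c.s + j) := by rw [hag.arr 4 (by omega), ha _ (by omega)]
  have := haN (c.s + j)
  refine Calc.mono (Calc.set ⟨⟨?_, ?_, ?_⟩, ?_⟩ ?_) (by simp [Expr.cost])
  · exact b.lt_of_le (by rw [h'.r6]; omega)
  · exact b.lt_of_le (by rw [hr]; omega)
  · simp only [Expr.eval, Op.eval, hr, h'.r6]
    exact b.lt_of_le_pow (k := 2) (by nlinarith) (by omega)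
  · simp only [Expr.eval, Op.eval, hr, h'.r6, ha']
    exact b.lt_of_le_pow (k := 2) (by nlinarith) (by omega)
  · simp only [Expr.eval, Op.eval, hr, h'.r6, ha']

/-- The sum of the squares of the cluster sizes. -/
def squaresProg : Prog :=
  .seq (sumLoop 26 6 <| .set 28 (.bin .mul
      (.bin .mul (.get 4 (.bin .add (.reg 6) (.reg 27))) (.reg 8))
      (.bin .mul (.get 4 (.bin .add (.reg 6) (.reg 27))) (.reg 8))))
    (.set 26 (.bin .add (.reg 26) (.bin .mul (.bin .mul (.reg 23) (.reg 8)) (.reg 8))))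

/-- A guessed number is at most `N ^ 2` and a fairlet has at most `N` vertices, so a square is at
most `N ^ 6`; the sum over the clusters and the remainder raise the exponent to `8`. Adding `numAdj`
in the final comparison gives `N ^ 9`, which explains the exponent `10` in `Bounds`. -/
theorem squares_le (b : Bounds w I ab N) (haN : ∀ j, a j < 2 * c.s + 2) :
    c.squares a ≤ N ^ 8 := by
  have hn := b.n_le
  have hs := c.s_le
  have hf : I.n / I.numFairlets ≤ N ^ 1 := (Nat.div_le_self _ _).trans (by rw [pow_one]; omega)
  refine add_le_pow b.two_le (p := 7) (sum_le_pow (p := 6) (by omega) fun i _ => ?_) ?_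
  · have h1 : a (c.s + i) ≤ N ^ 2 := by
      have := haN (c.s + i)
      nlinarith [b.two_le]
    exact mul_le_pow (p := 3) (q := 3) (mul_le_pow h1 hf) (mul_le_pow h1 hf)
  · refine le_pow_of_le b.two_le (p := 3) ?_ (by omega)
    exact mul_le_pow (p := 2) (mul_le_pow (p := 1) (by rw [pow_one]; exact rest_le b) hf) hf

theorem calc_squares (b : Bounds w I ab N) (h : MainMem I c ab B st)
    (h23 : st.reg 23 = c.rest a)
    (ha : ∀ j ≤ 2 * c.s, st.arr 4 j = a j) (haN : ∀ j, a j < 2 * c.s + 2) :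
    Calc w 26 5 squaresProg st ((c.s + 1) * 50) (c.squares a) := by
  have hn := b.n_le
  have hs := c.s_le
  have hN2 := b.two_le
  have hf : I.n / I.numFairlets ≤ N := (Nat.div_le_self _ _).trans (by omega)
  have hf' : I.n / I.numFairlets ≤ N ^ 1 := by rwa [pow_one]
  have hsq := squares_le b haN
  have hrest := rest_le (c := c) (a := a) b
  unfold Inst.Cover.squares at hsq
  refine Calc.mono (T := (c.s + 1) * (18 + 12) + 8) ?_ (by omega)
  refine Calc.seq (Calc.sumLoop (Tb := 18) (f := fun i => (a (c.s + i) * (I.n / I.numFairlets)) *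
      (a (c.s + i) * (I.n / I.numFairlets))) (by omega) h.r6 (b.lt_of_le (by omega)) b.one_le ?_
    (b.lt_of_le_pow (k := 8) (by omega) (by omega)) le_rfl) fun s' hag hr => ?_
  · intro j hj s' hag hr
    have h' := h.agree (by omega) (by omega) hag
    have ha' : s'.arr 4 (c.s + j) = a (c.s + j) := by rw [hag.arr 4 (by omega), ha _ (by omega)]
    have h1 : a (c.s + j) ≤ N ^ 2 := by
      have := haN (c.s + j)
      nlinarith
    have h2 : a (c.s + j) * (I.n / I.numFairlets) ≤ N ^ 3 := mul_le_pow h1 hf'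
    have hfit : (Expr.bin .mul (.get 4 (.bin .add (.reg 6) (.reg 27))) (.reg 8)).Fits w s' := by
      refine ⟨⟨⟨?_, ?_, ?_⟩, ?_⟩, ?_, ?_⟩
      · exact b.lt_of_le (by rw [h'.r6]; omega)
      · exact b.lt_of_le (by rw [hr]; omega)
      · simp only [Expr.eval, Op.eval, hr, h'.r6]
        exact b.lt_of_le_pow (k := 2) (by nlinarith) (by omega)
      · simp only [Expr.eval, Op.eval, hr, h'.r6, ha']
        exact b.lt_of_le_pow h1 (by omega)
      · exact b.lt_of_le (by rw [h'.r8]; omega)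
      · simp only [Expr.eval, Op.eval, hr, h'.r6, ha', h'.r8]
        exact b.lt_of_le_pow h2 (by omega)
    refine Calc.mono (Calc.set ⟨hfit, hfit, ?_⟩ ?_) (by simp [Expr.cost])
    · simp only [Expr.eval, Op.eval, hr, h'.r6, ha', h'.r8]
      exact b.lt_of_le_pow (mul_le_pow h2 h2) (by omega)
    · simp only [Expr.eval, Op.eval, hr, h'.r6, ha', h'.r8]
  · have h' := h.agree (by omega) (by omega) hag
    have e23 : s'.reg 23 = c.rest a := by rw [hag.reg 23 (by omega), h23]
    have h1 : c.rest a * (I.n / I.numFairlets) ≤ N ^ 2 :=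
      mul_le_pow (p := 1) (q := 1) (by rwa [pow_one]) hf'
    refine Calc.mono (Calc.set ⟨?_, ⟨⟨?_, ?_, ?_⟩, ?_, ?_⟩, ?_⟩ ?_) (by simp [Expr.cost])
    · rw [Expr.Fits, hr]
      exact b.lt_of_le_pow (k := 8) (by omega) (by omega)
    · exact b.lt_of_le (by rw [e23]; omega)
    · exact b.lt_of_le (by rw [h'.r8]; omega)
    · simp only [Expr.eval, Op.eval, e23, h'.r8]
      exact b.lt_of_le_pow h1 (by omega)
    · exact b.lt_of_le (by rw [h'.r8]; omega)
    · simp only [Expr.eval, Op.eval, e23, h'.r8]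
      exact b.lt_of_le_pow (mul_le_pow h1 hf') (by omega)
    · simp only [Expr.eval, Op.eval, e23, h'.r8, hr]
      exact b.lt_of_le_pow hsq (by omega)
    · simp only [Expr.eval, Op.eval, e23, h'.r8, hr, Inst.Cover.squares]

theorem numAdj_le (b : Bounds w I ab N) : I.numAdj ≤ N ^ 2 := by
  have hn := b.n_le
  refine sum_le_pow (p := 1) (by omega) fun u _ => ?_
  rw [pow_one]
  exact (sum_le_of_le_one fun v => I.adjN_le_one u v).trans (by omega)

theorem violations_le (b : Bounds w I ab N) : c.violations a ≤ N ^ 4 := by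
  have hn := b.n_le
  have hs := c.s_le
  have hκ := b.κ_le
  refine add_le_pow b.two_le (p := 3) (add_le_pow b.two_le (p := 2) ?_ ?_) ?_
  · refine le_pow_of_le b.two_le (p := 1) ?_ (by omega)
    rw [pow_one]
    exact (sum_le_of_le_one fun j => by split_ifs <;> omega).trans (show c.s ≤ N by omega)
  · split_ifs
    · exact Nat.one_le_pow _ _ (by omega)
    · exact Nat.zero_le _
  · refine le_pow_of_le b.two_le (p := 2) ?_ (by omega)
    refine sum_le_pow (p := 1) (by omega) fun q _ => ?_
    rw [pow_one]
    exact (sum_le_of_le_one fun j => by split_ifs <;> omega).trans (show c.s ≤ N by omega)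

/-- Tests one guess. -/
def guessProg : Prog :=
  .seq usedProg <| .seq (.set 23 (.bin .sub (.reg 7) (.reg 22))) <|
  .seq labelProg <| .seq capacityProg <|
  .seq (.set 24 (.bin .add (.bin .add (.reg 24) (.bin .lt (.reg 7) (.reg 22))) (.reg 25))) <|
  .seq innerProg <| .seq squaresProg <| .seq gainProg <|
  .set 22 (.bin .mul (.bin .eq (.reg 24) (.lit 0)) (.bin .sub (.lit 1) (.bin .lt
    (.bin .add (.bin .add (.bin .mul (.lit 2) (.reg 10)) (.reg 2))
      (.bin .mul (.lit 2) (.bin .add (.reg 25) (.bin .mul (.lit 2) (.reg 27)))))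
    (.bin .add (.reg 9) (.reg 26)))))

/-- A guess that violates a constraint is evaluated to the end and then multiplied by zero. So the
bounds for time and overflow are proved for arbitrary digits, also when more fairlets are used than
exist and `rest` is truncated. -/
theorem calc_guess (b : Bounds w I ab N) (hB : B ≤ N ^ 3) (h : MainMem I c ab B st)
    (ha : ∀ j ≤ 2 * c.s, st.arr 4 j = a j) (haN : ∀ j, a j < 2 * c.s + 2) :
    Calc w 22 5 guessProg st ((I.n + 1) * ((c.s + 2) ^ (c.s + 1) *
      ((c.s + 1) * ((I.n + 1) * ((c.s + 1) * (c.s + 1))))) * 1600) (c.accept a B) := by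
  have hn := b.n_le
  have hs := c.s_le
  have hN2 := b.two_le
  have hT := I.numFairlets_le
  have hvle := violations_le (c := c) (a := a) b
  have hused := used_le b haN
  have hrest := rest_le (c := c) (a := a) b
  refine Calc.mono (T := (c.s + 1) * 20 + (4 + ((c.s + 1) * 20 +
    ((I.n + 1) * ((I.n + 1) * ((c.s + 1) * (c.s + 1)) * 100) + (8 + ((c.s + 1) * (c.s + 1) * 50 +
    ((c.s + 1) * 50 + ((I.n + 1) * ((c.s + 2) ^ (c.s + 1) *
      ((c.s + 1) * ((I.n + 1) * ((c.s + 1) * (c.s + 1)) * 1302))) + 24)))))))) ?_ ?_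
  · refine Calc.seq (calc_used b h ha haN) fun s₁ hag₁ e22 => ?_
    have h₁ := h.agree (by omega) (by omega) hag₁
    refine Calc.andThen (d' := 23) (x := c.rest a) (by omega)
      (Calc.mono (Calc.set (fits_sub ?_ ?_) ?_) (by simp [Expr.cost])) fun s₂ hag₂ e23 => ?_
    · exact b.lt_of_le (by rw [h₁.r7]; omega)
    · exact b.lt_of_le_pow (by rw [e22]; exact hused) (by omega)
    · simp only [Expr.eval, Op.eval, h₁.r7, e22, Inst.Cover.rest]
    have h₂ := h₁.agree (by omega) (by omega) hag₂
    have ha₂ : ∀ j ≤ 2 * c.s, s₂.arr 4 j = a j := fun j hj => by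
      rw [hag₂.arr 4 (by omega), hag₁.arr 4 (by omega), ha j hj]
    refine Calc.andThen (by omega) (calc_label b h₂ ha₂ haN) fun s₃ hag₃ e24 => ?_
    have h₃ := h₂.agree (by omega) (by omega) hag₃
    have ha₃ : ∀ j ≤ 2 * c.s, s₃.arr 4 j = a j := fun j hj => by
      rw [hag₃.arr 4 (by omega), ha₂ j hj]
    refine Calc.andThen (by omega) (calc_capacity b h₃ ha₃ haN) fun s₄ hag₄ e25 => ?_
    have h₄ := h₃.agree (by omega) (by omega) hag₄
    have ha₄ : ∀ j ≤ 2 * c.s, s₄.arr 4 j = a j := fun j hj => by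
      rw [hag₄.arr 4 (by omega), ha₃ j hj]
    have f22 : s₄.reg 22 = c.used a := by
      rw [hag₄.reg 22 (by omega), hag₃.reg 22 (by omega), hag₂.reg 22 (by omega), e22]
    have f24 : s₄.reg 24 = _ := (hag₄.reg 24 (by omega)).trans e24
    unfold Inst.Cover.violations at hvle
    refine Calc.andThen (d' := 24) (x := c.violations a) (by omega)
      (Calc.mono (Calc.set ⟨⟨?_, fits_lt ?_ ?_ b.one_lt, ?_⟩, ?_, ?_⟩ ?_)
        (by simp [Expr.cost])) fun s₅ hag₅ e24' => ?_
    · rw [Expr.Fits, f24]; exact b.lt_of_le_pow (k := 4) (by omega) (by omega)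
    · exact b.lt_of_le (by rw [h₄.r7]; omega)
    · exact b.lt_of_le_pow (by rw [f22]; exact hused) (by omega)
    · simp only [Expr.eval, Op.eval, h₄.r7, f22, f24]
      exact b.lt_of_le_pow (k := 4) (by omega) (by omega)
    · rw [Expr.Fits, e25]; exact b.lt_of_le_pow (k := 4) (by omega) (by omega)
    · simp only [Expr.eval, Op.eval, h₄.r7, f22, f24, e25]
      exact b.lt_of_le_pow hvle (by omega)
    · simp only [Expr.eval, Op.eval, h₄.r7, f22, f24, e25, Inst.Cover.violations]
    have h₅ := h₄.agree (by omega) (by omega) hag₅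
    have ha₅ : ∀ j ≤ 2 * c.s, s₅.arr 4 j = a j := fun j hj => by
      rw [hag₅.arr 4 (by omega), ha₄ j hj]
    refine Calc.andThen (by omega) (calc_inner b h₅ ha₅ haN) fun s₆ hag₆ e25' => ?_
    have h₆ := h₅.agree (by omega) (by omega) hag₆
    have ha₆ : ∀ j ≤ 2 * c.s, s₆.arr 4 j = a j := fun j hj => by
      rw [hag₆.arr 4 (by omega), ha₅ j hj]
    have f23 : s₆.reg 23 = c.rest a := by
      rw [hag₆.reg 23 (by omega), hag₅.reg 23 (by omega), hag₄.reg 23 (by omega),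
        hag₃.reg 23 (by omega), e23]
    refine Calc.andThen (by omega) (calc_squares b h₆ f23 ha₆ haN) fun s₇ hag₇ e26 => ?_
    have h₇ := h₆.agree (by omega) (by omega) hag₇
    have ha₇ : ∀ j ≤ 2 * c.s, s₇.arr 4 j = a j := fun j hj => by
      rw [hag₇.arr 4 (by omega), ha₆ j hj]
    have f23' : s₇.reg 23 = c.rest a := by rw [hag₇.reg 23 (by omega), f23]
    refine Calc.andThen (by omega) (calc_gain b h₇ f23' ha₇ haN) fun s₈ hag₈ e27 => ?_
    have h₈ := h₇.agree (by omega) (by omega) hag₈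
    have g26 : s₈.reg 26 = c.squares a := by rw [hag₈.reg 26 (by omega), e26]
    have g25 : s₈.reg 25 = c.inner a := by
      rw [hag₈.reg 25 (by omega), hag₇.reg 25 (by omega), e25']
    have g24 : s₈.reg 24 = c.violations a := by
      rw [hag₈.reg 24 (by omega), hag₇.reg 24 (by omega), hag₆.reg 24 (by omega), e24']
    have hsq := squares_le (c := c) b haN
    have hgain := gain_le (c := c) (a := a) b
    have hinner := inner_le (c := c) (a := a) b
    have hadj := numAdj_le b
    have q1 : 2 * c.gain a ≤ N ^ 4 := two_mul_le_pow hN2 hgain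
    have q2 : c.inner a + 2 * c.gain a ≤ N ^ 5 :=
      add_le_pow hN2 (le_pow_of_le hN2 hinner (by omega)) q1
    have q3 : 2 * (c.inner a + 2 * c.gain a) ≤ N ^ 6 := two_mul_le_pow hN2 q2
    have q4 : 2 * B ≤ N ^ 4 := two_mul_le_pow hN2 hB
    have q5 : 2 * B + I.n ≤ N ^ 5 :=
      add_le_pow hN2 q4 (le_pow_of_le hN2 (p := 1) (by rw [pow_one]; omega) (by omega))
    have q6 : 2 * B + I.n + 2 * (c.inner a + 2 * c.gain a) ≤ N ^ 7 :=
      add_le_pow hN2 (le_pow_of_le hN2 q5 (by omega)) q3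
    have q7 : I.numAdj + c.squares a ≤ N ^ 9 :=
      add_le_pow hN2 (le_pow_of_le hN2 hadj (by omega)) hsq
    refine Calc.mono (Calc.set (fits_mul_of_le_one (fits_eq ?_ ?_ b.one_lt)
      (fits_sub ?_ (fits_lt ⟨⟨⟨?_, ?_, ?_⟩, ?_, ?_⟩, ⟨?_, ⟨?_, ⟨?_, ?_, ?_⟩, ?_⟩, ?_⟩, ?_⟩
        ⟨?_, ?_, ?_⟩ b.one_lt)) (Or.inl (eval_eq_le_one _ _ _))) ?_) (by simp [Expr.cost])
    · rw [Expr.Fits, g24]; exact b.lt_of_le_pow (violations_le b) (by omega)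
    · exact b.lt_of_le (by omega)
    · exact b.one_lt
    · exact b.two_lt
    · rw [Expr.Fits, h₈.r10]; exact b.lt_of_le_pow hB (by omega)
    · simp only [Expr.eval, Op.eval, h₈.r10]; exact b.lt_of_le_pow q4 (by omega)
    · exact b.lt_of_le (by rw [h₈.r2]; omega)
    · simp only [Expr.eval, Op.eval, h₈.r10, h₈.r2]; exact b.lt_of_le_pow q5 (by omega)
    · exact b.two_lt
    · rw [Expr.Fits, g25]; exact b.lt_of_le_pow hinner (by omega)
    · exact b.two_lt
    · rw [Expr.Fits, e27]; exact b.lt_of_le_pow hgain (by omega)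
    · simp only [Expr.eval, Op.eval, e27]; exact b.lt_of_le_pow q1 (by omega)
    · simp only [Expr.eval, Op.eval, e27, g25]; exact b.lt_of_le_pow q2 (by omega)
    · simp only [Expr.eval, Op.eval, e27, g25]; exact b.lt_of_le_pow q3 (by omega)
    · simp only [Expr.eval, Op.eval, e27, g25, h₈.r10, h₈.r2]; exact b.lt_of_le_pow q6 (by omega)
    · rw [Expr.Fits, h₈.r9]; exact b.lt_of_le_pow hadj (by omega)
    · rw [Expr.Fits, g26]; exact b.lt_of_le_pow hsq (by omega)
    · simp only [Expr.eval, Op.eval, g26, h₈.r9]; exact b.lt_of_le_pow q7 (by omega)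
    · simp only [Expr.eval, Op.eval, e27, g25, g24, g26, h₈.r10, h₈.r2, h₈.r9,
        Inst.Cover.accept]
      split_ifs <;> simp
  · have hX : 1 ≤ (c.s + 2) ^ (c.s + 1) := Nat.one_le_pow _ _ (by omega)
    set X := (c.s + 2) ^ (c.s + 1)
    have hU : c.s + 1 ≤ (c.s + 1) * (c.s + 1) := Nat.le_mul_of_pos_left _ (by omega)
    have e1 : (I.n + 1) * (X * ((c.s + 1) * ((I.n + 1) * ((c.s + 1) * (c.s + 1)) * 1302))) =
      (I.n + 1) * (X * ((c.s + 1) * ((I.n + 1) * ((c.s + 1) * (c.s + 1))))) * 1302 := by ring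
    have e2 : (I.n + 1) * ((I.n + 1) * ((c.s + 1) * (c.s + 1)) * 100) =
      (I.n + 1) * ((I.n + 1) * ((c.s + 1) * (c.s + 1))) * 100 := by ring
    rw [e1, e2]
    set U := (c.s + 1) * (c.s + 1)
    have hV : U ≤ (I.n + 1) * U := Nat.le_mul_of_pos_left _ (by omega)
    set V := (I.n + 1) * U
    have hV1 : V ≤ (I.n + 1) * V := Nat.le_mul_of_pos_left _ (by omega)
    have hV2 : V ≤ (c.s + 1) * V := Nat.le_mul_of_pos_left _ (by omega)
    have hV3 : (c.s + 1) * V ≤ X * ((c.s + 1) * V) := Nat.le_mul_of_pos_left _ hX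
    have hV4 : (I.n + 1) * V ≤ (I.n + 1) * (X * ((c.s + 1) * V)) :=
      Nat.mul_le_mul_left _ (hV2.trans hV3)
    omega

/-- Tests all guesses. -/
def searchProg : Prog := maxOdometer 20 4 11 12 guessProg

/-- The guesses are the vectors of `2 * s` digits in base `2 * s + 2`, whose sentinel digit `0` is
what the test for one guess expects in cell `2 * s`. -/
theorem calc_search (b : Bounds w I ab N) (hB : B ≤ N ^ 3) (h : MainMem I c ab B st) :
    Calc w 20 4 searchProg st ((2 * c.s + 2) ^ (2 * c.s) * ((c.s + 1) *
      ((I.n + 1) * ((c.s + 2) ^ (c.s + 1) *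
      ((c.s + 1) * ((I.n + 1) * ((c.s + 1) * (c.s + 1)))))) * 6528))
      ((Finset.range ((2 * c.s + 2) ^ (2 * c.s))).sup fun i =>
        c.accept (fun j => i / (2 * c.s + 2) ^ j % (2 * c.s + 2)) B) := by
  have hn := b.n_le
  have hs := c.s_le
  have hN2 := b.two_le
  refine Calc.maxOdometer (Tb := (I.n + 1) * ((c.s + 2) ^ (c.s + 1) *
      ((c.s + 1) * ((I.n + 1) * ((c.s + 1) * (c.s + 1))))) * 1600) (by omega) (by omega)
    h.r11 h.r12 (by omega) (b.lt_of_le_pow (k := 2) (by nlinarith) (by omega))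
    (b.lt_of_le_pow (k := 3) ?_ (by omega)) ?_ ?_ ?_
  · calc 2 * c.s + 2 + 1 ≤ N ^ 2 + N ^ 2 := by nlinarith
      _ ≤ N ^ 3 := add_le_pow hN2 le_rfl le_rfl
  · intro i _ s' hag hdig
    exact calc_guess b hB (h.agree (by omega) (by omega) hag) hdig
      fun j => Nat.mod_lt _ (by omega)
  · intro i _
    refine b.lt_of_le (x := c.accept _ B) ?_
    unfold Inst.Cover.accept
    split_ifs <;> omega
  · have hY : 1 ≤ (2 * c.s + 2) ^ (2 * c.s) := Nat.one_le_pow _ _ (by omega)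
    have hG : 1 ≤ (I.n + 1) * ((c.s + 2) ^ (c.s + 1) *
      ((c.s + 1) * ((I.n + 1) * ((c.s + 1) * (c.s + 1))))) := 
      Nat.succ_le_of_lt (by positivity)
    set Y := (2 * c.s + 2) ^ (2 * c.s)
    set G := (I.n + 1) * ((c.s + 2) ^ (c.s + 1) *
      ((c.s + 1) * ((I.n + 1) * ((c.s + 1) * (c.s + 1)))))
    calc (Y + 1) * ((2 * c.s + 1) * (G * 1600 + 32))
        ≤ (2 * Y) * ((2 * (c.s + 1)) * (G * 1632)) :=
          Nat.mul_le_mul (by omega) (Nat.mul_le_mul (by omega) (by omega))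
      _ = _ := by ring

theorem search_eq_one_iff {J : Inst} {c : J.Cover} :
    ((Finset.range ((2 * c.s + 2) ^ (2 * c.s))).sup fun i =>
        c.accept (fun j => i / (2 * c.s + 2) ^ j % (2 * c.s + 2)) B) =
      if ∃ M < (2 * c.s + 2) ^ (2 * c.s),
        c.accept (fun j => M / (2 * c.s + 2) ^ j % (2 * c.s + 2)) B = 1 then 1 else 0 := by
  have hle : ∀ a, c.accept a B ≤ 1 := fun a => by
    unfold Inst.Cover.accept
    split_ifs <;> omega
  split_ifs with h
  · obtain ⟨M, hM, h1⟩ := h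
    refine le_antisymm (Finset.sup_le fun i _ => hle _) ?_
    rw [← h1]
    exact Finset.le_sup (f := fun i => c.accept (fun j => i / (2 * c.s + 2) ^ j %
      (2 * c.s + 2)) B) (Finset.mem_range.2 hM)
  · push Not at h
    rw [← Nat.le_zero]
    refine Finset.sup_le fun i hi => ?_
    have := h i (Finset.mem_range.1 hi)
    have := hle fun j => i / (2 * c.s + 2) ^ j % (2 * c.s + 2)
    omega

end

end FairCC

/-! ### Loops with side effects, and the set-up of the constants -/

namespace WordRAM

/-- Run the body for all values of register `d` below register `rn`. -/
def forEach (d rn : ℕ) (body : Prog) : Prog :=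
  .seq (.set d (.lit 0)) <| .loop (.bin .lt (.reg d) (.reg rn)) <|
    .seq body (.set d (.bin .add (.reg d) (.lit 1)))

/-- Unlike in `Calc.forLoop`, the body may have lasting effects, such as filling an array or
advancing a position; the invariant describes them, and only the counter has to be left alone. -/
theorem Runs.forEach {w d rn N T : ℕ} {body : Prog} {s : State} (Inv : ℕ → State → Prop)
    (hNw : N < 2 ^ w) (hw : 1 ≤ w)
    (hN : ∀ i s', Inv i s' → s'.reg rn = N ∧ s'.reg d = i) (h0 : Inv 0 (s.setReg d 0))
    (hbody : ∀ i < N, ∀ s', Inv i s' →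
      Runs w body s' T fun s'' => s''.reg d = i ∧ Inv (i + 1) (s''.setReg d (i + 1))) :
    Runs w (forEach d rn body) s ((N + 1) * (T + 10)) (Inv N) := by
  have h1 : 1 < 2 ^ w := Nat.one_lt_two_pow (by omega)
  refine Runs.mono (T := 2 + (N * (T + 4 + 3 + 1) + 3 + 1)) (Q := Inv N) ?_ (by ring_nf; omega)
    fun _ h => h
  refine Runs.seq (Runs.set (Q := fun s' => s' = s.setReg d 0) ?_ rfl) ?_
  · simp [Expr.Fits]
  rintro s' rfl
  refine Runs.loop (e := .bin .lt (.reg d) (.reg rn)) Inv (fun i hi s' h => ?_)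
    (fun s' h => ?_) h0
  · obtain ⟨h2, h3⟩ := hN i s' h
    refine ⟨?_, ?_, ?_⟩
    · simp only [Expr.Fits, Expr.eval, h2, h3, Op.eval]
      refine ⟨by omega, hNw, ?_⟩
      split_ifs; omega
    · simp [Expr.eval, h2, h3, Op.eval, hi]
    · refine Runs.seq (hbody i hi s' h) fun s'' h'' => Runs.set ?_ ?_
      · simp only [Expr.Fits, Expr.eval, Op.eval, h''.1]
        omega
      · simpa only [Expr.eval, Op.eval, h''.1] using h''.2
  · obtain ⟨h2, h3⟩ := hN N s' h
    simp only [Expr.Fits, Expr.eval, h2, h3, Op.eval]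
    refine ⟨⟨by omega, hNw, ?_⟩, ?_⟩
    all_goals simp

/-- `s'` arises from `s` by writing `x` into register `r`, up to registers from `d` on and arrays
from `A` on. -/
structure Stored (d A r x : ℕ) (s s' : State) : Prop where
  self : s'.reg r = x
  reg : ∀ r' < d, r' ≠ r → s'.reg r' = s.reg r'
  arr : ∀ a < A, s'.arr a = s.arr a

/-- Write the value in register `d` computed by `p` into register `r`. -/
def storeProg (d r : ℕ) (p : Prog) : Prog := .seq p (.set r (.reg d))

theorem Calc.store {w d A r x T : ℕ} {p : Prog} {s : State} (h : Calc w d A p s T x)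
    (hx : x < 2 ^ w) : Runs w (storeProg d r p) s (T + 2) (Stored d A r x s) :=
  Runs.seq h fun s' h' => Runs.set (by rw [Expr.Fits, h'.2]; exact hx)
    ⟨by simp [Expr.eval, h'.2], fun r' hr hne => by simp [hne, h'.1.reg r' hr],
      fun a ha => by simp [h'.1.arr a ha]⟩

theorem Stored.agree {d A r x d' : ℕ} {s s' : State} (h : Stored d A r x s s') (hd : d' ≤ d)
    (hr : d' ≤ r) : Agree d' A s s' :=
  ⟨fun r' hr' => h.reg r' (by omega) (by omega), h.arr⟩

end WordRAM

namespace FairCC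
open WordRAM

/-- The largest common divisor of the color counts. -/
def numFairletsProg : Prog :=
  .seq (forEach 20 3 (.seq (cntProg 21 20) (.put 4 (.reg 20) (.reg 21)))) <|
    .seq (maxLoop 20 2 (.seq
      (sumLoop 22 3 (.set 24 (.bin .lt (.lit 0)
        (.bin .mod (.get 4 (.reg 23)) (.bin .add (.reg 21) (.lit 1))))))
      (.set 22 (.bin .mul (.bin .eq (.reg 22) (.lit 0)) (.bin .add (.reg 21) (.lit 1))))))
    (.set 20 (.bin .add (.lit 1) (.bin .sub (.reg 20) (.lit 1))))

section
variable {w N ab : ℕ} {I : Inst} {st : State}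

/-- The color counts are tabulated in array `4` before the divisors are tried; recounting for each
divisor would take cubic time. The final `1 + (x - 1)` is the maximum of `1` and `x`. -/
theorem calc_numFairlets (b : Bounds w I ab N) (h : GraphMem I ab st) :
    Calc w 20 4 numFairletsProg st ((I.n + 1) * ((I.n + 1) * 100)) I.numFairlets := by
  have hn := b.n_le
  have hκ := I.κ_le
  have h1 := b.one_lt
  refine Runs.mono (T := (I.κ + 1) * ((I.n + 1) * 20 + 3 + 10) +
    ((I.n + 1) * ((I.κ + 1) * 21 + 8 + 14) + 6)) (Q := fun s' => Agree 20 4 st s' ∧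
      s'.reg 20 = I.numFairlets) ?_ ?_ fun _ h => h
  · refine Runs.seq (Runs.forEach (fun i s' => Agree 20 4 st s' ∧ s'.reg 20 = i ∧
        ∀ q < i, s'.arr 4 q = I.cntN q) (N := I.κ) (b.lt_of_le (by omega)) b.one_le ?_ ?_ ?_)
        ?_
    · rintro i s' ⟨hag, hr, -⟩
      exact ⟨by rw [hag.reg 3 (by omega), h.r3], hr⟩
    · exact ⟨(Agree.refl st).setReg le_rfl _, by simp, by simp⟩
    · rintro i hi s' ⟨hag, hr, hq⟩
      have h' := h.agree (by omega) (by omega) hag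
      have hc := calc_cnt (A := 5) (q := 20) (d := 21) b h' (by omega) (by omega) (by omega) hr
        (by omega)
      refine Runs.seq hc fun s₁ h₁ => Runs.put ?_ ?_ ?_
      · rw [Expr.Fits, h₁.1.reg 20 (by omega), hr]
        exact b.lt_of_le (by omega)
      · rw [Expr.Fits, h₁.2]
        have := I.cntN_le i
        exact b.lt_of_le (by omega)
      · have hr1 : s₁.reg 20 = i := by rw [h₁.1.reg 20 (by omega), hr]
        refine ⟨by simpa, ((hag.trans (h₁.1.mono (by omega) (by omega))).setArr le_rfl _
          _).setReg le_rfl _, by simp, fun q hq' => ?_⟩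
        simp only [State.setReg_arr, State.setArr_arr, Expr.eval, hr1, h₁.2, true_and]
        split_ifs with hqi
        · rw [hqi]
        · rw [h₁.1.arr 4 (by omega)]
          exact hq q (by omega)
    · rintro s₁ ⟨hag₁, -, hcnt⟩
      have hmax : Calc w 20 5 (maxLoop 20 2 (.seq
          (sumLoop 22 3 (.set 24 (.bin .lt (.lit 0)
            (.bin .mod (.get 4 (.reg 23)) (.bin .add (.reg 21) (.lit 1))))))
          (.set 22 (.bin .mul (.bin .eq (.reg 22) (.lit 0)) (.bin .add (.reg 21) (.lit 1))))))
          s₁ ((I.n + 1) * ((I.κ + 1) * 21 + 8 + 14)) ((Finset.range I.n).sup fun d =>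
          if ∑ q ∈ Finset.range I.κ, (if I.cntN q % (d + 1) = 0 then 0 else 1) = 0
          then d + 1 else 0) := by
        refine Calc.maxLoop (Tb := (I.κ + 1) * 21 + 8) (N := I.n) (f := fun d =>
          if ∑ q ∈ Finset.range I.κ, (if I.cntN q % (d + 1) = 0 then 0 else 1) = 0
          then d + 1 else 0) (by omega) ?_ (b.lt_of_le (by omega)) b.one_le ?_ ?_ le_rfl
        · rw [hag₁.reg 2 (by omega), h.r2]
        · intro d hd s₂ hag₂ hr₂
          have hs : ∑ q ∈ Finset.range I.κ, (if I.cntN q % (d + 1) = 0 then 0 else 1) ≤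
              I.κ := by
            refine (Finset.sum_le_card_nsmul _ _ 1 fun q _ => ?_).trans (by simp)
            split_ifs <;> omega
          refine Calc.seq (T₁ := (I.κ + 1) * 21)
            (x := ∑ q ∈ Finset.range I.κ, (if I.cntN q % (d + 1) = 0 then 0 else 1))
            (Calc.sumLoop (Tb := 9) (by omega) (N := I.κ) ?_ (b.lt_of_le (by omega)) b.one_le
              ?_ (b.lt_of_le (by omega)) (Nat.mul_le_mul_left _ (by omega)))
            fun s₃ hag₃ hr₃ => ?_
          · rw [hag₂.reg 3 (by omega), hag₁.reg 3 (by omega), h.r3]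
          · intro q hq s₃ hag₃ hr₃
            have e21 : s₃.reg 21 = d := by rw [hag₃.reg 21 (by omega), hr₂]
            have e4 : s₃.arr 4 q = I.cntN q := by
              rw [hag₃.arr 4 (by omega), hag₂.arr 4 (by omega), hcnt q hq]
            have := I.cntN_le q
            refine Calc.mono (Calc.set (fits_lt ?_ (fits_mod ⟨?_, ?_⟩ ⟨?_, ?_, ?_⟩) h1) ?_)
              (by simp [Expr.cost])
            · exact b.lt_of_le (Nat.zero_le _)
            · exact b.lt_of_le (by rw [hr₃]; omega)
            · simp only [Expr.eval, hr₃, e4]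
              exact b.lt_of_le (by omega)
            · exact b.lt_of_le (by rw [e21]; omega)
            · exact h1
            · simp only [Expr.eval, Op.eval, e21]
              exact b.lt_of_le (by omega)
            · simp only [Expr.eval, Op.eval, hr₃, e4, e21, Nat.pos_iff_ne_zero, ite_not]
          · have e21 : s₃.reg 21 = d := by rw [hag₃.reg 21 (by omega), hr₂]
            refine Calc.mono (Calc.set (fits_mul_of_le_one (fits_eq ?_ ?_ h1) ⟨?_, h1, ?_⟩
              (Or.inl (eval_eq_le_one _ _ _))) ?_) (by simp [Expr.cost])
            · exact b.lt_of_le (by rw [hr₃]; omega)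
            · exact b.lt_of_le (Nat.zero_le _)
            · exact b.lt_of_le (by rw [e21]; omega)
            · simp only [Expr.eval, Op.eval, e21]
              exact b.lt_of_le (by omega)
            · simp only [Expr.eval, Op.eval, hr₃, e21]
              split_ifs <;> simp
        · intro d hd
          split_ifs
          · exact b.lt_of_le (by omega)
          · exact b.lt_of_le (by omega)
      refine Runs.seq hmax fun s₂ h₂ => ?_
      have hle := I.numFairlets_le
      unfold Inst.numFairlets at hle ⊢
      have h20 := h₂.2
      refine Runs.mono (Runs.set (Q := fun s' => Agree 20 4 st s' ∧ s'.reg 20 = _) ?_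
        ⟨?_, ?_⟩) (by simp [Expr.cost]) fun _ h => h
      · refine ⟨h1, fits_sub ?_ h1, ?_⟩
        · rw [Expr.Fits, h20]
          exact b.lt_of_le (by omega)
        · simp only [Expr.eval, Op.eval, h20]
          exact b.lt_of_le (by omega)
      · exact (hag₁.trans (h₂.1.mono (by omega) (by omega))).setReg le_rfl _
      · simp only [State.setReg_reg_self, Expr.eval, Op.eval, h20]
        omega
  · nlinarith [Nat.zero_le I.n]

/-- The number of ordered adjacent pairs. -/
def numAdjProg : Prog :=
  sumLoop 20 2 (sumLoop 22 2 (.set 24 (adjExpr (.reg 21) (.reg 23))))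

theorem calc_numAdj (b : Bounds w I ab N) (h : GraphMem I ab st) :
    Calc w 20 4 numAdjProg st ((I.n + 1) * ((I.n + 1) * 40)) I.numAdj := by
  have hn := b.n_le
  have hT := numAdj_le b
  refine Calc.sumLoop (Tb := (I.n + 1) * 21) (by omega) h.r2 (b.lt_of_le (by omega)) b.one_le
    ?_ (b.lt_of_le_pow hT (by omega)) (Nat.mul_le_mul_left _ (by omega))
  intro u hu s' hag hr
  have h' := h.agree (by omega) (by omega) hag
  refine Calc.sumLoop (Tb := 9) (by omega) h'.r2 (b.lt_of_le (by omega)) b.one_le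
    ?_ (b.lt_of_le ?_) (Nat.mul_le_mul_left _ (by omega))
  · intro v hv s'' hag' hr'
    have h'' := h'.agree (by omega) (by omega) hag'
    have e : s''.reg 21 = u := by rw [hag'.reg 21 (by omega), hr]
    refine Calc.mono (Calc.set (fits_adjExpr b h'' (u := u) (v := v) e hr' hu hv ?_ ?_)
      (eval_adjExpr h'' e hr' hu hv)) (by simp [Expr.cost, adjExpr])
    · exact b.lt_of_le (by rw [e]; omega)
    · exact b.lt_of_le (by rw [hr']; omega)
  · refine (Finset.sum_le_card_nsmul _ _ 1 fun v _ => I.adjN_le_one u v).trans ?_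
    simp
    omega

/-- The budget is in memory behind the adjacency matrix. -/
structure BudgetMem (I : Inst) (ab : ℕ) (st : State) : Prop where
  r0 : st.reg 0 = ab + I.n * I.n + I.budget.size
  bit : ∀ i < I.budget.size, st.arr 0 (ab + I.n * I.n + i) = (I.budget.testBit i).toNat

/-- The number of bits of the budget that are read. -/
def Inst.budgetBits (I : Inst) : ℕ := min I.budget.size (I.n * I.n).size

/-- The budget, cut off beyond the number of pairs of vertices. -/
def Inst.clippedBudget (I : Inst) : ℕ :=
  I.budget % 2 ^ I.budgetBits + if I.budgetBits < I.budget.size then 2 ^ I.budgetBits else 0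

/-- If bits are left unread, then the budget and the clipped budget are both at least a power of two
above `n²`; otherwise nothing is cut off. -/
theorem Inst.le_clippedBudget_iff {x : ℕ} (hx : x ≤ I.n ^ 2) :
    x ≤ I.clippedBudget ↔ x ≤ I.budget := by
  unfold Inst.clippedBudget
  split_ifs with h
  · have hb : I.budgetBits = (I.n * I.n).size := by unfold Inst.budgetBits at h ⊢; omega
    have h1 : I.n * I.n < 2 ^ I.budgetBits := by rw [hb]; exact Nat.lt_size_self _
    have h2 : 2 ^ I.budgetBits ≤ I.budget := Nat.lt_size.1 h
    rw [pow_two] at hx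
    omega
  · have hb : I.budgetBits = I.budget.size := by unfold Inst.budgetBits at h ⊢; omega
    rw [hb, Nat.mod_eq_of_lt (Nat.lt_size_self _), add_zero]

theorem two_pow_size_le (m : ℕ) : 2 ^ m.size ≤ 2 * m + 1 := by
  rcases Nat.eq_zero_or_pos m.size with h | h
  · rw [h]; omega
  · obtain ⟨j, hj⟩ : ∃ j, m.size = j + 1 := ⟨m.size - 1, by omega⟩
    have : 2 ^ j ≤ m := Nat.lt_size.1 (by omega)
    rw [hj, pow_succ]
    omega

theorem Inst.two_pow_budgetBits_le : 2 ^ I.budgetBits ≤ 2 * (I.n * I.n) + 1 :=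
  (Nat.pow_le_pow_right (by omega) (min_le_right _ _)).trans (two_pow_size_le _)

theorem Inst.clippedBudget_le : I.clippedBudget ≤ 4 * (I.n * I.n) + 2 := by
  have h1 := I.two_pow_budgetBits_le
  have h2 : I.budget % 2 ^ I.budgetBits < 2 ^ I.budgetBits := Nat.mod_lt _ (by positivity)
  unfold Inst.clippedBudget
  split_ifs <;> omega

/-- The clipped budget. -/
def budgetProg : Prog :=
  .seq (.set 20 (.lit 0)) <| .seq (.set 21 (.lit 1)) <|
  .seq (.set 22 (.bin .add (.reg 4) (.reg 15))) <|
  .seq (.loop (.bin .mul (.bin .lt (.reg 22) (.reg 0))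
      (.bin .lt (.reg 21) (.bin .add (.reg 15) (.lit 1)))) <|
    .seq (.set 20 (.bin .add (.reg 20) (.bin .mul (.get 0 (.reg 22)) (.reg 21)))) <|
    .seq (.set 21 (.bin .add (.reg 21) (.reg 21)))
      (.set 22 (.bin .add (.reg 22) (.lit 1)))) <|
  .set 20 (.bin .add (.reg 20) (.bin .mul (.bin .lt (.reg 22) (.reg 0)) (.reg 21)))

theorem mod_two_pow_succ' (x i : ℕ) :
    x % 2 ^ (i + 1) = x % 2 ^ i + (x.testBit i).toNat * 2 ^ i := by
  rw [pow_succ, Nat.mod_mul, Nat.toNat_testBit, mul_comm (_ % 2)]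

/-- The loop guard compares the current power of two with `n²`, so that the number of bits of `n²`
need not be computed. -/
theorem budget_read_iff (i : ℕ) :
    (i < I.budget.size ∧ 2 ^ i < I.n * I.n + 1) ↔ i < I.budgetBits := by
  rw [Nat.lt_succ_iff, ← Nat.lt_size]
  exact lt_min_iff.symm

/-- The budget may be too long for a word. Reading stops once the power of two exceeds `n²`, which
bounds all numbers and makes the time independent of the length of the budget. -/
theorem calc_budget (b : Bounds w I ab N) (h : GraphMem I ab st) (hb : BudgetMem I ab st)
    (hL : st.reg 0 ≤ N) (h15 : st.reg 15 = I.n * I.n) :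
    Calc w 20 4 budgetProg st ((I.n + 1) * ((I.n + 1) * 60)) I.clippedBudget := by
  have hn := b.n_le
  have hab := b.ab_le
  have h1 := b.one_lt
  have hN2 := b.two_le
  set K := I.budgetBits with hK
  have hpow : ∀ i ≤ K, 2 ^ i ≤ 2 * (I.n * I.n) + 1 := fun i hi =>
    (Nat.pow_le_pow_right (by omega) hi).trans I.two_pow_budgetBits_le
  have hKs : K ≤ I.budget.size := min_le_left _ _
  have hKn : K ≤ 2 * (I.n * I.n) + 1 := (Nat.lt_two_pow_self.le).trans (hpow K le_rfl)
  have hsmall : ∀ x, x ≤ 4 * (2 * (I.n * I.n) + 1) → x < 2 ^ w := fun x hx =>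
    b.lt_of_le_pow (k := 5) (hx.trans (by
      calc 4 * (2 * (I.n * I.n) + 1) ≤ 2 ^ 2 * (N * N * N) := by nlinarith
        _ ≤ N ^ 2 * (N * N * N) := Nat.mul_le_mul_right _ (Nat.pow_le_pow_left hN2 2)
        _ = N ^ 5 := by ring)) (by omega)
  have hmod : ∀ i, I.budget % 2 ^ i < 2 ^ i := fun i => Nat.mod_lt _ (by positivity)
  let Inv : ℕ → State → Prop := fun i s' => i ≤ K ∧ Agree 20 4 st s' ∧
    s'.reg 20 = I.budget % 2 ^ i ∧ s'.reg 21 = 2 ^ i ∧ s'.reg 22 = ab + I.n * I.n + i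
  have key : ∀ i s', Inv i s' → (Expr.bin .mul (.bin .lt (.reg 22) (.reg 0))
      (.bin .lt (.reg 21) (.bin .add (.reg 15) (.lit 1)))).Fits w s' ∧
      (Expr.bin .mul (.bin .lt (.reg 22) (.reg 0))
      (.bin .lt (.reg 21) (.bin .add (.reg 15) (.lit 1)))).eval s' = if i < K then 1 else 0 := by
    rintro i s' ⟨hi, hag, e20, e21, e22⟩
    have e0 := hag.reg 0 (by omega)
    have e15 := hag.reg 15 (by omega)
    have hp := hpow i hi
    have hr0 := hb.r0
    constructor
    · refine fits_mul_of_le_one (fits_lt ?_ ?_ h1) (fits_lt ?_ ⟨?_, h1, ?_⟩ h1)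
        (Or.inl (eval_lt_le_one _ _ _))
      · rw [Expr.Fits, e22]; exact b.lt_of_le (by omega)
      · rw [Expr.Fits, e0]; exact b.lt_of_le hL
      · rw [Expr.Fits, e21]; exact hsmall _ (by omega)
      · rw [Expr.Fits, e15, h15]; exact hsmall _ (by omega)
      · simp only [Expr.eval, Op.eval, e15, h15]; exact hsmall _ (by omega)
    · have := budget_read_iff (I := I) i
      simp only [Expr.eval, Op.eval, e22, e0, hb.r0, e21, e15, h15, Nat.add_lt_add_iff_left]
      rw [← hK] at this
      simp only [← this]
      by_cases hA : i < I.budget.size <;> by_cases hB : 2 ^ i < I.n * I.n + 1 <;> simp [hA, hB]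
  refine Runs.mono (T := 2 + (2 + (4 + ((K * (7 + (4 + 4) + 9 + 1) + 9 + 1) + 8))))
    (Q := fun s' => Agree 20 4 st s' ∧ s'.reg 20 = I.clippedBudget) ?_ (by nlinarith)
    fun _ h => h
  refine Runs.seq (Runs.set (Q := fun s' => s' = st.setReg 20 0) (b.lt_of_le (Nat.zero_le _))
    rfl) ?_
  rintro _ rfl
  refine Runs.seq (Runs.set (Q := fun s' => s' = (st.setReg 20 0).setReg 21 1) h1 rfl) ?_
  rintro _ rfl
  refine Runs.seq (Runs.set (Q := Inv 0) (e := .bin .add (.reg 4) (.reg 15))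
    ⟨?_, ?_, ?_⟩ ?_) fun s₁ h₁ => ?_
  · simp only [Expr.Fits, State.setReg_reg]
    norm_num [h.r4]
    exact b.lt_of_le (by omega)
  · simp only [Expr.Fits, State.setReg_reg]
    norm_num [h15]
    exact hsmall _ (by omega)
  · simp only [Expr.eval, Op.eval, State.setReg_reg]
    norm_num [h15, h.r4]
    exact b.lt_of_le (by omega)
  · refine ⟨Nat.zero_le _, (((Agree.refl st).setReg le_rfl _).setReg (by omega) _).setReg
      (by omega) _, ?_, ?_, ?_⟩
    · simp [Nat.mod_one]
    · simp
    · simp [Expr.eval, Op.eval, h15, h.r4]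
  refine Runs.seq (Runs.loop Inv (fun i hi s' hs' => ?_) (fun s' hs' => ?_) h₁)
    fun s₂ h₂ => ?_
  · obtain ⟨f, e⟩ := key i s' hs'
    refine ⟨f, by rw [e, if_pos hi]; omega, ?_⟩
    obtain ⟨-, hag, e20, e21, e22⟩ := hs'
    have hp := hpow i (by omega)
    have hp' := hpow (i + 1) (by omega)
    have := hmod i
    have hr0 := hb.r0
    have hbit : s'.arr 0 (ab + I.n * I.n + i) = (I.budget.testBit i).toNat := by
      rw [hag.arr 0 (by omega), hb.bit i (by omega)]
    have hbt : (I.budget.testBit i).toNat ≤ 1 := Bool.toNat_le _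
    have hbt' : (I.budget.testBit i).toNat * 2 ^ i ≤ 2 ^ i := by nlinarith
    refine Runs.seq (Runs.set (Q := fun s₃ => s₃ = s'.setReg 20 (I.budget % 2 ^ (i + 1))) ?_ ?_)
      ?_
    · refine ⟨?_, fits_mul_of_le_one ⟨?_, ?_⟩ ?_ (Or.inl ?_), ?_⟩
      · rw [Expr.Fits, e20]; exact hsmall _ (by omega)
      · rw [Expr.Fits, e22]; exact b.lt_of_le (by omega)
      · simp only [Expr.eval, e22, hbit]; exact hsmall _ (by omega)
      · rw [Expr.Fits, e21]; exact hsmall _ (by omega)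
      · simpa only [Expr.eval, e22, hbit] using hbt
      · simp only [Expr.eval, Op.eval, e20, e22, hbit, e21]
        exact hsmall _ (by omega)
    · simp only [Expr.eval, Op.eval, e20, e22, hbit, e21, mod_two_pow_succ']
    rintro _ rfl
    refine Runs.mono (T := 4 + 4) (Q := Inv (i + 1)) ?_ le_rfl fun _ h => h
    refine Runs.seq (Runs.set (Q := fun s₃ =>
      s₃ = (s'.setReg 20 (I.budget % 2 ^ (i + 1))).setReg 21 (2 ^ (i + 1))) ?_ ?_) ?_
    · simp only [Expr.Fits, Expr.eval, Op.eval, State.setReg_reg]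
      norm_num [e21]
      exact ⟨hsmall _ (by omega), hsmall _ (by omega)⟩
    · simp only [Expr.eval, Op.eval, State.setReg_reg]
      norm_num [e21, pow_succ, mul_two]
    rintro _ rfl
    refine Runs.set ?_ ⟨hi, ((hag.setReg le_rfl _).setReg (by omega) _).setReg (by omega) _,
      ?_, ?_, ?_⟩
    · simp only [Expr.Fits, Expr.eval, Op.eval, State.setReg_reg]
      norm_num [e22]
      exact ⟨b.lt_of_le (by omega), by have := b.one_le; omega, b.lt_of_le (by omega)⟩
    · simp
    · simp
    · simp [Expr.eval, Op.eval, e22]; omega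
  · obtain ⟨f, e⟩ := key K s' hs'
    exact ⟨f, by rw [e, if_neg (lt_irrefl _)]⟩
  · obtain ⟨-, hag, e20, e21, e22⟩ := h₂
    have hp := hpow K le_rfl
    have := hmod K
    have hr0 := hb.r0
    have e0 := hag.reg 0 (by omega)
    have hval : I.clippedBudget < 2 ^ w := hsmall _ (by have := I.clippedBudget_le; omega)
    have hev : (Expr.bin .add (.reg 20) (.bin .mul (.bin .lt (.reg 22) (.reg 0)) (.reg 21))).eval
        s₂ = I.clippedBudget := by
      simp only [Expr.eval, Op.eval, e20, e22, e0, hb.r0, e21, Nat.add_lt_add_iff_left,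
        Inst.clippedBudget, ← hK]
      split_ifs <;> simp
    refine Runs.mono (Runs.set (Q := fun s' => Agree 20 4 st s' ∧ s'.reg 20 = _)
      ⟨?_, fits_mul_of_le_one (fits_lt ?_ ?_ h1) ?_ (Or.inl (eval_lt_le_one _ _ _)), ?_⟩
      ⟨hag.setReg le_rfl _, ?_⟩) (by simp [Expr.cost]) fun _ h => h
    · rw [Expr.Fits, e20]; exact hsmall _ (by omega)
    · rw [Expr.Fits, e22]; exact b.lt_of_le (by omega)
    · rw [Expr.Fits, e0]; exact b.lt_of_le hL
    · rw [Expr.Fits, e21]; exact hsmall _ (by omega)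
    · have := hev ▸ hval
      simpa only [Expr.eval] using this
    · rw [State.setReg_reg_self, hev]

end

/-- Compute everything that the enumeration of guesses needs. -/
def setupProg : Prog :=
  .seq (storeProg 20 7 numFairletsProg) <|
  .seq (storeProg 20 8 (.set 20 (.bin .div (.reg 2) (.reg 7)))) <|
  .seq (storeProg 20 9 numAdjProg) <|
  .seq (storeProg 20 15 (.set 20 (.bin .mul (.reg 2) (.reg 2)))) <|
  .seq (storeProg 20 10 budgetProg) <|
  .seq (storeProg 20 11 (.set 20 (.bin .add (.reg 6) (.reg 6)))) <|
  .seq (storeProg 20 12 (.set 20 (.bin .add (.reg 11) (.lit 2)))) <|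
  .seq (storeProg 20 13 (.set 20 (.bin .add (.reg 6) (.lit 1)))) <|
  storeProg 20 14 (.set 20 (.bin .add (.reg 6) (.lit 2)))

section
variable {w N ab : ℕ} {I : Inst} {c : I.Cover} {st : State}

theorem runs_setup (b : Bounds w I ab N) (h : CoverMem I c ab st) (hb : BudgetMem I ab st)
    (hL : st.reg 0 ≤ N) :
    Runs w setupProg st ((I.n + 1) * ((I.n + 1) * 300))
      (MainMem I c ab I.clippedBudget) := by
  have hn := b.n_le
  have hab := b.ab_le
  have h1 := b.one_lt
  have h2 := b.two_lt
  have hN2 := b.two_le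
  have hs := c.s_le
  have hT := I.numFairlets_le
  have hclip := I.clippedBudget_le
  have hNN : 2 * N ≤ N ^ 2 := by nlinarith
  refine Runs.mono (T := ((I.n + 1) * ((I.n + 1) * 100) + 2) + ((4 + 2) +
    (((I.n + 1) * ((I.n + 1) * 40) + 2) + ((4 + 2) + (((I.n + 1) * ((I.n + 1) * 60) + 2) +
    ((4 + 2) + ((4 + 2) + ((4 + 2) + (4 + 2))))))))) (Q := MainMem I c ab I.clippedBudget)
    ?_ (by nlinarith [Nat.zero_le I.n]) fun _ h => h
  refine Runs.seq ((calc_numFairlets b h.toGraphMem).store (b.lt_of_le (by omega)))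
    fun s₁ k₁ => ?_
  have h₁ := h.agree (by omega) le_rfl (k₁.agree (d' := 7) (by omega) (by omega))
  refine Runs.seq (Calc.store (A := 4) (x := I.n / I.numFairlets) (Calc.set (fits_div ?_ ?_) ?_)
    (b.lt_of_le ((Nat.div_le_self _ _).trans (by omega)))) fun s₂ k₂ => ?_
  · rw [Expr.Fits, h₁.r2]; exact b.lt_of_le (by omega)
  · rw [Expr.Fits, k₁.self]; exact b.lt_of_le (by omega)
  · simp only [Expr.eval, Op.eval, h₁.r2, k₁.self]
  have h₂ := h₁.agree (by omega) le_rfl (k₂.agree (d' := 7) (by omega) (by omega))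
  refine Runs.seq ((calc_numAdj b h₂.toGraphMem).store
    (b.lt_of_le_pow (numAdj_le b) (by omega))) fun s₃ k₃ => ?_
  have h₃ := h₂.agree (by omega) le_rfl (k₃.agree (d' := 7) (by omega) (by omega))
  refine Runs.seq (Calc.store (A := 4) (x := I.n * I.n) (Calc.set ⟨?_, ?_, ?_⟩ ?_)
    (b.lt_of_le (by omega))) fun s₄ k₄ => ?_
  · rw [Expr.Fits, h₃.r2]; exact b.lt_of_le (by omega)
  · rw [Expr.Fits, h₃.r2]; exact b.lt_of_le (by omega)
  · simp only [Expr.eval, Op.eval, h₃.r2]; exact b.lt_of_le (by omega)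
  · simp only [Expr.eval, Op.eval, h₃.r2]
  have h₄ := h₃.agree (by omega) le_rfl (k₄.agree (d' := 7) (by omega) (by omega))
  have hag₄ : Agree 7 4 st s₄ := (k₁.agree (by omega) (by omega)).trans <|
    (k₂.agree (by omega) (by omega)).trans <| (k₃.agree (by omega) (by omega)).trans
    (k₄.agree (by omega) (by omega))
  have hb₄ : BudgetMem I ab s₄ :=
    ⟨by rw [hag₄.reg 0 (by omega), hb.r0], fun i hi => by
      rw [hag₄.arr 0 (by omega), hb.bit i hi]⟩
  refine Runs.seq ((calc_budget b h₄.toGraphMem hb₄ (by rw [hag₄.reg 0 (by omega)]; exact hL)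
    k₄.self).store (b.lt_of_le_pow (k := 5) ?_ (by omega))) fun s₅ k₅ => ?_
  · calc I.clippedBudget ≤ 2 ^ 2 * (N * N * N) := by nlinarith
      _ ≤ N ^ 2 * (N * N * N) := Nat.mul_le_mul_right _ (Nat.pow_le_pow_left hN2 2)
      _ = N ^ 5 := by ring
  have h₅ := h₄.agree (by omega) le_rfl (k₅.agree (d' := 7) (by omega) (by omega))
  refine Runs.seq (Calc.store (A := 4) (x := 2 * c.s) (Calc.set ⟨?_, ?_, ?_⟩ ?_)
    (b.lt_of_le_pow (k := 2) (by omega) (by omega))) fun s₆ k₆ => ?_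
  · rw [Expr.Fits, h₅.r6]; exact b.lt_of_le (by omega)
  · rw [Expr.Fits, h₅.r6]; exact b.lt_of_le (by omega)
  · simp only [Expr.eval, Op.eval, h₅.r6]; exact b.lt_of_le_pow (k := 2) (by omega) (by omega)
  · simp only [Expr.eval, Op.eval, h₅.r6]; omega
  have h₆ := h₅.agree (by omega) le_rfl (k₆.agree (d' := 7) (by omega) (by omega))
  refine Runs.seq (Calc.store (A := 4) (x := 2 * c.s + 2) (Calc.set ⟨?_, h2, ?_⟩ ?_)
    (b.lt_of_le_pow (k := 2) (by omega) (by omega))) fun s₇ k₇ => ?_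
  · rw [Expr.Fits, k₆.self]; exact b.lt_of_le_pow (k := 2) (by omega) (by omega)
  · simp only [Expr.eval, Op.eval, k₆.self]; exact b.lt_of_le_pow (k := 2) (by omega) (by omega)
  · simp only [Expr.eval, Op.eval, k₆.self]
  have h₇ := h₆.agree (by omega) le_rfl (k₇.agree (d' := 7) (by omega) (by omega))
  refine Runs.seq (Calc.store (A := 4) (x := c.s + 1) (Calc.set ⟨?_, h1, ?_⟩ ?_)
    (b.lt_of_le (by omega))) fun s₈ k₈ => ?_
  · rw [Expr.Fits, h₇.r6]; exact b.lt_of_le (by omega)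
  · simp only [Expr.eval, Op.eval, h₇.r6]; exact b.lt_of_le (by omega)
  · simp only [Expr.eval, Op.eval, h₇.r6]
  have h₈ := h₇.agree (by omega) le_rfl (k₈.agree (d' := 7) (by omega) (by omega))
  refine Runs.mono (Calc.store (A := 4) (x := c.s + 2) (Calc.set ⟨?_, h2, ?_⟩ ?_)
    (b.lt_of_le (by omega))) le_rfl fun s₉ k₉ => ?_
  · rw [Expr.Fits, h₈.r6]; exact b.lt_of_le (by omega)
  · simp only [Expr.eval, Op.eval, h₈.r6]; exact b.lt_of_le (by omega)
  · simp only [Expr.eval, Op.eval, h₈.r6]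
  refine ⟨h₈.agree (by omega) le_rfl (k₉.agree (d' := 7) (by omega) (by omega)),
    ?_, ?_, ?_, ?_, ?_, ?_, ?_, k₉.self, ?_⟩
  all_goals simp [k₉.reg, k₈.reg, k₇.reg, k₆.reg, k₅.reg, k₄.reg, k₃.reg, k₂.reg,
    k₂.self, k₃.self, k₄.self, k₅.self, k₆.self, k₇.self, k₈.self, k₁.self]

/-- No cost exceeds `n²`, so clipping keeps the answer; a cover does not involve the budget and can
be carried over to the modified instance. -/
theorem isYes_iff_clipped : I.IsYes ↔ ∃ M < (2 * c.s + 2) ^ (2 * c.s),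
    c.accept (fun j => M / (2 * c.s + 2) ^ j % (2 * c.s + 2)) I.clippedBudget = 1 := by
  rw [← Inst.isYes_congr_budget (I := I) (B := I.clippedBudget)
    fun x hx => I.le_clippedBudget_iff hx]
  let J : Inst := { I with budget := I.clippedBudget }
  let c' : J.Cover :=
    { s := c.s, cv := c.cv, mark := c.mark, mark_le := c.mark_le, lt := c.lt, inj := c.inj,
      mark_iff := c.mark_iff, cover := c.cover }
  exact c'.isYes_iff

/-- Set-up and enumeration of all guesses. -/
def decideProg : Prog := .seq setupProg searchProg

theorem calc_decide (b : Bounds w I ab N) (h : CoverMem I c ab st) (hb : BudgetMem I ab st)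
    (hL : st.reg 0 ≤ N) [Decidable I.IsYes] :
    Runs w decideProg st ((2 * c.s + 2) ^ (2 * c.s) * ((c.s + 2) ^ (c.s + 1) *
        (c.s + 1) ^ 4) * ((I.n + 1) ^ 2 * 7000))
      fun s' => s'.reg 20 = if I.IsYes then 1 else 0 := by
  have hN2 := b.two_le
  have hn := b.n_le
  have hX : 1 ≤ (2 * c.s + 2) ^ (2 * c.s) := Nat.one_le_pow _ _ (by omega)
  have hY : 1 ≤ (c.s + 2) ^ (c.s + 1) * (c.s + 1) ^ 4 := Nat.succ_le_of_lt (by positivity)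
  have hB : I.clippedBudget ≤ N ^ 3 := by
    have := I.clippedBudget_le
    calc I.clippedBudget ≤ (I.n + 2) ^ 3 := by nlinarith
      _ ≤ _ := Nat.pow_le_pow_left hn 3
  have hsearch := fun s' (hs' : MainMem I c ab I.clippedBudget s') =>
    Runs.mono (calc_search b hB hs') le_rfl fun _ h => h.2
  refine Runs.mono (Runs.seq (runs_setup b h hb hL) hsearch) ?_ fun s' hs' => ?_
  · calc _ = 1 * 1 * ((I.n + 1) ^ 2 * 300) + (2 * c.s + 2) ^ (2 * c.s) * ((c.s + 2) ^ (c.s + 1) *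
          (c.s + 1) ^ 4) * ((I.n + 1) ^ 2 * 6528) := by ring
      _ ≤ (2 * c.s + 2) ^ (2 * c.s) * ((c.s + 2) ^ (c.s + 1) *
          (c.s + 1) ^ 4) * ((I.n + 1) ^ 2 * 300) + (2 * c.s + 2) ^ (2 * c.s) *
          ((c.s + 2) ^ (c.s + 1) * (c.s + 1) ^ 4) * ((I.n + 1) ^ 2 * 6528) :=
        Nat.add_le_add_right (Nat.mul_le_mul_right _ (Nat.mul_le_mul hX hY)) _
      _ = (2 * c.s + 2) ^ (2 * c.s) * ((c.s + 2) ^ (c.s + 1) *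
          (c.s + 1) ^ 4) * ((I.n + 1) ^ 2 * 6828) := by ring
      _ ≤ _ := Nat.mul_le_mul_left _ (Nat.mul_le_mul_left _ (by omega))
  · rw [hs', search_eq_one_iff]
    simp only [← isYes_iff_clipped]

end

end FairCC

namespace FairCC
open WordRAM

/-! ### Greedy construction of a vertex cover -/

/-- `W` is a set of vertices that meets all edges. -/
def Inst.Covers (I : Inst) (W : Finset ℕ) : Prop :=
  W ⊆ Finset.range I.n ∧ ∀ u < I.n, ∀ v < I.n, I.adjN u v ≠ 0 → u ∈ W ∨ v ∈ W

section
variable {I : Inst}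

theorem Inst.adjN_ne_zero {u v : Fin I.n} : I.adjN u v ≠ 0 ↔ I.graph.Adj u v := by
  unfold Inst.adjN
  split_ifs with h
  · obtain ⟨_, _, h⟩ := h
    simpa using h
  · refine ⟨fun h' => absurd rfl h', fun h' => absurd ⟨u.2, v.2, h'⟩ h⟩

theorem Inst.adjN_self (u : ℕ) : I.adjN u u = 0 := by
  unfold Inst.adjN
  rw [if_neg]
  rintro ⟨_, _, h⟩
  exact h.ne rfl

theorem Inst.covers_of_isVertexCover {W : Set (Fin I.n)} (h : I.graph.IsVertexCover W) :
    ∃ W' : Finset ℕ, I.Covers W' ∧ (W'.card : ℕ∞) = W.encard := by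
  classical
  refine ⟨(Finset.univ.filter (· ∈ W)).image Fin.val, ⟨fun x hx => ?_, fun u hu v hv huv => ?_⟩,
    ?_⟩
  · obtain ⟨y, -, rfl⟩ := Finset.mem_image.1 hx
    exact Finset.mem_range.2 y.2
  · have := h ((Inst.adjN_ne_zero (u := ⟨u, hu⟩) (v := ⟨v, hv⟩)).1 huv)
    refine this.imp (fun h => ?_) fun h => ?_
    · exact Finset.mem_image.2 ⟨⟨u, hu⟩, by simpa using h, rfl⟩
    · exact Finset.mem_image.2 ⟨⟨v, hv⟩, by simpa using h, rfl⟩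
  · rw [Finset.card_image_of_injective _ Fin.val_injective, ← Set.encard_coe_eq_coe_finsetCard]
    congr 1
    ext; simp

theorem Inst.Covers.vertexCoverNum_le {W : Finset ℕ} (h : I.Covers W) :
    I.graph.vertexCoverNum ≤ (W.card : ℕ∞) := by
  have hc : I.graph.IsVertexCover {v : Fin I.n | (v : ℕ) ∈ W} := fun u v huv =>
    h.2 u u.2 v v.2 (Inst.adjN_ne_zero.2 huv)
  refine hc.vertexCoverNum_le.trans ?_
  rw [← Set.encard_coe_eq_coe_finsetCard, ← Fin.val_injective.encard_image]
  refine Set.encard_le_encard ?_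
  rintro _ ⟨v, hv, rfl⟩
  exact hv

/-- Replaces the extended natural number by attainment and a lower bound, for covers that are finite
sets of numbers as in memory. -/
theorem Inst.vertexCoverNum_eq_iff {k : ℕ} : I.graph.vertexCoverNum = (k : ℕ∞) ↔
    (∃ W, I.Covers W ∧ W.card = k) ∧ ∀ W, I.Covers W → k ≤ W.card := by
  constructor
  · intro h
    obtain ⟨W, hW, hc⟩ := I.graph.vertexCoverNum_exists
    obtain ⟨W', hW', hc'⟩ := Inst.covers_of_isVertexCover hc
    refine ⟨⟨W', hW', ?_⟩, fun W hW => ?_⟩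
    · rw [hW, h] at hc'
      exact_mod_cast hc'
    · have := hW.vertexCoverNum_le
      rw [h] at this
      exact_mod_cast this
  · rintro ⟨⟨W, hW, rfl⟩, h⟩
    refine le_antisymm hW.vertexCoverNum_le ?_
    obtain ⟨W₁, hW₁, hc⟩ := I.graph.vertexCoverNum_exists
    obtain ⟨W', hW', hc'⟩ := Inst.covers_of_isVertexCover hc
    rw [← hW₁, ← hc']
    exact_mod_cast h W' hW'

/-- The first `s` members of `cv` are the endpoints of a matching, and are marked. -/
structure Matched (I : Inst) (s : ℕ) (cv mark : ℕ → ℕ) : Prop where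
  mark_le : ∀ v < I.n, mark v ≤ 1
  lt : ∀ j < s, cv j < I.n
  inj : ∀ i < s, ∀ j < s, cv i = cv j → i = j
  mark_iff : ∀ v < I.n, mark v ≠ 0 ↔ ∃ j < s, cv j = v
  half : ∀ W, I.Covers W → s ≤ 2 * ∑ j ∈ Finset.range s, if cv j ∈ W then 1 else 0

theorem Matched.s_le {s : ℕ} {cv mark : ℕ → ℕ} (h : Matched I s cv mark) : s ≤ I.n := by
  have := Finset.card_le_card_of_injOn (s := Finset.range s) (t := Finset.range I.n) cv
    (fun j hj => by simpa using h.lt j (by simpa using hj))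
    (fun i hi j hj hij => h.inj i (by simpa using hi) j (by simpa using hj) hij)
  simpa using this

/-- The matched vertices are distinct, and every cover contains at least half of them. -/
theorem Matched.le_two_mul_card {s : ℕ} {cv mark : ℕ → ℕ} (h : Matched I s cv mark)
    {W : Finset ℕ} (hW : I.Covers W) : s ≤ 2 * W.card := by
  refine (h.half W hW).trans (Nat.mul_le_mul_left _ ?_)
  rw [← Finset.card_filter]
  refine Finset.card_le_card_of_injOn cv (fun j hj => ?_) fun i hi j hj hij => ?_
  · simp only [Finset.coe_filter, Set.mem_ofPred_eq] at hj
    exact hj.2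
  · simp only [Finset.coe_filter, Set.mem_ofPred_eq, Finset.mem_range] at hi hj
    exact h.inj i hi.1 j hj.1 hij

theorem Matched.zero {cv mark : ℕ → ℕ} (h : ∀ v < I.n, mark v = 0) : Matched I 0 cv mark where
  mark_le v hv := by simp [h v hv]
  lt := by simp
  inj := by simp
  mark_iff v hv := by simp [h v hv]
  half := by simp

/-- Both endpoints are new because they are unmarked, and distinct because they are adjacent. A
cover contains one of them, which pays for the two additional vertices. -/
theorem Matched.step {s u v : ℕ} {cv mark cv' mark' : ℕ → ℕ} (h : Matched I s cv mark)
    (hu : u < I.n) (hv : v < I.n) (huv : I.adjN u v ≠ 0) (hmu : mark u = 0) (hmv : mark v = 0)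
    (hcv : ∀ j < s, cv' j = cv j) (hcvu : cv' s = u) (hcvv : cv' (s + 1) = v)
    (hmark : ∀ x, mark' x = if x = u ∨ x = v then 1 else mark x) :
    Matched I (s + 2) cv' mark' where
  mark_le x hx := by
    rw [hmark]
    split_ifs
    · exact le_rfl
    · exact h.mark_le x hx
  lt j hj := by
    rcases (by omega : j < s ∨ j = s ∨ j = s + 1) with hj | rfl | rfl
    · rw [hcv j hj]; exact h.lt j hj
    · rwa [hcvu]
    · rwa [hcvv]
  inj i hi j hj hij := by
    have hne : u ≠ v := fun e => huv (by rw [e, Inst.adjN_self])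
    have hnu : ∀ j < s, cv j ≠ u := fun j hj e => (h.mark_iff u hu).2 ⟨j, hj, e⟩ hmu
    have hnv : ∀ j < s, cv j ≠ v := fun j hj e => (h.mark_iff v hv).2 ⟨j, hj, e⟩ hmv
    rcases (by omega : i < s ∨ i = s ∨ i = s + 1) with hi | hi | hi <;>
      rcases (by omega : j < s ∨ j = s ∨ j = s + 1) with hj | hj | hj
    · rw [hcv i hi, hcv j hj] at hij
      exact h.inj i hi j hj hij
    · rw [hcv i hi, hj, hcvu] at hij
      exact absurd hij (hnu i hi)
    · rw [hcv i hi, hj, hcvv] at hij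
      exact absurd hij (hnv i hi)
    · rw [hcv j hj, hi, hcvu] at hij
      exact absurd hij.symm (hnu j hj)
    · rw [hi, hj]
    · rw [hi, hj, hcvu, hcvv] at hij
      exact absurd hij hne
    · rw [hcv j hj, hi, hcvv] at hij
      exact absurd hij.symm (hnv j hj)
    · rw [hi, hj, hcvu, hcvv] at hij
      exact absurd hij.symm hne
    · rw [hi, hj]
  mark_iff x hx := by
    rw [hmark]
    constructor
    · intro hm
      split_ifs at hm with hx'
      · rcases hx' with rfl | rfl
        · exact ⟨s, by omega, hcvu⟩
        · exact ⟨s + 1, by omega, hcvv⟩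
      · obtain ⟨j, hj, e⟩ := (h.mark_iff x hx).1 hm
        exact ⟨j, by omega, by rw [hcv j hj, e]⟩
    · rintro ⟨j, hj, e⟩
      split_ifs with hx'
      · simp
      · rcases (by omega : j < s ∨ j = s ∨ j = s + 1) with hj | rfl | rfl
        · exact (h.mark_iff x hx).2 ⟨j, hj, by rw [← hcv j hj, e]⟩
        · exact absurd (Or.inl (by rw [← e, hcvu])) hx'
        · exact absurd (Or.inr (by rw [← e, hcvv])) hx'
  half W hW := by
    rw [Finset.sum_range_succ, Finset.sum_range_succ, hcvu, hcvv]
    have h1 := h.half W hW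
    have h2 : ∑ j ∈ Finset.range s, (if cv' j ∈ W then 1 else 0) =
        ∑ j ∈ Finset.range s, if cv j ∈ W then 1 else 0 :=
      Finset.sum_congr rfl fun j hj => by rw [hcv j (Finset.mem_range.1 hj)]
    rw [h2]
    rcases hW.2 u hu v hv huv with h3 | h3
    · rw [if_pos h3]; omega
    · rw [if_pos h3]; omega

/-- The pairs of vertices before `(i, j)` have been considered for the matching. -/
structure MatchInv (I : Inst) (st : State) (i j : ℕ) (s' : State) : Prop where
  frame : Stored 20 2 6 (s'.reg 6) st s'
  matched : Matched I (s'.reg 6) (s'.arr 3) (s'.arr 2)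
  done : ∀ u < I.n, ∀ v < I.n, (u < i ∨ u = i ∧ v < j) → s'.arr 2 u = 0 → s'.arr 2 v = 0 →
    I.adjN u v = 0

theorem MatchInv.setReg {st s' : State} {i j r x : ℕ} (h : MatchInv I st i j s') (hr : 20 ≤ r) :
    MatchInv I st i j (s'.setReg r x) := by
  have e : (s'.setReg r x).reg 6 = s'.reg 6 := by simp; omega
  refine ⟨⟨rfl, fun r' hr' hne => ?_, h.frame.arr⟩, by rw [e]; exact h.matched, h.done⟩
  rw [State.setReg_reg, if_neg (by omega)]
  exact h.frame.reg r' hr' hne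

theorem MatchInv.graphMem {st s' : State} {i j ab : ℕ} (h : MatchInv I st i j s')
    (hg : GraphMem I ab st) : GraphMem I ab s' :=
  hg.agree le_rfl le_rfl (h.frame.agree (by omega) (by omega))

/-- Match the vertices in registers `20` and `21` if this is possible. -/
def matchProg : Prog :=
  .cond (.bin .mul (adjExpr (.reg 20) (.reg 21)) (.bin .mul
      (.bin .eq (.get 2 (.reg 20)) (.lit 0)) (.bin .eq (.get 2 (.reg 21)) (.lit 0))))
    (.seq (.put 3 (.reg 6) (.reg 20)) <|
      .seq (.put 3 (.bin .add (.reg 6) (.lit 1)) (.reg 21)) <|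
      .seq (.put 2 (.reg 20) (.lit 1)) <| .seq (.put 2 (.reg 21) (.lit 1)) <|
      .set 6 (.bin .add (.reg 6) (.lit 2)))
    .skip

/-- Compute a maximal matching. -/
def coverProg : Prog := .seq (.set 6 (.lit 0)) (forEach 20 2 (forEach 21 2 matchProg))

variable {w N ab : ℕ} {st : State}

/-- Marks are never removed, so earlier pairs stay settled; afterwards `i` and `j` are non-adjacent
or one of them is marked. -/
theorem runs_match {i j : ℕ} {s' : State} (b : Bounds w I ab N) (h : GraphMem I ab st)
    (hi : i < I.n) (hj : j < I.n) (hs : MatchInv I st i j s') (h20 : s'.reg 20 = i)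
    (h21 : s'.reg 21 = j) :
    Runs w matchProg s' 40 fun s'' => s''.reg 20 = i ∧ s''.reg 21 = j ∧
      MatchInv I st i (j + 1) s'' := by
  have hn := b.n_le
  have hab := b.ab_le
  have h1 := b.one_lt
  have h2 := b.two_lt
  have hg := hs.graphMem h
  have hsle := hs.matched.s_le
  have hfi : (Expr.reg 20).Fits w s' := b.lt_of_le (by rw [h20]; omega)
  have hfj : (Expr.reg 21).Fits w s' := b.lt_of_le (by rw [h21]; omega)
  have hmi := hs.matched.mark_le i hi
  have hmj := hs.matched.mark_le j hj
  have hev : (Expr.bin .mul (adjExpr (.reg 20) (.reg 21)) (.bin .mul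
      (.bin .eq (.get 2 (.reg 20)) (.lit 0)) (.bin .eq (.get 2 (.reg 21)) (.lit 0)))).eval s' =
      I.adjN i j * ((if s'.arr 2 i = 0 then 1 else 0) * if s'.arr 2 j = 0 then 1 else 0) := by
    have := eval_adjExpr hg (e₁ := .reg 20) (e₂ := .reg 21) h20 h21 hi hj
    rw [Expr.eval, this]
    simp only [Expr.eval, Op.eval, h20, h21]
  refine Runs.mono (Runs.cond (T := 19)
    (fits_mul_of_le_one (fits_adjExpr b hg h20 h21 hi hj hfi hfj)
      (fits_mul_of_le_one (fits_eq ⟨hfi, ?_⟩ ?_ h1) (fits_eq ⟨hfj, ?_⟩ ?_ h1)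
        (Or.inl (eval_eq_le_one _ _ _))) (Or.inl ?_)) (fun hne => ?_) fun h0 => ?_)
    (by simp [Expr.cost, adjExpr]) fun _ h => h
  · simp only [Expr.eval, h20]; exact b.lt_of_le (by omega)
  · exact b.lt_of_le (Nat.zero_le _)
  · simp only [Expr.eval, h21]; exact b.lt_of_le (by omega)
  · exact b.lt_of_le (Nat.zero_le _)
  · rw [eval_adjExpr hg (e₁ := .reg 20) (e₂ := .reg 21) h20 h21 hi hj]
    exact I.adjN_le_one i j
  · rw [hev] at hne
    have hadj : I.adjN i j ≠ 0 := fun e => hne (by rw [e, zero_mul])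
    have hi0 : s'.arr 2 i = 0 := by
      by_contra e
      exact hne (by rw [if_neg e]; simp)
    have hj0 : s'.arr 2 j = 0 := by
      by_contra e
      exact hne (by rw [if_neg e]; simp)
    refine Runs.mono (T := 3 + (5 + (3 + (3 + 4))))
      (Q := fun s'' => s'' = ((((s'.setArr 3 (s'.reg 6) i).setArr 3 (s'.reg 6 + 1) j).setArr 2 i
        1).setArr 2 j 1).setReg 6 (s'.reg 6 + 2)) ?_ (by omega) ?_
    · refine Runs.seq (Runs.put (Q := fun s'' => s'' = s'.setArr 3 (s'.reg 6) i)
        (b.lt_of_le (by omega)) hfi (by simp only [Expr.eval, h20])) ?_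
      rintro _ rfl
      refine Runs.seq (Runs.put (Q := fun s'' => s'' =
        (s'.setArr 3 (s'.reg 6) i).setArr 3 (s'.reg 6 + 1) j) ⟨?_, h1, ?_⟩ hfj
        (by simp only [Expr.eval, Op.eval, State.setArr_reg, h21])) ?_
      · exact b.lt_of_le (by simp only [State.setArr_reg]; omega)
      · exact b.lt_of_le (by simp only [Expr.eval, Op.eval, State.setArr_reg]; omega)
      rintro _ rfl
      refine Runs.seq (Runs.put (Q := fun s'' => s'' =
        ((s'.setArr 3 (s'.reg 6) i).setArr 3 (s'.reg 6 + 1) j).setArr 2 i 1) hfi h1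
        (by simp only [Expr.eval, State.setArr_reg, h20])) ?_
      rintro _ rfl
      refine Runs.seq (Runs.put (Q := fun s'' => s'' =
        (((s'.setArr 3 (s'.reg 6) i).setArr 3 (s'.reg 6 + 1) j).setArr 2 i 1).setArr 2 j 1) hfj h1
        (by simp only [Expr.eval, State.setArr_reg, h21])) ?_
      rintro _ rfl
      refine Runs.set ⟨?_, h2, ?_⟩ rfl
      · exact b.lt_of_le (by simp only [State.setArr_reg]; omega)
      · exact b.lt_of_le (by simp only [Expr.eval, Op.eval, State.setArr_reg]; omega)
    · rintro _ rfl
      refine ⟨by simpa, by simpa, ⟨rfl, fun r hr hne => ?_, fun a ha => ?_⟩, ?_, ?_⟩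
      · simp [hne, hs.frame.reg r hr hne]
      · funext x
        simp only [State.setReg_arr, State.setArr_arr]
        rw [if_neg (by omega), if_neg (by omega), if_neg (by omega), if_neg (by omega),
          hs.frame.arr a ha]
      · rw [State.setReg_reg_self]
        refine hs.matched.step hi hj hadj hi0 hj0 (fun x hx => ?_) ?_ ?_ fun x => ?_
        · simp only [State.setReg_arr, State.setArr_arr]
          norm_num
          rw [if_neg (by omega), if_neg (by omega)]
        · simp
        · simp
        · simp only [State.setReg_arr, State.setArr_arr]
          norm_num
          split_ifs <;> first | rfl | omega
      · intro u hu v hv huv hu0 hv0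
        simp only [State.setReg_arr, State.setArr_arr, true_and] at hu0 hv0
        norm_num at hu0 hv0
        -- A vertex that is still unmarked is neither `i` nor `j`, so the pair just treated does not
        -- occur here.
        split_ifs at hu0 hv0 with a1 a2 a3 a4
        refine hs.done u hu v hv ?_ hu0 hv0
        omega
  · refine Runs.mono (Runs.skip (Q := fun s'' => s'' = s') rfl) (by omega) ?_
    rintro _ rfl
    refine ⟨h20, h21, hs.frame, hs.matched, fun u hu v hv huv hu0 hv0 => ?_⟩
    rcases (by omega : (u < i ∨ u = i ∧ v < j) ∨ (u = i ∧ v = j)) with h' | ⟨rfl, rfl⟩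
    · exact hs.done u hu v hv h' hu0 hv0
    · rw [hev, hu0, hv0] at h0
      simpa using h0

/-- After all pairs have been tried, the unmarked vertices are independent: the matching is maximal
and its endpoints form a cover. Its size is at most twice that of any other cover. -/
theorem runs_cover (b : Bounds w I ab N) (h : GraphMem I ab st) (h0 : ∀ v < I.n, st.arr 2 v = 0) :
    Runs w coverProg st ((I.n + 1) * ((I.n + 1) * 80)) fun s' => Stored 20 2 6 (s'.reg 6) st s' ∧
      ∃ c : I.Cover, CoverMem I c ab s' ∧ ∀ W, I.Covers W → c.s ≤ 2 * W.card := by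
  have hn := b.n_le
  have hNw : I.n < 2 ^ w := b.lt_of_le (by omega)
  refine Runs.mono (T := 2 + (I.n + 1) * ((I.n + 1) * (40 + 10) + 10))
    (Q := fun s' => s'.reg 20 = I.n ∧ MatchInv I st I.n 0 s') ?_
    (by nlinarith [Nat.zero_le I.n]) ?_
  · refine Runs.seq (Runs.set (Q := fun s' => s' = st.setReg 6 0) ?_ rfl) ?_
    · exact b.lt_of_le (Nat.zero_le _)
    rintro _ rfl
    refine Runs.forEach (fun i s' => s'.reg 20 = i ∧ MatchInv I st i 0 s') hNw b.one_le ?_ ?_ ?_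
    · rintro i s' ⟨h20, hs⟩
      exact ⟨(hs.graphMem h).r2, h20⟩
    · refine ⟨by simp, MatchInv.setReg ⟨⟨rfl, fun r hr hne => by simp [hne], fun a ha => rfl⟩,
        ?_, ?_⟩ le_rfl⟩
      · simpa using Matched.zero h0
      · intro u hu v hv h'
        omega
    · rintro i hi s' ⟨h20, hs⟩
      refine Runs.mono (Runs.forEach (fun j s' => s'.reg 20 = i ∧ s'.reg 21 = j ∧
        MatchInv I st i j s') hNw b.one_le ?_ ?_ ?_) le_rfl ?_
      · rintro j s₁ ⟨-, h21, hs₁⟩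
        exact ⟨(hs₁.graphMem h).r2, h21⟩
      · exact ⟨by simpa, by simp, hs.setReg (by omega)⟩
      · rintro j hj s₁ ⟨h20₁, h21, hs₁⟩
        refine Runs.mono (runs_match b h hi hj hs₁ h20₁ h21) le_rfl ?_
        rintro s₂ ⟨h20₂, h21₂, hs₂⟩
        exact ⟨h21₂, by simpa, by simp, hs₂.setReg (by omega)⟩
      · rintro s₁ ⟨h20₁, -, hs₁⟩
        refine ⟨h20₁, by simp, MatchInv.setReg ⟨hs₁.frame, hs₁.matched, ?_⟩ le_rfl⟩
        intro u hu v hv huv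
        exact hs₁.done u hu v hv (by omega)
  · rintro s' ⟨-, hs⟩
    refine ⟨hs.frame, ⟨s'.reg 6, s'.arr 3, s'.arr 2, hs.matched.mark_le, hs.matched.lt,
      hs.matched.inj, hs.matched.mark_iff, fun u hu v hv => hs.done u hu v hv (Or.inl hu)⟩,
      ⟨hs.graphMem h, rfl, fun _ _ => rfl, fun _ _ => rfl⟩,
      fun W hW => hs.matched.le_two_mul_card hW⟩

end

end FairCC

namespace FairCC
open WordRAM

/-! ### The encoding -/

/-- The list `l` is a block of `x` at position `p`. -/
def BlockAt (x : List Bool) (p : ℕ) (l : List Bool) : Prop :=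
  ∀ i < l.length, x[p + i]? = l[i]?

section
variable {x l l' : List Bool} {p : ℕ}

theorem blockAt_append :
    BlockAt x p (l ++ l') ↔ BlockAt x p l ∧ BlockAt x (p + l.length) l' := by
  constructor
  · refine fun h => ⟨fun i hi => ?_, fun i hi => ?_⟩
    · rw [h i (by rw [List.length_append]; omega), List.getElem?_append_left hi]
    · rw [add_assoc, h _ (by rw [List.length_append]; omega),
        List.getElem?_append_right (by omega), Nat.add_sub_cancel_left]
  · rintro ⟨h, h'⟩ i hi
    rw [List.length_append] at hi
    by_cases hil : i < l.length
    · rw [h i hil, List.getElem?_append_left hil]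
    · rw [List.getElem?_append_right (by omega), ← h' _ (by omega)]
      congr 1
      omega

theorem BlockAt.eq (h : BlockAt x 0 l) (hl : x.length = l.length) : x = l := by
  refine List.ext_getElem? fun i => ?_
  by_cases hi : i < l.length
  · simpa using h i hi
  · rw [List.getElem?_eq_none (by omega), List.getElem?_eq_none (by omega)]

theorem length_flatMap_range (g : ℕ → List Bool) (m : ℕ) :
    ((List.range m).flatMap g).length = ∑ u ∈ Finset.range m, (g u).length := by
  induction m with
  | zero => simp
  | succ m ih => rw [List.range_succ, List.flatMap_append, List.length_append, ih,
      Finset.sum_range_succ, List.flatMap_singleton]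

theorem blockAt_flatMap {g : ℕ → List Bool} {n : ℕ} :
    BlockAt x p ((List.range n).flatMap g) ↔
      ∀ v < n, BlockAt x (p + ∑ u ∈ Finset.range v, (g u).length) (g v) := by
  induction n with
  | zero => simp [BlockAt]
  | succ n ih =>
    rw [List.range_succ, List.flatMap_append, blockAt_append, List.flatMap_singleton,
      length_flatMap_range, Nat.forall_lt_succ_right]
    exact and_congr_left' ih

theorem blockAt_map {f : ℕ → Bool} {n : ℕ} :
    BlockAt x p ((List.range n).map f) ↔ ∀ i < n, x[p + i]? = some (f i) := by
  simp only [BlockAt, List.length_map, List.length_range]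
  refine forall_congr' fun i => forall_congr' fun hi => ?_
  rw [List.getElem?_map, List.getElem?_range hi, Option.map_some]

theorem blockAt_unary {a : ℕ} : BlockAt x p (unary a) ↔
    (∀ i < a, x[p + i]? = some true) ∧ x[p + a]? = some false := by
  unfold unary
  rw [blockAt_append, List.length_replicate]
  refine and_congr ?_ ?_
  · simp only [BlockAt, List.length_replicate]
    refine forall_congr' fun i => forall_congr' fun hi => ?_
    rw [List.getElem?_replicate, if_pos hi]
  · simp [BlockAt]

theorem length_unary (a : ℕ) : (unary a).length = a + 1 := by simp [unary]

/-- The last entry is the most significant bit, so the condition excludes leading zeros; the empty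
list encodes `0`. -/
theorem exists_bits (l : List Bool) (h : ∀ hl : l ≠ [], l.getLast hl = true) :
    ∃ b : ℕ, b.bits = l := by
  induction l with
  | nil => exact ⟨0, by simp⟩
  | cons a l ih =>
    by_cases hl : l = []
    · subst hl
      have : a = true := by simpa using h (by simp)
      exact ⟨1, by simp [this]⟩
    · obtain ⟨b, hb⟩ := ih fun _ => by
        have := h (by simp)
        rwa [List.getLast_cons hl] at this
      refine ⟨Nat.bit a b, ?_⟩
      rw [Nat.bits_append_bit _ _ fun h0 => ?_, hb]
      subst h0
      simp at hb
      exact (hl hb).elim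

theorem getD_eq_true {i : ℕ} : x.getD i false = true ↔ x[i]? = some true := by
  rw [List.getD_eq_getElem?_getD]
  cases h : x[i]? <;> simp

theorem getElem?_eq_some_false {i : ℕ} :
    x[i]? = some false ↔ i < x.length ∧ x.getD i false = false := by
  rw [List.getD_eq_getElem?_getD]
  by_cases hi : i < x.length
  · simp [hi]
  · rw [List.getElem?_eq_none (by omega)]
    simp [hi]

end

open Classical in
theorem Inst.encode_eq (I : Inst) : I.encode = unary I.n ++ unary I.κ ++
    (List.range I.n).flatMap (fun v => unary (I.colN v)) ++
    (List.range I.n).flatMap (fun u => (List.range I.n).map fun v => decide (I.adjN u v ≠ 0)) ++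
    I.budget.bits := by
  unfold Inst.encode
  congr 2
  · congr 1
    rw [← List.map_coe_finRange_eq_range, List.flatMap_map]
    refine List.flatMap_congr fun v _ => ?_
    rw [Inst.colN_eq]
  · rw [← List.map_coe_finRange_eq_range, List.flatMap_map]
    refine List.flatMap_congr fun u _ => ?_
    rw [List.map_map]
    refine List.map_congr_left fun v _ => ?_
    rw [Function.comp_apply, decide_eq_decide, Inst.adjN_ne_zero]

/-- `u` is the number of ones from position `p` on, counted up to `m`. -/
structure ReadSpec (x : List Bool) (p m u : ℕ) : Prop where
  le : u ≤ m
  one : ∀ i < u, x.getD (p + i) false = true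
  zero : u < m → x.getD (p + u) false = false

section
variable {x : List Bool} {p m u : ℕ}

theorem exists_readSpec (x : List Bool) (p m : ℕ) : ∃ u, ReadSpec x p m u := by
  by_cases h : ∃ u, x.getD (p + u) false = false ∧ u < m
  · classical
    refine ⟨Nat.find h, (Nat.find_spec h).2.le, fun i hi => ?_, fun _ => (Nat.find_spec h).1⟩
    have := Nat.find_min h hi
    have h2 := (Nat.find_spec h).2
    by_contra hc
    exact this ⟨by simpa using hc, by omega⟩
  · push Not at h
    refine ⟨m, le_rfl, fun i hi => ?_, fun h' => absurd h' (lt_irrefl _)⟩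
    by_contra hc
    have := h i (by simpa using hc)
    omega

/-- The cap `m` makes reading end soon even on malformed input. On a genuine unary block the result
is the number, cut off at `m`. -/
theorem ReadSpec.eq (h : ReadSpec x p m u) {a : ℕ} (ha : BlockAt x p (unary a)) :
    u = min a m := by
  rw [blockAt_unary, getElem?_eq_some_false] at ha
  have h1 := h.le
  rcases lt_trichotomy u (min a m) with hu | hu | hu
  · have := h.zero (by omega)
    rw [getD_eq_true.2 (ha.1 u (by omega))] at this
    cases this
  · exact hu
  · have := h.one a (by omega)
    rw [ha.2.2] at this
    cases this

theorem ReadSpec.unique {u' : ℕ} (h : ReadSpec x p m u) (h' : ReadSpec x p m u') : u = u' := by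
  have h1 := h.le
  have h2 := h'.le
  rcases lt_trichotomy u u' with hu | hu | hu
  · have := h.zero (by omega)
    rw [h'.one u hu] at this
    cases this
  · exact hu
  · have := h'.zero (by omega)
    rw [h.one u' hu] at this
    cases this

/-- Reading ended before the cap and inside the string, so it met a real zero and not the default
value beyond the end. -/
theorem ReadSpec.blockAt (h : ReadSpec x p m u) (hu : u < m) (hp : p + u < x.length) :
    BlockAt x p (unary u) :=
  blockAt_unary.2 ⟨fun i hi => getD_eq_true.1 (h.one i hi),
    getElem?_eq_some_false.2 ⟨hp, h.zero hu⟩⟩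

end

/-- The position of the color of vertex `v`. -/
def colPos (n κ : ℕ) (col : ℕ → ℕ) (v : ℕ) : ℕ := n + κ + 2 + ∑ u ∈ Finset.range v, (col u + 1)

/-- The numbers read from the bit string `x`, which may be no encoding. -/
structure Reading (x : List Bool) (n κ : ℕ) (col : ℕ → ℕ) : Prop where
  size : ReadSpec x 0 x.length n
  colors : ReadSpec x (n + 1) (n + 1) κ
  color : ∀ v < n, ReadSpec x (colPos n κ col v) κ (col v)

/-- The bit string is an encoding. -/
structure Valid (x : List Bool) (n κ : ℕ) (col : ℕ → ℕ) : Prop where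
  κ_lt : κ < n + 1
  col_lt : ∀ v < n, col v < κ
  length : colPos n κ col n + n * n ≤ x.length
  last : colPos n κ col n + n * n = x.length ∨ x.getD (x.length - 1) false = true
  symm : ∀ u < n, ∀ v < n, x.getD (colPos n κ col n + (u * n + v)) false =
    x.getD (colPos n κ col n + (v * n + u)) false
  irrefl : ∀ u < n, x.getD (colPos n κ col n + (u * n + u)) false = false

theorem colPos_le {n κ : ℕ} {col : ℕ → ℕ} {v : ℕ} (hv : v < n) :
    colPos n κ col v + col v + 1 ≤ colPos n κ col n := by
  have : ∑ u ∈ Finset.range (v + 1), (col u + 1) ≤ ∑ u ∈ Finset.range n, (col u + 1) :=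
    Finset.sum_le_sum_of_subset (Finset.range_mono hv)
  rw [Finset.sum_range_succ] at this
  unfold colPos
  omega

/-- The instance is in memory at the places described by the encoding. -/
structure Layout (x : List Bool) (n κ : ℕ) (col : ℕ → ℕ) (I : Inst) : Prop where
  n_eq : n = I.n
  κ_eq : κ = I.κ
  col_eq : ∀ v < n, col v = I.colN v
  adj : ∀ u < n, ∀ v < n, (x.getD (colPos n κ col n + (u * n + v)) false).toNat = I.adjN u v
  length : x.length = colPos n κ col n + n * n + I.budget.size
  bit : ∀ i < I.budget.size,
    x.getD (colPos n κ col n + n * n + i) false = I.budget.testBit i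

theorem BlockAt.refl (x : List Bool) : BlockAt x 0 x := fun i _ => by rw [zero_add]

/-- In an encoding no number is cut off by its cap, since `κ ≤ n < n + 1` and colors are below `κ`;
so the numbers read are those of the instance, and all blocks are where they are expected. -/
theorem Reading.layout {n κ : ℕ} {col : ℕ → ℕ} {I : Inst} (h : Reading I.encode n κ col) :
    Layout I.encode n κ col I ∧ Valid I.encode n κ col := by
  classical
  set x := I.encode with hx
  have hb := BlockAt.refl x
  nth_rw 2 [hx] at hb
  have hlen : x.length = _ := congrArg List.length I.encode_eq
  rw [I.encode_eq] at hb
  simp only [blockAt_append, List.length_append, length_unary, zero_add] at hb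
  simp only [List.length_append, length_unary, length_flatMap_range, List.length_map,
    List.length_range, Finset.sum_const, Finset.card_range, smul_eq_mul, Nat.size_eq_bits_len]
    at hlen
  obtain ⟨⟨⟨⟨hbn, hbκ⟩, hbc⟩, hbm⟩, hbb⟩ := hb
  have hn : n = I.n := by
    rw [h.size.eq hbn]
    omega
  have hκ : κ = I.κ := by
    rw [h.colors.eq (a := I.κ) (by rwa [hn])]
    have := I.κ_le
    omega
  rw [blockAt_flatMap] at hbc
  simp only [length_unary] at hbc
  -- Strong induction, because the position of a color depends on all earlier colors.
  have hcol : ∀ v < n, col v = I.colN v := by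
    intro v
    induction v using Nat.strong_induction_on with
    | _ v ih =>
      intro hv
      have e : colPos n κ col v = I.n + 1 + (I.κ + 1) + ∑ u ∈ Finset.range v, (I.colN u + 1) := by
        unfold colPos
        rw [Finset.sum_congr rfl fun u hu => by
          rw [ih u (Finset.mem_range.1 hu) ((Finset.mem_range.1 hu).trans hv)], hn, hκ]
        ring
      have := (h.color v hv).eq (a := I.colN v) (by rw [e]; exact hbc v (hn ▸ hv))
      have h2 := I.colN_lt (hn ▸ hv)
      omega
  have hpos : colPos n κ col n = I.n + 1 + (I.κ + 1) + ∑ u ∈ Finset.range I.n, (I.colN u + 1) := by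
    unfold colPos
    rw [Finset.sum_congr rfl fun u hu => by rw [hcol u (Finset.mem_range.1 hu)], hn, hκ]
    ring
  rw [length_flatMap_range] at hbm hbb
  rw [length_flatMap_range] at hbb
  simp only [length_unary, ← hpos] at hbm hbb hlen
  simp only [List.length_map, List.length_range, Finset.sum_const, Finset.card_range,
    smul_eq_mul] at hbb
  rw [blockAt_flatMap] at hbm
  have hcell : ∀ u < n, ∀ v < n,
      x.getD (colPos n κ col n + (u * n + v)) false = decide (I.adjN u v ≠ 0) := by
    intro u hu v hv
    have := hbm u (hn ▸ hu)
    rw [blockAt_map] at this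
    have := this v (hn ▸ hv)
    simp only [List.length_map, List.length_range, Finset.sum_const, Finset.card_range,
      smul_eq_mul, ← hn] at this
    rw [List.getD_eq_getElem?_getD, ← add_assoc, this, Option.getD_some]
  rw [← hn] at hlen hbb
  have hbit : ∀ i < I.budget.size,
      x.getD (colPos n κ col n + n * n + i) false = I.budget.testBit i := by
    intro i hi
    rw [← Nat.size_eq_bits_len] at hi
    rw [List.getD_eq_getElem?_getD, hbb i hi, Nat.testBit_eq_inth, List.getI_eq_getElem _ hi,
      List.getElem?_eq_getElem hi, Option.getD_some]
  refine ⟨⟨hn, hκ, hcol, fun u hu v hv => ?_, by rw [hlen], hbit⟩, ?_, ?_, ?_, ?_, ?_, ?_⟩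
  · rw [hcell u hu v hv]
    have := I.adjN_le_one u v
    by_cases h0 : I.adjN u v = 0
    · simp [h0]
    · simp [h0]; omega
  · have := I.κ_le
    omega
  · intro v hv
    rw [hcol v hv, hκ]
    exact I.colN_lt (hn ▸ hv)
  · omega
  -- A budget of `0` has no bits at all; otherwise the final bit of the string is the most
  -- significant bit of the budget, which is one.
  · rcases Nat.eq_zero_or_pos I.budget.size with h0 | h0
    · left
      omega
    · right
      have h1 := hbit (I.budget.size - 1) (by omega)
      rw [show colPos n κ col n + n * n + (I.budget.size - 1) = x.length - 1 by omega] at h1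
      rw [h1]
      have h2 : I.budget < 2 ^ (I.budget.size - 1 + 1) := by
        rw [Nat.sub_add_cancel h0]
        exact Nat.lt_size_self _
      have h3 : 2 ^ (I.budget.size - 1) ≤ I.budget := Nat.lt_size.1 (by omega)
      rw [Nat.testBit_eq_decide_div_mod_eq, decide_eq_true_eq]
      rw [pow_succ] at h2
      have : I.budget / 2 ^ (I.budget.size - 1) = 1 :=
        Nat.div_eq_of_lt_le (by omega) (by omega)
      rw [this]
  · intro u hu v hv
    rw [hcell u hu v hv, hcell v hv u hu, I.adjN_comm]
  · intro u hu
    rw [hcell u hu u hu, I.adjN_self]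
    rfl

/-- The conditions in `Valid` are complete: they are just what is needed to assemble an instance
from the numbers read, and its encoding agrees with `x` block by block and in length. -/
theorem Reading.exists_inst {x : List Bool} {n κ : ℕ} {col : ℕ → ℕ} (h : Reading x n κ col)
    (hv : Valid x n κ col) : ∃ I : Inst, I.encode = x := by
  classical
  set ab := colPos n κ col n with hab
  obtain ⟨B, hB⟩ := exists_bits (x.drop (ab + n * n)) fun hl => by
    have hlen := List.length_pos_iff.2 hl
    rw [List.length_drop] at hlen
    rw [List.getLast_drop]
    rcases hv.last with h1 | h1
    · omega
    · rw [List.getLast_eq_getElem]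
      rw [getD_eq_true, List.getElem?_eq_getElem (by omega)] at h1
      simpa using h1
  let I : Inst :=
    { n := n
      graph :=
        { Adj := fun u v => x.getD (ab + (u * n + v)) false = true
          symm := ⟨fun u v huv => by rw [hv.symm v v.2 u u.2]; exact huv⟩
          loopless := ⟨fun u hu => by rw [hv.irrefl u u.2] at hu; cases hu⟩ }
      budget := B
      κ := κ
      κ_le := by have := hv.κ_lt; omega
      color := fun v => ⟨col v, hv.col_lt v v.2⟩ }
  have hcol : ∀ v < n, I.colN v = col v := fun v hv' => I.colN_eq ⟨v, hv'⟩
  have hadj : ∀ u < n, ∀ v < n,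
      decide (I.adjN u v ≠ 0) = x.getD (ab + (u * n + v)) false := by
    intro u hu v hv'
    have : I.adjN u v ≠ 0 ↔ _ := I.adjN_ne_zero (u := ⟨u, hu⟩) (v := ⟨v, hv'⟩)
    rw [Bool.eq_iff_iff, decide_eq_true_eq, this]
  have hlen := hv.length
  have hpos : n + 1 + (κ + 1) + ∑ u ∈ Finset.range n, (I.colN u + 1) = ab := by
    rw [hab]
    unfold colPos
    rw [Finset.sum_congr rfl fun u hu => by rw [hcol u (Finset.mem_range.1 hu)]]
    ring
  have hge : n + κ + 2 ≤ ab := Nat.le_add_right _ _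
  refine ⟨I, (BlockAt.eq ?_ ?_).symm⟩
  · rw [I.encode_eq]
    simp only [blockAt_append, List.length_append, length_unary, zero_add,
      length_flatMap_range, List.length_map, List.length_range, Finset.sum_const,
      Finset.card_range, smul_eq_mul]
    change (((_ ∧ BlockAt x (n + 1) (unary κ)) ∧ BlockAt x (n + 1 + (κ + 1)) _) ∧
      BlockAt x (n + 1 + (κ + 1) + ∑ u ∈ Finset.range n, (I.colN u + 1)) _) ∧
      BlockAt x (n + 1 + (κ + 1) + ∑ u ∈ Finset.range n, (I.colN u + 1) + n * n) B.bits
    rw [hpos]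
    refine ⟨⟨⟨⟨h.size.blockAt (show n < _ by omega) (show 0 + n < _ by omega),
      h.colors.blockAt hv.κ_lt (by omega)⟩, ?_⟩, ?_⟩, ?_⟩
    · rw [blockAt_flatMap]
      intro v hv'
      have hle : colPos n κ col v + col v + 1 ≤ ab := colPos_le hv'
      have e : colPos n κ col v =
          n + 1 + (κ + 1) + ∑ u ∈ Finset.range v, (unary (I.colN u)).length := by
        unfold colPos
        rw [Finset.sum_congr rfl fun u hu => show (unary (I.colN u)).length = col u + 1 by
          rw [length_unary, hcol u ((Finset.mem_range.1 hu).trans hv')]]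
        ring
      rw [← e, hcol v hv']
      exact (h.color v hv').blockAt (hv.col_lt v hv') (by omega)
    · rw [blockAt_flatMap]
      intro u hu
      rw [blockAt_map]
      intro v hv'
      simp only [List.length_map, List.length_range, Finset.sum_const, Finset.card_range,
        smul_eq_mul]
      rw [hadj u hu v hv', add_assoc]
      have hi : u * n + v < n * n := index_lt hu hv'
      have hi' : ab + (u * n + v) < x.length := by omega
      change x[ab + (u * n + v)]? = _
      rw [List.getElem?_eq_getElem hi', List.getD_eq_getElem _ _ hi']
    · intro i hi
      rw [hB, List.getElem?_drop]
  · rw [I.encode_eq]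
    simp only [List.length_append, length_unary, length_flatMap_range, List.length_map,
      List.length_range, Finset.sum_const, Finset.card_range, smul_eq_mul]
    change _ = n + 1 + (κ + 1) + ∑ u ∈ Finset.range n, (I.colN u + 1) + n * n + B.bits.length
    rw [hpos, hB, List.length_drop]
    omega

end FairCC

namespace FairCC
open WordRAM

/-! ### Reading the input -/

/-- Read a number of at most the value of register `m` in unary, from the position in register
`4` on, into register `20`. -/
def readProg (m : ℕ) : Prog :=
  .seq (.set 20 (.lit 0)) <|
  .seq (.loop (.bin .mul (.get 0 (.reg 4)) (.bin .lt (.reg 20) (.reg m))) <|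
    .seq (.set 20 (.bin .add (.reg 20) (.lit 1))) (.set 4 (.bin .add (.reg 4) (.lit 1)))) <|
  .set 4 (.bin .add (.reg 4) (.lit 1))

/-- Word length `w` for numbers bounded by powers of `N`. -/
structure WordBound (w N : ℕ) : Prop where
  two_le : 2 ≤ N
  pow_le : N ^ 10 ≤ 2 ^ w

namespace WordBound
variable {w N : ℕ} (b : WordBound w N)
include b

theorem lt_of_le_pow (k : ℕ) {x : ℕ} (hx : x ≤ N ^ k) (hk : k < 10) : x < 2 ^ w :=
  hx.trans_lt ((Nat.pow_lt_pow_right b.two_le hk).trans_le b.pow_le)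

theorem lt_of_le {x : ℕ} (hx : x ≤ N) : x < 2 ^ w := b.lt_of_le_pow 1 (by simpa) (by omega)

theorem one_lt : 1 < 2 ^ w := b.lt_of_le (by have := b.two_le; omega)

theorem one_le : 1 ≤ w := by
  have := b.one_lt
  by_contra h
  obtain rfl : w = 0 := by omega
  simp at this

end WordBound

/-- The bits of `x` are in memory. -/
def BitsMem (x : List Bool) (st : State) : Prop :=
  ∀ i, st.arr 0 i = (x.getD i false).toNat

/-- The effect of reading a number at position `p`. -/
structure ReadPost (x : List Bool) (p M : ℕ) (st s' : State) : Prop where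
  spec : ReadSpec x p M (s'.reg 20)
  pos : s'.reg 4 = p + s'.reg 20 + 1
  reg : ∀ r, r ≠ 20 → r ≠ 4 → s'.reg r = st.reg r
  arr : s'.arr = st.arr

section
variable {w N : ℕ} {x : List Bool} {st : State}

/-- The loop ends at a zero or at the cap. In both cases one more cell is skipped, so the new
position is `p + u + 1` on malformed input too. -/
theorem runs_read (b : WordBound w N) (hx : BitsMem x st) {m M p u : ℕ} (hm : m ≠ 20) (hm' : m ≠ 4)
    (hM : st.reg m = M) (hp : st.reg 4 = p) (hpN : p + M + 1 ≤ N ^ 8)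
    (hu : ReadSpec x p M u) :
    Runs w (readProg m) st ((u + 1) * 20) (ReadPost x p M st) := by
  have h1 := b.one_lt
  have hw : ∀ y, y ≤ p + M + 1 → y < 2 ^ w := fun y hy =>
    b.lt_of_le_pow 8 (hy.trans hpN) (by omega)
  have hle := hu.le
  let Inv : ℕ → State → Prop := fun i s' => i ≤ u ∧ s'.reg 20 = i ∧ s'.reg 4 = p + i ∧
    (∀ r, r ≠ 20 → r ≠ 4 → s'.reg r = st.reg r) ∧ s'.arr = st.arr
  have key : ∀ i s', Inv i s' →
      (Expr.bin .mul (.get 0 (.reg 4)) (.bin .lt (.reg 20) (.reg m))).Fits w s' ∧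
      (Expr.bin .mul (.get 0 (.reg 4)) (.bin .lt (.reg 20) (.reg m))).eval s' =
        (x.getD (p + i) false).toNat * if i < M then 1 else 0 := by
    rintro i s' ⟨hi, e20, e4, hr, ha⟩
    have em : s'.reg m = M := by rw [hr m hm hm', hM]
    have hb : s'.arr 0 (p + i) = (x.getD (p + i) false).toNat := by rw [ha, hx]
    have hb1 : (x.getD (p + i) false).toNat ≤ 1 := Bool.toNat_le _
    constructor
    · refine fits_mul_of_le_one ⟨?_, ?_⟩ (fits_lt ?_ ?_ h1) (Or.inr (eval_lt_le_one _ _ _))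
      · rw [Expr.Fits, e4]; exact hw _ (by omega)
      · simp only [Expr.eval, e4, hb]; omega
      · rw [Expr.Fits, e20]; exact hw _ (by omega)
      · rw [Expr.Fits, em]; exact hw _ (by omega)
    · simp only [Expr.eval, Op.eval, e20, e4, em, hb]
  refine Runs.mono (T := 2 + ((u * (4 + 4 + 6 + 1) + 6 + 1) + 4)) (Q := ReadPost x p M st) ?_
    (by nlinarith) fun _ h => h
  refine Runs.seq (Runs.set (Q := Inv 0) (by simp [Expr.Fits]) ?_) fun s₁ h₁ => ?_
  · refine ⟨Nat.zero_le _, by simp [Expr.eval], by simpa, fun r hr hr' => by simp [hr], rfl⟩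
  refine Runs.seq (Runs.loop Inv (fun i hi s' hs' => ?_) (fun s' hs' => ?_) h₁) fun s₂ h₂ => ?_
  · obtain ⟨f, e⟩ := key i s' hs'
    refine ⟨f, by rw [e, hu.one i hi, if_pos (by omega)]; decide, ?_⟩
    obtain ⟨-, e20, e4, hr, ha⟩ := hs'
    refine Runs.seq (Runs.set (Q := fun s₃ => s₃ = s'.setReg 20 (i + 1)) ⟨?_, h1, ?_⟩ ?_) ?_
    · rw [Expr.Fits, e20]; exact hw _ (by omega)
    · simp only [Expr.eval, Op.eval, e20]; exact hw _ (by omega)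
    · simp only [Expr.eval, Op.eval, e20]
    rintro _ rfl
    have e4' : (s'.setReg 20 (i + 1)).reg 4 = p + i := by simpa
    refine Runs.set ⟨?_, h1, ?_⟩ ⟨hi, by simp, ?_, fun r h20 h4 => ?_, ha⟩
    · rw [Expr.Fits, e4']; exact hw _ (by omega)
    · simp only [Expr.eval, Op.eval, e4']; exact hw _ (by omega)
    · simp only [Expr.eval, Op.eval, e4', State.setReg_reg_self]; omega
    · simp [h20, h4, hr r h20 h4]
  · obtain ⟨f, e⟩ := key u s' hs'
    refine ⟨f, ?_⟩
    rw [e]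
    by_cases huM : u < M
    · rw [hu.zero huM]; simp
    · rw [if_neg huM, mul_zero]
  · obtain ⟨-, e20, e4, hr, ha⟩ := h₂
    refine Runs.set ⟨?_, h1, ?_⟩ ⟨?_, ?_, fun r h20 h4 => ?_, ha⟩
    · rw [Expr.Fits, e4]; exact hw _ (by omega)
    · simp only [Expr.eval, Op.eval, e4]; exact hw _ (by omega)
    · simpa [e20] using hu
    · simp [Expr.eval, Op.eval, e4, e20]
    · simp [h4, hr r h20 h4]

/-- Read the colors. -/
def colorsProg : Prog :=
  forEach 21 2 <| .seq (readProg 3) <| .seq (.put 1 (.reg 21) (.reg 20))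
    (.set 16 (.bin .mul (.reg 16) (.bin .lt (.reg 20) (.reg 3))))

/-- The number of violations of symmetry and irreflexivity. -/
def matrixProg : Prog :=
  sumLoop 20 2 (sumLoop 22 2 (.set 24 (.bin .add
    (.bin .sub (.lit 1) (.bin .eq (adjExpr (.reg 21) (.reg 23)) (adjExpr (.reg 23) (.reg 21))))
    (.bin .mul (.bin .eq (.reg 21) (.reg 23)) (adjExpr (.reg 21) (.reg 23))))))

/-- Restrict the flag in register `16` by the value of an expression. -/
def checkProg (e : Expr) : Prog := .set 16 (.bin .mul (.reg 16) e)

/-- Read the input and set the flag in register `16` if it is an encoding. -/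
def parseProg : Prog :=
  .seq (.set 4 (.lit 0)) <| .seq (readProg 0) <| .seq (.set 2 (.reg 20)) <|
  .seq (.set 5 (.bin .add (.reg 2) (.lit 1))) <| .seq (readProg 5) <| .seq (.set 3 (.reg 20)) <|
  .seq (.set 16 (.bin .lt (.reg 3) (.reg 5))) <|
  .seq colorsProg <|
  .seq (.set 5 (.bin .add (.reg 4) (.bin .mul (.reg 2) (.reg 2)))) <|
  .seq (checkProg (.bin .lt (.reg 5) (.bin .add (.reg 0) (.lit 1)))) <|
  .seq (checkProg (.bin .lt (.lit 0) (.bin .add (.bin .eq (.reg 5) (.reg 0))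
    (.get 0 (.bin .sub (.reg 0) (.lit 1)))))) <|
  .seq matrixProg (checkProg (.bin .eq (.reg 20) (.lit 0)))

/-- The position of the input and the flag, when the colors before vertex `i` have been read. -/
structure ColorsInv (x : List Bool) (n κ : ℕ) (st : State) (i : ℕ) (s' : State) : Prop where
  r21 : s'.reg 21 = i
  r4 : s'.reg 4 = colPos n κ (s'.arr 1) i
  spec : ∀ v < i, ReadSpec x (colPos n κ (s'.arr 1) v) κ (s'.arr 1 v)
  flag : s'.reg 16 ≤ 1
  flag_iff : s'.reg 16 = 1 ↔ st.reg 16 = 1 ∧ ∀ v < i, s'.arr 1 v < κ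
  reg : ∀ r < 20, r ≠ 4 → r ≠ 16 → s'.reg r = st.reg r
  arr : ∀ a, a ≠ 1 → s'.arr a = st.arr a

theorem colPos_congr {n κ v : ℕ} {col col' : ℕ → ℕ} (h : ∀ u < v, col u = col' u) :
    colPos n κ col v = colPos n κ col' v := by
  unfold colPos
  rw [Finset.sum_congr rfl fun u hu => by rw [h u (Finset.mem_range.1 hu)]]

theorem colPos_succ (n κ v : ℕ) (col : ℕ → ℕ) :
    colPos n κ col (v + 1) = colPos n κ col v + col v + 1 := by
  unfold colPos
  rw [Finset.sum_range_succ]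
  ring

theorem colPos_le_of_le {n κ : ℕ} {col : ℕ → ℕ} (hcol : ∀ v < n, col v ≤ κ) {v : ℕ} (hv : v ≤ n) :
    colPos n κ col v ≤ n + κ + 2 + n * (κ + 1) := by
  unfold colPos
  have : ∑ u ∈ Finset.range v, (col u + 1) ≤ n * (κ + 1) :=
    calc _ ≤ ∑ u ∈ Finset.range v, (κ + 1) := Finset.sum_le_sum fun u hu => by
          have := hcol u ((Finset.mem_range.1 hu).trans_le hv)
          omega
      _ = v * (κ + 1) := by simp
      _ ≤ _ := Nat.mul_le_mul_right _ hv
  omega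

/-- On malformed input positions may lie beyond the end of the string, but they remain polynomial in
`n` and fit into words. -/
theorem read_pos_le {n κ : ℕ} (hn : n + 2 ≤ N) (hκ : κ ≤ n + 1) :
    n + κ + 2 + n * (κ + 1) + n * n + κ + 1 ≤ N ^ 4 := by
  have h1 : n * (κ + 1) ≤ n * (n + 2) := Nat.mul_le_mul_left _ (by omega)
  calc _ ≤ (n + 2) ^ 4 := by
        have : n + (n + 1) + 2 + n * (n + 2) + n * n + (n + 1) + 1 ≤ (n + 2) ^ 4 := by
          ring_nf; nlinarith [Nat.zero_le (n ^ 3), Nat.zero_le (n ^ 4)]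
        omega
    _ ≤ _ := Nat.pow_le_pow_left hn 4

/-- A color equal to the cap `κ` is out of range. This clears the flag but does not stop the
reading, so the positions always obey `colPos`. -/
theorem runs_colors (b : WordBound w N) (hx : BitsMem x st) {n κ : ℕ} (h2 : st.reg 2 = n)
    (h3 : st.reg 3 = κ) (h4 : st.reg 4 = n + κ + 2) (hn : n + 2 ≤ N) (hκ : κ ≤ n + 1)
    (hf : st.reg 16 ≤ 1) :
    Runs w colorsProg st ((n + 1) * ((κ + 1) * 50)) (ColorsInv x n κ st n) := by
  have h1 := b.one_lt
  have hpos := read_pos_le hn hκ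
  have hN4 : N ^ 4 ≤ N ^ 8 := Nat.pow_le_pow_right (by omega) (by omega)
  have hw : ∀ y, y ≤ n + κ + 2 → y < 2 ^ w := fun y hy =>
    b.lt_of_le_pow 4 (hy.trans (by omega)) (by omega)
  refine Runs.mono (Runs.forEach (ColorsInv x n κ st) (T := (κ + 1) * 20 + (3 + 6))
    (hw _ (by omega))
    b.one_le (fun i s' h => ⟨?_, h.r21⟩) ?_ fun i hi s' h => ?_) ?_ fun _ h => h
  · rw [h.reg 2 (by omega) (by omega) (by omega), h2]
  · refine ⟨by simp, by simp [h4, colPos], by simp, by simpa, by simp, fun r hr _ _ => ?_,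
      fun _ _ => rfl⟩
    rw [State.setReg_reg, if_neg (by omega)]
  · have hcolle : ∀ v < i, s'.arr 1 v ≤ κ := fun v hv => (h.spec v hv).le
    have hp : colPos n κ (s'.arr 1) i ≤ n + κ + 2 + n * (κ + 1) := by
      unfold colPos
      have : ∑ u ∈ Finset.range i, (s'.arr 1 u + 1) ≤ n * (κ + 1) :=
        calc _ ≤ ∑ u ∈ Finset.range i, (κ + 1) := Finset.sum_le_sum fun u hu => by
              have := hcolle u (Finset.mem_range.1 hu)
              omega
          _ = i * (κ + 1) := by simp
          _ ≤ _ := Nat.mul_le_mul_right _ hi.le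
      omega
    have hx' : BitsMem x s' := fun j => by rw [h.arr 0 (by omega), hx j]
    have e3 : s'.reg 3 = κ := by rw [h.reg 3 (by omega) (by omega) (by omega), h3]
    obtain ⟨u₀, hu₀⟩ := exists_readSpec x (colPos n κ (s'.arr 1) i) κ
    refine Runs.seq (T₁ := (κ + 1) * 20)
      ((runs_read b hx' (by omega) (by omega) e3 h.r4 (by omega) hu₀).mono
      (Nat.mul_le_mul_right _ (Nat.succ_le_succ hu₀.le)) fun _ h => h) fun s₁ k => ?_
    have hu := k.spec.le
    set u := s₁.reg 20 with hu'
    have e21 : s₁.reg 21 = i := by rw [k.reg 21 (by omega) (by omega), h.r21]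
    have e16 : s₁.reg 16 = s'.reg 16 := k.reg 16 (by omega) (by omega)
    have e3' : s₁.reg 3 = κ := by rw [k.reg 3 (by omega) (by omega), e3]
    have hflag := h.flag
    refine Runs.seq (Runs.put (Q := fun s₂ => s₂ = s₁.setArr 1 i u) ?_ ?_ ?_) ?_
    · rw [Expr.Fits, e21]; exact hw _ (by omega)
    · rw [Expr.Fits]; exact hw _ (by omega)
    · simp only [Expr.eval, e21, ← hu']
    rintro _ rfl
    have hnew : ∀ v < i, (s₁.setArr 1 i u).arr 1 v = s'.arr 1 v := fun v hv => by
      rw [State.setArr_arr, if_neg (by omega), k.arr]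
    have hnewi : (s₁.setArr 1 i u).arr 1 i = u := by simp
    refine Runs.set (fits_mul_of_le_one ?_ (fits_lt ?_ ?_ h1) (Or.inr (eval_lt_le_one _ _ _)))
      ⟨?_, ?_, ?_, ?_, ?_, ?_, fun r hr hr4 hr16 => ?_, fun a ha => ?_⟩
    · rw [Expr.Fits, State.setArr_reg, e16]; omega
    · rw [Expr.Fits, State.setArr_reg]; exact hw _ (by omega)
    · rw [Expr.Fits, State.setArr_reg, e3']; exact hw _ (by omega)
    · simpa
    · simp
    · rw [State.setReg_reg, if_neg (by omega), State.setReg_reg, if_neg (by omega),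
        State.setArr_reg, State.setReg_arr, State.setReg_arr, colPos_succ, hnewi,
        colPos_congr hnew, k.pos]
    · intro v hv
      rw [State.setReg_arr, State.setReg_arr]
      rcases (by omega : v < i ∨ v = i) with hv | rfl
      · rw [hnew v hv, colPos_congr fun u hu => hnew u (hu.trans hv)]
        exact h.spec v hv
      · rw [hnewi, colPos_congr hnew]
        exact k.spec
    · rw [State.setReg_reg, if_neg (by omega), State.setReg_reg_self]
      simp only [Expr.eval, Op.eval, State.setArr_reg, e16]
      exact Nat.mul_le_mul hflag
        (by split_ifs <;> omega : (if s₁.reg 20 < s₁.reg 3 then 1 else 0) ≤ 1)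
    · rw [State.setReg_reg, if_neg (by omega), State.setReg_reg_self, State.setReg_arr,
        State.setReg_arr, Nat.forall_lt_succ_right, hnewi]
      simp only [Expr.eval, Op.eval, State.setArr_reg, e16, ← hu', e3']
      have hc : (∀ v < i, (s₁.setArr 1 i u).arr 1 v < κ) ↔ ∀ v < i, s'.arr 1 v < κ :=
        forall_congr' fun v => forall_congr' fun hv => by rw [hnew v hv]
      rw [hc, ← and_assoc, ← h.flag_iff]
      split_ifs with hlt
      · simp [hlt]
      · simp [hlt]
    · rw [State.setReg_reg, if_neg (by omega), State.setReg_reg, if_neg (by omega),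
        State.setArr_reg, k.reg r (by omega) (by omega), h.reg r hr hr4 hr16]
    · rw [State.setReg_arr, State.setReg_arr]
      funext j
      rw [State.setArr_arr, if_neg (by omega), k.arr, h.arr a ha]
  · nlinarith [Nat.zero_le (n * κ)]

/-- The contribution of two vertices to the number of violations. -/
def matrixBad (x : List Bool) (n ab u v : ℕ) : ℕ :=
  (1 - if (x.getD (ab + (u * n + v)) false).toNat = (x.getD (ab + (v * n + u)) false).toNat
    then 1 else 0) + (if u = v then 1 else 0) * (x.getD (ab + (u * n + v)) false).toNat

theorem matrixBad_le (x : List Bool) (n ab u v : ℕ) : matrixBad x n ab u v ≤ 2 := by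
  unfold matrixBad
  have : (x.getD (ab + (u * n + v)) false).toNat ≤ 1 := Bool.toNat_le _
  split_ifs <;> omega

theorem sum_matrixBad_eq_zero {n ab : ℕ} :
    ∑ u ∈ Finset.range n, ∑ v ∈ Finset.range n, matrixBad x n ab u v = 0 ↔
      (∀ u < n, ∀ v < n, x.getD (ab + (u * n + v)) false = x.getD (ab + (v * n + u)) false) ∧
      ∀ u < n, x.getD (ab + (u * n + u)) false = false := by
  have hbad : ∀ u v, matrixBad x n ab u v = 0 ↔
      x.getD (ab + (u * n + v)) false = x.getD (ab + (v * n + u)) false ∧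
      (u = v → x.getD (ab + (u * n + v)) false = false) := by
    intro u v
    unfold matrixBad
    by_cases huv : u = v
    · subst huv
      cases x.getD (ab + (u * n + u)) false <;> simp
    · cases x.getD (ab + (u * n + v)) false <;> cases x.getD (ab + (v * n + u)) false <;>
        simp [huv]
  simp only [Finset.sum_eq_zero_iff, Finset.mem_range, hbad]
  constructor
  · exact fun h => ⟨fun u hu v hv => (h u hu v hv).1, fun u hu => (h u hu u hu).2 rfl⟩
  · rintro ⟨h, h'⟩ u hu v hv
    refine ⟨h u hu v hv, ?_⟩
    rintro rfl
    exact h' u hu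

theorem calc_matrix (b : WordBound w N) (hx : BitsMem x st) {n ab : ℕ} (h2 : st.reg 2 = n)
    (h4 : st.reg 4 = ab) (hn : n + 2 ≤ N) (hab : ab + n * n ≤ N ^ 4) :
    Calc w 20 4 matrixProg st ((n + 1) * ((n + 1) * 80))
      (∑ u ∈ Finset.range n, ∑ v ∈ Finset.range n, matrixBad x n ab u v) := by
  have h1 := b.one_lt
  have hN := b.two_le
  have hw : ∀ y, y ≤ ab + n * n → y < 2 ^ w := fun y hy =>
    b.lt_of_le_pow 4 (hy.trans hab) (by omega)
  have hnw : ∀ y ≤ n, y < 2 ^ w := fun y hy => b.lt_of_le (by omega)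
  have hrow : ∀ u, ∑ v ∈ Finset.range n, matrixBad x n ab u v ≤ N ^ 2 := fun u =>
    sum_le_pow (p := 1) (by omega) fun v _ => (matrixBad_le x n ab u v).trans (by rwa [pow_one])
  have htot : ∑ u ∈ Finset.range n, ∑ v ∈ Finset.range n, matrixBad x n ab u v ≤ N ^ 3 :=
    sum_le_pow (p := 2) (by omega) fun u _ => hrow u
  refine Calc.sumLoop (Tb := (n + 1) * 50) (by omega) h2 (hnw _ le_rfl) b.one_le
    ?_ (b.lt_of_le_pow 3 htot (by omega)) (Nat.mul_le_mul_left _ (by omega))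
  intro u hu s' hag hr
  refine Calc.sumLoop (Tb := 38) (by omega) (by rw [hag.reg 2 (by omega), h2]) (hnw _ le_rfl)
    b.one_le ?_ (b.lt_of_le_pow 2 (hrow u) (by omega)) (Nat.mul_le_mul_left _ (by omega))
  intro v hv s'' hag' hr'
  have e21 : s''.reg 21 = u := by rw [hag'.reg 21 (by omega), hr]
  have e23 : s''.reg 23 = v := hr'
  have e2 : s''.reg 2 = n := by rw [hag'.reg 2 (by omega), hag.reg 2 (by omega), h2]
  have e4 : s''.reg 4 = ab := by rw [hag'.reg 4 (by omega), hag.reg 4 (by omega), h4]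
  have ha : ∀ i, s''.arr 0 i = (x.getD i false).toNat := fun i => by
    rw [hag'.arr 0 (by omega), hag.arr 0 (by omega), hx i]
  have hi := index_lt hu hv
  have hi' := index_lt hv hu
  have hb : ∀ i, (x.getD i false).toNat ≤ 1 := fun i => Bool.toNat_le _
  have f21 : (Expr.reg 21).Fits w s'' := by rw [Expr.Fits, e21]; exact hnw _ hu.le
  have f23 : (Expr.reg 23).Fits w s'' := by rw [Expr.Fits, e23]; exact hnw _ hv.le
  have fadj : ∀ r r' a c, s''.reg r = a → s''.reg r' = c → a * n + c < n * n →
      (Expr.reg r).Fits w s'' → (Expr.reg r').Fits w s'' →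
      (adjExpr (.reg r) (.reg r')).Fits w s'' ∧
      (adjExpr (.reg r) (.reg r')).eval s'' = (x.getD (ab + (a * n + c)) false).toNat := by
    intro r r' a c er er' hac fr fr'
    have hev : (adjExpr (.reg r) (.reg r')).eval s'' =
        (x.getD (ab + (a * n + c)) false).toNat := by
      simp only [adjExpr, Expr.eval, Op.eval, er, er', e2, e4, ha]
    refine ⟨⟨⟨?_, ⟨⟨fr, ?_, ?_⟩, fr', ?_⟩, ?_⟩, ?_⟩, hev⟩
    · rw [Expr.Fits, e4]; exact hw _ (by omega)
    · rw [Expr.Fits, e2]; exact hnw _ le_rfl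
    · simp only [Expr.eval, Op.eval, er, e2]; exact hw _ (by omega)
    · simp only [Expr.eval, Op.eval, er, er', e2]; exact hw _ (by omega)
    · simp only [Expr.eval, Op.eval, er, er', e2, e4]; exact hw _ (by omega)
    · have := hb (ab + (a * n + c))
      simp only [adjExpr, Expr.eval] at hev
      simp only [Expr.eval, hev]
      omega
  obtain ⟨f1, e1⟩ := fadj 21 23 u v e21 e23 hi f21 f23
  obtain ⟨f3, e3⟩ := fadj 23 21 v u e23 e21 hi' f23 f21
  have hev : (Expr.bin .add
    (.bin .sub (.lit 1) (.bin .eq (adjExpr (.reg 21) (.reg 23)) (adjExpr (.reg 23) (.reg 21))))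
    (.bin .mul (.bin .eq (.reg 21) (.reg 23)) (adjExpr (.reg 21) (.reg 23)))).eval s'' =
      matrixBad x n ab u v := by
    simp only [Expr.eval, Op.eval, e1, e3, e21, e23, matrixBad]
  refine Calc.mono (Calc.set ⟨fits_sub h1 (fits_eq f1 f3 h1),
    fits_mul_of_le_one (fits_eq f21 f23 h1) f1 (Or.inl (eval_eq_le_one _ _ _)), ?_⟩ hev)
    (by simp [Expr.cost, adjExpr])
  have hle := matrixBad_le x n ab u v
  have hlt : matrixBad x n ab u v < 2 ^ w := b.lt_of_le (by omega)
  rw [← hev] at hlt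
  exact hlt

/-- The result of reading the input. -/
structure ParsePost (x : List Bool) (n : ℕ) (st s' : State) : Prop where
  reading : Reading x n (s'.reg 3) (s'.arr 1)
  r0 : s'.reg 0 = st.reg 0
  r1 : s'.reg 1 = st.reg 1
  r2 : s'.reg 2 = n
  r4 : s'.reg 4 = colPos n (s'.reg 3) (s'.arr 1) n
  flag : s'.reg 16 ≤ 1
  flag_iff : s'.reg 16 = 1 ↔ Valid x n (s'.reg 3) (s'.arr 1)
  arr0 : s'.arr 0 = st.arr 0
  arr2 : s'.arr 2 = st.arr 2

theorem runs_check {e : Expr} {v : ℕ} (he : e.Fits w st) (hev : e.eval st = v) (hv : v ≤ 1)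
    (hf : st.reg 16 ≤ 1) (hw : 1 < 2 ^ w) :
    Runs w (checkProg e) st (e.cost + 3) fun s' =>
      (s'.reg 16 ≤ 1 ∧ (s'.reg 16 = 1 ↔ st.reg 16 = 1 ∧ v = 1)) ∧
      (∀ r, r ≠ 16 → s'.reg r = st.reg r) ∧ s'.arr = st.arr := by
  refine Runs.mono (Runs.set (Q := fun s' => s' = st.setReg 16 (st.reg 16 * v))
    (fits_mul_of_le_one ?_ he (Or.inl hf)) ?_) (by simp only [Expr.cost]; omega) ?_
  · rw [Expr.Fits]; omega
  · simp only [Expr.eval, Op.eval, hev]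
  · rintro _ rfl
    refine ⟨?_, fun r hr => by simp [hr], rfl⟩
    rw [State.setReg_reg_self]
    rcases (by omega : st.reg 16 = 0 ∨ st.reg 16 = 1) with h | h <;> simp [h, hv]

/-- The time depends on the number `n` that was read and not on the length of the string, which may
be dominated by the budget. A failed check merely clears the flag. -/
theorem runs_parse (b : WordBound w N) (hx : BitsMem x st) (h0 : st.reg 0 = x.length)
    (hL : x.length + 2 ≤ N) {n : ℕ} (hn : ReadSpec x 0 x.length n) :
    Runs w parseProg st ((n + 1) * ((n + 2) * 400)) (ParsePost x n st) := by
  have h1 := b.one_lt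
  have hN2 := b.two_le
  have hnL := hn.le
  have hN8 : N ≤ N ^ 8 := Nat.le_self_pow (by omega) _
  have hN4 : N ^ 4 ≤ N ^ 8 := Nat.pow_le_pow_right (by omega) (by omega)
  -- The first `n + 1` is the position behind the first block, the second is the cap; the cap is
  -- reached when there are too many colors, and the flag then starts as `0`.
  obtain ⟨κ, hκ⟩ := exists_readSpec x (n + 1) (n + 1)
  have hκn := hκ.le
  have hpos := read_pos_le (N := N) (n := n) (by omega) hκn
  have hpos' := read_pos_le (N := N) (n := n) (by omega) (le_refl (n + 1))
  have hw4 : ∀ y ≤ N ^ 4, y < 2 ^ w := fun y hy => b.lt_of_le_pow 4 hy (by omega)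
  refine Runs.mono (T := 2 + ((n + 1) * 20 + (2 + (4 + ((κ + 1) * 20 + (2 + (4 +
    ((n + 1) * ((κ + 1) * 50) + (6 + (8 + (13 + ((n + 1) * ((n + 1) * 80) + 6))))))))))))
    (Q := ParsePost x n st) ?_ (by nlinarith [Nat.zero_le (n * n)]) fun _ h => h
  refine Runs.seq (Runs.set (Q := fun s' => s' = st.setReg 4 0) ?_ rfl) ?_
  · exact b.lt_of_le (Nat.zero_le _)
  rintro _ rfl
  refine Runs.seq (runs_read (m := 0) (M := x.length) (p := 0) (st := st.setReg 4 0) b hx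
    (by omega) (by omega)
    (by simpa) (by simp) (by omega) hn) fun s₂ k₂ => ?_
  have e20 : s₂.reg 20 = n := k₂.spec.unique hn
  refine Runs.seq (Runs.set (Q := fun s' => s' = s₂.setReg 2 n) ?_ ?_) ?_
  · rw [Expr.Fits, e20]; exact b.lt_of_le (by omega)
  · simp only [Expr.eval, e20]
  rintro _ rfl
  refine Runs.seq (Runs.set (Q := fun s' => s' = (s₂.setReg 2 n).setReg 5 (n + 1)) ⟨?_, h1, ?_⟩
    ?_) ?_
  · rw [Expr.Fits, State.setReg_reg_self]; exact b.lt_of_le (by omega)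
  · simp only [Expr.eval, Op.eval, State.setReg_reg_self]; exact b.lt_of_le (by omega)
  · simp only [Expr.eval, Op.eval, State.setReg_reg_self]
  rintro _ rfl
  refine Runs.seq (runs_read (x := x) (m := 5) (M := n + 1) (p := n + 1) b (fun i => ?_) (by omega)
    (by omega) (by simp) ?_ (by omega) hκ) fun s₅ k₅ => ?_
  · rw [State.setReg_arr, State.setReg_arr, k₂.arr, State.setReg_arr, hx]
  · simp [k₂.pos, e20]
  have e20' : s₅.reg 20 = κ := k₅.spec.unique hκ
  refine Runs.seq (Runs.set (Q := fun s' => s' = s₅.setReg 3 κ) ?_ ?_) ?_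
  · rw [Expr.Fits, e20']; exact b.lt_of_le (by omega)
  · simp only [Expr.eval, e20']
  rintro _ rfl
  have e5 : (s₅.setReg 3 κ).reg 5 = n + 1 := by
    simp [k₅.reg]
  refine Runs.seq (Runs.set (Q := fun s' => s' =
    (s₅.setReg 3 κ).setReg 16 (if κ < n + 1 then 1 else 0)) (fits_lt ?_ ?_ h1) ?_) ?_
  · rw [Expr.Fits, State.setReg_reg_self]; exact b.lt_of_le (by omega)
  · rw [Expr.Fits, e5]; exact b.lt_of_le (by omega)
  · simp only [Expr.eval, Op.eval, e5, State.setReg_reg_self]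
  rintro _ rfl
  set s₇ := (s₅.setReg 3 κ).setReg 16 (if κ < n + 1 then 1 else 0) with hs₇
  have a₇ : s₇.arr = st.arr := by
    rw [hs₇, State.setReg_arr, State.setReg_arr, k₅.arr, State.setReg_arr, State.setReg_arr,
      k₂.arr, State.setReg_arr]
  have hx₇ : BitsMem x s₇ := fun i => by rw [a₇, hx]
  have r2₇ : s₇.reg 2 = n := by simp [hs₇, k₅.reg]
  have r0₇ : s₇.reg 0 = st.reg 0 := by simp [hs₇, k₅.reg, k₂.reg]
  have r1₇ : s₇.reg 1 = st.reg 1 := by simp [hs₇, k₅.reg, k₂.reg]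
  have r16₇ : s₇.reg 16 = if κ < n + 1 then 1 else 0 := by simp [hs₇]
  refine Runs.seq (runs_colors b hx₇ r2₇ (by simp [hs₇]) ?_ (by omega) hκn ?_)
    fun s₈ k₈ => ?_
  · simp [hs₇, k₅.pos, e20']; omega
  · rw [r16₇]; split_ifs <;> omega
  have hcolle : ∀ v < n, s₈.arr 1 v ≤ κ := fun v hv => (k₈.spec v hv).le
  have hab := colPos_le_of_le hcolle le_rfl
  set ab := colPos n κ (s₈.arr 1) n with hab'
  have r2₈ : s₈.reg 2 = n := by rw [k₈.reg 2 (by omega) (by omega) (by omega), r2₇]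
  have r3₈ : s₈.reg 3 = κ := by rw [k₈.reg 3 (by omega) (by omega) (by omega)]; simp [hs₇]
  have r0₈ : s₈.reg 0 = x.length := by
    rw [k₈.reg 0 (by omega) (by omega) (by omega), r0₇, h0]
  refine Runs.seq (Runs.set (Q := fun s' => s' = s₈.setReg 5 (ab + n * n))
    ⟨?_, ⟨?_, ?_, ?_⟩, ?_⟩ ?_) ?_
  · rw [Expr.Fits, k₈.r4]; exact hw4 _ (by omega)
  · rw [Expr.Fits, r2₈]; exact b.lt_of_le (by omega)
  · rw [Expr.Fits, r2₈]; exact b.lt_of_le (by omega)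
  · simp only [Expr.eval, Op.eval, r2₈]; exact hw4 _ (by omega)
  · simp only [Expr.eval, Op.eval, r2₈, k₈.r4]; exact hw4 _ (by omega)
  · simp only [Expr.eval, Op.eval, r2₈, k₈.r4, hab']
  rintro _ rfl
  refine Runs.seq (runs_check (v := if ab + n * n < x.length + 1 then 1 else 0)
    (fits_lt ?_ ⟨?_, h1, ?_⟩ h1) ?_ (by split_ifs <;> omega) ?_ h1) ?_
  · rw [Expr.Fits, State.setReg_reg_self]; exact hw4 _ (by omega)
  · simp only [Expr.Fits, State.setReg_reg]; norm_num [r0₈]; exact b.lt_of_le (by omega)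
  · simp only [Expr.eval, Op.eval, State.setReg_reg]; norm_num [r0₈]; exact b.lt_of_le (by omega)
  · simp only [Expr.eval, Op.eval, State.setReg_reg]; norm_num [r0₈]
  · simpa using k₈.flag
  rintro s₁₀ ⟨⟨f₁₀, fi₁₀⟩, r₁₀, a₁₀⟩
  have r5₁₀ : s₁₀.reg 5 = ab + n * n := by simp [r₁₀]
  have r0₁₀ : s₁₀.reg 0 = x.length := by simp [r₁₀, r0₈]
  have a0₁₀ : ∀ i, s₁₀.arr 0 i = (x.getD i false).toNat := fun i => by
    rw [a₁₀, State.setReg_arr, k₈.arr 0 (by omega), hx₇ i]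
  have hb1 : (x.getD (x.length - 1) false).toNat ≤ 1 := Bool.toNat_le _
  refine Runs.seq (runs_check (e := .bin .lt (.lit 0) (.bin .add (.bin .eq (.reg 5) (.reg 0))
    (.get 0 (.bin .sub (.reg 0) (.lit 1))))) (v := if 0 < (if ab + n * n = x.length then 1 else 0) +
    (x.getD (x.length - 1) false).toNat then 1 else 0)
    (fits_lt ?_ ⟨fits_eq ?_ ?_ h1, ⟨fits_sub ?_ h1, ?_⟩, ?_⟩ h1) ?_ (by split_ifs <;> omega) f₁₀ h1)
    ?_
  · exact b.lt_of_le (Nat.zero_le _)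
  · rw [Expr.Fits, r5₁₀]; exact hw4 _ (by omega)
  · rw [Expr.Fits, r0₁₀]; exact b.lt_of_le (by omega)
  · rw [Expr.Fits, r0₁₀]; exact b.lt_of_le (by omega)
  · simp only [Expr.eval, Op.eval, r0₁₀, a0₁₀]; omega
  · simp only [Expr.eval, Op.eval, r0₁₀, r5₁₀, a0₁₀]
    refine b.lt_of_le ?_
    split_ifs <;> omega
  · simp only [Expr.eval, Op.eval, r0₁₀, r5₁₀, a0₁₀]
  rintro s₁₁ ⟨⟨f₁₁, fi₁₁⟩, r₁₁, a₁₁⟩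
  have a0₁₁ : BitsMem x s₁₁ := fun i => by rw [a₁₁, a0₁₀]
  refine Runs.seq (calc_matrix b a0₁₁ (n := n) (ab := ab) ?_ ?_ (by omega) (by omega))
    fun s₁₂ k₁₂ => ?_
  · simp [r₁₁, r₁₀, r2₈]
  · simp [r₁₁, r₁₀, k₈.r4, hab']
  obtain ⟨ag, e20₁₂⟩ := k₁₂
  have r16₁₂ : s₁₂.reg 16 = s₁₁.reg 16 := ag.reg 16 (by omega)
  refine Runs.mono (runs_check (e := .bin .eq (.reg 20) (.lit 0))
    (v := if (∑ u ∈ Finset.range n, ∑ v ∈ Finset.range n,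
    matrixBad x n ab u v) = 0 then 1 else 0) (fits_eq ?_ ?_ h1) ?_ (by split_ifs <;> omega)
    (by omega) h1) (by simp [Expr.cost]) ?_
  · rw [Expr.Fits, e20₁₂]
    refine b.lt_of_le_pow 3 ?_ (by omega)
    exact sum_le_pow (p := 2) (by omega) fun u _ => sum_le_pow (p := 1) (by omega) fun v _ =>
      (matrixBad_le x n ab u v).trans (by rwa [pow_one])
  · exact b.lt_of_le (Nat.zero_le _)
  · simp only [Expr.eval, Op.eval, e20₁₂]
  rintro s₁₃ ⟨⟨f₁₃, fi₁₃⟩, r₁₃, a₁₃⟩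
  have a1 : s₁₃.arr 1 = s₈.arr 1 := by rw [a₁₃, ag.arr 1 (by omega), a₁₁, a₁₀, State.setReg_arr]
  have e3 : s₁₃.reg 3 = κ := by
    rw [r₁₃ 3 (by omega), ag.reg 3 (by omega), r₁₁ 3 (by omega), r₁₀ 3 (by omega)]
    simpa
  have hlow : ∀ r < 20, r ≠ 5 → r ≠ 16 → s₁₃.reg r = s₈.reg r := fun r hr hr5 hr16 => by
    rw [r₁₃ r hr16, ag.reg r hr, r₁₁ r hr16, r₁₀ r hr16, State.setReg_reg, if_neg hr5]
  refine ⟨by rw [e3, a1]; exact ⟨hn, hκ, k₈.spec⟩, ?_, ?_, ?_, ?_, f₁₃, ?_, ?_, ?_⟩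
  · rw [hlow 0 (by omega) (by omega) (by omega), r0₈, h0]
  · rw [hlow 1 (by omega) (by omega) (by omega), k₈.reg 1 (by omega) (by omega) (by omega), r1₇]
  · rw [hlow 2 (by omega) (by omega) (by omega), r2₈]
  · rw [hlow 4 (by omega) (by omega) (by omega), k₈.r4, e3, a1]
  · rw [fi₁₃, r16₁₂, fi₁₁, fi₁₀, State.setReg_reg, if_neg (by omega), k₈.flag_iff, r16₇, e3, a1]
    have hif : ∀ (P : Prop) [Decidable P], (if P then 1 else 0) = 1 ↔ P := fun P _ => by
      split_ifs with h <;> simp [h]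
    rw [hif, hif, hif, hif, sum_matrixBad_eq_zero]
    have hlast : 0 < (if ab + n * n = x.length then 1 else 0) +
        (x.getD (x.length - 1) false).toNat ↔
        ab + n * n = x.length ∨ x.getD (x.length - 1) false = true := by
      by_cases h : ab + n * n = x.length
      · simp [h]
      · cases x.getD (x.length - 1) false <;> simp [h]
    rw [hlast]
    constructor
    · rintro ⟨⟨⟨⟨c1, c2⟩, c3⟩, c4⟩, c5, c6⟩
      exact ⟨c1, c2, by omega, c4, c5, c6⟩
    · rintro ⟨c1, c2, c3, c4, c5, c6⟩
      exact ⟨⟨⟨⟨c1, c2⟩, by omega⟩, c4⟩, c5, c6⟩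
  · rw [a₁₃, ag.arr 0 (by omega), a₁₁, a₁₀, State.setReg_arr, k₈.arr 0 (by omega), a₇]
  · rw [a₁₃, ag.arr 2 (by omega), a₁₁, a₁₀, State.setReg_arr, k₈.arr 2 (by omega), a₇]

end

end FairCC

namespace FairCC
open WordRAM

/-! ### The vertex cover number -/

namespace Inst.Cover
variable {I : Inst} (c : I.Cover)

/-- The number of neighbors of `v` among the cover vertices with digit `0`. -/
noncomputable def forced (e : ℕ → ℕ) (v : ℕ) : ℕ :=
  ∑ j ∈ Finset.range c.s, I.adjN v (c.cv j) * (if e j = 0 then 1 else 0)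

/-- The number of adjacent pairs of cover vertices with digit `0`. -/
noncomputable def uncovered (e : ℕ → ℕ) : ℕ :=
  ∑ j ∈ Finset.range c.s, ∑ j' ∈ Finset.range c.s, I.adjN (c.cv j) (c.cv j') *
    ((if e j = 0 then 1 else 0) * (if e j' = 0 then 1 else 0))

/-- The size of the vertex cover that contains just the cover vertices with digit `1`, and all
neighbors of the other ones. -/
noncomputable def coverVal (e : ℕ → ℕ) : ℕ :=
  ∑ j ∈ Finset.range c.s, e j +
    ∑ v ∈ Finset.range I.n, (if c.mark v = 0 then 1 else 0) *
      (if 0 < c.forced e v then 1 else 0) +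
    c.uncovered e * I.n

/-- The size of a smallest vertex cover. -/
noncomputable def vcNum : ℕ :=
  (List.range (2 ^ c.s)).foldl (fun acc i => min acc (c.coverVal fun j => i / 2 ^ j % 2)) I.n

/-- A vertex of the given cover that is left out forces all its neighbors into the new one. If no
two vertices left out are adjacent, those neighbors are selected or unmarked, and the latter are
counted by `forced`. -/
theorem exists_covers_of_uncovered {e : ℕ → ℕ} (h : c.uncovered e = 0) :
    ∃ W, I.Covers W ∧ W.card ≤ c.coverVal e := by
  classical
  have hunc : ∀ j < c.s, ∀ j' < c.s, e j = 0 → e j' = 0 → I.adjN (c.cv j) (c.cv j') = 0 := by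
    intro j hj j' hj' h0 h0'
    have h1 := Finset.sum_eq_zero_iff.1 h j (Finset.mem_range.2 hj)
    have h2 := Finset.sum_eq_zero_iff.1 h1 j' (Finset.mem_range.2 hj')
    simpa [h0, h0'] using h2
  have hforced : ∀ v, ∀ j < c.s, e j = 0 → I.adjN v (c.cv j) ≠ 0 → 0 < c.forced e v := by
    intro v j hj h0 hne
    unfold forced
    refine lt_of_lt_of_le (Nat.pos_of_ne_zero ?_) (Finset.single_le_sum
      (f := fun j => I.adjN v (c.cv j) * (if e j = 0 then 1 else 0))
      (fun _ _ => Nat.zero_le _) (Finset.mem_range.2 hj))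
    simpa [h0] using hne
  refine ⟨((Finset.range c.s).filter fun j => e j ≠ 0).image c.cv ∪
    (Finset.range I.n).filter fun v => c.mark v = 0 ∧ 0 < c.forced e v, ⟨?_, ?_⟩, ?_⟩
  · intro v hv
    rcases Finset.mem_union.1 hv with hv | hv
    · obtain ⟨j, hj, rfl⟩ := Finset.mem_image.1 hv
      exact Finset.mem_range.2 (c.lt j (Finset.mem_range.1 (Finset.mem_filter.1 hj).1))
    · exact (Finset.mem_filter.1 hv).1
  · intro u hu v hv huv
    have key : ∀ u < I.n, ∀ v < I.n, I.adjN u v ≠ 0 → c.mark u = 0 → c.mark v ≠ 0 →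
        u ∈ ((Finset.range c.s).filter fun j => e j ≠ 0).image c.cv ∪
          (Finset.range I.n).filter (fun v => c.mark v = 0 ∧ 0 < c.forced e v) ∨
        v ∈ ((Finset.range c.s).filter fun j => e j ≠ 0).image c.cv ∪
          (Finset.range I.n).filter (fun v => c.mark v = 0 ∧ 0 < c.forced e v) := by
      intro u hu v hv huv hmu hmv
      obtain ⟨j, hj, rfl⟩ := (c.mark_iff v hv).1 hmv
      by_cases h0 : e j = 0
      · refine Or.inl (Finset.mem_union_right _ (Finset.mem_filter.2
          ⟨Finset.mem_range.2 hu, hmu, hforced u j hj h0 huv⟩))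
      · exact Or.inr (Finset.mem_union_left _ (Finset.mem_image.2
          ⟨j, Finset.mem_filter.2 ⟨Finset.mem_range.2 hj, h0⟩, rfl⟩))
    by_cases hmu : c.mark u = 0
    · by_cases hmv : c.mark v = 0
      · exact absurd (c.cover u hu v hv hmu hmv) huv
      · exact key u hu v hv huv hmu hmv
    · by_cases hmv : c.mark v = 0
      · exact (key v hv u hu (by rwa [I.adjN_comm]) hmv hmu).symm
      · obtain ⟨j, hj, rfl⟩ := (c.mark_iff u hu).1 hmu
        obtain ⟨j', hj', rfl⟩ := (c.mark_iff v hv).1 hmv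
        by_cases h0 : e j = 0
        · refine Or.inr (Finset.mem_union_left _ (Finset.mem_image.2 ⟨j',
            Finset.mem_filter.2 ⟨Finset.mem_range.2 hj', fun h0' => ?_⟩, rfl⟩))
          exact huv (hunc j hj j' hj' h0 h0')
        · exact Or.inl (Finset.mem_union_left _ (Finset.mem_image.2
            ⟨j, Finset.mem_filter.2 ⟨Finset.mem_range.2 hj, h0⟩, rfl⟩))
  · refine (Finset.card_union_le _ _).trans ?_
    unfold coverVal
    refine (Nat.add_le_add (Finset.card_image_le.trans ?_) ?_).trans (Nat.le_add_right _ _)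
    · rw [Finset.card_filter]
      exact Finset.sum_le_sum fun j _ => by split_ifs <;> omega
    · rw [Finset.card_filter]
      refine Finset.sum_le_sum fun v _ => ?_
      split_ifs <;> simp_all

/-- For the trace of `W` on the given cover, every forced vertex belongs to `W` and no edge between
vertices left out remains. -/
theorem coverVal_le_card {W : Finset ℕ} (hW : I.Covers W) :
    c.coverVal (fun j => if c.cv j ∈ W then 1 else 0) ≤ W.card := by
  have hz : ∀ j, (if c.cv j ∈ W then 1 else 0) = 0 ↔ c.cv j ∉ W := fun j => by
    split_ifs with h <;> simp [h]
  have hunc : c.uncovered (fun j => if c.cv j ∈ W then 1 else 0) = 0 := by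
    refine Finset.sum_eq_zero fun j hj => Finset.sum_eq_zero fun j' hj' => ?_
    simp only [hz]
    by_cases h : I.adjN (c.cv j) (c.cv j') = 0
    · rw [h, zero_mul]
    · rcases hW.2 _ (c.lt j (Finset.mem_range.1 hj)) _ (c.lt j' (Finset.mem_range.1 hj')) h with
        h | h <;> simp [h]
  have hcard : W.card = ∑ v ∈ Finset.range I.n, if v ∈ W then 1 else 0 := by
    rw [← Finset.card_filter, Finset.filter_mem_eq_inter, Finset.inter_eq_right.2 hW.1]
  rw [coverVal, hunc, zero_mul, add_zero, hcard, c.sum_split fun v => if v ∈ W then 1 else 0]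
  refine Nat.add_le_add_left (Finset.sum_le_sum fun v hv => ?_) _
  by_cases hm : c.mark v = 0
  · rw [if_pos hm, if_pos hm, one_mul]
    by_cases hf : 0 < c.forced (fun j => if c.cv j ∈ W then 1 else 0) v
    · obtain ⟨j, hj, hne⟩ := Finset.exists_ne_zero_of_sum_ne_zero hf.ne'
      simp only [hz] at hne
      have h1 : I.adjN v (c.cv j) ≠ 0 := fun h => hne (by rw [h, zero_mul])
      have h2 : c.cv j ∉ W := fun h => hne (by simp [h])
      have := hW.2 v (Finset.mem_range.1 hv) _ (c.lt j (Finset.mem_range.1 hj)) h1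
      rw [if_pos hf, if_pos (this.resolve_right h2)]
    · rw [if_neg hf]
      exact Nat.zero_le _
  · rw [if_neg hm, zero_mul]
    exact Nat.zero_le _

theorem coverVal_congr {e e' : ℕ → ℕ} (h : ∀ j < c.s, e j = e' j) :
    c.coverVal e = c.coverVal e' := by
  have h' : ∀ j ∈ Finset.range c.s, e j = e' j := fun j hj => h j (Finset.mem_range.1 hj)
  have hf : c.forced e = c.forced e' := funext fun v =>
    Finset.sum_congr rfl fun j hj => by rw [h' j hj]
  have hu : c.uncovered e = c.uncovered e' :=
    Finset.sum_congr rfl fun j hj => Finset.sum_congr rfl fun j' hj' => by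
      rw [h' j hj, h' j' hj']
  rw [coverVal, coverVal, hf, hu, Finset.sum_congr rfl h']

/-- The term `uncovered * n` lifts the value of an inadmissible trace to at least `n`. This is also
the initial value of the minimum, the size of the cover by all vertices, so such traces never win.
-/
theorem vertexCoverNum_eq : I.graph.vertexCoverNum = (c.vcNum : ℕ∞) := by
  rw [Inst.vertexCoverNum_eq_iff]
  have hlow : ∀ W, I.Covers W → c.vcNum ≤ W.card := by
    intro W hW
    obtain ⟨M, hM, hd⟩ := exists_digits 2 (fun j => if c.cv j ∈ W then 1 else 0) c.s
      fun j _ => by split_ifs <;> omega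
    exact (foldl_min_le hM).trans ((c.coverVal_congr hd).trans_le (c.coverVal_le_card hW))
  refine ⟨?_, hlow⟩
  suffices h : ∃ W, I.Covers W ∧ W.card ≤ c.vcNum by
    obtain ⟨W, hW, hle⟩ := h
    exact ⟨W, hW, le_antisymm hle (hlow W hW)⟩
  by_contra hno
  push Not at hno
  have hn := hno (Finset.range I.n) ⟨subset_rfl, fun u hu _ _ _ => Or.inl (Finset.mem_range.2 hu)⟩
  rw [Finset.card_range] at hn
  refine absurd (le_foldl_min (f := fun i => c.coverVal fun j => i / 2 ^ j % 2) (x₀ := I.n)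
    (M := 2 ^ c.s) (y := c.vcNum + 1) hn fun i _ => ?_) (by unfold vcNum; omega)
  by_cases h0 : c.uncovered (fun j => i / 2 ^ j % 2) = 0
  · obtain ⟨W, hW, hle⟩ := c.exists_covers_of_uncovered h0
    exact (hno W hW).trans_le hle
  · refine hn.trans_le ((Nat.le_mul_of_pos_left I.n (Nat.pos_of_ne_zero h0)).trans ?_)
    exact Nat.le_add_left _ _

end Inst.Cover

/-- The size of the vertex cover described by the digits in array `4`. -/
def coverValProg : Prog :=
  .seq (sumLoop 22 6 (.set 24 (.get 4 (.reg 23)))) <|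
  .seq (sumLoop 23 2 (.seq
    (sumLoop 25 6 (.set 27 (.bin .mul (adjExpr (.reg 24) (.get 3 (.reg 26)))
      (.bin .eq (.get 4 (.reg 26)) (.lit 0)))))
    (.set 25 (.bin .mul (.bin .eq (.get 2 (.reg 24)) (.lit 0)) (.bin .lt (.lit 0) (.reg 25)))))) <|
  .seq (sumLoop 24 6 (sumLoop 26 6 (.set 28 (.bin .mul
    (adjExpr (.get 3 (.reg 25)) (.get 3 (.reg 27)))
    (.bin .mul (.bin .eq (.get 4 (.reg 25)) (.lit 0)) (.bin .eq (.get 4 (.reg 27)) (.lit 0)))))))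
  (.set 22 (.bin .add (.bin .add (.reg 22) (.reg 23)) (.bin .mul (.reg 24) (.reg 2))))

/-- The size of a smallest vertex cover. -/
def vcNumProg : Prog := .seq (.set 17 (.lit 2)) (minOdometer 20 4 6 17 2 coverValProg)

section
variable {w N ab : ℕ} {I : Inst} {c : I.Cover} {st : State}

/-- The bound on the value is stated alongside, because the enumeration needs it for every digit
vector. -/
theorem calc_coverVal (b : Bounds w I ab N) (h : CoverMem I c ab st) {e : ℕ → ℕ}
    (he : ∀ j < c.s, st.arr 4 j = e j) (he1 : ∀ j, e j ≤ 1) :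
    Calc w 22 5 coverValProg st ((I.n + 1) * ((c.s + 1) * (c.s + 1)) * 150) (c.coverVal e) ∧
      c.coverVal e < 2 ^ w := by
  have hn := b.n_le
  have hs := c.s_le
  have hN2 := b.two_le
  have h1 := b.one_lt
  have hsw : ∀ j ≤ c.s, j < 2 ^ w := fun j hj => b.lt_of_le (by omega)
  have hnw : ∀ j ≤ I.n, j < 2 ^ w := fun j hj => b.lt_of_le (by omega)
  have hF : ∀ v, c.forced e v ≤ c.s := fun v => sum_le_of_le_one fun j => by
    have := I.adjN_le_one v (c.cv j)
    split_ifs <;> omega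
  have hA : ∑ j ∈ Finset.range c.s, e j ≤ c.s := sum_le_of_le_one he1
  have hB : ∑ v ∈ Finset.range I.n, (if c.mark v = 0 then 1 else 0) *
      (if 0 < c.forced e v then 1 else 0) ≤ I.n := sum_le_of_le_one fun v => by
    split_ifs <;> omega
  have hterm : ∀ j j', I.adjN (c.cv j) (c.cv j') *
      ((if e j = 0 then 1 else 0) * (if e j' = 0 then 1 else 0)) ≤ 1 := fun j j' => by
    have := I.adjN_le_one (c.cv j) (c.cv j')
    split_ifs <;> omega
  have hrow : ∀ j, ∑ j' ∈ Finset.range c.s, I.adjN (c.cv j) (c.cv j') *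
      ((if e j = 0 then 1 else 0) * (if e j' = 0 then 1 else 0)) ≤ c.s := fun j =>
    sum_le_of_le_one fun j' => hterm j j'
  have hC : c.uncovered e ≤ N ^ 2 := sum_le_pow (p := 1) (by omega) fun j _ => by
    rw [pow_one]
    exact (hrow j).trans (by omega)
  have hCn : c.uncovered e * I.n ≤ N ^ 3 := mul_le_pow hC (q := 1) (by rw [pow_one]; omega)
  have hAB : ∑ j ∈ Finset.range c.s, e j + ∑ v ∈ Finset.range I.n,
      (if c.mark v = 0 then 1 else 0) * (if 0 < c.forced e v then 1 else 0) ≤ N ^ 3 := by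
    refine le_pow_of_le hN2 (p := 2) ?_ (by omega)
    nlinarith
  have htot : c.coverVal e < 2 ^ w := b.lt_of_le_pow (add_le_pow hN2 hAB hCn) (by omega)
  refine ⟨?_, htot⟩
  refine Calc.mono (T := (c.s + 1) * 20 + ((I.n + 1) * ((c.s + 1) * 30 + 9 + 12) +
    ((c.s + 1) * ((c.s + 1) * 40 + 12) + 8))) ?_ ?_
  swap
  · nlinarith [Nat.zero_le (I.n * c.s), Nat.zero_le (I.n * (c.s * c.s)), Nat.zero_le (c.s * c.s)]
  refine Calc.seq (Calc.sumLoop (Tb := 3) (f := e) (by omega) h.r6 (hsw _ le_rfl) b.one_le ?_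
    (hsw _ hA) (Nat.mul_le_mul_left _ (by omega))) fun s₁ hag₁ hr₁ => ?_
  · intro j hj s' hag hr
    have ha : s'.arr 4 j = e j := by rw [hag.arr 4 (by omega), he j hj]
    have := he1 j
    refine Calc.mono (Calc.set ⟨?_, ?_⟩ ?_) (by simp [Expr.cost])
    · rw [Expr.Fits, hr]; exact hsw _ hj.le
    · simp only [Expr.eval, hr, ha]; omega
    · simp only [Expr.eval, hr, ha]
  have h₁ := h.agree (by omega) (by omega) hag₁
  refine Calc.andThen (by omega) (Calc.sumLoop (Tb := (c.s + 1) * 30 + 9)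
    (f := fun v => (if c.mark v = 0 then 1 else 0) * (if 0 < c.forced e v then 1 else 0))
    (by omega) h₁.r2 (hnw _ le_rfl) b.one_le ?_ (hnw _ hB) le_rfl) fun s₂ hag₂ hr₂ => ?_
  · intro v hv s' hag hr
    have h' := h₁.agree (by omega) (by omega) hag
    have hm := c.mark_le v hv
    have ha' : ∀ j < c.s, s'.arr 4 j = e j := fun j hj => by
      rw [hag.arr 4 (by omega), hag₁.arr 4 (by omega), he j hj]
    refine Calc.seq (T₁ := (c.s + 1) * 30) (x := c.forced e v) (Calc.sumLoop (Tb := 16)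
      (by omega) h'.r6 (hsw _ le_rfl) b.one_le ?_ (hsw _ (hF v))
      (Nat.mul_le_mul_left _ (by omega))) fun s₃ hag₃ hr₃ => ?_
    · intro j hj s₃ hag₃ hr₃
      have h₃ := h'.agree (by omega) (by omega) hag₃
      have e24 : s₃.reg 24 = v := by rw [hag₃.reg 24 (by omega), hr]
      have ha : s₃.arr 4 j = e j := by rw [hag₃.arr 4 (by omega), ha' j hj]
      have hcv : (Expr.get 3 (.reg 26)).eval s₃ = c.cv j := by
        simp only [Expr.eval, hr₃, h₃.cv j hj]
      have hlt := c.lt j hj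
      have f26 : (Expr.reg 26).Fits w s₃ := by rw [Expr.Fits, hr₃]; exact hsw _ hj.le
      have := he1 j
      refine Calc.mono (Calc.set (fits_mul_of_le_one (fits_adjExpr b h₃.toGraphMem (u := v) e24 hcv
        hv hlt ?_ ⟨f26, ?_⟩) (fits_eq ⟨f26, ?_⟩ ?_ h1) (Or.inr (eval_eq_le_one _ _ _))) ?_)
        (by simp [Expr.cost, adjExpr])
      · rw [Expr.Fits, e24]; exact hnw _ hv.le
      · simp only [Expr.eval, hr₃, h₃.cv j hj]; exact hnw _ hlt.le
      · simp only [Expr.eval, hr₃, ha]; omega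
      · exact hnw _ (Nat.zero_le _)
      · have := eval_adjExpr h₃.toGraphMem (e₁ := .reg 24) (u := v) e24 hcv hv hlt
        rw [Expr.eval, this]
        simp only [Expr.eval, Op.eval, hr₃, ha]
    · have h₃ := h'.agree (by omega) (by omega) hag₃
      have e24 : s₃.reg 24 = v := by rw [hag₃.reg 24 (by omega), hr]
      have := hF v
      refine Calc.mono (Calc.set (fits_mul_of_le_one (fits_eq ⟨?_, ?_⟩ ?_ h1) (fits_lt ?_ ?_ h1)
        (Or.inl (eval_eq_le_one _ _ _))) ?_) (by simp [Expr.cost])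
      · rw [Expr.Fits, e24]; exact hnw _ hv.le
      · simp only [Expr.eval, e24, h₃.mark v hv]; omega
      · exact hnw _ (Nat.zero_le _)
      · exact hnw _ (Nat.zero_le _)
      · rw [Expr.Fits, hr₃]; exact hsw _ this
      · simp only [Expr.eval, Op.eval, e24, h₃.mark v hv, hr₃]
  have h₂ := h₁.agree (by omega) (by omega) hag₂
  refine Calc.andThen (by omega) (Calc.sumLoop (Tb := (c.s + 1) * 40)
    (f := fun j => ∑ j' ∈ Finset.range c.s, I.adjN (c.cv j) (c.cv j') *
      ((if e j = 0 then 1 else 0) * (if e j' = 0 then 1 else 0)))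
    (by omega) h₂.r6 (hsw _ le_rfl) b.one_le ?_ (b.lt_of_le_pow hC (by omega)) le_rfl)
    fun s₃ hag₃ hr₃ => ?_
  · intro j hj s' hag hr
    have h' := h₂.agree (by omega) (by omega) hag
    refine Calc.sumLoop (Tb := 28) (by omega) h'.r6 (hsw _ le_rfl) b.one_le ?_ (hsw _ (hrow j))
      (Nat.mul_le_mul_left _ (by omega))
    intro j' hj' s₃ hag₃ hr₃
    have h₃ := h'.agree (by omega) (by omega) hag₃
    have e25 : s₃.reg 25 = j := by rw [hag₃.reg 25 (by omega), hr]
    have ha : ∀ j < c.s, s₃.arr 4 j = e j := fun j hj => by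
      rw [hag₃.arr 4 (by omega), hag.arr 4 (by omega), hag₂.arr 4 (by omega),
        hag₁.arr 4 (by omega), he j hj]
    have x1 : (Expr.get 3 (.reg 25)).eval s₃ = c.cv j := by
      simp only [Expr.eval, e25, h₃.cv j hj]
    have x2 : (Expr.get 3 (.reg 27)).eval s₃ = c.cv j' := by
      simp only [Expr.eval, hr₃, h₃.cv j' hj']
    have l1 := c.lt j hj
    have l2 := c.lt j' hj'
    have f25 : (Expr.reg 25).Fits w s₃ := by rw [Expr.Fits, e25]; exact hsw _ hj.le
    have f27 : (Expr.reg 27).Fits w s₃ := by rw [Expr.Fits, hr₃]; exact hsw _ hj'.le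
    have y1 := he1 j
    have y2 := he1 j'
    refine Calc.mono (Calc.set (fits_mul_of_le_one (fits_adjExpr b h₃.toGraphMem x1 x2 l1 l2
      ⟨f25, ?_⟩ ⟨f27, ?_⟩) (fits_mul_of_le_one (fits_eq ⟨f25, ?_⟩ ?_ h1) (fits_eq ⟨f27, ?_⟩ ?_ h1)
      (Or.inl (eval_eq_le_one _ _ _))) (Or.inl ?_)) ?_) (by simp [Expr.cost, adjExpr])
    · simp only [Expr.eval, e25, h₃.cv j hj]; exact hnw _ l1.le
    · simp only [Expr.eval, hr₃, h₃.cv j' hj']; exact hnw _ l2.le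
    · simp only [Expr.eval, e25, ha j hj]; omega
    · exact hnw _ (Nat.zero_le _)
    · simp only [Expr.eval, hr₃, ha j' hj']; omega
    · exact hnw _ (Nat.zero_le _)
    · rw [eval_adjExpr h₃.toGraphMem x1 x2 l1 l2]
      exact I.adjN_le_one _ _
    · have := eval_adjExpr h₃.toGraphMem x1 x2 l1 l2
      rw [Expr.eval, this]
      simp only [Expr.eval, Op.eval, e25, hr₃, ha j hj, ha j' hj']
  have h₃ := h₂.agree (by omega) (by omega) hag₃
  have e22 : s₃.reg 22 = ∑ j ∈ Finset.range c.s, e j := by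
    rw [hag₃.reg 22 (by omega), hag₂.reg 22 (by omega), hr₁]
  have e23 : s₃.reg 23 = _ := (hag₃.reg 23 (by omega)).trans hr₂
  have hev : (Expr.bin .add (.bin .add (.reg 22) (.reg 23)) (.bin .mul (.reg 24) (.reg 2))).eval
      s₃ = c.coverVal e := by
    simp only [Expr.eval, Op.eval, e22, e23, hr₃, h₃.r2]
    rfl
  refine Calc.mono (Calc.set ⟨⟨?_, ?_, ?_⟩, ⟨?_, ?_, ?_⟩, ?_⟩ hev) (by simp [Expr.cost])
  · rw [Expr.Fits, e22]; exact hsw _ hA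
  · rw [Expr.Fits, e23]; exact hnw _ hB
  · simp only [Expr.eval, Op.eval, e22, e23]; exact b.lt_of_le_pow hAB (by omega)
  · rw [Expr.Fits, hr₃]; exact b.lt_of_le_pow hC (by omega)
  · rw [Expr.Fits, h₃.r2]; exact hnw _ le_rfl
  · simp only [Expr.eval, Op.eval, hr₃, h₃.r2]; exact b.lt_of_le_pow hCn (by omega)
  · rw [← hev] at htot
    exact htot

theorem calc_vcNum (b : Bounds w I ab N) (h : CoverMem I c ab st) :
    Runs w vcNumProg st (2 ^ c.s * ((c.s + 1) ^ 3 * ((I.n + 1) * 400))) fun s' =>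
      s'.reg 20 = c.vcNum ∧ (∀ r < 20, r ≠ 17 → s'.reg r = st.reg r) ∧
      ∀ a < 4, s'.arr a = st.arr a := by
  have hn := b.n_le
  have hs := c.s_le
  have hN2 := b.two_le
  have hag : ∀ {s' : State}, Agree 20 4 (st.setReg 17 2) s' → Agree 7 4 st s' := fun h' =>
    ((Agree.refl st).setReg (by omega) 2).trans (h'.mono (by omega) le_rfl)
  refine Runs.mono (T := 2 + 2 ^ c.s * ((c.s + 1) ^ 3 * ((I.n + 1) * 380))) (Q := fun s' =>
    Agree 20 4 (st.setReg 17 2) s' ∧ s'.reg 20 = c.vcNum) ?_ ?_ ?_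
  · refine Runs.seq (Runs.set (Q := fun s' => s' = st.setReg 17 2) b.two_lt rfl) ?_
    rintro _ rfl
    refine Calc.minOdometer (Tb := (I.n + 1) * ((c.s + 1) * (c.s + 1)) * 150) (m := c.s) (b := 2)
      (by omega) (by omega) (by simpa using h.r6) (by simp) le_rfl (b.lt_of_le (by omega))
      (b.lt_of_le_pow (k := 2) (by nlinarith) (by omega)) (by simpa using h.r2)
      (b.lt_of_le (by omega)) ?_ ?_ ?_
    · intro i _ s' hag' hdig
      exact (calc_coverVal b (h.agree (by omega) le_rfl (hag hag')) (fun j hj => hdig j hj.le)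
        fun j => Nat.le_of_lt_succ (Nat.mod_lt _ (by omega))).1
    · intro i _
      -- The required bound concerns only the digits, while `calc_coverVal` speaks of a state that
      -- stores them; an artificial state serves the purpose.
      let s' : State := ⟨st.reg, fun a j => if a = 4 then i / 2 ^ j % 2 else st.arr a j⟩
      have hag' : Agree 7 4 st s' := ⟨fun _ _ => rfl, fun a ha => by
        funext j
        exact if_neg (by omega)⟩
      exact (calc_coverVal b (h.agree (by omega) le_rfl hag') (fun j _ => by simp [s'])
        fun j => Nat.le_of_lt_succ (Nat.mod_lt _ (by omega))).2
    · have hX : 1 ≤ 2 ^ c.s := Nat.one_le_pow _ _ (by omega)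
      have hU : 1 ≤ (I.n + 1) * ((c.s + 1) * (c.s + 1)) := Nat.succ_le_of_lt (by positivity)
      calc (2 ^ c.s + 1) * ((c.s + 1) * ((I.n + 1) * ((c.s + 1) * (c.s + 1)) * 150 + 32))
          ≤ (2 * 2 ^ c.s) * ((c.s + 1) * ((I.n + 1) * ((c.s + 1) * (c.s + 1)) * 190)) :=
            Nat.mul_le_mul (by omega) (Nat.mul_le_mul_left _ (by omega))
        _ = _ := by ring
  · have : 1 ≤ 2 ^ c.s * ((c.s + 1) ^ 3 * (I.n + 1)) := Nat.succ_le_of_lt (by positivity)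
    calc _ = 2 + 2 ^ c.s * ((c.s + 1) ^ 3 * (I.n + 1)) * 380 := by ring
      _ ≤ 2 ^ c.s * ((c.s + 1) ^ 3 * (I.n + 1)) * 400 := by omega
      _ = _ := by ring
  · rintro s' ⟨h', hr⟩
    exact ⟨hr, fun r hr hne => by rw [h'.reg r hr]; simp [hne], fun a ha => h'.arr a ha⟩

end

end FairCC

namespace FairCC
open WordRAM

/-! ### The algorithms -/

/-- One reading of the common string determines all data of both instances. It is needed because
membership in the problem refers to some instance with the given encoding. -/
theorem Inst.encode_injective {I J : Inst} (h : I.encode = J.encode) : I = J := by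
  have hread : ∃ n κ col, Reading I.encode n κ col := by
    obtain ⟨n, hn⟩ := exists_readSpec I.encode 0 I.encode.length
    obtain ⟨κ, hκ⟩ := exists_readSpec I.encode (n + 1) (n + 1)
    have : ∀ m, ∃ col : ℕ → ℕ, ∀ v < m, ReadSpec I.encode (colPos n κ col v) κ (col v) := by
      intro m
      induction m with
      | zero => exact ⟨fun _ => 0, by simp⟩
      | succ m ih =>
        obtain ⟨col, hcol⟩ := ih
        obtain ⟨u, hu⟩ := exists_readSpec I.encode (colPos n κ col m) κ
        have hold : ∀ v < m, Function.update col m u v = col v := fun v hv =>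
          Function.update_of_ne (by omega) _ _
        refine ⟨Function.update col m u, fun v hv => ?_⟩
        rw [colPos_congr fun w hw => hold w (by omega)]
        rcases (by omega : v < m ∨ v = m) with hv | rfl
        · rw [hold v hv]
          exact hcol v hv
        · rwa [Function.update_self]
    obtain ⟨col, hcol⟩ := this n
    exact ⟨n, κ, col, hn, hκ, hcol⟩
  obtain ⟨n, κ, col, hr⟩ := hread
  obtain ⟨h1, -⟩ := hr.layout
  rw [h] at hr
  obtain ⟨h2, -⟩ := hr.layout
  rw [h] at h1
  have hadj : ∀ u < n, ∀ v < n, I.adjN u v = J.adjN u v := fun u hu v hv => by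
    rw [← h1.adj u hu v hv, h2.adj u hu v hv]
  have hcol : ∀ v < n, I.colN v = J.colN v := fun v hv => by
    rw [← h1.col_eq v hv, h2.col_eq v hv]
  have hsize : I.budget.size = J.budget.size := by
    have e1 := h1.length
    have e2 := h2.length
    omega
  have hbit : ∀ i < I.budget.size, I.budget.testBit i = J.budget.testBit i := fun i hi => by
    rw [← h1.bit i hi, h2.bit i (hsize ▸ hi)]
  have hbudget : I.budget = J.budget := Nat.eq_of_testBit_eq fun i => by
    by_cases hi : i < I.budget.size
    · exact hbit i hi
    · have hlt : ∀ m : ℕ, m.size = I.budget.size → m.testBit i = false := fun m hm =>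
        Nat.testBit_lt_two_pow ((Nat.lt_size_self m).trans_le
          (Nat.pow_le_pow_right (by omega) (by omega)))
      rw [hlt _ rfl, hlt _ hsize.symm]
  have hn : I.n = J.n := by rw [← h1.n_eq, h2.n_eq]
  have hκ : I.κ = J.κ := by rw [← h1.κ_eq, h2.κ_eq]
  have hni := h1.n_eq
  clear h h1 h2 hsize hbit hr
  obtain ⟨n₁, G, B, κ₁, hle, χ⟩ := I
  obtain ⟨n₂, G', B', κ₂, hle', χ'⟩ := J
  dsimp only at hn hκ hbudget hni
  subst hn hκ hbudget hni
  congr 1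
  · ext u v
    rw [← Inst.adjN_ne_zero (I := ⟨n, G, B, κ₁, hle, χ⟩),
      ← Inst.adjN_ne_zero (I := ⟨n, G', B, κ₁, hle', χ'⟩), hadj u u.2 v v.2]
  · funext v
    have := hcol v v.2
    rw [Inst.colN_eq, Inst.colN_eq] at this
    exact Fin.ext this

/-- The answer to the question `Q` is in register `0`. -/
def Answered (Q : Prop) (st : State) : Prop := Q ∧ st.reg 0 = 1 ∨ ¬ Q ∧ st.reg 0 = 0

/-- The instance `I` has been read. -/
structure InputMem (w N k : ℕ) (I : Inst) (ab : ℕ) (st : State) : Prop where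
  bounds : Bounds w I ab N
  graph : GraphMem I ab st
  budget : BudgetMem I ab st
  r0 : st.reg 0 ≤ N
  r1 : st.reg 1 = k
  unmarked : ∀ v < I.n, st.arr 2 v = 0

section
variable {w N k : ℕ}

theorem runs_parse_encode {I : Inst} (b : WordBound w N) (hL : I.encode.length + 2 ≤ N) :
    Runs w parseProg (initState I.encode k) ((I.n + 1) * ((I.n + 2) * 400)) fun s' =>
      s'.reg 16 = 1 ∧ ∃ ab, InputMem w N k I ab s' := by
  obtain ⟨n, hn⟩ := exists_readSpec I.encode 0 I.encode.length
  have hbits : BitsMem I.encode (initState I.encode k) := fun i => rfl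
  have hrun := runs_parse b hbits rfl hL hn
  -- The final state is inspected in advance, only to learn that the number read is `I.n`; then the
  -- time bound can be stated in terms of `I.n`.
  obtain ⟨-, -, s₀, -, hpost⟩ := id hrun
  have hnI : n = I.n := hpost.reading.layout.1.n_eq
  rw [hnI] at hrun
  refine Runs.mono hrun le_rfl fun s' h => ?_
  obtain ⟨hl, hv⟩ := h.reading.layout
  have hlen := hv.length
  refine ⟨h.flag_iff.2 hv, _, ⟨?_, ?_, b.pow_le⟩, ⟨h.r2, ?_, h.r4, fun u hu v hv => ?_, ?_⟩,
    ⟨?_, fun i hi => ?_⟩, ?_, ?_, fun v _ => ?_⟩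
  · have : I.n ≤ I.encode.length := hpost.reading.size.le.trans' hnI.ge
    omega
  · omega
  · exact hl.κ_eq
  · rw [h.arr0, hbits, hl.adj u hu v hv]
  · exact hl.col_eq
  · rw [h.r0, ← hl.length]
    rfl
  · rw [h.arr0, hbits, hl.bit i hi]
  · rw [h.r0]
    exact (Nat.le_add_right _ 2).trans hL
  · rw [h.r1]
    rfl
  · rw [h.arr2]
    rfl

theorem runs_parse_invalid {x : List Bool} (b : WordBound w N) (hL : x.length + 2 ≤ N)
    (hx : ¬ ∃ I : Inst, I.encode = x) :
    Runs w parseProg (initState x k) ((x.length + 2) ^ 2 * 400) fun s' => s'.reg 16 = 0 := by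
  obtain ⟨n, hn⟩ := exists_readSpec x 0 x.length
  have hle := hn.le
  refine Runs.mono (runs_parse b (fun i => rfl) rfl hL hn) ?_ fun s' h => ?_
  · nlinarith
  · have := h.flag
    by_contra hne
    exact hx (h.reading.exists_inst (h.flag_iff.1 (by omega)))

/-- Enumerate all guesses and answer. -/
def answerProg : Prog := .seq decideProg (.set 0 (.reg 20))

/-- All powers are raised to the common base `2 * s + 2`; the exponents add up to `2 * s + (s + 1) +
4 = 3 * s + 5`. -/
theorem runs_answer {I : Inst} {c : I.Cover} {ab : ℕ} {st : State} (b : Bounds w I ab N)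
    (h : CoverMem I c ab st) (hb : BudgetMem I ab st) (hL : st.reg 0 ≤ N) :
    Runs w answerProg st ((2 * c.s + 2) ^ (3 * c.s + 5) * ((I.n + 2) ^ 2 * 7002))
      (Answered I.IsYes) := by
  classical
  have hY : 1 ≤ (2 * c.s + 2) ^ (3 * c.s + 5) := Nat.one_le_pow _ _ (by omega)
  have hZ : 1 ≤ (2 * c.s + 2) ^ (3 * c.s + 5) * (I.n + 2) ^ 2 := Nat.succ_le_of_lt (by positivity)
  refine Runs.mono (T := (2 * c.s + 2) ^ (3 * c.s + 5) * ((I.n + 2) ^ 2 * 7000) + 2)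
    (Q := Answered I.IsYes) ?_ (by rw [← mul_assoc, ← mul_assoc]; omega) fun _ h => h
  refine Runs.seq ((calc_decide b h hb hL).mono ?_ fun _ h => h) fun s' hs' => Runs.set ?_ ?_
  · refine Nat.mul_le_mul ?_ (Nat.mul_le_mul_right _ (Nat.pow_le_pow_left (by omega) 2))
    calc (2 * c.s + 2) ^ (2 * c.s) * ((c.s + 2) ^ (c.s + 1) * (c.s + 1) ^ 4)
        ≤ (2 * c.s + 2) ^ (2 * c.s) * ((2 * c.s + 2) ^ (c.s + 1) * (2 * c.s + 2) ^ 4) :=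
          Nat.mul_le_mul_left _ (Nat.mul_le_mul (Nat.pow_le_pow_left (by omega) _)
            (Nat.pow_le_pow_left (by omega) _))
      _ = _ := by rw [← pow_add, ← pow_add]; congr 1; omega
  · rw [Expr.Fits, hs']
    have := b.one_lt
    split_ifs <;> omega
  · unfold Answered
    rw [State.setReg_reg_self, Expr.eval, hs']
    by_cases hy : I.IsYes <;> simp [hy]

/-- The algorithm that knows only the encoding. -/
def fairProg : Prog :=
  .seq parseProg <| .cond (.reg 16) (.seq coverProg answerProg) .skip

/-- The vertex cover number enters only the analysis: from `s ≤ 2 * k` follow `2 * s + 2 ≤ 4 * k +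
2` and `3 * s + 5 ≤ 6 * k + 5`. -/
theorem runs_fair {I : Inst} (b : WordBound w N) (hL : I.encode.length + 2 ≤ N)
    (hk : I.graph.vertexCoverNum = (k : ℕ∞)) :
    Runs w fairProg (initState I.encode 0) ((4 * k + 2) ^ (6 * k + 5) * ((I.n + 2) ^ 2 * 8000))
      (Answered I.IsYes) := by
  obtain ⟨⟨W, hW, hWk⟩, -⟩ := Inst.vertexCoverNum_eq_iff.1 hk
  have hY : 1 ≤ (4 * k + 2) ^ (6 * k + 5) := Nat.one_le_pow _ _ (by omega)
  have hX : (I.n + 1) * (I.n + 1) ≤ (I.n + 2) ^ 2 := by nlinarith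
  have hX' : (I.n + 1) * (I.n + 2) ≤ (I.n + 2) ^ 2 := by nlinarith
  have hX1 : 1 ≤ (I.n + 2) ^ 2 := Nat.one_le_pow _ _ (by omega)
  refine Runs.mono (T := (I.n + 1) * ((I.n + 2) * 400) + (2 + ((I.n + 1) * ((I.n + 1) * 80) +
    (4 * k + 2) ^ (6 * k + 5) * ((I.n + 2) ^ 2 * 7002)))) (Q := Answered I.IsYes) ?_ ?_
    fun _ h => h
  · refine Runs.seq (runs_parse_encode (k := 0) b hL) ?_
    rintro s₁ ⟨hf, ab, h⟩
    refine Runs.cond ?_ (fun _ => ?_) fun h0 => absurd (hf.symm.trans h0) (by omega)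
    · rw [Expr.Fits, hf]
      exact b.one_lt
    · refine Runs.seq (runs_cover h.bounds h.graph h.unmarked) ?_
      rintro s₂ ⟨hst, c, hc, hcov⟩
      have hs := hcov W hW
      rw [hWk] at hs
      have hb : BudgetMem I ab s₂ := ⟨by rw [hst.reg 0 (by omega) (by omega), h.budget.r0],
        fun i hi => by rw [hst.arr 0 (by omega), h.budget.bit i hi]⟩
      refine Runs.mono (runs_answer h.bounds hc hb
        (by rw [hst.reg 0 (by omega) (by omega)]; exact h.r0)) (Nat.mul_le_mul_right _ ?_)
        fun _ h => h
      calc (2 * c.s + 2) ^ (3 * c.s + 5) ≤ (4 * k + 2) ^ (3 * c.s + 5) :=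
            Nat.pow_le_pow_left (by omega) _
        _ ≤ _ := Nat.pow_le_pow_right (by omega) (by omega)
  · calc _ = (I.n + 1) * (I.n + 2) * 400 + 2 + (I.n + 1) * (I.n + 1) * 80 +
          (4 * k + 2) ^ (6 * k + 5) * ((I.n + 2) ^ 2 * 7002) := by ring
      _ ≤ 1 * ((I.n + 2) ^ 2 * 482) + (4 * k + 2) ^ (6 * k + 5) * ((I.n + 2) ^ 2 * 7002) := by
          omega
      _ ≤ (4 * k + 2) ^ (6 * k + 5) * ((I.n + 2) ^ 2 * 482) +
          (4 * k + 2) ^ (6 * k + 5) * ((I.n + 2) ^ 2 * 7002) :=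
          Nat.add_le_add_right (Nat.mul_le_mul_right _ hY) _
      _ = (4 * k + 2) ^ (6 * k + 5) * ((I.n + 2) ^ 2 * 7484) := by ring
      _ ≤ _ := Nat.mul_le_mul_left _ (Nat.mul_le_mul_left _ (by omega))

/-- Answer no. -/
def rejectProg : Prog := .set 0 (.lit 0)

theorem runs_reject {Q : Prop} {T : ℕ} {st : State} (hQ : ¬ Q) (hT : 2 ≤ T) :
    Runs w rejectProg st T (Answered Q) :=
  Runs.mono (Runs.set (Q := Answered Q) (by simp [Expr.Fits]) (Or.inr ⟨hQ, by simp [Expr.eval]⟩))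
    hT fun _ h => h

/-- The algorithm for the parameterized problem: reject if the input is no encoding, or the
number in register `1` is not the vertex cover number. -/
def parProg : Prog :=
  .seq parseProg <| .cond (.reg 16)
    (.seq coverProg <| .cond (.bin .lt (.reg 6) (.bin .add (.bin .add (.reg 1) (.reg 1)) (.lit 1)))
      (.seq vcNumProg <| .cond (.bin .eq (.reg 20) (.reg 1)) answerProg rejectProg) rejectProg)
    rejectProg

theorem Inst.Cover.vcNum_le {I : Inst} (c : I.Cover) : c.vcNum ≤ I.n := foldl_min_le_init _

/-- The given `k` may be wrong. The test `s ≤ 2 * k` precedes all exponential work, which bounds the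
time in terms of `k` in any case; rejecting is sound since a cover of size `k` would imply `s ≤ 2 *
k`. Only then is the exact vertex cover number compared with `k`. -/
theorem runs_par (x : List Bool) (b : WordBound w N) (hL : x.length + 2 ≤ N)
    (hkw : 2 * k + 1 < 2 ^ w) :
    Runs w parProg (initState x k) ((4 * k + 2) ^ (6 * k + 5) * ((x.length + 2) ^ 2 * 8000))
      (Answered ((x, k) ∈ parByVertexCover)) := by
  have hY : 1 ≤ (4 * k + 2) ^ (6 * k + 5) := Nat.one_le_pow _ _ (by omega)
  have hL1 : 1 ≤ (x.length + 2) ^ 2 := Nat.one_le_pow _ _ (by omega)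
  by_cases hx : ∃ I : Inst, I.encode = x
  · obtain ⟨I, rfl⟩ := hx
    set L := I.encode.length
    have hn : I.n ≤ L := by
      have h := congrArg List.length I.encode_eq
      simp only [List.length_append, length_unary] at h
      change L = _ at h
      omega
    have hmem : (I.encode, k) ∈ parByVertexCover ↔
        I.graph.vertexCoverNum = (k : ℕ∞) ∧ I.IsYes := by
      constructor
      · rintro ⟨J, hJ, hk, hy⟩
        obtain rfl := Inst.encode_injective hJ
        exact ⟨hk, hy⟩
      · exact fun ⟨hk, hy⟩ => ⟨I, rfl, hk, hy⟩
    have hX : (I.n + 1) * (I.n + 1) ≤ (L + 2) ^ 2 := by nlinarith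
    have hX' : (I.n + 1) * (I.n + 2) ≤ (L + 2) ^ 2 := by nlinarith
    refine Runs.mono (T := (I.n + 1) * ((I.n + 2) * 400) + (2 + ((I.n + 1) * ((I.n + 1) * 80) +
      (8 + ((4 * k + 2) ^ (6 * k + 5) * ((L + 2) ^ 2 * 400) + (4 +
      (4 * k + 2) ^ (6 * k + 5) * ((L + 2) ^ 2 * 7002)))))))
      (Q := Answered ((I.encode, k) ∈ parByVertexCover)) ?_ ?_ fun _ h => h
    · refine Runs.seq (runs_parse_encode b hL) ?_
      rintro s₁ ⟨hf, ab, h⟩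
      refine Runs.cond ?_ (fun _ => ?_) fun h0 => absurd (hf.symm.trans h0) (by omega)
      · rw [Expr.Fits, hf]
        exact b.one_lt
      refine Runs.seq (runs_cover h.bounds h.graph h.unmarked) ?_
      rintro s₂ ⟨hst, c, hc, hcov⟩
      have hcs := c.s_le
      have hnN := h.bounds.n_le
      have hb : BudgetMem I ab s₂ := ⟨by rw [hst.reg 0 (by omega) (by omega), h.budget.r0],
        fun i hi => by rw [hst.arr 0 (by omega), h.budget.bit i hi]⟩
      have e1 : s₂.reg 1 = k := by rw [hst.reg 1 (by omega) (by omega), h.r1]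
      have e0 : s₂.reg 0 ≤ N := by rw [hst.reg 0 (by omega) (by omega)]; exact h.r0
      have hev : (Expr.bin .lt (.reg 6) (.bin .add (.bin .add (.reg 1) (.reg 1)) (.lit 1))).eval
          s₂ = if c.s < k + k + 1 then 1 else 0 := by
        simp only [Expr.eval, Op.eval, hc.r6, e1]
      refine Runs.mono (Runs.cond (e := .bin .lt (.reg 6)
        (.bin .add (.bin .add (.reg 1) (.reg 1)) (.lit 1)))
        (T := (4 * k + 2) ^ (6 * k + 5) * ((L + 2) ^ 2 * 400) + (4 +
          (4 * k + 2) ^ (6 * k + 5) * ((L + 2) ^ 2 * 7002)))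
        (Q := Answered ((I.encode, k) ∈ parByVertexCover))
        (fits_lt ?_ ⟨⟨?_, ?_, ?_⟩, b.one_lt, ?_⟩ b.one_lt) (fun hne => ?_) fun h0 => ?_)
        (by simp [Expr.cost]) fun _ h => h
      · rw [Expr.Fits, hc.r6]; exact h.bounds.lt_of_le (by omega)
      · rw [Expr.Fits, e1]; omega
      · rw [Expr.Fits, e1]; omega
      · simp only [Expr.eval, Op.eval, e1]; omega
      · simp only [Expr.eval, Op.eval, e1]; omega
      · rw [hev] at hne
        have hsk : c.s ≤ 2 * k := by
          by_contra hc'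
          exact hne (if_neg (by omega))
        have hpow : (2 * c.s + 2) ^ (3 * c.s + 5) ≤ (4 * k + 2) ^ (6 * k + 5) :=
          calc (2 * c.s + 2) ^ (3 * c.s + 5) ≤ (4 * k + 2) ^ (3 * c.s + 5) :=
                Nat.pow_le_pow_left (by omega) _
            _ ≤ _ := Nat.pow_le_pow_right (by omega) (by omega)
        refine Runs.seq ((calc_vcNum h.bounds hc).mono ?_ fun _ h => h) ?_
        · calc 2 ^ c.s * ((c.s + 1) ^ 3 * ((I.n + 1) * 400))
              ≤ (2 * c.s + 2) ^ c.s * ((2 * c.s + 2) ^ 3 * ((L + 2) ^ 2 * 400)) :=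
                Nat.mul_le_mul (Nat.pow_le_pow_left (by omega) _)
                  (Nat.mul_le_mul (Nat.pow_le_pow_left (by omega) _)
                    (Nat.mul_le_mul_right _ (by nlinarith)))
            _ = (2 * c.s + 2) ^ (c.s + 3) * ((L + 2) ^ 2 * 400) := by ring
            _ ≤ (2 * c.s + 2) ^ (3 * c.s + 5) * ((L + 2) ^ 2 * 400) :=
                Nat.mul_le_mul_right _ (Nat.pow_le_pow_right (by omega) (by omega))
            _ ≤ _ := Nat.mul_le_mul_right _ hpow
        rintro s₃ ⟨e20, hr, ha⟩
        have hag : Agree 7 4 s₂ s₃ := ⟨fun r hr' => hr r (by omega) (by omega), ha⟩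
        have hc₃ := hc.agree (by omega) le_rfl hag
        have e1' : s₃.reg 1 = k := by rw [hag.reg 1 (by omega), e1]
        have hb₃ : BudgetMem I ab s₃ := ⟨by rw [hag.reg 0 (by omega), hb.r0],
          fun i hi => by rw [hag.arr 0 (by omega), hb.bit i hi]⟩
        have hvc : I.graph.vertexCoverNum = (k : ℕ∞) ↔ c.vcNum = k := by
          rw [c.vertexCoverNum_eq]
          exact Nat.cast_inj
        have hev' : (Expr.bin .eq (.reg 20) (.reg 1)).eval s₃ = if c.vcNum = k then 1 else 0 := by
          simp only [Expr.eval, Op.eval, e20, e1']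
        have hvn := c.vcNum_le
        refine Runs.cond (fits_eq ?_ ?_ b.one_lt) (fun hne => ?_) fun h0 => ?_
        · rw [Expr.Fits, e20]; exact h.bounds.lt_of_le (by omega)
        · rw [Expr.Fits, e1']; omega
        · rw [hev'] at hne
          have hv : c.vcNum = k := by
            by_contra hc'
            exact hne (if_neg hc')
          rw [hmem, hvc, and_iff_right hv]
          exact Runs.mono (runs_answer h.bounds hc₃ hb₃ (by rw [hag.reg 0 (by omega)]; exact e0))
            (Nat.mul_le_mul hpow (Nat.mul_le_mul_right _ (Nat.pow_le_pow_left (by omega) 2)))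
            fun _ h => h
        · rw [hev'] at h0
          have hv : c.vcNum ≠ k := fun e => by rw [if_pos e] at h0; omega
          refine runs_reject (fun hm => hv (hvc.1 (hmem.1 hm).1)) ?_
          have : 1 ≤ (4 * k + 2) ^ (6 * k + 5) * (L + 2) ^ 2 := Nat.succ_le_of_lt (by positivity)
          rw [← mul_assoc]
          omega
      · rw [hev] at h0
        refine runs_reject (fun hm => ?_) (by omega)
        obtain ⟨⟨W, hW, hWk⟩, -⟩ := Inst.vertexCoverNum_eq_iff.1 (hmem.1 hm).1
        have := hcov W hW
        rw [if_pos (by omega)] at h0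
        omega
    · calc _ = (I.n + 1) * (I.n + 2) * 400 + 14 + (I.n + 1) * (I.n + 1) * 80 +
            (4 * k + 2) ^ (6 * k + 5) * ((L + 2) ^ 2 * 7402) := by ring
        _ ≤ 1 * ((L + 2) ^ 2 * 494) + (4 * k + 2) ^ (6 * k + 5) * ((L + 2) ^ 2 * 7402) := by
            omega
        _ ≤ (4 * k + 2) ^ (6 * k + 5) * ((L + 2) ^ 2 * 494) +
            (4 * k + 2) ^ (6 * k + 5) * ((L + 2) ^ 2 * 7402) :=
            Nat.add_le_add_right (Nat.mul_le_mul_right _ hY) _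
        _ = (4 * k + 2) ^ (6 * k + 5) * ((L + 2) ^ 2 * 7896) := by ring
        _ ≤ _ := Nat.mul_le_mul_left _ (Nat.mul_le_mul_left _ (by omega))
  · have hno : ¬ (x, k) ∈ parByVertexCover := by
      rintro ⟨I, hI, -⟩
      exact hx ⟨I, hI⟩
    refine Runs.mono (T := (x.length + 2) ^ 2 * 400 + (2 + 2))
      (Q := Answered ((x, k) ∈ parByVertexCover)) ?_ ?_ fun _ h => h
    · refine Runs.seq (runs_parse_invalid b hL hx) fun s₁ hf => ?_
      refine Runs.cond ?_ (fun hne => absurd hf hne) fun _ => runs_reject hno le_rfl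
      rw [Expr.Fits, hf]
      positivity
    · calc (x.length + 2) ^ 2 * 400 + (2 + 2) ≤ 1 * ((x.length + 2) ^ 2 * 8000) := by omega
        _ ≤ _ := Nat.mul_le_mul_right _ hY

theorem Runs.answers {p : Prog} {s : State} {T : ℕ} {Q : Prop}
    (h : Runs w p s T (Answered Q)) : ∃ t ≤ T, p.Answers w s t Q := by
  obtain ⟨t, ht, s', he, hQ⟩ := h
  exact ⟨t, ht, s', he, hQ⟩

end

theorem primrec_parBound : Primrec fun k : ℕ => (4 * k + 2) ^ (6 * k + 5) * 32000 := by
  have hpow : Primrec₂ fun a b : ℕ => a ^ b :=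
    Primrec₂.unpaired'.1 Nat.Primrec.pow
  have hlin : ∀ a b : ℕ, Primrec fun k : ℕ => a * k + b := fun a b =>
    Primrec.nat_add.comp (Primrec.nat_mul.comp (Primrec.const a) Primrec.id) (Primrec.const b)
  exact Primrec.nat_mul.comp (hpow.comp (hlin 4 2) (hlin 6 5)) (Primrec.const 32000)

theorem parByVertexCover_mem_FPT : parByVertexCover ∈ FPT := by
  -- The running time needs only exponent `2`; exponent `10` makes the words long enough for
  -- `WordBound`. The factor is `32000 = 4 * 8000`, from `(L + 2) ^ 2 ≤ 4 * (L + 1) ^ 2`, and it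
  -- also exceeds the `2 ^ 10` lost in passing from `L + 2` to `L + 1`.
  refine ⟨parProg, fun k => (4 * k + 2) ^ (6 * k + 5) * 32000, 10, primrec_parBound.to_comp,
    fun x k => ?_⟩
  set f := (4 * k + 2) ^ (6 * k + 5) * 32000 with hf
  have hY : 4 * k + 2 ≤ (4 * k + 2) ^ (6 * k + 5) := Nat.le_self_pow (by omega) _
  have hw : f * (x.length + 1) ^ 10 < 2 ^ (f * (x.length + 1) ^ 10).size := Nat.lt_size_self _
  have hL : 1 ≤ (x.length + 1) ^ 10 := Nat.one_le_pow _ _ (by omega)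
  have hfk : f ≤ f * (x.length + 1) ^ 10 := Nat.le_mul_of_pos_right _ hL
  have b : WordBound (f * (x.length + 1) ^ 10).size (x.length + 2) := by
    refine ⟨by omega, le_trans ?_ hw.le⟩
    calc (x.length + 2) ^ 10 ≤ (2 * (x.length + 1)) ^ 10 := Nat.pow_le_pow_left (by omega) _
      _ = 1024 * (x.length + 1) ^ 10 := by rw [mul_pow]; norm_num
      _ ≤ _ := Nat.mul_le_mul_right _ (by omega)
  obtain ⟨t, ht, h⟩ := Runs.answers (runs_par x b le_rfl (k := k) (by omega))
  refine ⟨t, ht.trans ?_, h⟩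
  calc (4 * k + 2) ^ (6 * k + 5) * ((x.length + 2) ^ 2 * 8000)
      ≤ (4 * k + 2) ^ (6 * k + 5) * ((2 * (x.length + 1)) ^ 2 * 8000) :=
        Nat.mul_le_mul_left _ (Nat.mul_le_mul_right _ (Nat.pow_le_pow_left (by omega) 2))
    _ = f * (x.length + 1) ^ 2 := by rw [hf]; ring
    _ ≤ _ := Nat.mul_le_mul_left _ (Nat.pow_le_pow_right (by omega) (by omega))

/-- For `k ≥ 2` one has `4 * k + 2 ≤ k ^ 4` and `4 * (6 * k + 5) ≤ 44 * k`. The factor `6 ^ 11` is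
the left side at `k = 1`, and it also covers `k = 0`, where `0 ^ 0 = 1`. -/
theorem pow_bound (k : ℕ) : (4 * k + 2) ^ (6 * k + 5) ≤ 6 ^ 11 * k ^ (44 * k) := by
  rcases (by omega : k = 0 ∨ k = 1 ∨ 2 ≤ k) with rfl | rfl | hk
  · norm_num
  · norm_num
  · calc (4 * k + 2) ^ (6 * k + 5) ≤ (k ^ 4) ^ (6 * k + 5) := Nat.pow_le_pow_left (by
          have : 2 ^ 3 ≤ k ^ 3 := Nat.pow_le_pow_left hk 3
          calc 4 * k + 2 ≤ 2 ^ 3 * k := by omega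
            _ ≤ k ^ 3 * k := Nat.mul_le_mul_right _ this
            _ = k ^ 4 := by ring) _
      _ = k ^ (4 * (6 * k + 5)) := by rw [← pow_mul]
      _ ≤ k ^ (44 * k) := Nat.pow_le_pow_right (by omega) (by omega)
      _ ≤ _ := Nat.le_mul_of_pos_left _ (by norm_num)

/-- The quadratic time is better than required. The constant `8` comes from `n + 2 ≤ 2 * m` with `m
= max n 2`, and from the logarithm of `2` being at least `1 / 2`. -/
theorem sq_le_mul_log (n : ℕ) : ((n + 2 : ℕ) : ℝ) ^ 2 ≤
    8 * (((max n 2 : ℕ) : ℝ) ^ (5 / 2 : ℝ) * Real.log ((max n 2 : ℕ) : ℝ)) := by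
  set m := max n 2 with hm
  have hm2 : (2 : ℝ) ≤ m := by exact_mod_cast le_max_right n 2
  have h1 : ((n + 2 : ℕ) : ℝ) ≤ 2 * m := by
    have : n + 2 ≤ 2 * m := by omega
    exact_mod_cast this
  have h2 : (m : ℝ) ^ 2 ≤ (m : ℝ) ^ (5 / 2 : ℝ) := by
    rw [← Real.rpow_natCast]
    exact Real.rpow_le_rpow_of_exponent_le (by linarith) (by norm_num)
  have h3 : (1 : ℝ) / 2 ≤ Real.log m :=
    le_trans (by have := Real.log_two_gt_d9; linarith) (Real.log_le_log (by norm_num) hm2)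
  calc ((n + 2 : ℕ) : ℝ) ^ 2 ≤ (2 * m) ^ 2 := by gcongr
    _ = 8 * ((m : ℝ) ^ 2 * (1 / 2)) := by ring
    _ ≤ _ := by gcongr

theorem two_le_length_encode (I : Inst) : 2 ≤ I.encode.length := by
  have h := congrArg List.length I.encode_eq
  simp only [List.length_append, length_unary] at h
  omega

/-- With `L` the length, `L + 2` is at most the square of `2 ^ L.size`; the tenth power explains the
factor `20`. -/
theorem wordBound_encode (I : Inst) :
    WordBound (20 * I.encode.length.size) (I.encode.length + 2) := by
  have h2 := two_le_length_encode I
  refine ⟨by omega, ?_⟩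
  have hlt := Nat.lt_size_self I.encode.length
  calc (I.encode.length + 2) ^ 10 ≤ (2 ^ I.encode.length.size * 2 ^ I.encode.length.size) ^ 10 :=
        Nat.pow_le_pow_left (by nlinarith) _
    _ = _ := by rw [← pow_add, ← pow_mul]; congr 1; omega

theorem exists_time (I : Inst) (k : ℕ) (hk : I.graph.vertexCoverNum = (k : ℕ∞)) :
    ∃ t : ℕ, (t : ℝ) ≤ (6 ^ 11 * 64000 : ℕ) * (k : ℝ) ^ (44 * k) *
        ((max I.n 2 : ℕ) : ℝ) ^ (5 / 2 : ℝ) * Real.log ((max I.n 2 : ℕ) : ℝ) ∧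
      fairProg.Answers (20 * Nat.size I.encode.length) (initState I.encode 0) t I.IsYes := by
  obtain ⟨t, ht, h⟩ := Runs.answers (runs_fair (wordBound_encode I) le_rfl hk)
  refine ⟨t, ?_, h⟩
  have h1 : (t : ℝ) ≤ (4 * k + 2 : ℕ) ^ (6 * k + 5) * (((I.n + 2 : ℕ) : ℝ) ^ 2 * 8000) := by
    exact_mod_cast ht
  have h2 : ((4 * k + 2 : ℕ) : ℝ) ^ (6 * k + 5) ≤ 6 ^ 11 * (k : ℝ) ^ (44 * k) := by
    exact_mod_cast pow_bound k
  have h3 := sq_le_mul_log I.n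
  set X := ((max I.n 2 : ℕ) : ℝ) ^ (5 / 2 : ℝ)
  set Y := Real.log ((max I.n 2 : ℕ) : ℝ)
  calc (t : ℝ) ≤ _ := h1
    _ ≤ (6 ^ 11 * (k : ℝ) ^ (44 * k)) * (8 * (X * Y) * 8000) := by gcongr
    _ = _ := by push_cast; ring

end FairCC

theorem theorem1 :
    FairCC.parByVertexCover ∈ WordRAM.FPT ∧
    ∃ (p : WordRAM.Prog) (C c d : ℕ), ∀ (I : FairCC.Inst) (k : ℕ),
      I.graph.vertexCoverNum = (k : ℕ∞) →
      ∃ t : ℕ,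
        (t : ℝ) ≤ C * (k : ℝ) ^ (c * k) *
          ((max I.n 2 : ℕ) : ℝ) ^ (5 / 2 : ℝ) * Real.log ((max I.n 2 : ℕ) : ℝ) ∧
        p.Answers (d * Nat.size I.encode.length) (WordRAM.initState I.encode 0) t I.IsYes :=
  ⟨FairCC.parByVertexCover_mem_FPT, FairCC.fairProg, _, _, _, FairCC.exists_time⟩
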